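/- **Setting.** Let $M$ be a smooth manifold of dimension $m$ and $\pi_E:E\to M$ a smooth oriented real vector bundle of rank $n\ge 1$ with a Finsler metric $F$, i.e. $F:E\to[0,\infty)$ is smooth on $E\setminus 0$, $F(cy)=cF(y)$ for $c>0$, and $g_{ij}:=\tfrac12[F^2]_{y^iy^j}$ is positive definite at every $y\neq0$. Let $SE=(E\setminus0)/\mathbb R_{>0}$ be the sphere bundle, with points $(x,[y])$, $\pi:SE\to M$ its projection, and $\ell=y/F(y)$ the tautological section of $\pi^*E$. Then $(g_{ij})$ defines a Riemannian metric $g$ on $\pi^*E$; put $A_{ijk}:=\tfrac F4[F^2]_{y^iy^jy^k}$ and $A^j_{ik}:=g^{jl}A_{lik}$. Fix a smooth Ehresmann connection on $E\setminus0$, invariant under the dilations $y\mapsto cy$, $c>0$, with coefficients $N^i_A$; put $\delta y^i:=(dy^i+N^i_A\,dx^A)/F$. The forms $dx^A,\delta y^i$ descend to $SE$ and induce the splitting of $T^*SE$ into a horizontal and a vertical part. Let $D$ be a smooth connection on $\pi^*E$ compatible with $g$. For a local frame $(s_i)$ of $E$ and the induced frame $\mathfrak s_i=\pi^*s_i$ of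 $\pi^*E$ write $D\mathfrak s_i=(\gamma^j_{iA}\,dx^A+\varrho^j_{ik}\,\delta y^k)\otimes\mathfrak s_j$. The modified connection $\nabla$ of $D$ is the connection on $\pi^*E$ given by $$\nabla\mathfrak s_i=(\gamma^j_{iA}\,dx^A+A^j_{ik}\,\delta y^k)\otimes\mathfrak s_j .$$ For a local oriented $g$-orthonormal frame $e_1,\dots,e_n$ of $\pi^*E$ write $\nabla e_i=\varpi_i^j\otimes e_j$ and $\Omega_i^j=d\varpi_i^j-\varpi_i^k\wedge\varpi_k^j$. On sections of $\bigwedge T^*SE\otimes\bigwedge\pi^*E$ use the product $(a\otimes b)\cdot(c\otimes d)=(-1)^{jk}(a\wedge c)\otimes(b\wedge d)$, where $j=\deg b$ and $k=\deg c$; identify the curvature with $\Omega=\tfrac12\sum_{i,j}\Omega_i^j\otimes e_i\wedge e_j$; let $\mathcal B$ be the Berezin integral, $\mathcal B(a\otimes e_1\wedge\dots\wedge e_n)=a$ and $\mathcal B(a\otimes\eta)=0$ for $\eta\in\bigwedge^j\pi^*E$ with $j<n$. Put $\mathrm{Pf}(-\Omega):=\mathcal B(e^{-\Omega})$. The frame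 is called adapted if $e_n=\ell$; for an adapted frame and $0\le k\le\lfloor\frac{n-1}2\rfloor$ put $$\Phi_k:=\sum\epsilon_{\alpha_1\dots\alpha_{n-1}}\,\Omega_{\alpha_1}^{\alpha_2}\wedge\dots\wedge\Omega_{\alpha_{2k-1}}^{\alpha_{2k}}\wedge\varpi_{\alpha_{2k+1}}^n\wedge\dots\wedge\varpi_{\alpha_{n-1}}^n ,$$ the sum being over all permutations $(\alpha_1,\dots,\alpha_{n-1})$ of $(1,\dots,n-1)$, with $\epsilon$ the sign. **Proposition.** Oriented $g$-orthonormal frames exist around every point of $SE$, and if $n\ge2$ they can be chosen adapted. The form $\mathrm{Pf}(-\Omega)$ does not depend on the frame and is a smooth $n$-form on $SE$. There are smooth $(n-1)$-forms on $SE$, again denoted by $\Phi_k$, that agree with the $\Phi_k$ above on the domain of every adapted oriented orthonormal frame (so for $n\ge2$ they are unique), such that $$\mathrm{Pf}(-\Omega)=(-1)^{n-1}\,d\left(\sum_{k=0}^{\lfloor (n-1)/2\rfloor}\frac{(-1)^k\,2^{n/2}}{k!\,(n-1-2k)!\,2^{2k+1}}\,\Gamma\!\left(\frac{n-2k}{2}\right)\Phi_k\right).$$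 Consequently $\Omega^\nabla:=(2\pi)^{-n/2}\,\mathrm{Pf}(-\Omega)=d\Pi$, where $$\Pi:=\frac{(-1)^{n-1}}{\pi^{n/2}}\sum_{k=0}^{\lfloor (n-1)/2\rfloor}\frac{(-1)^k}{k!\,(n-1-2k)!\,2^{2k+1}}\,\Gamma\!\left(\frac{n-2k}{2}\right)\Phi_k .$$ -/

import Mathlib

open Bundle Set Module
open scoped Manifold ContDiff Topology

noncomputable section

namespace FinslerGBC

/-- The model fibre `ℝ^(q+1)` of a vector bundle of rank `n = q + 1`. -/
abbrev FibModel (q : ℕ) := EuclideanSpace ℝ (Fin (q + 1))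

/-- The standard unit sphere in `ℝ^(q+1)`. -/
abbrev UnitSphere (q : ℕ) := Metric.sphere (0 : FibModel q) 1

section raySphere
variable {q : ℕ}

/-- The unit vector `v / |v|`. -/
def direction (v : FibModel q) (hv : v ≠ 0) : UnitSphere q :=
  ⟨‖v‖⁻¹ • v, by simp [norm_smul, norm_ne_zero_iff.2 hv]⟩

lemma direction_eq_of_sameRay {v w : FibModel q} (hv : v ≠ 0) (hw : w ≠ 0)
    (h : SameRay ℝ v w) : direction v hv = direction w hw :=
  Subtype.ext ((sameRay_iff_inv_norm_smul_eq_of_ne hv hw).1 h)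

lemma sphere_ne_zero (v : UnitSphere q) : (v : FibModel q) ≠ 0 :=
  Metric.ne_of_mem_sphere v.2 one_ne_zero

lemma direction_someVector (v : FibModel q) (hv : v ≠ 0) :
    direction (rayOfNeZero ℝ v hv).someVector (Module.Ray.someVector_ne_zero _) =
      direction v hv := by
  refine direction_eq_of_sameRay _ _ ?_
  rw [← ray_eq_iff (R := ℝ) (Module.Ray.someVector_ne_zero _) hv]
  exact Module.Ray.someVector_ray _

/-- The rays of `ℝ^(q+1)` correspond to the points of the unit sphere. -/
def rayEquivSphere : Module.Ray ℝ (FibModel q) ≃ UnitSphere q where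
  toFun r := direction r.someVector r.someVector_ne_zero
  invFun v := rayOfNeZero ℝ (v : FibModel q) (sphere_ne_zero v)
  left_inv r := by
    conv_rhs => rw [← r.someVector_ray]
    rw [ray_eq_iff]
    exact SameRay.sameRay_pos_smul_left _ (inv_pos.2 (norm_pos_iff.2 r.someVector_ne_zero))
  right_inv v := by
    have hv : ‖(v : FibModel q)‖ = 1 := by simp
    exact (direction_someVector _ (sphere_ne_zero v)).trans (Subtype.ext (by simp [direction]))

lemma rayEquivSphere_rayOfNeZero (v : FibModel q) (hv : v ≠ 0) :
    rayEquivSphere (rayOfNeZero ℝ v hv) = direction v hv :=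
  direction_someVector v hv

end raySphere

variable {m q : ℕ} {M : Type*} [TopologicalSpace M]
  [ChartedSpace (EuclideanSpace ℝ (Fin m)) M]
  {E : M → Type*} [∀ x, AddCommGroup (E x)] [∀ x, Module ℝ (E x)]

/-- The fibre at `x` of the projective sphere bundle: the rays `[y] = {c y | c > 0}`, `y ∈ E x ∖ 0`. -/
def RayFiber (_q : ℕ) (E : M → Type*) [∀ x, AddCommGroup (E x)] [∀ x, Module ℝ (E x)] (x : M) :
    Type _ := Module.Ray ℝ (E x)

variable (q E) in
/-- The projective sphere bundle `SE`, with points `(x, [y])`. -/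
abbrev SphereBundle := TotalSpace (UnitSphere q) (RayFiber q E)

variable [TopologicalSpace (TotalSpace (FibModel q) E)] [∀ x, TopologicalSpace (E x)]
  [FiberBundle (FibModel q) E] [VectorBundle ℝ (FibModel q) E]

open Classical in
/-- The linear isomorphism `E x ≃ ℝ^(q+1)` given by the trivialization `e`, if `x` lies in its base set
(and by a preferred trivialization otherwise). -/
def fiberEquiv (e : Trivialization (FibModel q) (π (FibModel q) E)) [MemTrivializationAtlas e]
    (x : M) : E x ≃ₗ[ℝ] FibModel q :=
  if h : x ∈ e.baseSet then e.linearEquivAt ℝ x h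
  else (trivializationAt (FibModel q) E x).linearEquivAt ℝ x
    (FiberBundle.mem_baseSet_trivializationAt' x)

lemma fiberEquiv_of_mem (e : Trivialization (FibModel q) (π (FibModel q) E))
    [MemTrivializationAtlas e] {x : M} (h : x ∈ e.baseSet) :
    fiberEquiv e x = e.linearEquivAt ℝ x h := dif_pos h

lemma fiberEquiv_symm_apply (e e' : Trivialization (FibModel q) (π (FibModel q) E))
    [MemTrivializationAtlas e] [MemTrivializationAtlas e'] {x : M}
    (h : x ∈ e'.baseSet ∩ e.baseSet) (v : FibModel q) :
    fiberEquiv e x ((fiberEquiv e' x).symm v) = e'.coordChangeL ℝ e x v := by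
  rw [fiberEquiv_of_mem e h.2, fiberEquiv_of_mem e' h.1, Trivialization.coordChangeL_apply e' e h]
  rfl

/-- The local trivialization `(x, [y]) ↦ (x, e(y) / |e(y)|)` of `SE` induced by `e`. -/
def rayPretrivialization (e : Trivialization (FibModel q) (π (FibModel q) E))
    [MemTrivializationAtlas e] : Pretrivialization (UnitSphere q) (π (UnitSphere q) (RayFiber q E)) where
  toFun z := (z.1, rayEquivSphere (Module.Ray.map (fiberEquiv e z.1) z.2))
  invFun z := ⟨z.1, (Module.Ray.map (fiberEquiv e z.1)).symm (rayEquivSphere.symm z.2)⟩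
  source := π (UnitSphere q) (RayFiber q E) ⁻¹' e.baseSet
  target := e.baseSet ×ˢ univ
  map_source' z hz := ⟨hz, mem_univ _⟩
  map_target' z hz := hz.1
  left_inv' z _ := by
    exact congrArg (TotalSpace.mk z.1) ((congrArg _ (Equiv.symm_apply_apply _ _)).trans
      (Equiv.symm_apply_apply _ _))
  right_inv' z _ := Prod.ext rfl ((congrArg _ (Equiv.apply_symm_apply _ _)).trans
    (Equiv.apply_symm_apply _ _))
  open_target := e.open_baseSet.prod isOpen_univ
  baseSet := e.baseSet
  open_baseSet := e.open_baseSet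
  source_eq := rfl
  target_eq := rfl
  proj_toFun _ _ := rfl

instance (x : M) : TopologicalSpace (RayFiber q E x) :=
  TopologicalSpace.induced (fun r ↦ rayEquivSphere
    (Module.Ray.map (fiberEquiv (trivializationAt (FibModel q) E x) x) r)) inferInstance

lemma rayPretrivialization_change (e e' : Trivialization (FibModel q) (π (FibModel q) E))
    [MemTrivializationAtlas e] [MemTrivializationAtlas e'] {z : M × UnitSphere q}
    (h : z.1 ∈ e'.baseSet ∩ e.baseSet) :
    rayPretrivialization e ((rayPretrivialization e').toPartialEquiv.symm z) =
      (z.1, direction (e'.coordChangeL ℝ e z.1 z.2)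
        ((e'.coordChangeL ℝ e z.1).map_ne_zero_iff.2 (sphere_ne_zero z.2))) := by
  change (z.1, rayEquivSphere (Module.Ray.map (fiberEquiv e z.1)
    ((Module.Ray.map (fiberEquiv e' z.1)).symm (rayOfNeZero ℝ (z.2 : FibModel q)
      (sphere_ne_zero z.2))))) = _
  rw [Module.Ray.map_symm, Module.Ray.map_apply, Module.Ray.map_apply, rayEquivSphere_rayOfNeZero]
  simp only [fiberEquiv_symm_apply e e' h]

variable (q E) in
/-- The fibre bundle structure of `SE → M`. -/
def rayPrebundle : FiberPrebundle (UnitSphere q) (RayFiber q E) where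
  pretrivializationAtlas := {p | ∃ (e : Trivialization (FibModel q) (π (FibModel q) E))
    (_ : MemTrivializationAtlas e), p = rayPretrivialization e}
  pretrivializationAt x := rayPretrivialization (trivializationAt (FibModel q) E x)
  mem_base_pretrivializationAt x := FiberBundle.mem_baseSet_trivializationAt' x
  pretrivialization_mem_atlas x := ⟨_, inferInstance, rfl⟩
  continuous_trivChange := by
    rintro _ ⟨e, he, rfl⟩ _ ⟨e', he', rfl⟩
    have hs : ∀ z ∈ (rayPretrivialization e').target ∩
        (rayPretrivialization e').toPartialEquiv.symm ⁻¹' (rayPretrivialization e).source,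
        z.1 ∈ e'.baseSet ∩ e.baseSet := fun z hz ↦ ⟨hz.1.1, hz.2⟩
    have hc : ContinuousOn (fun z : M × UnitSphere q ↦
        (e'.coordChangeL ℝ e z.1 : FibModel q →L[ℝ] FibModel q) z.2)
        ((rayPretrivialization e').target ∩
        (rayPretrivialization e').toPartialEquiv.symm ⁻¹' (rayPretrivialization e).source) := by
      refine ContinuousOn.clm_apply ((continuousOn_coordChange ℝ e' e).comp continuousOn_fst hs)
        (continuous_subtype_val.comp continuous_snd).continuousOn
    have hne : ∀ z : M × UnitSphere q, e'.coordChangeL ℝ e z.1 (z.2 : FibModel q) ≠ 0 := fun z ↦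
      (e'.coordChangeL ℝ e z.1).map_ne_zero_iff.2 (sphere_ne_zero z.2)
    refine ContinuousOn.congr (f := fun z : M × UnitSphere q ↦ (z.1, direction _ (hne z))) ?_
      fun z hz ↦ rayPretrivialization_change e e' (hs z hz)
    refine continuousOn_fst.prodMk (Topology.IsInducing.subtypeVal.continuousOn_iff.2 ?_)
    exact (hc.norm.inv₀ fun z _ ↦ norm_ne_zero_iff.2 (hne z)).smul hc
  totalSpaceMk_isInducing x := by
    have h : Topology.IsInducing (fun r : RayFiber q E x ↦ rayEquivSphere
      (Module.Ray.map (fiberEquiv (trivializationAt (FibModel q) E x) x) r)) := ⟨rfl⟩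
    exact (isEmbedding_prodMkRight x).isInducing.comp h

instance : TopologicalSpace (SphereBundle q E) := (rayPrebundle q E).totalSpaceTopology

instance : FiberBundle (UnitSphere q) (RayFiber q E) := (rayPrebundle q E).toFiberBundle

instance : Fact (finrank ℝ (FibModel q) = q + 1) := ⟨by simp⟩

instance : ChartedSpace (ModelProd (EuclideanSpace ℝ (Fin m)) (EuclideanSpace ℝ (Fin q)))
    (SphereBundle q E) :=
  ChartedSpace.comp _ (M × UnitSphere q) _


/-- `v / |v|`, with an arbitrary value at `0`. -/
def directionOrDefault (v : FibModel q) : UnitSphere q :=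
  if hv : v ≠ 0 then direction v hv else ⟨EuclideanSpace.single 0 1, by simp⟩

lemma directionOrDefault_of_ne {v : FibModel q} (hv : v ≠ 0) :
    directionOrDefault v = direction v hv := dif_pos hv

lemma contMDiffAt_direction {v : FibModel q} (hv : v ≠ 0) :
    ContMDiffAt 𝓘(ℝ, FibModel q) (𝓡 q) ∞ (directionOrDefault (q := q)) v := by
  let U : TopologicalSpace.Opens (FibModel q) := ⟨{v | v ≠ 0}, isOpen_ne⟩
  have h : ContMDiff 𝓘(ℝ, FibModel q) 𝓘(ℝ, FibModel q) ∞
      (fun w : U ↦ ‖(w : FibModel q)‖⁻¹ • (w : FibModel q)) := by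
    intro w
    refine (contMDiffAt_subtype_iff (f := fun w : FibModel q ↦ ‖w‖⁻¹ • w)).2 ?_
    exact (((contDiffAt_norm ℝ w.2).inv (norm_ne_zero_iff.2 w.2)).smul contDiffAt_id).contMDiffAt
  have h2 := (h.codRestrict_sphere (n := q) (fun w ↦ (direction w.1 w.2).2)) ⟨v, hv⟩
  refine (contMDiffAt_subtype_iff (U := U) (x := ⟨v, hv⟩)).1 ?_
  refine h2.congr_of_eventuallyEq (Filter.Eventually.of_forall fun w ↦ ?_)
  exact dif_pos w.2

lemma contMDiffOn_triv_change [ContMDiffVectorBundle ∞ (FibModel q) E (𝓡 m)]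
    (e e' : Trivialization (FibModel q) (π (FibModel q) E))
    [MemTrivializationAtlas e] [MemTrivializationAtlas e'] :
    ContMDiffOn ((𝓡 m).prod (𝓡 q)) ((𝓡 m).prod (𝓡 q)) ∞
      (rayPretrivialization e ∘ (rayPretrivialization e').toPartialEquiv.symm)
      ((e'.baseSet ∩ e.baseSet) ×ˢ univ) := by
  have hc : ContMDiffOn ((𝓡 m).prod (𝓡 q)) 𝓘(ℝ, FibModel q) ∞ (fun z : M × UnitSphere q ↦
        (e'.coordChangeL ℝ e z.1 : FibModel q →L[ℝ] FibModel q) z.2)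
        ((e'.baseSet ∩ e.baseSet) ×ˢ univ) := by
    refine ContMDiffOn.clm_apply ((contMDiffOn_coordChangeL e' e).comp
      contMDiff_fst.contMDiffOn fun z hz ↦ hz.1) ?_
    exact ((contMDiff_coe_sphere (E := FibModel q) (n := q)).comp contMDiff_snd).contMDiffOn
  have hne : ∀ z : M × UnitSphere q, e'.coordChangeL ℝ e z.1 (z.2 : FibModel q) ≠ 0 := fun z ↦
      (e'.coordChangeL ℝ e z.1).map_ne_zero_iff.2 (sphere_ne_zero z.2)
  refine ContMDiffOn.congr (f := fun z ↦ (z.1, directionOrDefault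
    ((e'.coordChangeL ℝ e z.1 : FibModel q →L[ℝ] FibModel q) z.2))) ?_
      fun z hz ↦ ?_
  · refine contMDiff_fst.contMDiffOn.prodMk fun z hz ↦ ?_
    exact (contMDiffAt_direction (hne z)).comp_contMDiffWithinAt z (hc z hz)
  · refine (rayPretrivialization_change e e' hz.1).trans ?_
    refine Prod.ext rfl ?_
    exact (directionOrDefault_of_ne (hne z)).symm

instance [IsManifold (𝓡 m) ∞ M] [ContMDiffVectorBundle ∞ (FibModel q) E (𝓡 m)] :
    IsManifold ((𝓡 m).prod (𝓡 q)) ∞ (SphereBundle q E) := by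
  refine isManifold_of_contDiffOn ((𝓡 m).prod (𝓡 q)) ∞ _ ?_
  rintro _ _ ⟨_, ⟨t, ⟨_, ⟨e, he, rfl⟩, ht⟩, rfl⟩, c, hc, rfl⟩
    ⟨_, ⟨t', ⟨_, ⟨e', he', rfl⟩, ht'⟩, rfl⟩, c', hc', rfl⟩
  have h1 := contMDiffOn_of_mem_maximalAtlas (n := ∞) (I := (𝓡 m).prod (𝓡 q))
    (IsManifold.subset_maximalAtlas hc')
  have h2 := contMDiffOn_symm_of_mem_maximalAtlas (n := ∞) (I := (𝓡 m).prod (𝓡 q))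
    (IsManifold.subset_maximalAtlas hc)
  have h3 := contMDiffOn_triv_change (m := m) e' e
  let z₀ : ModelProd (EuclideanSpace ℝ (Fin m)) (EuclideanSpace ℝ (Fin q)) := (0, 0)
  have h4 := ((contMDiffOn_iff.1 (h1.comp' (h3.comp' h2))).2 z₀ z₀)
  have hz₀ : extChartAt ((𝓡 m).prod (𝓡 q)) z₀ = ((𝓡 m).prod (𝓡 q)).toPartialEquiv := by
    ext <;> simp [extChartAt, chartAt_self_eq]
  rw [hz₀] at h4
  subst ht ht'
  refine (h4.congr_mono (fun z hz ↦ rfl) ?_)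
  intro z hz
  exact ⟨⟨trivial, trivial⟩, ⟨⟨hz.1.1.1, ⟨hz.1.1.2.1, hz.1.2.1⟩, trivial⟩, hz.1.2.2⟩, ⟨trivial, trivial⟩⟩

variable (m q E) in
lemma contMDiff_sphereProj [IsManifold (𝓡 m) ∞ M]
    [ContMDiffVectorBundle ∞ (FibModel q) E (𝓡 m)] :
    ContMDiff ((𝓡 m).prod (𝓡 q)) (𝓡 m) ∞ (π (UnitSphere q) (RayFiber q E)) := by
  intro p
  have h1 := contMDiffOn_chart (I := (𝓡 m).prod (𝓡 q)) (n := ∞) (x := p)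
  have h2 := contMDiffOn_chart_symm (I := 𝓡 m) (n := ∞) (x := p.proj)
  have h3 : ContMDiff ((𝓡 m).prod (𝓡 q)) (𝓡 m) ∞
    (fun z : ModelProd (EuclideanSpace ℝ (Fin m)) (EuclideanSpace ℝ (Fin q)) ↦ z.1) := by
    have h := contMDiff_fst (I := 𝓡 m) (J := 𝓡 q) (M := EuclideanSpace ℝ (Fin m))
      (N := EuclideanSpace ℝ (Fin q)) (n := ∞)
    rwa [chartedSpaceSelf_prod] at h
  have hsrc : ∀ w ∈ (chartAt (ModelProd (EuclideanSpace ℝ (Fin m)) (EuclideanSpace ℝ (Fin q)))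
      p).source, w.proj ∈ (chartAt (EuclideanSpace ℝ (Fin m)) p.proj).source := by
    intro w hw
    exact hw.2.1
  have h4 := h2.comp (h3.comp_contMDiffOn h1) (fun w hw ↦
    (chartAt (EuclideanSpace ℝ (Fin m)) p.proj).map_source (hsrc w hw))
  have h5 := h4.contMDiffAt ((chartAt _ p).open_source.mem_nhds (mem_chart_source _ p))
  refine h5.congr_of_eventuallyEq ?_
  filter_upwards [(chartAt (ModelProd (EuclideanSpace ℝ (Fin m)) (EuclideanSpace ℝ (Fin q)))
    p).open_source.mem_nhds (mem_chart_source _ p)] with w hw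
  exact ((chartAt (EuclideanSpace ℝ (Fin m)) p.proj).left_inv (hsrc w hw)).symm

variable (m q E) in
/-- The projection `π : SE → M`. -/
def sphereProj [IsManifold (𝓡 m) ∞ M]
    [ContMDiffVectorBundle ∞ (FibModel q) E (𝓡 m)] :
    ContMDiffMap ((𝓡 m).prod (𝓡 q)) (𝓡 m) (SphereBundle q E) M ∞ :=
  ⟨_, contMDiff_sphereProj m q E⟩


section Forms

variable {T : Type*} [AddCommGroup T] [Module ℝ T] {W : Type*} [Ring W] [Algebra ℝ W]

/-- The wedge product of alternating maps (sum over shuffles, so that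
`(α ∧ β)(u, v) = α(u) β(v) - α(v) β(u)` for one-forms). -/
def wedge {a b : ℕ} (α : T [⋀^Fin a]→ₗ[ℝ] W) (β : T [⋀^Fin b]→ₗ[ℝ] W) :
    T [⋀^Fin (a + b)]→ₗ[ℝ] W :=
  ((LinearMap.mul' ℝ W).compAlternatingMap (α.domCoprod β)).domDomCongr finSumFinEquiv

/-- The product `α₁ ∧ ⋯ ∧ αₖ` of `k` forms of degree `d`. -/
def wedgeFamily (d : ℕ) : (k : ℕ) → (Fin k → T [⋀^Fin d]→ₗ[ℝ] W) → T [⋀^Fin (d * k)]→ₗ[ℝ] W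
  | 0, _ => AlternatingMap.constOfIsEmpty ℝ T (Fin 0) 1
  | k + 1, α => wedge (wedgeFamily d k fun i ↦ α i.castSucc) (α (Fin.last k))

variable {V : Type*} [AddCommGroup V] [Module ℝ V]

/-- The product `(a ⊗ b) · (c ⊗ d) = (-1)^{jk} (a ∧ c) ⊗ (b ∧ d)` (for `b` of degree `j` and `c` of
degree `k`) of forms with values in the exterior algebra of `V`; the involution is `(-1)^j` on `⋀^j V`. -/
def bigradedMul {a b : ℕ} (α : T [⋀^Fin a]→ₗ[ℝ] ExteriorAlgebra ℝ V)
    (β : T [⋀^Fin b]→ₗ[ℝ] ExteriorAlgebra ℝ V) :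
    T [⋀^Fin (a + b)]→ₗ[ℝ] ExteriorAlgebra ℝ V :=
  wedge (((CliffordAlgebra.involute (Q := (0 : QuadraticForm ℝ V))).toLinearMap ^ b
    ).compAlternatingMap α) β

/-- Powers with respect to `bigradedMul`. -/
def bigradedPow {d : ℕ} (α : T [⋀^Fin d]→ₗ[ℝ] ExteriorAlgebra ℝ V) :
    (k : ℕ) → T [⋀^Fin (d * k)]→ₗ[ℝ] ExteriorAlgebra ℝ V
  | 0 => AlternatingMap.constOfIsEmpty ℝ T (Fin 0) 1
  | k + 1 => bigradedMul (bigradedPow α k) α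

/-- The component of form degree `d` of `exp(-α) = ∑ₖ (-1)^k α^k / k!`, for `α` of form degree 2. -/
def expNeg (α : T [⋀^Fin 2]→ₗ[ℝ] ExteriorAlgebra ℝ V) (d : ℕ) :
    T [⋀^Fin d]→ₗ[ℝ] ExteriorAlgebra ℝ V :=
  ∑ k ∈ Finset.range (d + 1),
    if h : 2 * k = d then
      ((-1) ^ k / (k.factorial : ℝ)) • (bigradedPow α k).domDomCongr (finCongr h)
    else 0

/-- The Berezin integral, determined by the oriented orthonormal basis `b`: the coefficient of
`b₁ ∧ ⋯ ∧ bₙ`; it vanishes on `⋀^j V` for `j ≠ n`. -/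
def berezin {n : ℕ} (b : Basis (Fin n) ℝ V) : ExteriorAlgebra ℝ V →ₗ[ℝ] ℝ :=
  ExteriorAlgebra.liftAlternating (Pi.single n b.det)

end Forms

section DiffForm

variable {B : Type*} [NormedAddCommGroup B] [NormedSpace ℝ B] [FiniteDimensional ℝ B]
  {H : Type*} [TopologicalSpace H] (I : ModelWithCorners ℝ B H)
  {S : Type*} [TopologicalSpace S] [ChartedSpace H S]

lemma continuous_alternating {k : ℕ} (f : B [⋀^Fin k]→ₗ[ℝ] ℝ) : Continuous f := by
  let b := finBasis ℝ B
  have h : ∀ v : Fin k → B, f v = ∑ r : Fin k → Fin (finrank ℝ B),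
      (∏ i, b.repr (v i) (r i)) • f (fun i ↦ b (r i)) := by
    intro v
    conv_lhs => rw [show v = fun i ↦ ∑ j, b.repr (v i) j • b j from
      funext fun i ↦ (b.sum_repr (v i)).symm]
    rw [← f.coe_multilinearMap, MultilinearMap.map_sum]
    exact Finset.sum_congr rfl fun r _ ↦ MultilinearMap.map_smul_univ _ _ _
  rw [show (f : (Fin k → B) → ℝ) = _ from funext h]
  refine continuous_finsetSum _ fun r _ ↦ Continuous.smul (f := fun v : Fin k → B ↦ ∏ i, b.repr (v i) (r i))
    (continuous_finsetProd _ fun i _ ↦ ?_) continuous_const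
  exact ((b.coord (r i)).continuous_of_finiteDimensional).comp (continuous_apply i)

/-- An alternating map on a finite-dimensional space is continuous. -/
def toContinuousForm {k : ℕ} (f : B [⋀^Fin k]→ₗ[ℝ] ℝ) : B [⋀^Fin k]→L[ℝ] ℝ :=
  { f with cont := continuous_alternating f }

variable (S) in
/-- Differential forms of degree `k` on `S` (smoothness is a separate condition). -/
abbrev DiffForm (k : ℕ) := (p : S) → TangentSpace I p [⋀^Fin k]→ₗ[ℝ] ℝ

/-- The expression of a differential form in the chart at `p`. -/
def chartForm {k : ℕ} (α : DiffForm I S k) (p : S) (z : B) : B [⋀^Fin k]→L[ℝ] ℝ :=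
  toContinuousForm ((α ((extChartAt I p).symm z)).compLinearMap
    (mfderiv 𝓘(ℝ, B) I (extChartAt I p).symm z : B →L[ℝ] _).toLinearMap)

/-- Smoothness of a differential form (on a manifold without boundary). -/
def IsSmoothForm {k : ℕ} (α : DiffForm I S k) : Prop :=
  ∀ p : S, ContDiffOn ℝ ∞ (chartForm I α p) (extChartAt I p).target

/-- The exterior derivative (on a manifold without boundary), computed in charts. -/
def extD {k : ℕ} (α : DiffForm I S k) : DiffForm I S (k + 1) := fun p ↦
  (extDeriv (chartForm I α p) (extChartAt I p p)).toAlternatingMap.compLinearMap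
    (mfderiv I 𝓘(ℝ, B) (extChartAt I p) p).toLinearMap

end DiffForm

section Finsler

variable (m q) in
/-- The model with corners of the total space of a rank `q + 1` bundle over an `m`-manifold. -/
abbrev totalModel := (𝓡 m).prod 𝓘(ℝ, FibModel q)

variable (m q) in
/-- The model with corners of the sphere bundle. -/
abbrev sphereModel := (𝓡 m).prod (𝓡 q)

/-- The fundamental tensor `g_y(u, v) = ½ (∂²F²/∂yⁱ∂yʲ)(y) uⁱ vʲ`, for `y, u, v ∈ E x`. -/
def fundamentalTensor (F : TotalSpace (FibModel q) E → ℝ) {x : M} (y u v : E x) : ℝ :=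
  1 / 2 * lineDeriv ℝ (fun z ↦ lineDeriv ℝ (fun w ↦ F ⟨x, w⟩ ^ 2) z v) y u

/-- The Cartan tensor `A_y(u, v, w) = (F/4) (∂³F²/∂yⁱ∂yʲ∂yᵏ)(y) uⁱ vʲ wᵏ`, for `y, u, v, w ∈ E x`. -/
def cartanTensor (F : TotalSpace (FibModel q) E → ℝ) {x : M} (y u v w : E x) : ℝ :=
  F ⟨x, y⟩ / 4 * lineDeriv ℝ (fun z ↦ lineDeriv ℝ
    (fun z' ↦ lineDeriv ℝ (fun y' ↦ F ⟨x, y'⟩ ^ 2) z' w) z v) y u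

variable (m) in
/-- `F` is a Finsler metric on the vector bundle `E`. -/
structure IsFinslerMetric (F : TotalSpace (FibModel q) E → ℝ) : Prop where
  nonneg : ∀ y, 0 ≤ F y
  smooth : ContMDiffOn (totalModel m q) 𝓘(ℝ) ∞ F {y | y.2 ≠ 0}
  homogeneous : ∀ (x : M) (y : E x) (c : ℝ), 0 < c → F ⟨x, c • y⟩ = c * F ⟨x, y⟩
  posDef : ∀ (x : M) (y : E x), y ≠ 0 → ∀ v : E x, v ≠ 0 → 0 < fundamentalTensor F y v v

/-- The value `ℓ_p = y / F(y) ∈ E x` at `p = (x, [y])` of the tautological section. -/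
def taut (F : TotalSpace (FibModel q) E → ℝ) (p : SphereBundle q E) : E p.proj :=
  (F ⟨p.proj, Module.Ray.someVector (p.2 : Module.Ray ℝ (E p.proj))⟩)⁻¹ •
    Module.Ray.someVector (p.2 : Module.Ray ℝ (E p.proj))

/-- The tautological section as a map `SE → E ∖ 0`, a section of the quotient map `E ∖ 0 → SE`
whose image is `{F = 1}`. -/
def tautLift (F : TotalSpace (FibModel q) E → ℝ) (p : SphereBundle q E) :
    TotalSpace (FibModel q) E := ⟨p.proj, taut F p⟩

open Classical in
/-- The quotient map `E ∖ 0 → SE`, `(x, y) ↦ (x, [y])` (with the value `p₀` on the zero section). -/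
def toSphere (p₀ : SphereBundle q E) (y : TotalSpace (FibModel q) E) : SphereBundle q E :=
  if h : y.2 ≠ 0 then ⟨y.proj, (rayOfNeZero ℝ y.2 h : Module.Ray ℝ (E y.proj))⟩ else p₀

/-- The Riemannian metric `g` induced by `F` on the fibre of `π^*E` over `p = (x, [y])`; since
`g_y` is homogeneous of degree zero in `y`, it is computed at `y = ℓ_p`. -/
def sphereMetric (F : TotalSpace (FibModel q) E → ℝ) (p : SphereBundle q E) (u v : E p.proj) : ℝ :=
  fundamentalTensor F (taut F p) u v

/-- An orientation of the bundle `E`. -/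
def IsBundleOrientation (o : ∀ x, Orientation ℝ (E x) (Fin (q + 1))) : Prop :=
  ∀ x₀ : M, ∀ᶠ x in 𝓝 x₀,
    Orientation.map (Fin (q + 1)) (fiberEquiv (trivializationAt (FibModel q) E x₀) x) (o x) =
      Orientation.map (Fin (q + 1)) (fiberEquiv (trivializationAt (FibModel q) E x₀) x₀) (o x₀)

section Ehresmann

variable [IsManifold (𝓡 m) ∞ M] [ContMDiffVectorBundle ∞ (FibModel q) E (𝓡 m)]

variable (m q E) in
/-- An Ehresmann connection on `E ∖ 0`, given by the projection `Θ` of `T(E ∖ 0)` onto the vertical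
bundle, invariant under the dilations of the fibres. -/
structure EhresmannConnection where
  /-- the connection form (its values over the zero section are irrelevant) -/
  form : (y : TotalSpace (FibModel q) E) →
    TangentSpace (totalModel m q) y →L[ℝ] TangentSpace (totalModel m q) y
  isVertical : ∀ y, y.2 ≠ 0 → ∀ ζ,
    mfderiv (totalModel m q) (𝓡 m) (π (FibModel q) E) y (form y ζ) = 0
  apply_vertical : ∀ y, y.2 ≠ 0 → ∀ ζ,
    mfderiv (totalModel m q) (𝓡 m) (π (FibModel q) E) y ζ = 0 → form y ζ = ζ
  smooth : ContMDiffOn (totalModel m q) ((totalModel m q).prod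
      𝓘(ℝ, (EuclideanSpace ℝ (Fin m) × FibModel q) →L[ℝ] (EuclideanSpace ℝ (Fin m) × FibModel q)))
    ∞ (fun y ↦ TotalSpace.mk'
      ((EuclideanSpace ℝ (Fin m) × FibModel q) →L[ℝ] (EuclideanSpace ℝ (Fin m) × FibModel q))
      (E := fun y : TotalSpace (FibModel q) E ↦
        TangentSpace (totalModel m q) y →L[ℝ] TangentSpace (totalModel m q) y) y (form y))
    {y | y.2 ≠ 0}
  dilation_invariant : ∀ (c : ℝ), 0 < c → ∀ y : TotalSpace (FibModel q) E, y.2 ≠ 0 → ∀ ζ,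
    letI dil : TotalSpace (FibModel q) E → TotalSpace (FibModel q) E := fun z ↦ ⟨z.proj, c • z.2⟩
    form (dil y) (mfderiv (totalModel m q) (totalModel m q) dil y ζ) =
      mfderiv (totalModel m q) (totalModel m q) dil y (form y ζ)

variable (F : TotalSpace (FibModel q) E → ℝ) (Θ : EhresmannConnection m q E)

/-- The vertical component of the differential of the tautological section,
`T_p SE → V_ℓ E ⊆ T_ℓ E`. -/
def verticalLift (p : SphereBundle q E) :
    TangentSpace (sphereModel m q) p →L[ℝ] TangentSpace (totalModel m q) (tautLift F p) :=
  (Θ.form (tautLift F p)).comp (mfderiv (sphereModel m q) (totalModel m q) (tautLift F) p)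

/-- The projection of `T_p SE` onto the vertical bundle `V(SE)` along the horizontal bundle
`H(SE)`, the image of `ker Θ` in `T(SE)`. -/
def verticalProj (p : SphereBundle q E) :
    TangentSpace (sphereModel m q) p →L[ℝ] TangentSpace (sphereModel m q) p :=
  ContinuousLinearMap.comp (M₃ := TangentSpace (sphereModel m q) p)
    (mfderiv (totalModel m q) (sphereModel m q) (toSphere p) (tautLift F p)) (verticalLift F Θ p)

/-- The `π^*E`-valued one-form `δy = δyⁱ ⊗ 𝔰ᵢ` on `SE`, where `δyⁱ = (dyⁱ + Nⁱ_A dxᴬ) / F`: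
the vertical space `V_ℓ E` is identified with `E x`, and `F(ℓ) = 1`. -/
def deltaY (p : SphereBundle q E) : TangentSpace (sphereModel m q) p →L[ℝ] E p.proj :=
  ((trivializationAt (FibModel q) E p.proj).symmL ℝ p.proj).comp
    (ContinuousLinearMap.comp (M₃ := FibModel q) (mfderiv (totalModel m q) 𝓘(ℝ, FibModel q)
      (fun z ↦ (trivializationAt (FibModel q) E p.proj z).2) (tautLift F p)) (verticalLift F Θ p))

end Ehresmann

variable (q) in
/-- The local frame `𝔰₁, …, 𝔰ₙ` of `E` around `x₀` given by the preferred trivialization. -/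
def stdFrame (x₀ : M) (i : Fin (q + 1)) : (x : M) → E x :=
  (trivializationAt (FibModel q) E x₀).localFrame (EuclideanSpace.basisFun _ ℝ).toBasis i

variable (q) in
/-- The `i`-th coordinate on `E x` with respect to the frame `stdFrame q x` at `x`. -/
def stdCoord (x : M) (i : Fin (q + 1)) : E x →L[ℝ] ℝ :=
  (EuclideanSpace.proj i).comp ((trivializationAt (FibModel q) E x).continuousLinearMapAt ℝ x)

/-- `A^j_{ik} = g^{jl} A_{lik}` at `p`, with respect to the frame `stdFrame q p.proj`. -/
def cartanCoeff (F : TotalSpace (FibModel q) E → ℝ) (p : SphereBundle q E)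
    (j i k : Fin (q + 1)) : ℝ :=
  ∑ l, (Matrix.of fun a b ↦ sphereMetric F p (stdFrame q p.proj a p.proj)
      (stdFrame q p.proj b p.proj))⁻¹ j l *
    cartanTensor F (taut F p) (stdFrame q p.proj l p.proj) (stdFrame q p.proj i p.proj)
      (stdFrame q p.proj k p.proj)

end Finsler

section Connection

instance {B B' : Type*} (f : B' → B) (E : B → Type*) [∀ x, AddCommGroup (E x)] (x : B') :
    AddCommGroup ((f *ᵖ E) x) :=
  inferInstanceAs (AddCommGroup (E (f x)))

instance {B B' : Type*} (f : B' → B) (E : B → Type*) [∀ x, AddCommGroup (E x)]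
    [∀ x, TopologicalSpace (E x)] [∀ x, IsTopologicalAddGroup (E x)] (x : B') :
    IsTopologicalAddGroup ((f *ᵖ E) x) :=
  inferInstanceAs (IsTopologicalAddGroup (E (f x)))

instance {B B' : Type*} (f : B' → B) (E : B → Type*) [∀ x, AddCommGroup (E x)]
    [∀ x, Module ℝ (E x)] [∀ x, TopologicalSpace (E x)] [∀ x, ContinuousSMul ℝ (E x)] (x : B') :
    ContinuousSMul ℝ ((f *ᵖ E) x) :=
  inferInstanceAs (ContinuousSMul ℝ (E (f x)))

variable [∀ x, IsTopologicalAddGroup (E x)] [∀ x, ContinuousSMul ℝ (E x)]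
  [IsManifold (𝓡 m) ∞ M] [ContMDiffVectorBundle ∞ (FibModel q) E (𝓡 m)]

variable (m q E) in
/-- The fibres of the pull-back bundle `π^*E` over `SE`. -/
abbrev PullbackBundle := sphereProj m q E *ᵖ E

variable (m q E) in
/-- Connections on `π^*E`. -/
abbrev Connection := CovariantDerivative (sphereModel m q) (FibModel q) (PullbackBundle m q E)

/-- A connection is smooth if it maps smooth local sections to smooth local sections. -/
def IsSmoothConnection (D : Connection m q E) : Prop :=
  ∀ U : Set (SphereBundle q E), IsOpen U → ContMDiffCovariantDerivativeOn (FibModel q) ∞ D.toFun U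

variable (m q) in
/-- The section of `π^*E` induced by a section of `E`. -/
def pullbackSection (s : (x : M) → E x) : (p : SphereBundle q E) → PullbackBundle m q E p :=
  fun p ↦ s p.proj

/-- `D` is compatible with the metric `g`: `d(g(X, Y)) = g(DX, Y) + g(X, DY)`. -/
def IsMetricCompatible (F : TotalSpace (FibModel q) E → ℝ) (D : Connection m q E) : Prop :=
  ∀ (p : SphereBundle q E) (X Y : (p : SphereBundle q E) → PullbackBundle m q E p),
    MDifferentiableAt (sphereModel m q) ((sphereModel m q).prod 𝓘(ℝ, FibModel q))
      (fun p ↦ TotalSpace.mk' (FibModel q) p (X p)) p →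
    MDifferentiableAt (sphereModel m q) ((sphereModel m q).prod 𝓘(ℝ, FibModel q))
      (fun p ↦ TotalSpace.mk' (FibModel q) p (Y p)) p →
    ∀ ξ : TangentSpace (sphereModel m q) p,
      mfderiv (sphereModel m q) 𝓘(ℝ) (fun p ↦ sphereMetric F p (X p) (Y p)) p ξ =
        sphereMetric F p (D X p ξ) (Y p) + sphereMetric F p (X p) (D Y p ξ)

/-- The modified connection `∇` of `D`: if `D 𝔰ᵢ = (γʲ_{iA} dxᴬ + ϱʲ_{ik} δyᵏ) ⊗ 𝔰ⱼ`, then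
`∇ 𝔰ᵢ = (γʲ_{iA} dxᴬ + Aʲ_{ik} δyᵏ) ⊗ 𝔰ⱼ`. So `∇` is `D` plus the tensor
`(Aʲ_{ik} - ϱʲ_{ik}) δyᵏ`, where `ϱʲ_{ik} δyᵏ(ξ) 𝔰ⱼ` is `D 𝔰ᵢ` on the vertical part of `ξ`. -/
def modifiedConnection (F : TotalSpace (FibModel q) E → ℝ) (Θ : EhresmannConnection m q E)
    (D : Connection m q E) : Connection m q E :=
  D.addOneForm fun p ↦ ∑ i, ContinuousLinearMap.smulRight (stdCoord q p.proj i)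
    ((∑ j, ∑ k, cartanCoeff F p j i k •
        ((stdCoord q p.proj k).comp (deltaY F Θ p)).smulRight (stdFrame q p.proj j p.proj)) -
      (D (pullbackSection m q (stdFrame q p.proj i)) p).comp (verticalProj F Θ p))

/-- A local oriented `g`-orthonormal frame `e₁, …, eₙ` of `π^*E` on an open set of `SE`
(here `n = q + 1`, and the indices run through `Fin (q + 1)`). -/
structure OrthonormalFrame (F : TotalSpace (FibModel q) E → ℝ)
    (o : ∀ x, Orientation ℝ (E x) (Fin (q + 1))) where
  domain : Set (SphereBundle q E)
  isOpen_domain : IsOpen domain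
  vec : Fin (q + 1) → (p : SphereBundle q E) → PullbackBundle m q E p
  isLocalFrame : IsLocalFrameOn (sphereModel m q) (FibModel q) ∞ vec domain
  orthonormal : ∀ p ∈ domain, ∀ i j, sphereMetric F p (vec i p) (vec j p) = if i = j then 1 else 0
  oriented : ∀ p (hp : p ∈ domain), (isLocalFrame.toBasisAt hp).orientation = o p.proj

variable {F : TotalSpace (FibModel q) E → ℝ} {o : ∀ x, Orientation ℝ (E x) (Fin (q + 1))}

/-- The frame is adapted if `eₙ = ℓ`. -/
def OrthonormalFrame.IsAdapted (e : OrthonormalFrame (m := m) F o) : Prop :=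
  ∀ p ∈ e.domain, e.vec (Fin.last q) p = taut F p

/-- The connection forms `ϖᵢʲ`, defined by `∇ eᵢ = ϖᵢʲ ⊗ eⱼ`. -/
def connForm (N : Connection m q E) (e : OrthonormalFrame (m := m) F o) (i j : Fin (q + 1)) :
    DiffForm (sphereModel m q) (SphereBundle q E) 1 := fun p ↦
  AlternatingMap.ofSubsingleton ℝ _ ℝ 0 ((e.isLocalFrame.coeff j p).comp (N (e.vec i) p).toLinearMap)

/-- The curvature forms `Ωᵢʲ = dϖᵢʲ - ϖᵢᵏ ∧ ϖₖʲ`. -/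
def curvForm (N : Connection m q E) (e : OrthonormalFrame (m := m) F o) (i j : Fin (q + 1)) :
    DiffForm (sphereModel m q) (SphereBundle q E) 2 := fun p ↦
  extD (sphereModel m q) (connForm N e i j) p -
    ∑ k, wedge (connForm N e i k p) (connForm N e k j p)

/-- The curvature at `p` as an element of `⋀²T*_p SE ⊗ ⋀²(π^*E)_p`, where an endomorphism `B` in
`𝔰𝔬(π^*E)` is identified with `½ ∑ g(B eᵢ, eⱼ) eᵢ ∧ eⱼ`. -/
def curvElement (N : Connection m q E) (e : OrthonormalFrame (m := m) F o)
    (p : SphereBundle q E) : TangentSpace (sphereModel m q) p [⋀^Fin 2]→ₗ[ℝ]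
      ExteriorAlgebra ℝ (PullbackBundle m q E p) :=
  (1 / 2 : ℝ) • ∑ i, ∑ j, (LinearMap.toSpanSingleton ℝ _
    (ExteriorAlgebra.ι ℝ (e.vec i p) * ExteriorAlgebra.ι ℝ (e.vec j p))).compAlternatingMap
      (curvForm N e i j p)

/-- The Pfaffian `Pf(-Ω) = 𝓑(exp(-Ω))` at a point `p` of the domain of the frame. -/
def pfaffian (N : Connection m q E) (e : OrthonormalFrame (m := m) F o) (p : SphereBundle q E)
    (hp : p ∈ e.domain) : TangentSpace (sphereModel m q) p [⋀^Fin (q + 1)]→ₗ[ℝ] ℝ :=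
  (berezin (e.isLocalFrame.toBasisAt hp)).compAlternatingMap
    (expNeg (curvElement N e p) (q + 1))

/-- Chern's form `Φₖ = ∑ ε_{α₁…α_{n-1}} Ω_{α₁}^{α₂} ∧ ⋯ ∧ Ω_{α_{2k-1}}^{α_{2k}} ∧ ϖ_{α_{2k+1}}^n ∧
⋯ ∧ ϖ_{α_{n-1}}^n`, where `n = q + 1` and `2k ≤ q`. -/
def chernForm (N : Connection m q E) (e : OrthonormalFrame (m := m) F o) (k : Fin (q / 2 + 1)) :
    DiffForm (sphereModel m q) (SphereBundle q E) q := fun p ↦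
  ∑ σ : Equiv.Perm (Fin q), ((Equiv.Perm.sign σ : ℤ) : ℝ) •
    (wedge
      (wedgeFamily 2 k fun i ↦
        curvForm N e (σ ⟨2 * i, by omega⟩).castSucc (σ ⟨2 * i + 1, by omega⟩).castSucc p)
      (wedgeFamily 1 (q - 2 * k) fun j ↦
        connForm N e (σ ⟨2 * k + j, by omega⟩).castSucc (Fin.last q) p)).domDomCongr
    (finCongr (by omega))

end Connection

end FinslerGBC

end

open FinslerGBC

open Bundle Set Module
open scoped Manifold ContDiff Topology

noncomputable section

namespace FinslerGBC

section

/-! ### Forms with values in an exterior algebra, as elements of one larger exterior algebra -/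

section SuperAlgebra

variable {T : Type*} [AddCommGroup T] [Module ℝ T] {W : Type*} [Ring W] [Algebra ℝ W]
  {V : Type*} [AddCommGroup V] [Module ℝ V]

/-! All forms are moved into a single algebra, where the formula is a short calculation. For a
tangent space T and a fibre V, the exterior algebra `SuperAlg T V` of T* ⊕ V receives the forms with
values in ⋀V. The sign rule of `bigradedMul` makes this map multiplicative (`extSuper_bigradedMul`),
and a real form α can be recovered from α · e₁⋯eₙ (`evalSuper_realSuper_mul`,
`realSuper_injective`). So forms may be compared after multiplication by e₁⋯eₙ. There Pf(-Ω) becomes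
(-Ω)^{n/2}/(n/2)!, or 0 for odd n (`realSuper_pfaffian_mul`), and Φₖ becomes a constant times Ω^k
θ^{n-1-2k} eₙ with θ = ∑_{a<n} ϖₐⁿ eₐ (`realSuper_chernSum_mul`).

Let 𝐃 be the exterior covariant derivative. The connection matrix is skew, so e₁⋯eₙ is parallel, and
d of a form can be computed as 𝐃 of its product with e₁⋯eₙ. The Bianchi identity says 𝐃Ω = 0, the
definition of the curvature gives 𝐃θ = -ζ with ζ = ∑_{a<n} Ωₙᵃ eₐ, and 𝐃eₙ = -θ. Hence 𝐃(Ω^k θ^l eₙ)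
= -Ω^k θ^{l+1} - l Ω^k θ^{l-1} ζ eₙ (`IsCurvatureAt.extDeriv_chernSum`). Now write Ω = R - ζeₙ with
R free of eₙ. Since (ζeₙ)² = 0, and R^k θ^l = 0 as soon as 2k + l > n - 1, everything reduces to
multiples of R^k θ^{n-2-2k} ζeₙ. The sum over k telescopes because the coefficients satisfy (k+1)
cₖ₊₁ = (n-1-2k) cₖ, which is the functional equation of Γ (`chernCoeff'_succ`). The surviving end
term is zero for odd n and the Pfaffian for even n (`chern_telescope`, `curvSuper_telescope`).

From ∇ this needs only smoothness and compatibility with g. Along vertical directions, compatibility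
of D reads g(D𝔰ₐ, 𝔰_b) + g(𝔰ₐ, D𝔰_b) = dg_{ab} = 2 A_{abk} δyᵏ. Thus A is the symmetric part of ϱ,
and ∇ - D is a skew tensor built from D and g alone (`sphereMetric_modifiedConnection`). This gives
both properties.

The local formula holds for any oriented orthonormal frame; adapted ones are needed to make Φₖ
global. Gram–Schmidt started at ℓ produces them (`exists_frame`). A change of frame conjugates the
curvature matrix by an element of SO(n), so the Pfaffian is invariant (`pfaffian_frame_change`). Two
adapted frames share eₙ, so θ and hence Φₖ are invariant too (`chernForm_frame_change`). -/

/-- `a! b! (α ∧ β)` is the alternating sum over all permutations. -/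
lemma wedge_apply {a b : ℕ} (α : T [⋀^Fin a]→ₗ[ℝ] W) (β : T [⋀^Fin b]→ₗ[ℝ] W)
    (v : Fin (a + b) → T) :
    (a.factorial * b.factorial) • wedge α β v = ∑ σ : Equiv.Perm (Fin a ⊕ Fin b),
      ((Equiv.Perm.sign σ : ℤ) : ℝ) • (α (fun i ↦ v (finSumFinEquiv (σ (Sum.inl i)))) *
        β (fun i ↦ v (finSumFinEquiv (σ (Sum.inr i))))) := by
  have h := congrArg (fun f ↦ (LinearMap.mul' ℝ W) (f fun i ↦ v (finSumFinEquiv i)))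
    (MultilinearMap.domCoprod_alternization_eq α β)
  simp only [Fintype.card_fin, AlternatingMap.smul_apply, map_nsmul] at h
  refine Eq.trans ?_ (h.symm.trans ?_)
  · rfl
  · rw [MultilinearMap.alternatization_apply, map_sum]
    refine Finset.sum_congr rfl fun σ _ ↦ ?_
    simp only [MultilinearMap.domDomCongr_apply, MultilinearMap.domCoprod_apply]
    rw [Units.smul_def, map_zsmul, LinearMap.mul'_apply]
    exact (Int.cast_smul_eq_zsmul ℝ _ _).symm

variable (T V) in
/-- The exterior algebra of `T* ⊕ V`, the home of forms on `T` with values in `⋀V`. -/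
abbrev SuperAlg := ExteriorAlgebra ℝ (Dual ℝ T × V)

variable {ι : Type*} [Fintype ι] (t : Basis ι ℝ T)

variable (V) in
/-- The product of the coordinate forms with indices `r`. -/
def coordProd {k : ℕ} (r : Fin k → ι) : SuperAlg T V :=
  ExteriorAlgebra.ιMulti ℝ k fun a ↦ (t.coord (r a), (0 : V))

/-- The element of `SuperAlg T V` given by a form with values in `W`, where `j` maps `W` to
`SuperAlg T V`. -/
def toSuper (j : W →ₗ[ℝ] SuperAlg T V) {k : ℕ} : (T [⋀^Fin k]→ₗ[ℝ] W) →ₗ[ℝ] SuperAlg T V where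
  toFun α := (k.factorial : ℝ)⁻¹ • ∑ r : Fin k → ι, coordProd V t r * j (α fun a ↦ t (r a))
  map_add' α β := by
    simp only [AlternatingMap.add_apply, map_add, mul_add, Finset.sum_add_distrib, smul_add]
  map_smul' c α := by
    simp only [AlternatingMap.smul_apply, map_smul, mul_smul_comm, ← Finset.smul_sum,
      RingHom.id_apply, smul_comm c]

lemma toSuper_apply (j : W →ₗ[ℝ] SuperAlg T V) {k : ℕ} (α : T [⋀^Fin k]→ₗ[ℝ] W) :
    toSuper t j α =
      (k.factorial : ℝ)⁻¹ • ∑ r : Fin k → ι, coordProd V t r * j (α fun a ↦ t (r a)) := rfl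

lemma toSuper_wedge (j : W →ₗ[ℝ] SuperAlg T V) {a b : ℕ} (α : T [⋀^Fin a]→ₗ[ℝ] W)
    (β : T [⋀^Fin b]→ₗ[ℝ] W) :
    toSuper t j (wedge α β) = ((a.factorial : ℝ)⁻¹ * (b.factorial : ℝ)⁻¹) •
      ∑ r : Fin a → ι, ∑ s : Fin b → ι, coordProd V t r * coordProd V t s *
        j (α (fun i ↦ t (r i)) * β fun i ↦ t (s i)) := by
  have key : ∀ σ : Equiv.Perm (Fin a ⊕ Fin b), ∑ r : Fin (a + b) → ι, coordProd V t r *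
      j (((Equiv.Perm.sign σ : ℤ) : ℝ) •
        (α (fun i ↦ t (r (finSumFinEquiv (σ (Sum.inl i))))) *
          β fun i ↦ t (r (finSumFinEquiv (σ (Sum.inr i)))))) =
      ∑ r : Fin a → ι, ∑ s : Fin b → ι, coordProd V t r * coordProd V t s *
        j (α (fun i ↦ t (r i)) * β fun i ↦ t (s i)) := by
    intro σ
    rw [← Fintype.sum_prod_type']
    let ε : (Fin (a + b) → ι) ≃ (Fin a → ι) × (Fin b → ι) :=
      ((σ.trans finSumFinEquiv).arrowCongr (Equiv.refl ι)).symm.trans (Equiv.sumArrowEquivProdArrow _ _ _)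
    refine Fintype.sum_equiv ε _ _ fun r ↦ ?_
    have h1 : coordProd V t (ε r).1 * coordProd V t (ε r).2 =
        ((Equiv.Perm.sign σ : ℤ) : ℝ) • coordProd V t r := by
      rw [coordProd, coordProd, ExteriorAlgebra.ιMulti_mul_ιMulti]
      have h2 : Fin.append (fun c ↦ (t.coord ((ε r).1 c), (0 : V)))
          (fun c ↦ (t.coord ((ε r).2 c), (0 : V))) =
          (fun c ↦ (t.coord (r c), (0 : V))) ∘ (finSumFinEquiv.permCongr σ) := by
        funext c
        refine Fin.addCases (fun c ↦ ?_) (fun c ↦ ?_) c <;>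
        simp [ε, Equiv.permCongr_apply, Equiv.sumArrowEquivProdArrow, Equiv.arrowCongr]
      rw [h2, AlternatingMap.map_perm, Equiv.Perm.sign_permCongr, Units.smul_def, coordProd]
      exact (Int.cast_smul_eq_zsmul ℝ _ _).symm
    have h3 : ((Equiv.Perm.sign σ : ℤ) : ℝ) * ((Equiv.Perm.sign σ : ℤ) : ℝ) = 1 := by
      rcases Int.units_eq_one_or (Equiv.Perm.sign σ) with h | h <;> simp [h]
    rw [h1, map_smul, mul_smul_comm, smul_mul_assoc]
    rfl
  have hf : ((a.factorial : ℝ) * b.factorial) ≠ 0 := by positivity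
  have h4 : ((a.factorial : ℝ) * b.factorial) • ∑ r : Fin (a + b) → ι, coordProd V t r *
      j (wedge α β fun c ↦ t (r c)) = ((a + b).factorial : ℝ) •
      ∑ r : Fin a → ι, ∑ s : Fin b → ι, coordProd V t r * coordProd V t s *
        j (α (fun i ↦ t (r i)) * β fun i ↦ t (s i)) := by
    have : ∀ r : Fin (a + b) → ι, ((a.factorial : ℝ) * b.factorial) • (coordProd V t r *
      j (wedge α β fun c ↦ t (r c))) = ∑ σ : Equiv.Perm (Fin a ⊕ Fin b), coordProd V t r *
      j (((Equiv.Perm.sign σ : ℤ) : ℝ) •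
        (α (fun i ↦ t (r (finSumFinEquiv (σ (Sum.inl i))))) *
          β fun i ↦ t (r (finSumFinEquiv (σ (Sum.inr i)))))) := by
      intro r
      rw [← Finset.mul_sum, ← map_sum, ← wedge_apply α β (fun c ↦ t (r c)), ← mul_smul_comm, ← map_smul]
      congr 2
      rw [← Nat.cast_smul_eq_nsmul ℝ]
      push_cast
      rfl
    rw [Finset.smul_sum, Finset.sum_congr rfl fun r _ ↦ this r, Finset.sum_comm,
      Finset.sum_congr rfl fun σ _ ↦ key σ]
    simp [Fintype.card_perm, Nat.cast_smul_eq_nsmul]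
  rw [toSuper_apply, ← mul_inv, eq_inv_smul_iff₀ hf, smul_comm, h4, smul_smul,
    inv_mul_cancel₀ (by positivity), one_smul]


lemma toSuper_domDomCongr (j : W →ₗ[ℝ] SuperAlg T V) {k l : ℕ} (h : k = l)
    (α : T [⋀^Fin k]→ₗ[ℝ] W) : toSuper t j (α.domDomCongr (finCongr h)) = toSuper t j α := by
  subst h
  rfl

variable (V) in
/-- The element of `SuperAlg T V` given by a real-valued form. -/
def realSuper {k : ℕ} : (T [⋀^Fin k]→ₗ[ℝ] ℝ) →ₗ[ℝ] SuperAlg T V :=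
  toSuper t (Algebra.linearMap ℝ (SuperAlg T V))

lemma realSuper_apply {k : ℕ} (α : T [⋀^Fin k]→ₗ[ℝ] ℝ) : realSuper V t α =
    (k.factorial : ℝ)⁻¹ • ∑ r : Fin k → ι, α (fun a ↦ t (r a)) • coordProd V t r := by
  refine congrArg _ (Finset.sum_congr rfl fun r _ ↦ ?_)
  rw [Algebra.linearMap_apply, ← Algebra.commutes, Algebra.smul_def]

lemma realSuper_wedge {a b : ℕ} (α : T [⋀^Fin a]→ₗ[ℝ] ℝ) (β : T [⋀^Fin b]→ₗ[ℝ] ℝ) :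
    realSuper V t (wedge α β) = realSuper V t α * realSuper V t β := by
  rw [realSuper, realSuper, realSuper, toSuper_wedge, toSuper_apply, toSuper_apply, smul_mul_smul_comm,
    Finset.sum_mul_sum]
  refine congrArg _ (Finset.sum_congr rfl fun r _ ↦ Finset.sum_congr rfl fun s _ ↦ ?_)
  simp only [Algebra.linearMap_apply, map_mul]
  rw [mul_assoc, mul_assoc, ← mul_assoc (coordProd V t s), ← Algebra.commutes _ (coordProd V t s)]
  simp only [mul_assoc]

lemma realSuper_wedgeFamily (d k : ℕ) (α : Fin k → T [⋀^Fin d]→ₗ[ℝ] ℝ) :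
    realSuper V t (wedgeFamily d k α) = (List.ofFn fun i ↦ realSuper V t (α i)).prod := by
  induction k with
  | zero =>
    rw [realSuper_apply]
    simp [wedgeFamily, coordProd]
  | succ k ih =>
    rw [wedgeFamily, realSuper_wedge, ih, List.ofFn_succ', List.concat_eq_append, List.prod_append]
    simp

lemma realSuper_one (α : T [⋀^Fin 1]→ₗ[ℝ] ℝ) : realSuper V t α =
    ExteriorAlgebra.ι ℝ (∑ i, α (fun _ ↦ t i) • t.coord i, (0 : V)) := by
  rw [realSuper_apply]
  have h : (∑ i, α (fun _ ↦ t i) • t.coord i, (0 : V)) =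
      ∑ i, α (fun _ ↦ t i) • (t.coord i, (0 : V)) := by
    simp [Prod.ext_iff, Prod.fst_sum, Prod.snd_sum]
  rw [h, map_sum]
  simp only [Nat.factorial_one, Nat.cast_one, inv_one, one_smul, map_smul]
  refine Fintype.sum_equiv (Equiv.funUnique (Fin 1) ι) _ _ fun r ↦ ?_
  have : r = fun _ ↦ r 0 := funext fun i ↦ by rw [Subsingleton.elim i 0]
  rw [this]
  simp [coordProd, ExteriorAlgebra.ιMulti_apply]

variable (T V) in
/-- The inclusion `⋀V → SuperAlg T V`. -/
def inrSuper : ExteriorAlgebra ℝ V →ₐ[ℝ] SuperAlg T V :=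
  ExteriorAlgebra.map (LinearMap.inr ℝ (Dual ℝ T) V)

/-- The `i`-th basis vector as an element of `SuperAlg T V`. -/
abbrev vecSuper (T : Type*) [AddCommGroup T] [Module ℝ T] {V : Type*} [AddCommGroup V] [Module ℝ V]
    (v : V) : SuperAlg T V := ExteriorAlgebra.ι ℝ ((0 : Dual ℝ T), v)

lemma ι_anticomm {M : Type*} [AddCommGroup M] [Module ℝ M] (x y : M) :
    ExteriorAlgebra.ι ℝ x * ExteriorAlgebra.ι ℝ y =
      -(ExteriorAlgebra.ι ℝ y * ExteriorAlgebra.ι ℝ x) :=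
  eq_neg_of_add_eq_zero_left (ExteriorAlgebra.ι_add_mul_swap x y)

/-- A covector anticommutes with each vector, so moving it past y costs one sign for each degree of
y, which is what the grading involution records. -/
lemma inrSuper_mul_ι (f : Dual ℝ T) (y : ExteriorAlgebra ℝ V) :
    inrSuper T V y * ExteriorAlgebra.ι ℝ (f, (0 : V)) = ExteriorAlgebra.ι ℝ (f, (0 : V)) *
      inrSuper T V (CliffordAlgebra.involute (Q := (0 : QuadraticForm ℝ V)) y) := by
  induction y using ExteriorAlgebra.induction with
  | algebraMap r =>
    have : CliffordAlgebra.involute (Q := (0 : QuadraticForm ℝ V))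
      (algebraMap ℝ (ExteriorAlgebra ℝ V) r) = algebraMap ℝ (ExteriorAlgebra ℝ V) r :=
      AlgHom.commutes _ _
    rw [this, AlgHom.commutes]
    exact Algebra.commutes _ _
  | ι x =>
    have : CliffordAlgebra.involute (Q := (0 : QuadraticForm ℝ V)) (ExteriorAlgebra.ι ℝ x) =
      -ExteriorAlgebra.ι ℝ x := CliffordAlgebra.involute_ι _
    rw [this, map_neg, inrSuper, ExteriorAlgebra.map_apply_ι, mul_neg]
    exact ι_anticomm _ _
  | mul a b ha hb =>
    have : CliffordAlgebra.involute (Q := (0 : QuadraticForm ℝ V)) (a * b) =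
      (CliffordAlgebra.involute (Q := (0 : QuadraticForm ℝ V)) a : ExteriorAlgebra ℝ V) *
      (CliffordAlgebra.involute (Q := (0 : QuadraticForm ℝ V)) b : ExteriorAlgebra ℝ V) :=
      map_mul _ _ _
    rw [this, map_mul, map_mul, mul_assoc, hb, ← mul_assoc, ha, mul_assoc]
  | add a b ha hb =>
    have : CliffordAlgebra.involute (Q := (0 : QuadraticForm ℝ V)) (a + b) =
      (CliffordAlgebra.involute (Q := (0 : QuadraticForm ℝ V)) a : ExteriorAlgebra ℝ V) +
      (CliffordAlgebra.involute (Q := (0 : QuadraticForm ℝ V)) b : ExteriorAlgebra ℝ V) :=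
      map_add _ _ _
    rw [this, map_add, map_add, add_mul, ha, hb, mul_add]

lemma inrSuper_mul_coordProd {b : ℕ} (s : Fin b → ι) (y : ExteriorAlgebra ℝ V) :
    inrSuper T V y * coordProd V t s = coordProd V t s *
      inrSuper T V (((CliffordAlgebra.involute (Q := (0 : QuadraticForm ℝ V))).toLinearMap ^ b) y) := by
  induction b generalizing y with
  | zero => simp [coordProd]
  | succ b ih =>
    have h : coordProd V t s = ExteriorAlgebra.ι ℝ (t.coord (s 0), (0 : V)) *
        coordProd V t (fun i ↦ s i.succ) := ExteriorAlgebra.ιMulti_succ_apply _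
    rw [h, ← mul_assoc, inrSuper_mul_ι, mul_assoc, ih, ← mul_assoc, pow_succ]
    rfl

/-- The element of `SuperAlg T V` given by a form with values in `⋀V`. -/
def extSuper {k : ℕ} : (T [⋀^Fin k]→ₗ[ℝ] ExteriorAlgebra ℝ V) →ₗ[ℝ] SuperAlg T V :=
  toSuper t (inrSuper T V).toLinearMap

/-- The sign (-1)^{jk} in the product is the cost of moving the b covectors of the second factor to
the left across the ⋀V-part of the first, so the bigraded product is the ordinary product of ⋀(T* ⊕
V). -/
lemma extSuper_bigradedMul {a b : ℕ} (α : T [⋀^Fin a]→ₗ[ℝ] ExteriorAlgebra ℝ V)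
    (β : T [⋀^Fin b]→ₗ[ℝ] ExteriorAlgebra ℝ V) :
    extSuper t (bigradedMul α β) = extSuper t α * extSuper t β := by
  rw [extSuper, extSuper, extSuper, bigradedMul, toSuper_wedge, toSuper_apply, toSuper_apply, smul_mul_smul_comm,
    Finset.sum_mul_sum]
  refine congrArg _ (Finset.sum_congr rfl fun r _ ↦ Finset.sum_congr rfl fun s _ ↦ ?_)
  simp only [AlgHom.toLinearMap_apply, LinearMap.compAlternatingMap_apply, map_mul]
  rw [mul_assoc (coordProd V t r) (inrSuper T V _), ← mul_assoc (inrSuper T V _) (coordProd V t s),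
    inrSuper_mul_coordProd]
  simp only [mul_assoc]

lemma extSuper_bigradedPow {d : ℕ} (α : T [⋀^Fin d]→ₗ[ℝ] ExteriorAlgebra ℝ V) (k : ℕ) :
    extSuper t (bigradedPow α k) = extSuper t α ^ k := by
  induction k with
  | zero =>
    rw [extSuper, toSuper_apply]
    simp [bigradedPow, coordProd]
  | succ k ih => rw [bigradedPow, extSuper_bigradedMul, ih, pow_succ]

lemma extSuper_comp_toSpanSingleton {k : ℕ} (α : T [⋀^Fin k]→ₗ[ℝ] ℝ) (y : ExteriorAlgebra ℝ V) :
    extSuper t ((LinearMap.toSpanSingleton ℝ _ y).compAlternatingMap α) =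
      realSuper V t α * inrSuper T V y := by
  rw [extSuper, toSuper_apply, realSuper_apply, smul_mul_assoc, Finset.sum_mul]
  refine congrArg _ (Finset.sum_congr rfl fun r _ ↦ ?_)
  simp

/-- Recovers a form `α` of degree `k` from `realSuper V t α * (e₁ ⋯ eₙ)`. -/
def evalSuper {n k : ℕ} (b : Basis (Fin n) ℝ V) (w : Fin k → T) : SuperAlg T V →ₗ[ℝ] ℝ :=
  ExteriorAlgebra.liftAlternating (Pi.single (k + n)
    (((Matrix.detRowAlternating (n := Fin k ⊕ Fin n) (R := ℝ)).compLinearMap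
      (LinearMap.pi (Sum.elim
        (fun i ↦ (Module.Dual.eval ℝ T (w i)).comp (LinearMap.fst ℝ (Dual ℝ T) V))
        fun i ↦ (b.coord i).comp (LinearMap.snd ℝ (Dual ℝ T) V)))).domDomCongr finSumFinEquiv))

variable (T) in
/-- The product of the vectors `e i` in `SuperAlg T V`. -/
def vecProd {n : ℕ} (e : Fin n → V) : SuperAlg T V :=
  ExteriorAlgebra.ιMulti ℝ n fun i ↦ ((0 : Dual ℝ T), e i)

/-- The defining determinant is block diagonal on such a product, and the block belonging to V is
the identity. -/
lemma evalSuper_coordProd_mul {n k : ℕ} (b : Basis (Fin n) ℝ V) (w : Fin k → T) (r : Fin k → ι) :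
    evalSuper b w (coordProd V t r * vecProd T b) =
      Matrix.det (Matrix.of fun i j ↦ t.coord (r i) (w j)) := by
  rw [coordProd, vecProd, ExteriorAlgebra.ιMulti_mul_ιMulti, evalSuper,
    ExteriorAlgebra.liftAlternating_apply_ιMulti, Pi.single_eq_same]
  simp only [AlternatingMap.domDomCongr_apply, AlternatingMap.compLinearMap_apply]
  change Matrix.det _ = _
  rw [← mul_one (Matrix.det (Matrix.of _)),
    ← Matrix.det_one (n := Fin n) (R := ℝ), ← Matrix.det_fromBlocks_zero₂₁ _ 0]
  congr 1
  ext i j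
  rcases i with i | i <;> rcases j with j | j <;>
    simp [Matrix.one_apply, Finsupp.single_apply]

/-- Expanding the determinants over permutations, each of the k! permutations reproduces the basis
expansion of α(w), because α is alternating. -/
lemma evalSuper_realSuper_mul {n k : ℕ} (b : Basis (Fin n) ℝ V) (w : Fin k → T)
    (α : T [⋀^Fin k]→ₗ[ℝ] ℝ) : evalSuper b w (realSuper V t α * vecProd T b) = α w := by
  classical
  rw [realSuper_apply, smul_mul_assoc, map_smul, Finset.sum_mul, map_sum,
    inv_smul_eq_iff₀ (by positivity)]
  have h1 : ∀ σ : Equiv.Perm (Fin k), ∑ r : Fin k → ι, α (fun a ↦ t (r a)) *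
      (((Equiv.Perm.sign σ : ℤ) : ℝ) * ∏ i, t.coord (r (σ i)) (w i)) = α w := by
    intro σ
    have : α w = ((Equiv.Perm.sign σ : ℤ) : ℝ) * α (fun i ↦ w (σ⁻¹ i)) := by
      have := α.map_perm w σ⁻¹
      rw [show (fun i ↦ w (σ⁻¹ i)) = w ∘ ⇑σ⁻¹ from rfl, this, Equiv.Perm.sign_inv, Units.smul_def,
        ← Int.cast_smul_eq_zsmul ℝ, smul_eq_mul, ← mul_assoc]
      rcases Int.units_eq_one_or (Equiv.Perm.sign σ) with h | h <;> simp [h]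
    rw [this]
    have h2 : (fun i ↦ w (σ⁻¹ i)) = fun i ↦ ∑ j, t.coord j (w (σ⁻¹ i)) • t j :=
      funext fun i ↦ (t.sum_repr _).symm
    rw [h2, ← α.coe_multilinearMap, MultilinearMap.map_sum, Finset.mul_sum]
    refine Finset.sum_congr rfl fun r _ ↦ ?_
    rw [MultilinearMap.map_smul_univ, smul_eq_mul]
    have : ∏ i, t.coord (r i) (w (σ⁻¹ i)) = ∏ i, t.coord (r (σ i)) (w i) :=
      Fintype.prod_equiv σ⁻¹ _ _ fun i ↦ by simp
    rw [this, AlternatingMap.coe_multilinearMap]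
    ring
  rw [Finset.sum_congr rfl fun r _ ↦ by
    rw [smul_mul_assoc, map_smul, evalSuper_coordProd_mul, Matrix.det_apply', smul_eq_mul,
      Finset.mul_sum], Finset.sum_comm]
  refine (Finset.sum_congr rfl fun σ _ ↦ h1 σ).trans ?_
  simp [Fintype.card_perm]

end SuperAlgebra

end

section

/-! ### The coefficients and the telescoping sum -/

section Telescope

/-- The coefficient of `Φₖ` in the transgression formula. -/
def chernCoeff (q k : ℕ) : ℝ :=
  (-1 : ℝ) ^ k * (2 : ℝ) ^ (((q : ℝ) + 1) / 2) /
      (k.factorial * (q - 2 * k).factorial * 2 ^ (2 * k + 1)) *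
    Real.Gamma (((q : ℝ) + 1 - 2 * k) / 2)

/-- `chernCoeff` with the factors that appear when `Φₖ` is written as a product. -/
def chernCoeff' (q k : ℕ) : ℝ := chernCoeff q k * (-1) ^ ((q - 2 * k).choose 2) * 2 ^ k

lemma neg_one_pow_choose_add_two (l : ℕ) :
    (-1 : ℝ) ^ ((l + 2).choose 2) = -(-1) ^ (l.choose 2) := by
  have : (l + 2).choose 2 = l.choose 2 + 2 * l + 1 := by
    rw [Nat.choose_succ_succ' (l + 1) 1, Nat.choose_succ_succ' l 1]
    simp
    ring
  rw [this, pow_succ, pow_add, pow_mul]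
  simp

/-- The recursion behind the cancellation. It comes from Γ(s+1) = sΓ(s) with s = (q-1-2k)/2; the
sign (-1)^k is compensated by the change of the sign with exponent `choose 2`. -/
lemma chernCoeff'_succ {q k : ℕ} (h : 2 * (k + 1) ≤ q) :
    (k + 1) * chernCoeff' q (k + 1) = (q - 2 * k : ℕ) * chernCoeff' q k := by
  obtain ⟨l, rfl⟩ := Nat.exists_eq_add_of_le h
  have h1 : 2 * (k + 1) + l - 2 * (k + 1) = l := by omega
  have h2 : 2 * (k + 1) + l - 2 * k = l + 2 := by omega
  have hG : Real.Gamma ((((2 * (k + 1) + l : ℕ) : ℝ) + 1 - 2 * k) / 2) =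
      ((l + 1 : ℝ) / 2) * Real.Gamma ((((2 * (k + 1) + l : ℕ) : ℝ) + 1 - 2 * (k + 1 : ℕ)) / 2) := by
    rw [show (((2 * (k + 1) + l : ℕ) : ℝ) + 1 - 2 * (k + 1 : ℕ)) / 2 = (l + 1) / 2 by
      push_cast; ring, ← Real.Gamma_add_one (by positivity)]
    congr 1
    push_cast
    ring
  have hf : ((l + 2).factorial : ℝ) = (l + 2) * (l + 1) * l.factorial := by
    rw [Nat.factorial_succ, Nat.factorial_succ]; push_cast; ring
  have hk : ((k + 1).factorial : ℝ) = (k + 1) * k.factorial := by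
    rw [Nat.factorial_succ]; push_cast; ring
  rw [chernCoeff', chernCoeff', chernCoeff, chernCoeff, h1, h2, hG, neg_one_pow_choose_add_two, hf, hk]
  generalize Real.Gamma _ = G
  generalize (2 : ℝ) ^ ((((2 * (k + 1) + l : ℕ) : ℝ) + 1) / 2) = P
  have h3 : (k.factorial : ℝ) ≠ 0 := by positivity
  have h4 : (l.factorial : ℝ) ≠ 0 := by positivity
  push_cast
  field_simp
  ring

/-- For even rank n = 2K + 2 the last value of Γ is Γ(1) = 1, and all powers of 2 cancel. -/
lemma chernCoeff'_last (K : ℕ) :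
    chernCoeff' (2 * K + 1) K = (K.factorial : ℝ)⁻¹ * (-1) ^ K := by
  have h1 : 2 * K + 1 - 2 * K = 1 := by omega
  have h2 : ((((2 * K + 1 : ℕ) : ℝ) + 1 - 2 * K) / 2) = 1 := by push_cast; ring
  have h3 : (2 : ℝ) ^ ((((2 * K + 1 : ℕ) : ℝ) + 1) / 2) = 2 ^ (K + 1) := by
    rw [← Real.rpow_natCast]; congr 1; push_cast; ring
  rw [chernCoeff', chernCoeff, h1, h2, h3, Real.Gamma_one]
  have h4 : (K.factorial : ℝ) ≠ 0 := by positivity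
  simp only [Nat.factorial_one, Nat.choose_eq_zero_of_lt (show 1 < 2 by norm_num)]
  field_simp
  push_cast
  ring

variable {Z : Type*} [CommRing Z] [Algebra ℝ Z]

/-- The binomial expansion stops after the linear term in u. -/
lemma sub_pow_of_sq_zero (R u : Z) (hu : u * u = 0) (k : ℕ) :
    (R - u) ^ (k + 1) = R ^ (k + 1) - ((k + 1 : ℕ) : ℝ) • (R ^ k * u) := by
  induction k with
  | zero => simp
  | succ k ih =>
    rw [pow_succ, ih]
    simp only [Nat.cast_smul_eq_nsmul, nsmul_eq_mul]
    push_cast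
    linear_combination ((k : Z) + 1) * R ^ k * hu

lemma sub_pow_mul_of_sq_zero (R u : Z) (hu : u * u = 0) (k : ℕ) : (R - u) ^ k * u = R ^ k * u := by
  cases k with
  | zero => simp
  | succ k =>
    rw [sub_pow_of_sq_zero R u hu, sub_mul, smul_mul_assoc, mul_assoc, hu]
    simp

/-- The telescoping sum behind the transgression formula. -/
lemma chern_telescope (q : ℕ) (R θ u : Z) (hu : u * u = 0)
    (hR : ∀ k l, q < 2 * k + l → R ^ k * θ ^ l = 0) :
    (if q % 2 = 1 then (((-1) ^ ((q + 1) / 2) / ((q + 1) / 2).factorial : ℝ)) •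
      (R - u) ^ ((q + 1) / 2) else 0) = (-1 : ℝ) ^ q • ∑ k ∈ Finset.range (q / 2 + 1),
      chernCoeff' q k • (-((R - u) ^ k * θ ^ (q - 2 * k + 1)) -
        ((q - 2 * k : ℕ) : ℝ) • ((R - u) ^ k * θ ^ (q - 2 * k - 1) * u)) := by
  -- Closed form of the partial sums. The part of term K + 1 with exponent q - 2(K+1) + 1 cancels
  -- the previous remainder by the recursion. For q = 2K the truncated exponent q - 2K - 1 is
  -- harmless because its coefficient is zero.
  have h1 : ∀ K, 2 * K ≤ q → ∑ k ∈ Finset.range (K + 1),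
      chernCoeff' q k • (-((R - u) ^ k * θ ^ (q - 2 * k + 1)) -
        ((q - 2 * k : ℕ) : ℝ) • ((R - u) ^ k * θ ^ (q - 2 * k - 1) * u)) =
      -(((q - 2 * K : ℕ) : ℝ) * chernCoeff' q K) • (R ^ K * θ ^ (q - 2 * K - 1) * u) := by
    intro K
    induction K with
    | zero =>
      intro _
      have := hR 0 (q + 1) (by omega)
      simp only [pow_zero, one_mul] at this
      simp only [zero_add, Finset.sum_range_one, mul_zero, Nat.sub_zero, this, pow_zero, one_mul,
        neg_zero, zero_sub, smul_neg, smul_smul, neg_smul]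
      rw [mul_comm (q : ℝ)]
    | succ K ih =>
      intro hK
      have h2 : (R - u) ^ (K + 1) * θ ^ (q - 2 * (K + 1) + 1) =
          -(((K + 1 : ℕ) : ℝ) • (R ^ K * θ ^ (q - 2 * K - 1) * u)) := by
        rw [sub_pow_of_sq_zero R u hu, sub_mul, hR _ _ (by omega),
          show q - 2 * (K + 1) + 1 = q - 2 * K - 1 by omega, zero_sub, smul_mul_assoc]
        congr 2
        ring
      have h3 := chernCoeff'_succ hK
      rw [Finset.sum_range_succ, ih (by omega), h2, mul_right_comm ((R - u) ^ (K + 1)),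
        sub_pow_mul_of_sq_zero R u hu, mul_right_comm (R ^ (K + 1)), neg_neg, smul_sub, smul_smul,
        smul_smul, ← h3]
      push_cast
      module
  rw [h1 _ (by omega)]
  split_ifs with hq
  · obtain ⟨K, rfl⟩ : ∃ K, q = 2 * K + 1 := ⟨q / 2, by omega⟩
    rw [show (2 * K + 1) / 2 = K by omega, show (2 * K + 1 + 1) / 2 = K + 1 by omega,
      show 2 * K + 1 - 2 * K = 1 by omega, sub_pow_of_sq_zero R u hu, chernCoeff'_last]
    have := hR (K + 1) 0 (by omega)
    simp only [pow_zero, mul_one] at this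
    rw [this, zero_sub, smul_neg, smul_smul, smul_smul, ← neg_smul]
    simp only [Nat.sub_self, pow_zero, mul_one]
    congr 1
    have h4 : ((K + 1).factorial : ℝ) = (K + 1) * K.factorial := by
      rw [Nat.factorial_succ]; push_cast; ring
    have h5 : (K.factorial : ℝ) ≠ 0 := by positivity
    rw [h4, pow_succ (-1 : ℝ) (2 * K), pow_mul]
    push_cast
    field_simp
    ring
  · rw [show q - 2 * (q / 2) = 0 by omega]
    simp

end Telescope

/-! ### Products of sums expanded over index functions -/

section Expansion

variable {A : Type*} [Ring A] [Algebra ℝ A] {J : Type*} [Fintype J]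

lemma prod_ofFn_add_two {k : ℕ} (f : Fin (2 * (k + 1)) → A) : (List.ofFn f).prod =
    (List.ofFn fun i : Fin (2 * k) ↦ f ⟨i, by omega⟩).prod *
      (f ⟨2 * k, by omega⟩ * f ⟨2 * k + 1, by omega⟩) := by
  have h := List.ofFn_succ' (n := 2 * k + 1) f
  have h' := List.ofFn_succ' (n := 2 * k) fun i ↦ f i.castSucc
  rw [List.concat_eq_append] at h h'
  rw [show List.ofFn f = _ from h, h', List.prod_append, List.prod_append, List.prod_singleton,
    List.prod_singleton, mul_assoc]
  rfl

/-- The Ω's are central, so each new one can be collected on the left of the vectors already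
present. -/
lemma sum_pairs_pow (Ω : J → J → A) (e : J → A) (hΩ : ∀ a b y, Commute (Ω a b) y) (k : ℕ) :
    (∑ a, ∑ b, Ω a b * (e a * e b)) ^ k = ∑ γ : Fin (2 * k) → J,
      (List.ofFn fun i : Fin k ↦ Ω (γ ⟨2 * i, by omega⟩) (γ ⟨2 * i + 1, by omega⟩)).prod *
        (List.ofFn fun i ↦ e (γ i)).prod := by
  induction k with
  | zero => simp
  | succ k ih =>
    let ε : (Fin (2 * (k + 1)) → J) ≃ (Fin (2 * k) → J) × (J × J) :=
      (Fin.snocEquiv (fun _ : Fin (2 * k + 1 + 1) ↦ J)).symm.trans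
        (((Equiv.refl J).prodCongr (Fin.snocEquiv (fun _ : Fin (2 * k + 1) ↦ J)).symm).trans
        ⟨fun x ↦ (x.2.2, (x.2.1, x.1)), fun x ↦ (x.2.2, (x.2.1, x.1)), fun _ ↦ rfl, fun _ ↦ rfl⟩)
    rw [pow_succ, ih, Finset.sum_mul, Fintype.sum_equiv ε _ (fun x ↦
      (List.ofFn fun i : Fin k ↦ Ω (x.1 ⟨2 * i, by omega⟩) (x.1 ⟨2 * i + 1, by omega⟩)).prod *
      Ω x.2.1 x.2.2 * ((List.ofFn fun i ↦ e (x.1 i)).prod * (e x.2.1 * e x.2.2))),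
      Fintype.sum_prod_type]
    · refine Finset.sum_congr rfl fun γ _ ↦ ?_
      rw [Finset.mul_sum, Fintype.sum_prod_type]
      refine Finset.sum_congr rfl fun a _ ↦ ?_
      rw [Finset.mul_sum]
      refine Finset.sum_congr rfl fun b _ ↦ ?_
      simp only [mul_assoc]
      congr 1
      rw [← mul_assoc, ← (hΩ a b _).eq, mul_assoc]
    · intro γ
      rw [prod_ofFn_add_two, List.ofFn_succ', List.concat_eq_append, List.prod_append,
        List.prod_singleton]
      rfl

lemma prod_mul_comm_of_anticomm {l : ℕ} (e : Fin l → A) (y : A) (h : ∀ i, e i * y = -(y * e i)) :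
    (List.ofFn e).prod * y = (-1 : ℝ) ^ l • (y * (List.ofFn e).prod) := by
  induction l with
  | zero => simp
  | succ l ih =>
    rw [List.ofFn_succ, List.prod_cons, mul_assoc, ih _ fun i ↦ h i.succ, mul_smul_comm, ← mul_assoc,
      h, pow_succ]
    simp [mul_assoc]

/-- Adding one more factor moves its w across the l earlier vectors, at the cost (-1)^l. In all the
exponent is 0 + 1 + ⋯ + (l-1). -/
lemma sum_singles_pow (w e : J → A) (h : ∀ a b, e a * w b = -(w b * e a)) (l : ℕ) :
    ∑ γ : Fin l → J, (List.ofFn fun i ↦ w (γ i)).prod * (List.ofFn fun i ↦ e (γ i)).prod =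
      (-1 : ℝ) ^ (l.choose 2) • (∑ a, w a * e a) ^ l := by
  induction l with
  | zero => simp
  | succ l ih =>
    rw [← Fintype.sum_equiv (Fin.snocEquiv (fun _ : Fin (l + 1) ↦ J)) (fun x ↦
      (-1 : ℝ) ^ l • (((List.ofFn fun i ↦ w (x.2 i)).prod * (List.ofFn fun i ↦ e (x.2 i)).prod) *
      (w x.1 * e x.1))) _ ?_, Fintype.sum_prod_type_right]
    · simp only [← Finset.smul_sum, ← Finset.mul_sum, ← Finset.sum_mul]
      rw [ih, smul_mul_assoc, smul_smul, pow_succ (∑ a, w a * e a), Nat.choose_succ_succ' l 1,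
        Nat.choose_one_right, pow_add]
    · intro x
      have h1 := prod_mul_comm_of_anticomm (fun i ↦ e (x.2 i)) (w x.1) fun i ↦ h _ _
      have h2 : ((-1 : ℝ) ^ l * (-1) ^ l) = 1 := by rw [← mul_pow]; simp
      rw [List.ofFn_succ', List.ofFn_succ', List.concat_eq_append, List.concat_eq_append,
        List.prod_append, List.prod_append, List.prod_singleton, List.prod_singleton]
      simp only [Fin.snocEquiv_apply, Fin.snoc_castSucc, Fin.snoc_last]
      rw [mul_assoc _ (List.prod _) (w x.1 * e x.1), ← mul_assoc (List.prod _) (w x.1), h1,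
        smul_mul_assoc, mul_smul_comm, smul_smul, h2, one_smul]
      simp only [mul_assoc]

lemma commute_prod_pairs (e : J → A) (he : ∀ a b y, Commute (e a * e b) y) (k : ℕ)
    (γ : Fin (2 * k) → J) (y : A) : Commute (List.ofFn fun i ↦ e (γ i)).prod y := by
  induction k with
  | zero => simp
  | succ k ih =>
    rw [prod_ofFn_add_two]
    exact (ih _).mul_left (he _ _ _)

/-- Combines the two expansions. Separating the blocks produces no further sign, since the first
block contains an even number of vectors and is therefore central. -/
lemma sum_pairs_singles (Ω : J → J → A) (w e : J → A) (hΩ : ∀ a b y, Commute (Ω a b) y)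
    (h : ∀ a b, e a * w b = -(w b * e a)) (he : ∀ a b y, Commute (e a * e b) y) {k l n : ℕ}
    (hn : 2 * k + l = n) : ∑ γ : Fin n → J,
      (List.ofFn fun i : Fin k ↦ Ω (γ ⟨2 * i, by omega⟩) (γ ⟨2 * i + 1, by omega⟩)).prod *
      (List.ofFn fun i : Fin l ↦ w (γ ⟨2 * k + i, by omega⟩)).prod * (List.ofFn fun i ↦ e (γ i)).prod =
      (-1 : ℝ) ^ (l.choose 2) • ((∑ a, ∑ b, Ω a b * (e a * e b)) ^ k * (∑ a, w a * e a) ^ l) := by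
  subst hn
  rw [← Fintype.sum_equiv (Fin.appendEquiv (2 * k) l) (fun x ↦
    ((List.ofFn fun i : Fin k ↦ Ω (x.1 ⟨2 * i, by omega⟩) (x.1 ⟨2 * i + 1, by omega⟩)).prod *
      (List.ofFn fun i ↦ e (x.1 i)).prod) * ((List.ofFn fun i ↦ w (x.2 i)).prod *
      (List.ofFn fun i ↦ e (x.2 i)).prod)) _ ?_, Fintype.sum_prod_type]
  · simp only [← Finset.mul_sum, ← Finset.sum_mul]
    rw [sum_singles_pow w e h, ← sum_pairs_pow Ω e hΩ, mul_smul_comm]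
  · intro x
    have h1 : (List.ofFn fun i ↦ e (Fin.append x.1 x.2 i)).prod = (List.ofFn fun i ↦ e (x.1 i)).prod *
        (List.ofFn fun i ↦ e (x.2 i)).prod := by
      rw [← List.prod_append, ← List.ofFn_fin_append]
      congr 2
      funext i
      refine Fin.addCases (fun c ↦ ?_) (fun c ↦ ?_) i <;> simp
    have h2 : ∀ i : Fin (2 * k), Fin.appendEquiv (2 * k) l x ⟨i, by omega⟩ = x.1 i := fun i ↦
      Fin.append_left _ _ i
    have h3 : ∀ i : Fin l, Fin.append x.1 x.2 ⟨2 * k + i, by omega⟩ = x.2 i := fun i ↦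
      Fin.append_right _ _ i
    change _ = _ * _ * (List.ofFn fun i ↦ e (Fin.append x.1 x.2 i)).prod
    rw [h1]
    have h4 : (List.ofFn fun i : Fin k ↦ Ω ((Fin.appendEquiv (2 * k) l x) ⟨2 * i, by omega⟩)
        ((Fin.appendEquiv (2 * k) l x) ⟨2 * i + 1, by omega⟩)).prod =
        (List.ofFn fun i : Fin k ↦ Ω (x.1 ⟨2 * i, by omega⟩) (x.1 ⟨2 * i + 1, by omega⟩)).prod := by
      congr 2
      funext i
      exact congrArg₂ Ω (h2 ⟨2 * (i : ℕ), by omega⟩) (h2 ⟨2 * (i : ℕ) + 1, by omega⟩)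
    have h5 : (List.ofFn fun i : Fin l ↦ w ((Fin.appendEquiv (2 * k) l x) ⟨2 * k + i, by omega⟩)) =
        List.ofFn fun i ↦ w (x.2 i) := by
      congr 1
      funext i
      exact congrArg w (h3 i)
    rw [h4, h5]
    simp only [mul_assoc]
    congr 1
    rw [← mul_assoc, (commute_prod_pairs e he k x.1 _).eq, mul_assoc]

end Expansion

end

section

/-! ### Curvature, θ and Chern's forms as elements of the algebra -/

section SuperElements

variable {M : Type*} [AddCommGroup M] [Module ℝ M]

/-- Passing a generator produces two signs, which cancel. This makes the curvature element, θ and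
ζeₙ central. -/
lemma commute_ι_mul_ι (x y : M) (z : ExteriorAlgebra ℝ M) :
    Commute (ExteriorAlgebra.ι ℝ x * ExteriorAlgebra.ι ℝ y) z := by
  induction z using ExteriorAlgebra.induction with
  | algebraMap r => exact (Algebra.commutes r _).symm
  | ι m =>
    rw [commute_iff_eq, mul_assoc, ι_anticomm y m, mul_neg, ← mul_assoc, ι_anticomm x m]
    simp [mul_assoc]
  | mul a b ha hb => exact ha.mul_right hb
  | add a b ha hb => exact ha.add_right hb

variable {T : Type*} [AddCommGroup T] [Module ℝ T] {V : Type*} [AddCommGroup V] [Module ℝ V]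
  {ι : Type*} [Fintype ι] (t : Basis ι ℝ T) {q : ℕ}

lemma commute_realSuper_two (α : T [⋀^Fin 2]→ₗ[ℝ] ℝ) (z : SuperAlg T V) :
    Commute (realSuper V t α) z := by
  rw [realSuper_apply]
  refine Commute.smul_left (Commute.sum_left _ _ _ fun r _ ↦ Commute.smul_left ?_ _) _
  have : coordProd V t r = ExteriorAlgebra.ι ℝ (t.coord (r 0), (0 : V)) *
      ExteriorAlgebra.ι ℝ (t.coord (r 1), (0 : V)) := by
    rw [coordProd, ExteriorAlgebra.ιMulti_apply, List.ofFn_succ, List.ofFn_succ]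
    simp
  rw [this]
  exact commute_ι_mul_ι _ _ _

lemma realSuper_one_mul_vecSuper (α : T [⋀^Fin 1]→ₗ[ℝ] ℝ) (v : V) :
    vecSuper T v * realSuper V t α = -(realSuper V t α * vecSuper T v) := by
  rw [realSuper_one]
  exact ι_anticomm _ _

lemma commute_realSuper_one_mul_vecSuper (α : T [⋀^Fin 1]→ₗ[ℝ] ℝ) (v : V) (z : SuperAlg T V) :
    Commute (realSuper V t α * vecSuper T v) z := by
  rw [realSuper_one]
  exact commute_ι_mul_ι _ _ _

lemma vecProd_eq {n : ℕ} (e : Fin n → V) :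
    vecProd T e = (List.ofFn fun i ↦ vecSuper T (e i)).prod :=
  ExteriorAlgebra.ιMulti_apply _

/-- `½ ∑ Ωᵢⱼ eᵢ eⱼ`. -/
def curvSuper (e : Fin (q + 1) → V) (Ω : Fin (q + 1) → Fin (q + 1) → T [⋀^Fin 2]→ₗ[ℝ] ℝ) :
    SuperAlg T V :=
  (1 / 2 : ℝ) • ∑ i, ∑ j, realSuper V t (Ω i j) * (vecSuper T (e i) * vecSuper T (e j))

/-- `∑_{a < n} wₐₙ eₐ`. -/
def thetaSuper (e : Fin (q + 1) → V) (w : Fin (q + 1) → Fin (q + 1) → T [⋀^Fin 1]→ₗ[ℝ] ℝ) :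
    SuperAlg T V :=
  ∑ a : Fin q, realSuper V t (w a.castSucc (Fin.last q)) * vecSuper T (e a.castSucc)

/-- `∑_{a < n} Ωₙₐ eₐ`. -/
def zetaSuper (e : Fin (q + 1) → V) (Ω : Fin (q + 1) → Fin (q + 1) → T [⋀^Fin 2]→ₗ[ℝ] ℝ) :
    SuperAlg T V :=
  ∑ a : Fin q, realSuper V t (Ω (Fin.last q) a.castSucc) * vecSuper T (e a.castSucc)

/-- `½ ∑_{a, b < n} Ω_{ab} eₐ e_b`. -/
def restCurvSuper (e : Fin (q + 1) → V) (Ω : Fin (q + 1) → Fin (q + 1) → T [⋀^Fin 2]→ₗ[ℝ] ℝ) :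
    SuperAlg T V :=
  (1 / 2 : ℝ) • ∑ a : Fin q, ∑ b : Fin q, realSuper V t (Ω a.castSucc b.castSucc) *
    (vecSuper T (e a.castSucc) * vecSuper T (e b.castSucc))

variable (e : Fin (q + 1) → V) (Ω : Fin (q + 1) → Fin (q + 1) → T [⋀^Fin 2]→ₗ[ℝ] ℝ)
  (w : Fin (q + 1) → Fin (q + 1) → T [⋀^Fin 1]→ₗ[ℝ] ℝ)

lemma commute_curvSuper (z : SuperAlg T V) : Commute (curvSuper t e Ω) z :=
  Commute.smul_left (Commute.sum_left _ _ _ fun _ _ ↦ Commute.sum_left _ _ _ fun _ _ ↦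
    (commute_realSuper_two t _ _).mul_left (commute_ι_mul_ι _ _ _)) _

lemma commute_restCurvSuper (z : SuperAlg T V) : Commute (restCurvSuper t e Ω) z :=
  Commute.smul_left (Commute.sum_left _ _ _ fun _ _ ↦ Commute.sum_left _ _ _ fun _ _ ↦
    (commute_realSuper_two t _ _).mul_left (commute_ι_mul_ι _ _ _)) _

lemma commute_thetaSuper (z : SuperAlg T V) : Commute (thetaSuper t e w) z :=
  Commute.sum_left _ _ _ fun _ _ ↦ commute_realSuper_one_mul_vecSuper t _ _ _

lemma commute_zetaSuper_mul (z : SuperAlg T V) :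
    Commute (zetaSuper t e Ω * vecSuper T (e (Fin.last q))) z := by
  rw [zetaSuper, Finset.sum_mul]
  refine Commute.sum_left _ _ _ fun _ _ ↦ ?_
  rw [mul_assoc]
  exact (commute_realSuper_two t _ _).mul_left (commute_ι_mul_ι _ _ _)

lemma vecSuper_sq (v : V) : vecSuper T v * vecSuper T v = 0 := ExteriorAlgebra.ι_sq_zero _

lemma vecSuper_mul_zetaSuper (v : V) :
    vecSuper T v * zetaSuper t e Ω = -(zetaSuper t e Ω * vecSuper T v) := by
  rw [zetaSuper, Finset.mul_sum, Finset.sum_mul, ← Finset.sum_neg_distrib]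
  refine Finset.sum_congr rfl fun a _ ↦ ?_
  rw [← mul_assoc, ← (commute_realSuper_two t _ _).eq, mul_assoc, ι_anticomm, mul_neg, mul_assoc]

lemma zetaSuper_mul_sq : (zetaSuper t e Ω * vecSuper T (e (Fin.last q))) *
    (zetaSuper t e Ω * vecSuper T (e (Fin.last q))) = 0 := by
  rw [mul_assoc, ← mul_assoc (vecSuper T _), vecSuper_mul_zetaSuper, neg_mul, mul_assoc,
    vecSuper_sq]
  simp

/-- By skew symmetry the terms (a, n) and (n, a) coincide, and their sum cancels the factor ½. -/
lemma curvSuper_eq (hΩ : ∀ i j, Ω j i = -Ω i j) : curvSuper t e Ω =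
    restCurvSuper t e Ω - zetaSuper t e Ω * vecSuper T (e (Fin.last q)) := by
  have h0 : Ω (Fin.last q) (Fin.last q) = 0 := by
    have := hΩ (Fin.last q) (Fin.last q)
    rwa [eq_neg_iff_add_eq_zero, ← two_smul ℝ, smul_eq_zero_iff_right two_ne_zero] at this
  have h1 : ∀ a : Fin q, realSuper V t (Ω a.castSucc (Fin.last q)) *
      (vecSuper T (e a.castSucc) * vecSuper T (e (Fin.last q))) +
      realSuper V t (Ω (Fin.last q) a.castSucc) *
      (vecSuper T (e (Fin.last q)) * vecSuper T (e a.castSucc)) =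
      -((2 : ℝ) • (realSuper V t (Ω (Fin.last q) a.castSucc) * vecSuper T (e a.castSucc) *
        vecSuper T (e (Fin.last q)))) := by
    intro a
    rw [hΩ (Fin.last q) a.castSucc, ι_anticomm (_, e (Fin.last q)), map_neg, mul_neg, neg_mul,
      two_smul, mul_assoc]
    abel
  have h2 : (∑ i, ∑ j, realSuper V t (Ω i j) * (vecSuper T (e i) * vecSuper T (e j))) =
      (∑ a : Fin q, ∑ b : Fin q, realSuper V t (Ω a.castSucc b.castSucc) *
    (vecSuper T (e a.castSucc) * vecSuper T (e b.castSucc))) +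
      ∑ a : Fin q, (realSuper V t (Ω a.castSucc (Fin.last q)) *
      (vecSuper T (e a.castSucc) * vecSuper T (e (Fin.last q))) +
      realSuper V t (Ω (Fin.last q) a.castSucc) *
      (vecSuper T (e (Fin.last q)) * vecSuper T (e a.castSucc))) := by
    rw [Fin.sum_univ_castSucc]
    simp only [Fin.sum_univ_castSucc (n := q), h0, map_zero, zero_mul, add_zero,
      Finset.sum_add_distrib]
    abel
  rw [curvSuper, h2, restCurvSuper, smul_add, sub_eq_add_neg, zetaSuper, Finset.sum_mul,
    Finset.sum_congr rfl fun a _ ↦ h1 a, Finset.sum_neg_distrib, ← Finset.smul_sum, smul_neg,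
    smul_smul]
  norm_num

/-- A product of vectors with a repeated index vanishes, so a signed sum over permutations may be
replaced by an unsigned sum over all index functions. This is what turns Chern's sum into a product
of powers. -/
lemma sum_perm_smul_vecProd {n : ℕ} (e : Fin n → V) (f : (Fin n → Fin n) → SuperAlg T V) :
    (∑ σ : Equiv.Perm (Fin n), ((Equiv.Perm.sign σ : ℤ) : ℝ) • f σ) * vecProd T e =
      ∑ γ : Fin n → Fin n, f γ * vecProd T (e ∘ γ) := by
  rw [Finset.sum_mul]
  refine Finset.sum_of_injOn (fun σ : Equiv.Perm (Fin n) ↦ (σ : Fin n → Fin n))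
    (fun _ _ _ _ h ↦ DFunLike.coe_injective h) (fun _ _ ↦ Finset.mem_coe.2 (Finset.mem_univ _))
    (fun γ _ hγ ↦ ?_) fun σ _ ↦ ?_
  · rw [vecProd, ExteriorAlgebra.ιMulti_eq_zero_of_not_inj, mul_zero]
    intro hinj
    refine hγ ⟨Equiv.ofBijective γ ((Finite.injective_iff_bijective).1 fun a b hab ↦ hinj ?_),
      by simp, rfl⟩
    simp [hab]
  · have h := (ExteriorAlgebra.ιMulti ℝ n).map_perm (fun i ↦ ((0 : Dual ℝ T), e i)) σ
    have h' : vecProd T (e ∘ σ) = ((Equiv.Perm.sign σ : ℤ) : ℝ) • vecProd T e := by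
      rw [Int.cast_smul_eq_zsmul, ← Units.smul_def]
      exact h
    rw [h', smul_mul_assoc, mul_smul_comm]

lemma restCurvSuper_pow_mul (k l n : ℕ) (hn : 2 * k + l = n) :
    (2 : ℝ) ^ k • (-1 : ℝ) ^ (l.choose 2) • (restCurvSuper t e Ω ^ k * thetaSuper t e w ^ l) =
    ∑ γ : Fin n → Fin q, (List.ofFn fun i : Fin k ↦ realSuper V t
        (Ω (γ ⟨2 * i, by omega⟩).castSucc (γ ⟨2 * i + 1, by omega⟩).castSucc)).prod *
      (List.ofFn fun i : Fin l ↦ realSuper V t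
        (w (γ ⟨2 * k + i, by omega⟩).castSucc (Fin.last q))).prod *
      vecProd T fun i ↦ e (γ i).castSucc := by
  simp only [vecProd_eq]
  rw [sum_pairs_singles (fun a b : Fin q ↦ realSuper V t (Ω a.castSucc b.castSucc))
    (fun a ↦ realSuper V t (w a.castSucc (Fin.last q))) (fun a ↦ vecSuper T (e a.castSucc))
    (fun _ _ _ ↦ commute_realSuper_two t _ _) (fun _ _ ↦ realSuper_one_mul_vecSuper t _ _)
    (fun _ _ _ ↦ commute_ι_mul_ι _ _ _) hn, restCurvSuper, smul_pow, smul_mul_assoc, smul_smul,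
    smul_smul, mul_right_comm, ← mul_pow]
  norm_num
  rfl

/-- Every monomial contains 2k + l of the q vectors e₁, …, e_q, so some vector is repeated. -/
lemma restCurvSuper_pow_mul_eq_zero (k l : ℕ) (h : q < 2 * k + l) :
    restCurvSuper t e Ω ^ k * thetaSuper t e w ^ l = 0 := by
  have h1 := restCurvSuper_pow_mul t e Ω w k l _ rfl
  rw [Finset.sum_eq_zero, smul_smul] at h1
  · exact (smul_eq_zero_iff_right (by positivity)).1 h1
  · intro γ _
    rw [vecProd, ExteriorAlgebra.ιMulti_eq_zero_of_not_inj, mul_zero]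
    intro hinj
    have : Function.Injective γ := fun a b hab ↦ hinj (by simp [hab])
    have := Fintype.card_le_of_injective γ this
    simp at this
    omega

/-- Chern's form `Φₖ` built from a matrix of one-forms and a matrix of two-forms. -/
def chernSum (k : Fin (q / 2 + 1)) : T [⋀^Fin q]→ₗ[ℝ] ℝ :=
  ∑ σ : Equiv.Perm (Fin q), ((Equiv.Perm.sign σ : ℤ) : ℝ) •
    (wedge
      (wedgeFamily 2 k fun i ↦ Ω (σ ⟨2 * i, by omega⟩).castSucc (σ ⟨2 * i + 1, by omega⟩).castSucc)
      (wedgeFamily 1 (q - 2 * k) fun j ↦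
        w (σ ⟨2 * k + j, by omega⟩).castSucc (Fin.last q))).domDomCongr
    (finCongr (by omega))

lemma realSuper_domDomCongr {k l : ℕ} (h : k = l) (α : T [⋀^Fin k]→ₗ[ℝ] ℝ) :
    realSuper V t (α.domDomCongr (finCongr h)) = realSuper V t α := toSuper_domDomCongr t _ h α

lemma vecProd_succ_last : vecProd T e =
    vecProd T (fun a : Fin q ↦ e a.castSucc) * vecSuper T (e (Fin.last q)) := by
  rw [vecProd_eq, vecProd_eq, List.ofFn_succ', List.concat_eq_append, List.prod_append,
    List.prod_singleton]

/-- The difference of the two curvature elements contains eₙ as a factor, and eₙ² = 0. -/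
lemma curvSuper_pow_mul_last (hΩ : ∀ i j, Ω j i = -Ω i j) (k : ℕ) :
    curvSuper t e Ω ^ k * vecSuper T (e (Fin.last q)) =
      restCurvSuper t e Ω ^ k * vecSuper T (e (Fin.last q)) := by
  induction k with
  | zero => simp
  | succ k ih =>
    have h : curvSuper t e Ω * vecSuper T (e (Fin.last q)) =
        restCurvSuper t e Ω * vecSuper T (e (Fin.last q)) := by
      rw [curvSuper_eq t e Ω hΩ, sub_mul, mul_assoc (zetaSuper t e Ω), vecSuper_sq]
      simp
    rw [pow_succ, mul_assoc, h, ← mul_assoc, ((commute_restCurvSuper t e Ω _).symm).eq, mul_assoc, ih,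
      ← mul_assoc, ← pow_succ']

/-- The sign comes from pairing each ϖ with its vector, and 2^k from the ½ in the curvature element.
Writing the result with the full curvature instead of its part without eₙ pays off because only the
former is covariantly closed. -/
lemma realSuper_chernSum_mul (hΩ : ∀ i j, Ω j i = -Ω i j) (k : Fin (q / 2 + 1)) :
    realSuper V t (chernSum Ω w k) * vecProd T e =
      ((-1 : ℝ) ^ ((q - 2 * (k : ℕ)).choose 2) * 2 ^ (k : ℕ)) •
        (curvSuper t e Ω ^ (k : ℕ) * thetaSuper t e w ^ (q - 2 * (k : ℕ)) *
          vecSuper T (e (Fin.last q))) := by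
  have hk : 2 * (k : ℕ) + (q - 2 * k) = q := by omega
  have h1 := sum_perm_smul_vecProd (T := T) (fun a : Fin q ↦ e a.castSucc) fun γ ↦
    (List.ofFn fun i : Fin (k : ℕ) ↦ realSuper V t
        (Ω (γ ⟨2 * i, by omega⟩).castSucc (γ ⟨2 * i + 1, by omega⟩).castSucc)).prod *
      (List.ofFn fun i : Fin (q - 2 * k) ↦ realSuper V t
        (w (γ ⟨2 * k + i, by omega⟩).castSucc (Fin.last q))).prod
  have h2 := restCurvSuper_pow_mul t e Ω w k (q - 2 * k) q hk
  have h3 := h1.trans h2.symm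
  rw [vecProd_succ_last, ← mul_assoc, chernSum, map_sum]
  simp only [map_smul, realSuper_domDomCongr, realSuper_wedge, realSuper_wedgeFamily]
  rw [h3, smul_smul, smul_mul_assoc, mul_comm ((2 : ℝ) ^ _), mul_assoc, mul_assoc,
    (commute_thetaSuper t e w _).pow_left _ |>.eq, ← mul_assoc, ← mul_assoc,
    curvSuper_pow_mul_last t e Ω hΩ]

/-- The telescoping identity is commutative algebra; this form carries it into a noncommutative
algebra along the inclusion of a commutative subalgebra. -/
lemma map_chern_telescope {Z A : Type*} [CommRing Z] [Algebra ℝ Z] [Ring A] [Algebra ℝ A]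
    (f : Z →ₐ[ℝ] A) (q : ℕ) (R θ u : Z) (hu : u * u = 0)
    (hR : ∀ k l, q < 2 * k + l → R ^ k * θ ^ l = 0) :
    (if q % 2 = 1 then (((-1) ^ ((q + 1) / 2) / ((q + 1) / 2).factorial : ℝ)) •
      (f R - f u) ^ ((q + 1) / 2) else 0) = (-1 : ℝ) ^ q • ∑ k ∈ Finset.range (q / 2 + 1),
      chernCoeff' q k • (-((f R - f u) ^ k * f θ ^ (q - 2 * k + 1)) -
        ((q - 2 * k : ℕ) : ℝ) • ((f R - f u) ^ k * f θ ^ (q - 2 * k - 1) * f u)) := by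
  have h := congrArg f (chern_telescope q R θ u hu hR)
  rw [apply_ite f] at h
  simpa only [map_smul, map_sum, map_sub, map_neg, map_mul, map_pow, map_zero] using h

/-- The transgression identity in `SuperAlg T V`. -/
lemma curvSuper_telescope (hΩ : ∀ i j, Ω j i = -Ω i j) :
    (if q % 2 = 1 then (((-1) ^ ((q + 1) / 2) / ((q + 1) / 2).factorial : ℝ)) •
      curvSuper t e Ω ^ ((q + 1) / 2) else 0) = (-1 : ℝ) ^ q • ∑ k ∈ Finset.range (q / 2 + 1),
      chernCoeff' q k • (-(curvSuper t e Ω ^ k * thetaSuper t e w ^ (q - 2 * k + 1)) -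
        ((q - 2 * k : ℕ) : ℝ) • (curvSuper t e Ω ^ k * thetaSuper t e w ^ (q - 2 * k - 1) *
          (zetaSuper t e Ω * vecSuper T (e (Fin.last q))))) := by
  -- The three elements involved have even total degree, hence lie in the centre, where the
  -- commutative identity applies.
  let C := Subalgebra.center ℝ (SuperAlg T V)
  have mem : ∀ x : SuperAlg T V, (∀ y, Commute x y) → x ∈ C := fun x hx ↦
    Subalgebra.mem_center_iff.2 fun y ↦ (hx y).symm.eq
  let R : C := ⟨_, mem _ (commute_restCurvSuper t e Ω)⟩
  let θ : C := ⟨_, mem _ (commute_thetaSuper t e w)⟩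
  let u : C := ⟨_, mem _ (commute_zetaSuper_mul t e Ω)⟩
  have hu : u * u = 0 := Subtype.ext (zetaSuper_mul_sq t e Ω)
  have hRu : C.val R - C.val u = curvSuper t e Ω := (curvSuper_eq t e Ω hΩ).symm
  rw [← hRu]
  exact map_chern_telescope C.val q R θ u hu fun k l hkl ↦
    Subtype.ext (restCurvSuper_pow_mul_eq_zero t e Ω w k l hkl)

end SuperElements

/-! ### The Berezin integral and the Pfaffian as a power -/

section Pfaffian

variable {T : Type*} [AddCommGroup T] [Module ℝ T] {V : Type*} [AddCommGroup V] [Module ℝ V]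
  {ι : Type*} [Fintype ι] (t : Basis ι ℝ T)

/-- The degree in ⋀V has to be followed, because the Berezin integral loses no information only in
the top degree. -/
lemma wedge_mem {a b : ℕ} (α : T [⋀^Fin a]→ₗ[ℝ] ExteriorAlgebra ℝ V)
    (β : T [⋀^Fin b]→ₗ[ℝ] ExteriorAlgebra ℝ V) (k l : ℕ) (hα : ∀ v, α v ∈ ⋀[ℝ]^k V)
    (hβ : ∀ v, β v ∈ ⋀[ℝ]^l V) (v : Fin (a + b) → T) : wedge α β v ∈ ⋀[ℝ]^(k + l) V := by
  have h := wedge_apply α β v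
  rw [← Nat.cast_smul_eq_nsmul ℝ, ← eq_inv_smul_iff₀ (by positivity)] at h
  rw [h]
  refine Submodule.smul_mem _ _ (Submodule.sum_mem _ fun σ _ ↦ Submodule.smul_mem _ _ ?_)
  rw [ExteriorAlgebra.exteriorPower, pow_add]
  exact Submodule.mul_mem_mul (hα _) (hβ _)

/-- The involution is the algebra map induced by -id on V, so it sends decomposable k-vectors to
decomposable k-vectors. -/
lemma involute_mem (k : ℕ) (y : ExteriorAlgebra ℝ V) (hy : y ∈ ⋀[ℝ]^k V) :
    CliffordAlgebra.involute (Q := (0 : QuadraticForm ℝ V)) y ∈ ⋀[ℝ]^k V := by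
  rw [← ExteriorAlgebra.ιMulti_span_fixedDegree] at hy ⊢
  induction hy using Submodule.span_induction with
  | mem x hx =>
    obtain ⟨v, rfl⟩ := hx
    have : CliffordAlgebra.involute (Q := (0 : QuadraticForm ℝ V)) (ExteriorAlgebra.ιMulti ℝ k v) =
        ExteriorAlgebra.map (-LinearMap.id) (ExteriorAlgebra.ιMulti ℝ k v) := by
      refine DFunLike.congr_fun (F := ExteriorAlgebra ℝ V →ₐ[ℝ] ExteriorAlgebra ℝ V) ?_ _
      refine ExteriorAlgebra.hom_ext (LinearMap.ext fun x ↦ ?_)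
      have : CliffordAlgebra.involute (Q := (0 : QuadraticForm ℝ V)) (ExteriorAlgebra.ι ℝ x) =
        -ExteriorAlgebra.ι ℝ x := CliffordAlgebra.involute_ι _
      simp [this]
    rw [this, ExteriorAlgebra.map_apply_ιMulti]
    exact Submodule.subset_span ⟨_, rfl⟩
  | zero => rw [map_zero]; exact Submodule.zero_mem _
  | add x y _ _ hx hy => rw [map_add]; exact Submodule.add_mem _ hx hy
  | smul c x _ hx => rw [map_smul]; exact Submodule.smul_mem _ _ hx

lemma involute_pow_mem (k d : ℕ) (y : ExteriorAlgebra ℝ V) (hy : y ∈ ⋀[ℝ]^k V) :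
    ((CliffordAlgebra.involute (Q := (0 : QuadraticForm ℝ V))).toLinearMap ^ d) y ∈ ⋀[ℝ]^k V := by
  induction d with
  | zero => exact hy
  | succ d ih => rw [pow_succ']; exact involute_mem _ _ ih

lemma bigradedPow_mem {d : ℕ} (α : T [⋀^Fin d]→ₗ[ℝ] ExteriorAlgebra ℝ V) (l : ℕ)
    (hα : ∀ v, α v ∈ ⋀[ℝ]^l V) (k : ℕ) (v : Fin (d * k) → T) :
    bigradedPow α k v ∈ ⋀[ℝ]^(l * k) V := by
  induction k with
  | zero =>
    simp only [bigradedPow, AlternatingMap.constOfIsEmpty_apply, mul_zero, ExteriorAlgebra.exteriorPower, pow_zero]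
    exact Submodule.one_le.1 le_rfl
  | succ k ih =>
    refine wedge_mem _ _ _ _ (fun v ↦ ?_) hα v
    exact involute_pow_mem _ _ _ (ih v)

lemma vecProd_eq_inrSuper {n : ℕ} (e : Fin n → V) :
    vecProd T e = inrSuper T V (ExteriorAlgebra.ιMulti ℝ n e) := by
  rw [inrSuper, ExteriorAlgebra.map_apply_ιMulti]
  rfl

lemma ιMulti_eq_det_smul {n : ℕ} (b : Basis (Fin n) ℝ V) : ExteriorAlgebra.ιMulti ℝ n =
    (LinearMap.toSpanSingleton ℝ _ (ExteriorAlgebra.ιMulti ℝ n b)).compAlternatingMap b.det := by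
  refine Basis.ext_alternating b fun i h ↦ ?_
  let σ : Equiv.Perm (Fin n) := Equiv.ofBijective i (Finite.injective_iff_bijective.1 h)
  change ExteriorAlgebra.ιMulti ℝ n (b ∘ σ) = (LinearMap.toSpanSingleton ℝ _
    (ExteriorAlgebra.ιMulti ℝ n b)).compAlternatingMap b.det (b ∘ σ)
  simp [AlternatingMap.map_perm, Basis.det_self]

/-- The top power is spanned by products v₁ ∧ ⋯ ∧ vₙ = det(v) b₁ ∧ ⋯ ∧ bₙ. -/
lemma eq_berezin_smul {n : ℕ} (b : Basis (Fin n) ℝ V) (y : ExteriorAlgebra ℝ V)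
    (hy : y ∈ ⋀[ℝ]^n V) : y = berezin b y • ExteriorAlgebra.ιMulti ℝ n b := by
  rw [← ExteriorAlgebra.ιMulti_span_fixedDegree] at hy
  induction hy using Submodule.span_induction with
  | mem x hx =>
    obtain ⟨v, rfl⟩ := hx
    rw [berezin, ExteriorAlgebra.liftAlternating_apply_ιMulti, Pi.single_eq_same]
    exact DFunLike.congr_fun (ιMulti_eq_det_smul b) v
  | zero => simp
  | add x y _ _ hx hy => rw [map_add, add_smul, ← hx, ← hy]
  | smul c x _ hx => rw [map_smul, smul_assoc, ← hx]

lemma extSuper_eq_of_mem {n k : ℕ} (b : Basis (Fin n) ℝ V)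
    (α : T [⋀^Fin k]→ₗ[ℝ] ExteriorAlgebra ℝ V) (hα : ∀ v, α v ∈ ⋀[ℝ]^n V) :
    realSuper V t ((berezin b).compAlternatingMap α) * vecProd T b = extSuper t α := by
  have : α = (LinearMap.toSpanSingleton ℝ _ (ExteriorAlgebra.ιMulti ℝ n b)).compAlternatingMap
      ((berezin b).compAlternatingMap α) := by
    ext v
    exact eq_berezin_smul b _ (hα v)
  conv_rhs => rw [this]
  rw [extSuper_comp_toSpanSingleton, vecProd_eq_inrSuper]

/-- The Berezin integral followed by multiplication with e₁⋯eₙ is the identity in top degree, so it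
disappears from the calculation. -/
lemma realSuper_pfaffian_mul {n : ℕ} (b : Basis (Fin n) ℝ V)
    (α : T [⋀^Fin 2]→ₗ[ℝ] ExteriorAlgebra ℝ V) (hα : ∀ v, α v ∈ ⋀[ℝ]^2 V) :
    realSuper V t ((berezin b).compAlternatingMap (expNeg α n)) * vecProd T b =
      if n % 2 = 0 then (((-1) ^ (n / 2) / (n / 2).factorial : ℝ)) • extSuper t α ^ (n / 2)
      else 0 := by
  rw [expNeg]
  split_ifs with hn
  · have h2 : 2 * (n / 2) = n := by omega
    -- Only the power k = n/2 has form degree n.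
    rw [Finset.sum_eq_single_of_mem (n / 2) (Finset.mem_range.2 (by omega))
      fun k _ hk ↦ dif_neg (by omega), dif_pos h2, extSuper_eq_of_mem, map_smul]
    · congr 1
      rw [extSuper, toSuper_domDomCongr, ← extSuper, extSuper_bigradedPow]
    · intro v
      refine Submodule.smul_mem _ _ ?_
      have h3 : ⋀[ℝ]^(2 * (n / 2)) V = ⋀[ℝ]^n V := by rw [h2]
      rw [← h3]
      exact bigradedPow_mem α 2 hα (n / 2) _
  · rw [Finset.sum_eq_zero fun k _ ↦ dif_neg (by omega)]
    have : (berezin b).compAlternatingMap (0 : T [⋀^Fin n]→ₗ[ℝ] ExteriorAlgebra ℝ V) = 0 := by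
      ext v
      simp
    rw [this, map_zero, zero_mul]

lemma extSuper_curv {q : ℕ} (e : Fin (q + 1) → V)
    (Ω : Fin (q + 1) → Fin (q + 1) → T [⋀^Fin 2]→ₗ[ℝ] ℝ) :
    extSuper t ((1 / 2 : ℝ) • ∑ i, ∑ j, (LinearMap.toSpanSingleton ℝ _
      (ExteriorAlgebra.ι ℝ (e i) * ExteriorAlgebra.ι ℝ (e j))).compAlternatingMap (Ω i j)) =
      curvSuper t e Ω := by
  simp only [map_smul, map_sum, extSuper_comp_toSpanSingleton, curvSuper, map_mul, inrSuper,
    ExteriorAlgebra.map_apply_ι]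
  rfl

lemma alternating_sum_apply {W : Type*} [AddCommGroup W] [Module ℝ W] {κ ν : Type*} (s : Finset κ)
    (f : κ → T [⋀^ν]→ₗ[ℝ] W) (v : ν → T) : (∑ i ∈ s, f i) v = ∑ i ∈ s, f i v := by
  classical
  induction s using Finset.induction_on with
  | empty => simp
  | insert a s ha ih => rw [Finset.sum_insert ha, Finset.sum_insert ha, AlternatingMap.add_apply, ih]

lemma curv_mem {q : ℕ} (e : Fin (q + 1) → V)
    (Ω : Fin (q + 1) → Fin (q + 1) → T [⋀^Fin 2]→ₗ[ℝ] ℝ) (v : Fin 2 → T) :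
    ((1 / 2 : ℝ) • ∑ i, ∑ j, (LinearMap.toSpanSingleton ℝ _
      (ExteriorAlgebra.ι ℝ (e i) * ExteriorAlgebra.ι ℝ (e j))).compAlternatingMap (Ω i j)) v ∈
      ⋀[ℝ]^2 V := by
  simp only [AlternatingMap.smul_apply, alternating_sum_apply]
  refine Submodule.smul_mem _ _ (Submodule.sum_mem _ fun i _ ↦ Submodule.sum_mem _ fun j _ ↦ ?_)
  rw [LinearMap.compAlternatingMap_apply, LinearMap.toSpanSingleton_apply]
  refine Submodule.smul_mem _ _ ?_
  rw [ExteriorAlgebra.exteriorPower, pow_two]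
  exact Submodule.mul_mem_mul ⟨_, rfl⟩ ⟨_, rfl⟩

end Pfaffian

end

section

/-! ### Derivatives of maps into an algebra without a norm -/

section SuperDeriv

variable {B : Type*} [NormedAddCommGroup B] [NormedSpace ℝ B] {A : Type*} [Ring A] [Algebra ℝ A]

/-- `f'` is the derivative at `z` of the map `f` to a real algebra, where `f` takes values in a
finite-dimensional subspace near `z`. -/
def HasSuperDeriv (f : B → A) (f' : B → A) (z : B) : Prop :=
  ∃ (n : ℕ) (c : Fin n → B → ℝ) (c' : Fin n → B →L[ℝ] ℝ) (a : Fin n → A),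
    (∀ j, HasFDerivAt (c j) (c' j) z) ∧ (∀ᶠ y in 𝓝 z, f y = ∑ j, c j y • a j) ∧
      ∀ v, f' v = ∑ j, c' j v • a j

lemma HasSuperDeriv.of_fintype {J : Type*} [Fintype J] {f f' : B → A} {z : B} (c : J → B → ℝ)
    (c' : J → B →L[ℝ] ℝ) (a : J → A) (hc : ∀ j, HasFDerivAt (c j) (c' j) z)
    (hf : ∀ᶠ y in 𝓝 z, f y = ∑ j, c j y • a j) (hf' : ∀ v, f' v = ∑ j, c' j v • a j) :
    HasSuperDeriv f f' z := by
  let ε := (Fintype.equivFin J).symm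
  refine ⟨_, fun i ↦ c (ε i), fun i ↦ c' (ε i), fun i ↦ a (ε i), fun i ↦ hc _, ?_, fun v ↦ ?_⟩
  · filter_upwards [hf] with y hy
    rw [hy]
    exact (Equiv.sum_comp ε fun j ↦ c j y • a j).symm
  · rw [hf']
    exact (Equiv.sum_comp ε fun j ↦ c' j v • a j).symm

lemma HasSuperDeriv.dual_comp {f f' : B → A} {z : B} (h : HasSuperDeriv f f' z) (φ : A →ₗ[ℝ] ℝ) :
    ∃ L : B →L[ℝ] ℝ, HasFDerivAt (fun y ↦ φ (f y)) L z ∧ ∀ v, L v = φ (f' v) := by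
  obtain ⟨n, c, c', a, hc, hf, hf'⟩ := h
  refine ⟨∑ j, φ (a j) • c' j, ?_, fun v ↦ by simp [hf', mul_comm]⟩
  have h1 : HasFDerivAt (fun y ↦ ∑ j, c j y * φ (a j)) (∑ j, φ (a j) • c' j) z :=
    HasFDerivAt.fun_sum fun j _ ↦ (hc j).mul_const (φ (a j))
  refine h1.congr_of_eventuallyEq ?_
  filter_upwards [hf] with y hy
  simp [hy]

/-- Linear functionals separate the points of the algebra and reduce the claim to uniqueness of
scalar derivatives, although the finite expansions of the two maps may be unrelated. -/
lemma HasSuperDeriv.unique {f g f' g' : B → A} {z : B} (hf : HasSuperDeriv f f' z)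
    (hg : HasSuperDeriv g g' z) (h : ∀ᶠ y in 𝓝 z, f y = g y) : f' = g' := by
  funext v
  rw [← sub_eq_zero]
  refine (Module.forall_dual_apply_eq_zero_iff ℝ _).1 fun φ ↦ ?_
  obtain ⟨L, h1, hL⟩ := hf.dual_comp φ
  obtain ⟨L', h2, hL'⟩ := hg.dual_comp φ
  have h3 := h1.unique (h2.congr_of_eventuallyEq (h.mono fun y hy ↦ congrArg φ hy))
  rw [map_sub, sub_eq_zero, ← hL, ← hL', h3]

lemma HasSuperDeriv.congr_deriv {f f' g' : B → A} {z : B} (hf : HasSuperDeriv f f' z)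
    (h : ∀ v, g' v = f' v) : HasSuperDeriv f g' z := (funext h : g' = f') ▸ hf

lemma HasSuperDeriv.congr {f g f' : B → A} {z : B} (hf : HasSuperDeriv f f' z)
    (h : ∀ᶠ y in 𝓝 z, g y = f y) : HasSuperDeriv g f' z := by
  obtain ⟨n, c, c', a, hc, hf, hf'⟩ := hf
  exact ⟨n, c, c', a, hc, (h.and hf).mono fun y hy ↦ hy.1.trans hy.2, hf'⟩

lemma hasSuperDeriv_const (a : A) (z : B) : HasSuperDeriv (fun _ ↦ a) (fun _ ↦ 0) z :=
  ⟨1, fun _ _ ↦ 1, fun _ ↦ 0, fun _ ↦ a, fun _ ↦ hasFDerivAt_const _ _, by simp, by simp⟩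

lemma HasSuperDeriv.mul {f g f' g' : B → A} {z : B} (hf : HasSuperDeriv f f' z)
    (hg : HasSuperDeriv g g' z) :
    HasSuperDeriv (fun y ↦ f y * g y) (fun v ↦ f' v * g z + f z * g' v) z := by
  obtain ⟨n, c, c', a, hc, hf, hf'⟩ := hf
  obtain ⟨m, d, d', b, hd, hg, hg'⟩ := hg
  refine .of_fintype (J := Fin n × Fin m) (fun j y ↦ c j.1 y * d j.2 y)
    (fun j ↦ c j.1 z • d' j.2 + d j.2 z • c' j.1) (fun j ↦ a j.1 * b j.2)
    (fun j ↦ (hc j.1).mul (hd j.2)) ?_ fun v ↦ ?_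
  · filter_upwards [hf, hg] with y h1 h2
    rw [h1, h2, Finset.sum_mul_sum, Fintype.sum_prod_type]
    simp only [smul_mul_smul_comm]
  · rw [hf', hg', hf.self_of_nhds, hg.self_of_nhds, Finset.sum_mul_sum, Finset.sum_mul_sum,
      Fintype.sum_prod_type, ← Finset.sum_add_distrib]
    refine Finset.sum_congr rfl fun i _ ↦ ?_
    rw [← Finset.sum_add_distrib]
    refine Finset.sum_congr rfl fun j _ ↦ ?_
    simp only [smul_mul_smul_comm, add_apply, smul_apply,
      smul_eq_mul]
    module

lemma HasSuperDeriv.sum {κ : Type*} (s : Finset κ) {f f' : κ → B → A} {z : B}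
    (h : ∀ i ∈ s, HasSuperDeriv (f i) (f' i) z) :
    HasSuperDeriv (fun y ↦ ∑ i ∈ s, f i y) (fun v ↦ ∑ i ∈ s, f' i v) z := by
  choose! n c c' a hc hf hf' using h
  refine .of_fintype (J := Σ i : s, Fin (n i)) (fun j ↦ c j.1 j.2) (fun j ↦ c' j.1 j.2)
    (fun j ↦ a j.1 j.2) (fun j ↦ hc _ j.1.2 _) ?_ fun v ↦ ?_
  · filter_upwards [(Filter.eventually_all_finset s).2 hf] with y hy
    rw [Fintype.sum_sigma, ← Finset.sum_attach]
    exact Finset.sum_congr rfl fun i _ ↦ hy i i.2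
  · rw [Fintype.sum_sigma, ← Finset.sum_attach]
    exact Finset.sum_congr rfl fun i _ ↦ hf' i i.2 v

lemma HasSuperDeriv.const_smul {f f' : B → A} {z : B} (h : HasSuperDeriv f f' z) (r : ℝ) :
    HasSuperDeriv (fun y ↦ r • f y) (fun v ↦ r • f' v) z := by
  obtain ⟨n, c, c', a, hc, hf, hf'⟩ := h
  refine ⟨n, c, c', fun j ↦ r • a j, hc, hf.mono fun y hy ↦ ?_, fun v ↦ ?_⟩
  · simp only [hy, Finset.smul_sum, smul_comm r]
  · simp only [hf', Finset.smul_sum, smul_comm r]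

lemma HasSuperDeriv.sub {f f' g g' : B → A} {z : B} (hf : HasSuperDeriv f f' z)
    (hg : HasSuperDeriv g g' z) :
    HasSuperDeriv (fun y ↦ f y - g y) (fun v ↦ f' v - g' v) z := by
  have := HasSuperDeriv.sum (Finset.univ : Finset (Fin 2)) (z := z)
    (f := ![f, fun y ↦ (-1 : ℝ) • g y]) (f' := ![f', fun y ↦ (-1 : ℝ) • g' y]) (by
      intro i _
      fin_cases i
      exacts [hf, hg.const_smul _])
  simpa [Fin.sum_univ_two, sub_eq_add_neg] using this

end SuperDeriv

/-! ### Derivations of the exterior algebra -/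

section Derivation

variable {M : Type*} [AddCommGroup M] [Module ℝ M]

/-- The algebra map to the dual numbers defining `extDerivation`. -/
def extDerivationHom (g : M →ₗ[ℝ] M) :
    ExteriorAlgebra ℝ M →ₐ[ℝ] TrivSqZeroExt (ExteriorAlgebra ℝ M) (ExteriorAlgebra ℝ M) :=
  -- The map m ↦ m + ε g(m) extends because its square is ε(m g(m) + g(m) m) = 0. The ε-component of
  -- the extension satisfies the Leibniz rule.
  ExteriorAlgebra.lift ℝ ⟨(TrivSqZeroExt.inlAlgHom ℝ _ _).toLinearMap ∘ₗ ExteriorAlgebra.ι ℝ +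
    (TrivSqZeroExt.inrHom _ _).restrictScalars ℝ ∘ₗ ExteriorAlgebra.ι ℝ ∘ₗ g, fun m ↦ by
      refine TrivSqZeroExt.ext ?_ ?_
      · simp
      · simp⟩

lemma fst_extDerivationHom (g : M →ₗ[ℝ] M) (x : ExteriorAlgebra ℝ M) :
    (extDerivationHom g x).fst = x := by
  have : (TrivSqZeroExt.fstHom ℝ _ _).comp (extDerivationHom g) = AlgHom.id ℝ _ := by
    ext m
    simp [extDerivationHom]
  exact DFunLike.congr_fun this x

/-- The derivation of the exterior algebra that extends `g`. -/
def extDerivation (g : M →ₗ[ℝ] M) (x : ExteriorAlgebra ℝ M) : ExteriorAlgebra ℝ M :=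
  (extDerivationHom g x).snd

lemma extDerivation_mul (g : M →ₗ[ℝ] M) (x y : ExteriorAlgebra ℝ M) :
    extDerivation g (x * y) = extDerivation g x * y + x * extDerivation g y := by
  simp [extDerivation, fst_extDerivationHom, add_comm]

lemma extDerivation_add (g : M →ₗ[ℝ] M) (x y : ExteriorAlgebra ℝ M) :
    extDerivation g (x + y) = extDerivation g x + extDerivation g y := by
  simp [extDerivation]

lemma extDerivation_smul (g : M →ₗ[ℝ] M) (r : ℝ) (y : ExteriorAlgebra ℝ M) :
    extDerivation g (r • y) = r • extDerivation g y := by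
  simp [extDerivation]

lemma extDerivation_one (g : M →ₗ[ℝ] M) : extDerivation g 1 = 0 := by simp [extDerivation]

lemma extDerivation_sum (g : M →ₗ[ℝ] M) {κ : Type*} (s : Finset κ) (f : κ → ExteriorAlgebra ℝ M) :
    extDerivation g (∑ i ∈ s, f i) = ∑ i ∈ s, extDerivation g (f i) :=
  map_sum (AddMonoidHom.mk' (extDerivation g) (extDerivation_add g)) _ _

lemma extDerivation_ι (g : M →ₗ[ℝ] M) (m : M) :
    extDerivation g (ExteriorAlgebra.ι ℝ m) = ExteriorAlgebra.ι ℝ (g m) := by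
  simp [extDerivation, extDerivationHom]

lemma extDerivation_ιMulti (g : M →ₗ[ℝ] M) {n : ℕ} (v : Fin n → M) :
    extDerivation g (ExteriorAlgebra.ιMulti ℝ n v) =
      ∑ i, ExteriorAlgebra.ιMulti ℝ n (Function.update v i (g (v i))) := by
  induction n with
  | zero => simp [extDerivation_one]
  | succ n ih =>
    rw [ExteriorAlgebra.ιMulti_succ_apply, extDerivation_mul, extDerivation_ι, Fin.sum_univ_succ,
      ExteriorAlgebra.ιMulti_succ_apply, ih, Finset.mul_sum]
    refine congrArg₂ (· + ·) ?_ (Finset.sum_congr rfl fun i _ ↦ ?_)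
    · congr 1
    · rw [ExteriorAlgebra.ιMulti_succ_apply]
      rw [Function.update_of_ne (Fin.succ_ne_zero i).symm]
      congr 2
      funext j
      by_cases h : j = i
      · subst h; simp [Matrix.vecTail]
      · simp [Matrix.vecTail, Function.update_of_ne h,
          Function.update_of_ne (fun h' ↦ h (Fin.succ_injective _ h'))]

end Derivation

/-! ### Endomorphisms of V acting on the algebra -/

section CovDeriv

variable {T : Type*} [AddCommGroup T] [Module ℝ T] {V : Type*} [AddCommGroup V] [Module ℝ V]
  {ι : Type*} [Fintype ι] (t : Basis ι ℝ T)

variable (T) in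
/-- The derivation of `SuperAlg T V` extending an endomorphism of `V` and vanishing on `T*`. -/
abbrev vecDerivation (f : V →ₗ[ℝ] V) : SuperAlg T V → SuperAlg T V :=
  extDerivation (LinearMap.prodMap (0 : Dual ℝ T →ₗ[ℝ] Dual ℝ T) f)

lemma vecDerivation_realSuper (f : V →ₗ[ℝ] V) {k : ℕ} (α : T [⋀^Fin k]→ₗ[ℝ] ℝ) :
    vecDerivation T f (realSuper V t α) = 0 := by
  rw [realSuper_apply, vecDerivation, extDerivation_smul, extDerivation_sum, Finset.sum_eq_zero, smul_zero]
  intro r _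
  rw [extDerivation_smul, coordProd, extDerivation_ιMulti, Finset.sum_eq_zero, smul_zero]
  intro i _
  refine AlternatingMap.map_coord_zero _ i ?_
  simp

lemma vecDerivation_vecSuper (f : V →ₗ[ℝ] V) (v : V) :
    vecDerivation T f (vecSuper T v) = vecSuper T (f v) := by
  rw [vecDerivation, extDerivation_ι]
  simp

lemma vecSuper_add (v w : V) : vecSuper T (v + w) = vecSuper T v + vecSuper T w := by
  rw [← map_add]; simp

lemma vecSuper_smul (r : ℝ) (v : V) : vecSuper T (r • v) = r • vecSuper T v := by
  rw [← map_smul]; simp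

lemma vecSuper_sum {κ : Type*} (s : Finset κ) (v : κ → V) :
    vecSuper T (∑ i ∈ s, v i) = ∑ i ∈ s, vecSuper T (v i) :=
  map_sum (AddMonoidHom.mk' (vecSuper T) vecSuper_add) _ _

/-- The derivation acts on the top product through the trace: an off-diagonal entry repeats a
vector, and the diagonal entries vanish by assumption. -/
lemma vecDerivation_vecProd {n : ℕ} (e : Fin n → V) (f : V →ₗ[ℝ] V) (m : Fin n → Fin n → ℝ)
    (hf : ∀ i, f (e i) = ∑ j, m i j • e j) (hm : ∀ i, m i i = 0) :
    vecDerivation T f (vecProd T e) = 0 := by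
  rw [vecProd, vecDerivation, extDerivation_ιMulti]
  refine Finset.sum_eq_zero fun i _ ↦ ?_
  have h : LinearMap.prodMap (0 : Dual ℝ T →ₗ[ℝ] Dual ℝ T) f (0, e i) =
      ∑ j, m i j • ((0 : Dual ℝ T), e j) := by
    refine Prod.ext ?_ ?_
    · simp [Prod.fst_sum]
    · simp [Prod.snd_sum, hf]
  rw [h, AlternatingMap.map_update_sum]
  refine Finset.sum_eq_zero fun j _ ↦ ?_
  rw [AlternatingMap.map_update_smul]
  by_cases hij : i = j
  · subst hij
    rw [hm, zero_smul]
  · rw [AlternatingMap.map_update_self _ (fun i ↦ ((0 : Dual ℝ T), e i)) hij, smul_zero]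

end CovDeriv

end

section

/-! ### Covariant derivatives in a chart -/

section LocalTransgression

variable {B : Type*} [NormedAddCommGroup B] [NormedSpace ℝ B]
  {V : Type*} [AddCommGroup V] [Module ℝ V] {ι : Type*} [Fintype ι] (t : Basis ι ℝ B)

variable (V) in
/-- The `i`-th coordinate one-form. -/
abbrev coordGen (i : ι) : SuperAlg B V := ExteriorAlgebra.ι ℝ (t.coord i, (0 : V))

lemma realSuper_one_eq_sum (α : B [⋀^Fin 1]→ₗ[ℝ] ℝ) :
    realSuper V t α = ∑ i, α (fun _ ↦ t i) • coordGen V t i := by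
  rw [realSuper_one]
  simp only [coordGen, ← map_smul, ← map_sum]
  congr 1
  refine Prod.ext ?_ ?_ <;> simp [Prod.fst_sum, Prod.snd_sum]

lemma coordGen_mul_realSuper_one (i : ι) (α : B [⋀^Fin 1]→ₗ[ℝ] ℝ) :
    coordGen V t i * realSuper V t α = -(realSuper V t α * coordGen V t i) := by
  rw [realSuper_one]
  exact ι_anticomm _ _

lemma hasSuperDeriv_realSuper {k : ℕ} (α : B → B [⋀^Fin k]→L[ℝ] ℝ) (z : B)
    (h : DifferentiableAt ℝ α z) : HasSuperDeriv (fun y ↦ realSuper V t (α y).toAlternatingMap)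
      (fun v ↦ realSuper V t (fderiv ℝ α z v).toAlternatingMap) z := by
  refine .of_fintype (J := Fin k → ι) (fun r y ↦ α y fun a ↦ t (r a))
    (fun r ↦ (ContinuousAlternatingMap.apply ℝ B ℝ fun a ↦ t (r a)).comp (fderiv ℝ α z))
    (fun r ↦ (k.factorial : ℝ)⁻¹ • coordProd V t r) (fun r ↦ ?_) (.of_forall fun y ↦ ?_) fun v ↦ ?_
  · exact (ContinuousAlternatingMap.apply ℝ B ℝ fun a ↦ t (r a)).hasFDerivAt.comp z h.hasFDerivAt
  · rw [realSuper_apply, Finset.smul_sum]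
    exact Finset.sum_congr rfl fun r _ ↦ smul_comm _ _ _
  · rw [realSuper_apply, Finset.smul_sum]
    exact Finset.sum_congr rfl fun r _ ↦ smul_comm _ _ _

lemma ιMulti_eq_removeNth {M : Type*} [AddCommGroup M] [Module ℝ M] {k : ℕ} (v : Fin (k + 1) → M)
    (j : Fin (k + 1)) : ExteriorAlgebra.ιMulti ℝ (k + 1) v =
      (-1 : ℝ) ^ (j : ℕ) • (ExteriorAlgebra.ι ℝ (v j) *
        ExteriorAlgebra.ιMulti ℝ k (j.removeNth v)) := by
  have h : j.insertNth (v j) (j.removeNth v) = v := Fin.insertNth_self_removeNth j v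
  conv_lhs => rw [← h]
  rw [AlternatingMap.map_insertNth, ← Int.cast_smul_eq_zsmul ℝ, ExteriorAlgebra.ιMulti_succ_apply]
  push_cast
  rfl

/-- The formula d = ∑ dxⁱ ∧ ∂ᵢ. It is how the exterior derivative enters the algebra. -/
lemma sum_coordGen_mul_realSuper {k : ℕ} (α : B → B [⋀^Fin k]→L[ℝ] ℝ) (z : B) :
    ∑ i, coordGen V t i * realSuper V t (fderiv ℝ α z (t i)).toAlternatingMap =
      realSuper V t (extDeriv α z).toAlternatingMap := by
  have h1 : ∀ r : Fin (k + 1) → ι, ∀ j : Fin (k + 1), coordProd V t r =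
      (-1 : ℝ) ^ (j : ℕ) • (coordGen V t (r j) * coordProd V t (j.removeNth r)) :=
    fun r j ↦ ιMulti_eq_removeNth _ j
  -- Moving the j-th covector to the front absorbs the sign (-1)^j, so the k + 1 positions
  -- contribute equally. Together they account for the quotient (k+1)!/k!.
  have h2 : ∀ j : Fin (k + 1), ∑ r : Fin (k + 1) → ι, ((-1 : ℝ) ^ (j : ℕ) *
      fderiv ℝ α z (t (r j)) (fun a ↦ t (j.removeNth r a))) • coordProd V t r =
      ∑ i, ∑ r : Fin k → ι, (fderiv ℝ α z (t i) fun a ↦ t (r a)) •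
        (coordGen V t i * coordProd V t r) := by
    intro j
    rw [← Fintype.sum_prod_type', ← Fintype.sum_equiv (Fin.insertNthEquiv (fun _ ↦ ι) j)
      _ _ fun x ↦ rfl]
    refine Finset.sum_congr rfl fun x _ ↦ ?_
    rw [h1 _ j, smul_smul]
    have h4 : j.removeNth (Fin.insertNthEquiv (fun _ ↦ ι) j x) = x.2 := by
      simp [Fin.insertNthEquiv]
    simp only [Fin.insertNthEquiv_apply, Fin.insertNth_apply_same, h4]
    congr 1
    rw [mul_right_comm, ← mul_pow]
    simp
  rw [realSuper_apply]
  have h3 : ∀ r : Fin (k + 1) → ι, (extDeriv α z).toAlternatingMap (fun a ↦ t (r a)) =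
      ∑ j : Fin (k + 1), (-1 : ℝ) ^ (j : ℕ) * fderiv ℝ α z (t (r j))
        (fun a ↦ t (j.removeNth r a)) := by
    intro r
    refine (ContinuousAlternatingMap.alternatizeUncurryFin_apply _ _).trans ?_
    refine Finset.sum_congr rfl fun j _ ↦ ?_
    rw [← Int.cast_smul_eq_zsmul ℝ]
    push_cast
    rfl
  simp only [h3, Finset.sum_smul]
  rw [Finset.sum_comm, Finset.sum_congr rfl fun j _ ↦ h2 j]
  simp only [realSuper_apply, mul_smul_comm, Finset.mul_sum, Finset.sum_const, Finset.card_univ,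
    Fintype.card_fin, ← Finset.smul_sum, ← Nat.cast_smul_eq_nsmul ℝ, smul_smul]
  congr 1
  rw [Nat.factorial_succ]
  push_cast
  field_simp

/-- `D` is the covariant derivative of `f` at `z`, where `W v` is the endomorphism of `V` given by
the connection in the direction `v`. -/
def HasCovDeriv (W : B → V →ₗ[ℝ] V) (f D : B → SuperAlg B V) (z : B) : Prop :=
  HasSuperDeriv f (fun v ↦ D v - vecDerivation B (W v) (f z)) z

variable {W : B → V →ₗ[ℝ] V} {z : B}

lemma HasCovDeriv.mul {f g D D' : B → SuperAlg B V} (hf : HasCovDeriv W f D z)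
    (hg : HasCovDeriv W g D' z) :
    HasCovDeriv W (fun y ↦ f y * g y) (fun v ↦ D v * g z + f z * D' v) z := by
  refine (HasSuperDeriv.mul hf hg).congr_deriv fun v ↦ ?_
  rw [vecDerivation, extDerivation_mul]
  noncomm_ring

lemma HasCovDeriv.sum {κ : Type*} (s : Finset κ) {f D : κ → B → SuperAlg B V}
    (h : ∀ i ∈ s, HasCovDeriv W (f i) (D i) z) :
    HasCovDeriv W (fun y ↦ ∑ i ∈ s, f i y) (fun v ↦ ∑ i ∈ s, D i v) z := by
  refine (HasSuperDeriv.sum s h).congr_deriv fun v ↦ ?_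
  rw [vecDerivation, extDerivation_sum, Finset.sum_sub_distrib]

lemma HasCovDeriv.const_smul {f D : B → SuperAlg B V} (h : HasCovDeriv W f D z) (r : ℝ) :
    HasCovDeriv W (fun y ↦ r • f y) (fun v ↦ r • D v) z := by
  refine (HasSuperDeriv.const_smul h r).congr_deriv fun v ↦ ?_
  rw [vecDerivation, extDerivation_smul, smul_sub]

/-- Centrality of the value at z suffices to collect the factor that has been differentiated on the
right. -/
lemma HasCovDeriv.pow {f D : B → SuperAlg B V} (h : HasCovDeriv W f D z)
    (hc : ∀ x, Commute (f z) x) (k : ℕ) :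
    HasCovDeriv W (fun y ↦ f y ^ k) (fun v ↦ (k : ℝ) • (f z ^ (k - 1) * D v)) z := by
  induction k with
  | zero =>
    refine ((hasSuperDeriv_const (1 : SuperAlg B V) z).congr (.of_forall fun y ↦ ?_)).congr_deriv
      fun v ↦ ?_
    · simp
    · simp [vecDerivation, extDerivation_one]
  | succ k ih =>
    refine ((ih.mul h).congr (.of_forall fun y ↦ ?_)).congr_deriv fun v ↦ ?_
    · exact pow_succ _ _
    · simp only [← pow_succ]
      congr 1
      rw [smul_mul_assoc, mul_assoc, ← (hc (D v)).eq, ← mul_assoc, ← pow_succ, Nat.add_sub_cancel]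
      cases k with
      | zero => simp
      | succ k => rw [Nat.add_sub_cancel]; push_cast; module

lemma hasCovDeriv_vecSuper (e : V) :
    HasCovDeriv W (fun _ ↦ vecSuper B e) (fun v ↦ vecSuper B (W v e)) z := by
  refine (hasSuperDeriv_const _ _).congr_deriv fun v ↦ ?_
  rw [vecDerivation_vecSuper, sub_self]

lemma hasCovDeriv_realSuper {k : ℕ} (α : B → B [⋀^Fin k]→L[ℝ] ℝ)
    (h : DifferentiableAt ℝ α z) : HasCovDeriv W (fun y ↦ realSuper V t (α y).toAlternatingMap)
      (fun v ↦ realSuper V t (fderiv ℝ α z v).toAlternatingMap) z := by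
  refine (hasSuperDeriv_realSuper t α z h).congr_deriv fun v ↦ ?_
  rw [vecDerivation_realSuper, sub_zero]

lemma HasCovDeriv.congr {f g D : B → SuperAlg B V} (hf : HasCovDeriv W f D z)
    (h : ∀ᶠ y in 𝓝 z, g y = f y) : HasCovDeriv W g D z := by
  refine (HasSuperDeriv.congr hf h).congr_deriv fun v ↦ ?_
  rw [h.self_of_nhds]

lemma HasCovDeriv.unique {f D D' : B → SuperAlg B V} (hf : HasCovDeriv W f D z)
    (hf' : HasCovDeriv W f D' z) (v : B) : D v = D' v :=
  sub_left_injective (congrFun (HasSuperDeriv.unique hf hf' (.of_forall fun _ ↦ rfl)) v)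

end LocalTransgression

end

section

/-! ### Connection forms, curvature and the Bianchi identity in a chart -/

section LocalChern

variable {B : Type*} [NormedAddCommGroup B] [NormedSpace ℝ B]
  {V : Type*} [AddCommGroup V] [Module ℝ V] {ι : Type*} [Fintype ι] (t : Basis ι ℝ B)
  {q : ℕ} (b : Basis (Fin (q + 1)) ℝ V)

/-- The endomorphism of `V` given in the basis `b` by a matrix of one-forms and a vector. -/
def connEnd (w : Fin (q + 1) → Fin (q + 1) → B [⋀^Fin 1]→ₗ[ℝ] ℝ) (v : B) : V →ₗ[ℝ] V :=
  b.constr ℝ fun a ↦ ∑ c, w a c (fun _ ↦ v) • b c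

lemma connEnd_basis (w : Fin (q + 1) → Fin (q + 1) → B [⋀^Fin 1]→ₗ[ℝ] ℝ) (v : B)
    (a : Fin (q + 1)) : connEnd b w v (b a) = ∑ c, w a c (fun _ ↦ v) • b c :=
  Basis.constr_basis _ _ _ _

lemma sum_coordGen_mul_connEnd (w : Fin (q + 1) → Fin (q + 1) → B [⋀^Fin 1]→ₗ[ℝ] ℝ)
    (a : Fin (q + 1)) : ∑ i, coordGen V t i * vecSuper B (connEnd b w (t i) (b a)) =
      ∑ c, realSuper V t (w a c) * vecSuper B (b c) := by
  simp only [connEnd_basis, vecSuper_sum, vecSuper_smul, realSuper_one_eq_sum, Finset.mul_sum,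
    Finset.sum_mul]
  rw [Finset.sum_comm]
  simp only [mul_smul_comm, smul_mul_assoc]

/-- The exterior covariant derivative of α ⊗ eₐ. The minus sign appears because dxⁱ passes the
one-form α; in the analogue for two-forms it is absent. -/
lemma sum_coordGen_mul_one_form (α : B → B [⋀^Fin 1]→L[ℝ] ℝ) (z : B)
    (w : Fin (q + 1) → Fin (q + 1) → B [⋀^Fin 1]→ₗ[ℝ] ℝ) (a : Fin (q + 1)) :
    ∑ i, coordGen V t i * (realSuper V t (fderiv ℝ α z (t i)).toAlternatingMap * vecSuper B (b a) +
      realSuper V t (α z).toAlternatingMap * vecSuper B (connEnd b w (t i) (b a))) =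
    realSuper V t (extDeriv α z).toAlternatingMap * vecSuper B (b a) -
      realSuper V t (α z).toAlternatingMap *
        ∑ c, realSuper V t (w a c) * vecSuper B (b c) := by
  rw [← sum_coordGen_mul_connEnd, ← sum_coordGen_mul_realSuper, Finset.mul_sum, Finset.sum_mul,
    ← Finset.sum_sub_distrib]
  refine Finset.sum_congr rfl fun i _ ↦ ?_
  rw [mul_add, ← mul_assoc, ← mul_assoc (coordGen V t i) (realSuper V t (α z).toAlternatingMap),
    coordGen_mul_realSuper_one t i (α z).toAlternatingMap, neg_mul, mul_assoc (realSuper V t _),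
    sub_eq_add_neg]

lemma sum_coordGen_mul_two_form (α : B → B [⋀^Fin 2]→L[ℝ] ℝ) (z : B)
    (w : Fin (q + 1) → Fin (q + 1) → B [⋀^Fin 1]→ₗ[ℝ] ℝ) (a c : Fin (q + 1)) :
    ∑ i, coordGen V t i * (realSuper V t (fderiv ℝ α z (t i)).toAlternatingMap *
        (vecSuper B (b a) * vecSuper B (b c)) +
      realSuper V t (α z).toAlternatingMap * (vecSuper B (connEnd b w (t i) (b a)) *
        vecSuper B (b c) + vecSuper B (b a) * vecSuper B (connEnd b w (t i) (b c)))) =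
    realSuper V t (extDeriv α z).toAlternatingMap * (vecSuper B (b a) * vecSuper B (b c)) +
      realSuper V t (α z).toAlternatingMap *
        (∑ d, realSuper V t (w a d) * (vecSuper B (b d) * vecSuper B (b c)) +
        ∑ d, realSuper V t (w c d) * (vecSuper B (b a) * vecSuper B (b d))) := by
  have h1 : ∑ d, realSuper V t (w a d) * (vecSuper B (b d) * vecSuper B (b c)) =
      ∑ i, coordGen V t i * (vecSuper B (connEnd b w (t i) (b a)) * vecSuper B (b c)) := by
    simp only [← mul_assoc]
    rw [← Finset.sum_mul, ← sum_coordGen_mul_connEnd, Finset.sum_mul]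
  have h2 : ∑ d, realSuper V t (w c d) * (vecSuper B (b a) * vecSuper B (b d)) =
      ∑ i, coordGen V t i * (vecSuper B (b a) * vecSuper B (connEnd b w (t i) (b c))) := by
    simp only [fun v : V ↦ ι_anticomm ((0 : Dual ℝ B), b a) (0, v), mul_neg, Finset.sum_neg_distrib]
    simp only [← mul_assoc]
    rw [← Finset.sum_mul, ← sum_coordGen_mul_connEnd, Finset.sum_mul]
  rw [h1, h2, ← Finset.sum_add_distrib, ← sum_coordGen_mul_realSuper, Finset.mul_sum, Finset.sum_mul,
    ← Finset.sum_add_distrib]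
  refine Finset.sum_congr rfl fun i _ ↦ ?_
  rw [mul_add, ← mul_assoc, ← mul_add, ← mul_assoc, ← mul_assoc,
    ← (commute_realSuper_two t (α z).toAlternatingMap (coordGen V t i)).eq, mul_assoc (realSuper V t _)]

variable {w : Fin (q + 1) → Fin (q + 1) → B → B [⋀^Fin 1]→L[ℝ] ℝ}
  {Ω : Fin (q + 1) → Fin (q + 1) → B → B [⋀^Fin 2]→L[ℝ] ℝ} {z : B}

/-- Near `z`, `Ω` is the curvature of the skew-symmetric matrix `w` of smooth one-forms. -/
structure IsCurvatureAt (w : Fin (q + 1) → Fin (q + 1) → B → B [⋀^Fin 1]→L[ℝ] ℝ)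
    (Ω : Fin (q + 1) → Fin (q + 1) → B → B [⋀^Fin 2]→L[ℝ] ℝ) (z : B) : Prop where
  contDiffAt : ∀ i j, ContDiffAt ℝ ∞ (w i j) z
  differentiableAt : ∀ i j, DifferentiableAt ℝ (Ω i j) z
  antisymm : ∀ᶠ y in 𝓝 z, ∀ i j, w j i y = -w i j y
  curv : ∀ᶠ y in 𝓝 z, ∀ i j, (Ω i j y).toAlternatingMap = (extDeriv (w i j) y).toAlternatingMap -
    ∑ k, wedge (w i k y).toAlternatingMap (w k j y).toAlternatingMap

/-- `evalSuper` reconstructs the form. This is the way back from the algebra to differential forms.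
-/
lemma realSuper_injective {T : Type*} [AddCommGroup T] [Module ℝ T] {κ : Type*} [Fintype κ]
    (t : Basis κ ℝ T) {n : ℕ} (b : Basis (Fin n) ℝ V) {k : ℕ} {α β : T [⋀^Fin k]→ₗ[ℝ] ℝ}
    (h : realSuper V t α * vecProd T b = realSuper V t β * vecProd T b) : α = β := by
  ext v
  rw [← evalSuper_realSuper_mul t b v α, h, evalSuper_realSuper_mul]

lemma realSuper_wedge_one (α β : B [⋀^Fin 1]→ₗ[ℝ] ℝ) :
    realSuper V t (k := 2) (wedge α β) = realSuper V t α * realSuper V t β :=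
  realSuper_wedge t α β

lemma toAlternatingMap_neg {k : ℕ} (α : B [⋀^Fin k]→L[ℝ] ℝ) :
    (-α).toAlternatingMap = -α.toAlternatingMap := rfl

lemma realSuper_one_anticomm (α β : B [⋀^Fin 1]→ₗ[ℝ] ℝ) :
    realSuper V t α * realSuper V t β = -(realSuper V t β * realSuper V t α) := by
  rw [realSuper_one, realSuper_one]
  exact ι_anticomm _ _

/-- Transposing both factors of w ∧ w introduces two signs that cancel, and reordering the one-forms
gives one more. Skewness of w is used near each point because the term dw sees the germ. -/
lemma IsCurvatureAt.curv_antisymm (t : Basis ι ℝ B) (b : Basis (Fin (q + 1)) ℝ V)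
    (h : IsCurvatureAt w Ω z) :
    ∀ᶠ y in 𝓝 z, ∀ i j, (Ω j i y).toAlternatingMap = -(Ω i j y).toAlternatingMap := by
  filter_upwards [h.curv, h.antisymm.eventually_nhds] with y hy hw i j
  refine realSuper_injective t b ?_
  congr 1
  have h1 : extDeriv (w j i) y = -extDeriv (w i j) y := by
    have : w j i =ᶠ[𝓝 y] fun y ↦ (-1 : ℝ) • w i j y :=
      hw.mono fun y hy ↦ (hy i j).trans (neg_one_smul ℝ (w i j y)).symm
    rw [this.extDeriv_eq]
    exact (extDeriv_smul _ _).trans (neg_one_smul ℝ _)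
  rw [hy j i, hy i j, h1, toAlternatingMap_neg, map_neg, map_sub, map_sub, map_neg, map_sum, map_sum,
    neg_sub, sub_eq_add_neg, sub_eq_add_neg, add_comm, ← Finset.sum_neg_distrib]
  congr 1
  refine Finset.sum_congr rfl fun k _ ↦ ?_
  rw [realSuper_wedge_one, realSuper_wedge_one, hw.self_of_nhds k j, hw.self_of_nhds i k,
    toAlternatingMap_neg, toAlternatingMap_neg, map_neg, map_neg, neg_mul_neg,
    realSuper_one_anticomm, neg_neg]

variable (V) in
lemma IsCurvatureAt.realSuper_extDeriv (h : IsCurvatureAt w Ω z) (i j : Fin (q + 1)) :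
    realSuper V t (extDeriv (w i j) z).toAlternatingMap =
      realSuper V t (Ω i j z).toAlternatingMap + ∑ k, realSuper V t (w i k z).toAlternatingMap *
        realSuper V t (w k j z).toAlternatingMap := by
  rw [h.curv.self_of_nhds i j, map_sub, map_sum]
  simp only [realSuper_wedge_one, sub_add_cancel]

lemma IsCurvatureAt.contDiffAt_extDeriv (h : IsCurvatureAt w Ω z) (i j : Fin (q + 1)) :
    DifferentiableAt ℝ (extDeriv (w i j)) z := by
  have h1 : DifferentiableAt ℝ (fderiv ℝ (w i j)) z :=
    ((h.contDiffAt i j).fderiv_right (m := 1) (by norm_cast)).differentiableAt one_ne_zero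
  exact (ContinuousAlternatingMap.alternatizeUncurryFinCLM ℝ B ℝ).differentiableAt.comp z h1

lemma IsCurvatureAt.extDeriv_extDeriv_eq_zero (h : IsCurvatureAt w Ω z) (i j : Fin (q + 1)) :
    extDeriv (extDeriv (w i j)) z = 0 :=
  extDeriv_extDeriv_apply (r := 2) ((h.contDiffAt i j).of_le ENat.LEInfty.out) (by simp)

variable (V) in
-- Since d² = 0, only the quadratic part of Ω = dw - w ∧ w is differentiated. After dw = Ω + w ∧ w
-- is substituted, the cubic terms cancel.
lemma IsCurvatureAt.bianchi (h : IsCurvatureAt w Ω z) (i j : Fin (q + 1)) :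
    realSuper V t (extDeriv (Ω i j) z).toAlternatingMap =
      ∑ k, (realSuper V t (w i k z).toAlternatingMap * realSuper V t (Ω k j z).toAlternatingMap -
        realSuper V t (Ω i k z).toAlternatingMap * realSuper V t (w k j z).toAlternatingMap) := by
  have h1 := hasSuperDeriv_realSuper (V := V) t (extDeriv (w i j)) z (h.contDiffAt_extDeriv i j)
  have h2 := fun i j ↦ hasSuperDeriv_realSuper (V := V) t (w i j) z
    ((h.contDiffAt i j).differentiableAt (by simp))
  have h3 := hasSuperDeriv_realSuper (V := V) t (Ω i j) z (h.differentiableAt i j)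
  have h4 := h1.sub (HasSuperDeriv.sum Finset.univ fun k _ ↦ (h2 i k).mul (h2 k j))
  have h5 := h3.unique h4 <| h.curv.mono fun y hy ↦ by
    rw [hy i j, map_sub, map_sum]
    simp only [realSuper_wedge_one]
  rw [← sum_coordGen_mul_realSuper]
  simp only [fun v ↦ congrFun h5 v, mul_sub, Finset.sum_sub_distrib]
  rw [sum_coordGen_mul_realSuper, h.extDeriv_extDeriv_eq_zero]
  have h6 : ∀ k, ∑ l, coordGen V t l * (realSuper V t (fderiv ℝ (w i k) z (t l)).toAlternatingMap *
      realSuper V t (w k j z).toAlternatingMap + realSuper V t (w i k z).toAlternatingMap *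
      realSuper V t (fderiv ℝ (w k j) z (t l)).toAlternatingMap) =
      realSuper V t (extDeriv (w i k) z).toAlternatingMap * realSuper V t (w k j z).toAlternatingMap -
      realSuper V t (w i k z).toAlternatingMap *
        realSuper V t (extDeriv (w k j) z).toAlternatingMap := by
    intro k
    rw [← sum_coordGen_mul_realSuper, ← sum_coordGen_mul_realSuper, Finset.mul_sum, Finset.sum_mul,
      ← Finset.sum_sub_distrib]
    refine Finset.sum_congr rfl fun l _ ↦ ?_
    rw [mul_add, ← mul_assoc, ← mul_assoc (coordGen V t l) (realSuper V t (w i k z).toAlternatingMap),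
      coordGen_mul_realSuper_one t l (w i k z).toAlternatingMap, neg_mul, mul_assoc (realSuper V t (w i k z).toAlternatingMap),
      sub_eq_add_neg]
  simp only [Finset.mul_sum]
  rw [Finset.sum_comm, Finset.sum_congr rfl fun k _ ↦ h6 k]
  simp only [h.realSuper_extDeriv V t, add_mul, mul_add, Finset.sum_sub_distrib,
    Finset.sum_add_distrib, Finset.sum_mul, Finset.mul_sum]
  rw [Finset.sum_comm (f := fun k l ↦ _ * _ * realSuper V t (w k j z).toAlternatingMap)]
  simp only [mul_assoc]
  change realSuper V t 0 - _ = _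
  rw [map_zero]
  abel

end LocalChern

end

section

/-! ### The transgression formula in a chart -/

section LocalChern

variable {B : Type*} [NormedAddCommGroup B] [NormedSpace ℝ B]
  {V : Type*} [AddCommGroup V] [Module ℝ V] {ι : Type*} [Fintype ι] (t : Basis ι ℝ B)
  {q : ℕ} (b : Basis (Fin (q + 1)) ℝ V)
  {w : Fin (q + 1) → Fin (q + 1) → B → B [⋀^Fin 1]→L[ℝ] ℝ}
  {Ω : Fin (q + 1) → Fin (q + 1) → B → B [⋀^Fin 2]→L[ℝ] ℝ} {z : B}

/-- The matrix `w` of one-forms at the point `y`. -/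
abbrev formsAt {k : ℕ} (w : Fin (q + 1) → Fin (q + 1) → B → B [⋀^Fin k]→L[ℝ] ℝ) (y : B)
    (i j : Fin (q + 1)) : B [⋀^Fin k]→ₗ[ℝ] ℝ := (w i j y).toAlternatingMap

lemma eq_zero_of_eq_neg {N : Type*} [AddCommGroup N] [Module ℝ N] {x : N} (h : x = -x) : x = 0 := by
  have h2 : (2 : ℝ) • x = 0 := by rw [two_smul]; nth_rw 1 [h]; exact neg_add_cancel x
  exact (smul_eq_zero.1 h2).resolve_left two_ne_zero

lemma IsCurvatureAt.antisymm_at (h : IsCurvatureAt w Ω z) (i j : Fin (q + 1)) :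
    formsAt w z j i = -formsAt w z i j := by
  rw [formsAt, h.antisymm.self_of_nhds i j, toAlternatingMap_neg]

/-- The Bianchi identity in the form 𝐃Ω = 0: after indices are renamed and w is transposed, the
terms from dΩᵢⱼ cancel those from the rotation of eᵢ and eⱼ. -/
lemma IsCurvatureAt.hasCovDeriv_curvSuper (h : IsCurvatureAt w Ω z) : ∃ D,
    HasCovDeriv (connEnd b (formsAt w z)) (fun y ↦ curvSuper t b (formsAt Ω y)) D z ∧
    ∑ i, coordGen V t i * D (t i) = 0 := by
  refine ⟨_, HasCovDeriv.const_smul (HasCovDeriv.sum Finset.univ fun i _ ↦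
    HasCovDeriv.sum Finset.univ fun j _ ↦
      (hasCovDeriv_realSuper t (Ω i j) (h.differentiableAt i j)).mul
        ((hasCovDeriv_vecSuper (b i)).mul (hasCovDeriv_vecSuper (b j)))) (1 / 2), ?_⟩
  simp only [mul_smul_comm, ← Finset.smul_sum, Finset.mul_sum]
  rw [Finset.sum_comm, Finset.sum_congr rfl fun i _ ↦ Finset.sum_comm]
  simp only [sum_coordGen_mul_two_form, h.bianchi V t]
  have hc : ∀ i j k l : Fin (q + 1), realSuper V t (formsAt w z i j) * realSuper V t (formsAt Ω z k l) =
      realSuper V t (formsAt Ω z k l) * realSuper V t (formsAt w z i j) :=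
    fun i j k l ↦ (commute_realSuper_two t _ _).eq.symm
  simp only [Finset.sum_mul, Finset.mul_sum, mul_add, Finset.sum_add_distrib, sub_mul, hc,
    Finset.sum_sub_distrib, ← mul_assoc]
  have h1 : ∑ i, ∑ j, ∑ k, realSuper V t (formsAt Ω z k j) * realSuper V t (formsAt w z i k) *
      vecSuper B (b i) * vecSuper B (b j) = -∑ i, ∑ j, ∑ k, realSuper V t (formsAt Ω z i j) *
        realSuper V t (formsAt w z i k) * vecSuper B (b k) * vecSuper B (b j) := by
    rw [Finset.sum_congr rfl fun i _ ↦ Finset.sum_comm, Finset.sum_comm, ← Finset.sum_neg_distrib]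
    refine Finset.sum_congr rfl fun k _ ↦ ?_
    rw [Finset.sum_comm, ← Finset.sum_neg_distrib]
    refine Finset.sum_congr rfl fun j _ ↦ ?_
    rw [← Finset.sum_neg_distrib]
    refine Finset.sum_congr rfl fun i _ ↦ ?_
    rw [h.antisymm_at k i, map_neg, mul_neg, neg_mul, neg_mul]
  have h2 : ∑ i, ∑ j, ∑ k, realSuper V t (formsAt Ω z i k) * realSuper V t (formsAt w z k j) *
      vecSuper B (b i) * vecSuper B (b j) = ∑ i, ∑ j, ∑ k, realSuper V t (formsAt Ω z i j) *
        realSuper V t (formsAt w z j k) * vecSuper B (b i) * vecSuper B (b k) :=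
    Finset.sum_congr rfl fun i _ ↦ Finset.sum_comm
  rw [h1, h2]
  abel_nf
  simp

lemma thetaSuper_eq_sum {T : Type*} [AddCommGroup T] [Module ℝ T] {κ : Type*} [Fintype κ]
    (t : Basis κ ℝ T) (b : Basis (Fin (q + 1)) ℝ V) {w : Fin (q + 1) → Fin (q + 1) → T [⋀^Fin 1]→ₗ[ℝ] ℝ}
    (hw : w (Fin.last q) (Fin.last q) = 0) : thetaSuper t b w =
      ∑ a, realSuper V t (w a (Fin.last q)) * vecSuper T (b a) := by
  rw [Fin.sum_univ_castSucc, hw, map_zero, zero_mul, add_zero, thetaSuper]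

lemma zetaSuper_eq_sum {T : Type*} [AddCommGroup T] [Module ℝ T] {κ : Type*} [Fintype κ]
    (t : Basis κ ℝ T) (b : Basis (Fin (q + 1)) ℝ V) {Ω : Fin (q + 1) → Fin (q + 1) → T [⋀^Fin 2]→ₗ[ℝ] ℝ}
    (hΩ : Ω (Fin.last q) (Fin.last q) = 0) : zetaSuper t b Ω =
      ∑ a, realSuper V t (Ω (Fin.last q) a) * vecSuper T (b a) := by
  rw [Fin.sum_univ_castSucc, hΩ, map_zero, zero_mul, add_zero, zetaSuper]

/-- Here dϖₐⁿ = Ωₐⁿ + ∑ ϖₐᵏ ∧ ϖₖⁿ, and the quadratic part is cancelled by the rotation of the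
vectors eₐ. Skew symmetry turns Ωₐⁿ into -Ωₙᵃ. -/
lemma IsCurvatureAt.hasCovDeriv_thetaSuper (h : IsCurvatureAt w Ω z) : ∃ D,
    HasCovDeriv (connEnd b (formsAt w z)) (fun y ↦ thetaSuper t b (formsAt w y)) D z ∧
    ∑ i, coordGen V t i * D (t i) = -zetaSuper t b (formsAt Ω z) := by
  refine ⟨_, HasCovDeriv.congr (HasCovDeriv.sum Finset.univ fun a _ ↦
    (hasCovDeriv_realSuper t (w a (Fin.last q))
      ((h.contDiffAt a (Fin.last q)).differentiableAt (by simp))).mul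
        (hasCovDeriv_vecSuper (b a))) ?_, ?_⟩
  · filter_upwards [h.antisymm] with y hy
    refine thetaSuper_eq_sum t b ?_
    have h1 := hy (Fin.last q) (Fin.last q)
    rw [formsAt, eq_zero_of_eq_neg h1]
    rfl
  have hΩ := (h.curv_antisymm t b).self_of_nhds
  rw [zetaSuper_eq_sum t b (eq_zero_of_eq_neg (hΩ _ _))]
  simp only [Finset.mul_sum]
  rw [Finset.sum_comm]
  simp only [sum_coordGen_mul_one_form, h.realSuper_extDeriv V t]
  simp only [add_mul, Finset.sum_sub_distrib, Finset.sum_add_distrib, Finset.sum_mul,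
    Finset.mul_sum, ← mul_assoc]
  have h1 : ∑ a, ∑ k, realSuper V t (formsAt w z a k) * realSuper V t (formsAt w z k (Fin.last q)) *
      vecSuper B (b a) = ∑ a, ∑ k, realSuper V t (formsAt w z a (Fin.last q)) *
        realSuper V t (formsAt w z a k) * vecSuper B (b k) := by
    rw [Finset.sum_comm]
    refine Finset.sum_congr rfl fun k _ ↦ Finset.sum_congr rfl fun a _ ↦ ?_
    rw [realSuper_one_anticomm, h.antisymm_at k a, map_neg, mul_neg, neg_neg]
  rw [h1, add_sub_cancel_right, ← Finset.sum_neg_distrib]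
  refine Finset.sum_congr rfl fun a _ ↦ ?_
  rw [hΩ (Fin.last q) a, map_neg, neg_mul]

lemma IsCurvatureAt.sum_coordGen_mul_last (h : IsCurvatureAt w Ω z) :
    ∑ i, coordGen V t i * vecSuper B (connEnd b (formsAt w z) (t i) (b (Fin.last q))) =
      -thetaSuper t b (formsAt w z) := by
  rw [sum_coordGen_mul_connEnd, thetaSuper_eq_sum t b (eq_zero_of_eq_neg (h.antisymm_at _ _)),
    ← Finset.sum_neg_distrib]
  refine Finset.sum_congr rfl fun c _ ↦ ?_
  rw [h.antisymm_at c, map_neg, neg_mul]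

/-- A skew matrix has zero diagonal, so the volume element is parallel. Hence multiplying by it
commutes with differentiating a form. -/
lemma IsCurvatureAt.hasCovDeriv_vecProd (h : IsCurvatureAt w Ω z) :
    HasCovDeriv (connEnd b (formsAt w z)) (fun _ ↦ vecProd B b) (fun _ ↦ 0) z := by
  refine (hasSuperDeriv_const _ _).congr_deriv fun v ↦ ?_
  rw [vecDerivation_vecProd b _ (fun a c ↦ formsAt w z a c fun _ ↦ v) (connEnd_basis _ _ _), sub_zero]
  exact fun i ↦ eq_zero_of_eq_neg <| DFunLike.congr_fun (h.antisymm_at _ _) _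

/-- Bookkeeping for ∑ dxⁱ ∇ᵢ applied to Ω^k θ^l eₙ: the even factors are central, so dxⁱ reaches the
differentiated factor without a sign. -/
lemma sum_central_mul {A : Type*} [Ring A] [Algebra ℝ A] {O' O θ' θ P e : A} (x D D' e' : ι → A)
    (r k l : ℝ) (hO' : ∀ y, Commute O' y) (hO : ∀ y, Commute O y) (hθ' : ∀ y, Commute θ' y)
    (hP : ∀ y, Commute P y) :
    ∑ i, x i * (r • ((k • (O' * D i) * θ + O * (l • (θ' * D' i))) * e + P * e' i)) =
      r • (k • (O' * (∑ i, x i * D i) * θ * e) + l • (O * θ' * (∑ i, x i * D' i) * e) +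
        P * ∑ i, x i * e' i) := by
  simp only [Finset.mul_sum, Finset.sum_mul, Finset.smul_sum, ← Finset.sum_add_distrib]
  refine Finset.sum_congr rfl fun i _ ↦ ?_
  rw [mul_smul_comm, mul_add, ← mul_assoc (x i) P, ← (hP (x i)).eq, ← mul_assoc (x i), mul_add (x i),
    add_mul, smul_mul_assoc, mul_smul_comm, mul_smul_comm, mul_smul_comm, smul_mul_assoc,
    smul_mul_assoc, ← mul_assoc (x i) (O' * D i), ← mul_assoc (x i) O', ← (hO' (x i)).eq,
    ← mul_assoc (x i) O, ← (hO (x i)).eq, ← mul_assoc (O * x i), mul_assoc O (x i) θ',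
    ← (hθ' (x i)).eq]
  simp only [mul_assoc]

/-- The Leibniz rule with 𝐃Ω = 0, 𝐃θ = -ζ and 𝐃eₙ = -θ. For l = 0 the exponent l - 1 is truncated,
but the coefficient l removes that term. -/
lemma IsCurvatureAt.extDeriv_chernSum (h : IsCurvatureAt w Ω z) (k : Fin (q / 2 + 1))
    (Φ : B → B [⋀^Fin q]→L[ℝ] ℝ) (hΦ : DifferentiableAt ℝ Φ z)
    (hΦk : ∀ᶠ y in 𝓝 z, (Φ y).toAlternatingMap = chernSum (formsAt Ω y) (formsAt w y) k) :
    realSuper V t (extDeriv Φ z).toAlternatingMap * vecProd B b =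
      ((-1 : ℝ) ^ ((q - 2 * (k : ℕ)).choose 2) * 2 ^ (k : ℕ)) •
        (-(curvSuper t b (formsAt Ω z) ^ (k : ℕ) * thetaSuper t b (formsAt w z) ^ (q - 2 * (k : ℕ) + 1)) -
        ((q - 2 * k : ℕ) : ℝ) • (curvSuper t b (formsAt Ω z) ^ (k : ℕ) *
          thetaSuper t b (formsAt w z) ^ (q - 2 * (k : ℕ) - 1) *
          (zetaSuper t b (formsAt Ω z) * vecSuper B (b (Fin.last q))))) := by
  obtain ⟨D, hD, hD0⟩ := h.hasCovDeriv_curvSuper t b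
  obtain ⟨D', hD', hD'0⟩ := h.hasCovDeriv_thetaSuper t b
  have hO := commute_curvSuper t b (formsAt Ω z)
  have hθ := commute_thetaSuper t b (formsAt w z)
  have h1 := (hasCovDeriv_realSuper t Φ hΦ).mul (h.hasCovDeriv_vecProd b)
  have h2 := ((((hD.pow hO k).mul (hD'.pow hθ (q - 2 * (k : ℕ)))).mul
    (hasCovDeriv_vecSuper (b (Fin.last q)))).const_smul
      ((-1 : ℝ) ^ ((q - 2 * (k : ℕ)).choose 2) * 2 ^ (k : ℕ))).congr
        (g := fun y ↦ realSuper V t (Φ y).toAlternatingMap * vecProd B b) <| by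
    filter_upwards [hΦk, h.curv_antisymm t b] with y hy hΩ
    rw [hy, realSuper_chernSum_mul t b _ _ hΩ]
  -- The covariant derivative of Φ · e₁⋯eₙ is computed twice: from the parallel volume element, and
  -- from the product Ω^k θ^l eₙ.
  have h3 := h1.unique h2
  have h4 : ∀ i, coordGen V t i * realSuper V t (fderiv ℝ Φ z (t i)).toAlternatingMap * vecProd B b =
      coordGen V t i * _ := fun i ↦ (mul_assoc _ _ _).trans <|
    congrArg (coordGen V t i * ·) <| Eq.trans (by rw [mul_zero, add_zero]) (h3 (t i))
  rw [← sum_coordGen_mul_realSuper, Finset.sum_mul, Finset.sum_congr rfl fun i _ ↦ h4 i]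
  refine (sum_central_mul (coordGen V t) (fun i ↦ D (t i)) (fun i ↦ D' (t i))
    (fun i ↦ vecSuper B (connEnd b (formsAt w z) (t i) (b (Fin.last q)))) _ _ _
    (fun x ↦ (hO x).pow_left _) (fun x ↦ (hO x).pow_left _) (fun x ↦ (hθ x).pow_left _)
    (fun x ↦ ((hO x).pow_left _).mul_left ((hθ x).pow_left _))).trans ?_
  rw [hD0, hD'0, h.sum_coordGen_mul_last]
  congr 1
  simp only [mul_zero, zero_mul, smul_zero, zero_add, mul_neg, neg_mul, smul_neg, pow_succ, mul_assoc]
  abel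

/-- The local form of the transgression formula. -/
theorem IsCurvatureAt.pfaffian_eq (t : Basis ι ℝ B) (h : IsCurvatureAt w Ω z)
    (Φ : Fin (q / 2 + 1) → B → B [⋀^Fin q]→L[ℝ] ℝ) (hΦ : ∀ k, DifferentiableAt ℝ (Φ k) z)
    (hΦk : ∀ k, ∀ᶠ y in 𝓝 z, (Φ k y).toAlternatingMap = chernSum (formsAt Ω y) (formsAt w y) k) :
    (berezin b).compAlternatingMap (expNeg ((1 / 2 : ℝ) • ∑ i, ∑ j, (LinearMap.toSpanSingleton ℝ _
      (ExteriorAlgebra.ι ℝ (b i) * ExteriorAlgebra.ι ℝ (b j))).compAlternatingMap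
        (formsAt Ω z i j)) (q + 1)) =
      (-1 : ℝ) ^ q • ∑ k : Fin (q / 2 + 1), chernCoeff q k • (extDeriv (Φ k) z).toAlternatingMap := by
  refine realSuper_injective t b ?_
  rw [realSuper_pfaffian_mul t b _ (curv_mem b (formsAt Ω z)), extSuper_curv, map_smul, map_sum,
    smul_mul_assoc, Finset.sum_mul]
  simp only [map_smul, smul_mul_assoc, fun k ↦ h.extDeriv_chernSum t b k (Φ k) (hΦ k) (hΦk k)]
  have h1 := curvSuper_telescope t b (formsAt Ω z) (formsAt w z) (h.curv_antisymm t b).self_of_nhds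
  -- The rank is n = q + 1, so the Pfaffian is nonzero only for odd q.
  have h2 : ((q + 1) % 2 = 0) = (q % 2 = 1) := propext ⟨fun h ↦ by omega, fun h ↦ by omega⟩
  simp only [h2]
  rw [h1, Finset.sum_range]
  congr 1
  refine Finset.sum_congr rfl fun k _ ↦ ?_
  rw [smul_smul, chernCoeff', mul_assoc]

end LocalChern

end

section

/-! ### Wedge products and pull-backs -/

section WedgeReal

variable {T : Type*} [AddCommGroup T] [Module ℝ T]

lemma wedge_apply_eq {a b : ℕ} (α : T [⋀^Fin a]→ₗ[ℝ] ℝ) (β : T [⋀^Fin b]→ₗ[ℝ] ℝ)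
    (v : Fin (a + b) → T) :
    wedge α β v = ((a.factorial * b.factorial : ℕ) : ℝ)⁻¹ * ∑ σ : Equiv.Perm (Fin a ⊕ Fin b),
      ((Equiv.Perm.sign σ : ℤ) : ℝ) * (α (fun i ↦ v (finSumFinEquiv (σ (Sum.inl i)))) *
        β (fun i ↦ v (finSumFinEquiv (σ (Sum.inr i))))) := by
  have h := wedge_apply α β v
  simp only [smul_eq_mul, nsmul_eq_mul] at h
  rw [← h, inv_mul_cancel_left₀]
  exact Nat.cast_ne_zero.2 (by positivity)

lemma wedge_compLinearMap {T' : Type*} [AddCommGroup T'] [Module ℝ T'] {a b : ℕ}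
    (α : T [⋀^Fin a]→ₗ[ℝ] ℝ) (β : T [⋀^Fin b]→ₗ[ℝ] ℝ) (f : T' →ₗ[ℝ] T) :
    (wedge α β).compLinearMap f = wedge (α.compLinearMap f) (β.compLinearMap f) := by
  ext v
  rw [AlternatingMap.compLinearMap_apply, wedge_apply_eq, wedge_apply_eq]
  rfl

lemma wedgeFamily_compLinearMap {T' : Type*} [AddCommGroup T'] [Module ℝ T'] (d k : ℕ)
    (α : Fin k → T [⋀^Fin d]→ₗ[ℝ] ℝ) (f : T' →ₗ[ℝ] T) :
    (wedgeFamily d k α).compLinearMap f = wedgeFamily d k fun i ↦ (α i).compLinearMap f := by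
  induction k with
  | zero => rfl
  | succ k ih =>
    rw [wedgeFamily, wedgeFamily, ← ih]
    exact wedge_compLinearMap _ _ f

lemma compLinearMap_sum {T' κ : Type*} [AddCommGroup T'] [Module ℝ T'] {k : ℕ} (s : Finset κ)
    (α : κ → T [⋀^Fin k]→ₗ[ℝ] ℝ) (f : T' →ₗ[ℝ] T) :
    (∑ i ∈ s, α i).compLinearMap f = ∑ i ∈ s, (α i).compLinearMap f := by
  ext v
  rw [AlternatingMap.compLinearMap_apply, alternating_sum_apply, alternating_sum_apply]
  rfl

lemma chernSum_compLinearMap {T' : Type*} [AddCommGroup T'] [Module ℝ T'] {q : ℕ}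
    (Ω : Fin (q + 1) → Fin (q + 1) → T [⋀^Fin 2]→ₗ[ℝ] ℝ)
    (w : Fin (q + 1) → Fin (q + 1) → T [⋀^Fin 1]→ₗ[ℝ] ℝ) (k : Fin (q / 2 + 1)) (f : T' →ₗ[ℝ] T) :
    (chernSum Ω w k).compLinearMap f =
      chernSum (fun i j ↦ (Ω i j).compLinearMap f) (fun i j ↦ (w i j).compLinearMap f) k := by
  rw [chernSum, compLinearMap_sum, chernSum]
  refine Finset.sum_congr rfl fun σ _ ↦ ?_
  rw [← wedgeFamily_compLinearMap, ← wedgeFamily_compLinearMap, ← wedge_compLinearMap]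
  rfl

/-- The sum over permutations is the expansion of a 2 × 2 determinant. -/
lemma wedge_one_one_apply (α β : T [⋀^Fin 1]→ₗ[ℝ] ℝ) (v : Fin 2 → T) :
    wedge (a := 1) (b := 1) α β v =
      α (fun _ ↦ v 0) * β (fun _ ↦ v 1) - α (fun _ ↦ v 1) * β (fun _ ↦ v 0) := by
  have h := Matrix.det_fin_two (Matrix.of fun i j : Fin 2 ↦
    if j = 0 then α (fun _ ↦ v i) else β (fun _ ↦ v i))
  rw [Matrix.det_apply', ← (finSumFinEquiv (m := 1) (n := 1)).permCongr.sum_comp] at h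
  simp only [Fin.prod_univ_two, Matrix.of_apply, if_pos, one_ne_zero, if_false] at h
  rw [wedge_apply_eq]
  refine Eq.trans ?_ (h.trans (by ring))
  rw [Nat.factorial_one, mul_one, Nat.cast_one, inv_one, one_mul]
  refine Finset.sum_congr rfl fun σ _ ↦ ?_
  rw [Equiv.Perm.sign_permCongr]
  congr 3 <;> refine funext fun i ↦ ?_ <;> rw [Subsingleton.elim i 0] <;> rfl

end WedgeReal

/-! ### Smooth families of alternating forms -/

section SmoothAlternating

variable {B : Type*} [NormedAddCommGroup B] [NormedSpace ℝ B] [FiniteDimensional ℝ B]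
  {G : Type*} [NormedAddCommGroup G] [NormedSpace ℝ G] {k : ℕ}

variable (B k) in
/-- A form on a finite-dimensional space is determined linearly by its values on basis vectors. -/
lemma exists_eq_sum_smul_form : ∃ g : (Fin k → Fin (finrank ℝ B)) → B [⋀^Fin k]→L[ℝ] ℝ,
    ∀ α : B [⋀^Fin k]→L[ℝ] ℝ, α = ∑ r, α (fun i ↦ finBasis ℝ B (r i)) • g r := by
  let ev : B [⋀^Fin k]→L[ℝ] ℝ →ₗ[ℝ] ((Fin k → Fin (finrank ℝ B)) → ℝ) :=
    { toFun := fun α r ↦ α fun i ↦ finBasis ℝ B (r i)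
      map_add' := fun _ _ ↦ rfl
      map_smul' := fun _ _ ↦ rfl }
  have hev : LinearMap.ker ev = ⊥ := by
    refine LinearMap.ker_eq_bot'.2 fun α hα ↦ ?_
    have : α.toAlternatingMap = 0 := Basis.ext_alternating (finBasis ℝ B) fun r _ ↦ congrFun hα r
    exact ContinuousAlternatingMap.toAlternatingMap_injective this
  obtain ⟨g, hg⟩ := ev.exists_leftInverse_of_injective hev
  refine ⟨fun r ↦ g (Pi.single r 1), fun α ↦ ?_⟩
  have h1 : g (ev α) = α := LinearMap.congr_fun hg α
  conv_lhs => rw [← h1, ← Finset.univ_sum_single (ev α), map_sum]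
  refine Finset.sum_congr rfl fun r _ ↦ ?_
  rw [← map_smul, ← Pi.single_smul, smul_eq_mul, mul_one]
  rfl

/-- In finite dimension a form is a combination of fixed forms whose coefficients are its values on
basis vectors. -/
lemma contDiffAt_form_iff {n : WithTop ℕ∞} {f : G → B [⋀^Fin k]→L[ℝ] ℝ} {z : G} :
    ContDiffAt ℝ n f z ↔ ∀ v, ContDiffAt ℝ n (fun y ↦ f y v) z := by
  refine ⟨fun h v ↦ ?_, fun h ↦ ?_⟩
  · exact (ContinuousAlternatingMap.apply ℝ B ℝ v).contDiff.contDiffAt.comp z h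
  · obtain ⟨g, hg⟩ := exists_eq_sum_smul_form B k
    rw [funext fun y ↦ hg (f y)]
    exact ContDiffAt.sum fun r _ ↦ (h _).smul contDiffAt_const

lemma ContDiffAt.form_apply {n : WithTop ℕ∞} {f : G → B [⋀^Fin k]→L[ℝ] ℝ} {z : G}
    {v : Fin k → G → B} (hf : ContDiffAt ℝ n f z) (hv : ∀ i, ContDiffAt ℝ n (v i) z) :
    ContDiffAt ℝ n (fun y ↦ f y fun i ↦ v i y) z := by
  obtain ⟨g, hg⟩ := exists_eq_sum_smul_form B k
  have h : (fun y ↦ f y fun i ↦ v i y) = fun y ↦ ∑ r, f y (fun i ↦ finBasis ℝ B (r i)) *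
      g r fun i ↦ v i y := by
    ext y
    conv_lhs => rw [hg (f y)]
    simp
  rw [h]
  refine ContDiffAt.sum fun r _ ↦ (contDiffAt_form_iff.1 hf _).mul ?_
  exact (g r).toContinuousMultilinearMap.contDiff.contDiffAt.comp z (contDiffAt_pi.2 hv)

end SmoothAlternating

end

section

/-! ### Differential forms on a manifold and independence of the chart -/

section ManifoldForms

variable {B : Type*} [NormedAddCommGroup B] [NormedSpace ℝ B] [FiniteDimensional ℝ B]
  {H : Type*} [TopologicalSpace H] {I : ModelWithCorners ℝ B H} [I.Boundaryless]
  {S : Type*} [TopologicalSpace S] [ChartedSpace H S] [IsManifold I ∞ S] {k : ℕ}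

variable (I) in
/-- The transition map from the chart at `p` to the chart at `p'`. -/
def chartChange (p p' : S) (z : B) : B := extChartAt I p' ((extChartAt I p).symm z)

lemma contMDiffAt_extChartAt_symm' {p : S} {z : B} (hz : z ∈ (extChartAt I p).target) :
    ContMDiffAt 𝓘(ℝ, B) I ∞ (extChartAt I p).symm z :=
  (contMDiffOn_extChartAt_symm p).contMDiffAt ((isOpen_extChartAt_target p).mem_nhds hz)

lemma contDiffAt_chartChange {p p' : S} {z : B} (hz : z ∈ (extChartAt I p).target)
    (hz' : (extChartAt I p).symm z ∈ (extChartAt I p').source) :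
    ContDiffAt ℝ ∞ (chartChange I p p') z := by
  rw [← contMDiffAt_iff_contDiffAt]
  rw [extChartAt_source] at hz'
  exact (contMDiffAt_extChartAt' hz').comp z (contMDiffAt_extChartAt_symm' hz)

lemma eventually_mem_chart {p p' : S} {z : B} (hz : z ∈ (extChartAt I p).target)
    (hz' : (extChartAt I p).symm z ∈ (extChartAt I p').source) :
    ∀ᶠ y in 𝓝 z, y ∈ (extChartAt I p).target ∧ (extChartAt I p).symm y ∈ (extChartAt I p').source :=
  ((isOpen_extChartAt_target p).eventually_mem hz).and <|
    (contMDiffAt_extChartAt_symm' hz).continuousAt ((isOpen_extChartAt_source p').mem_nhds hz')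

/-- The chain rule. The equality is heterogeneous because the two base points, and with them the
tangent spaces, are equal only propositionally. -/
lemma mfderiv_extChartAt_symm_eq {p p' : S} {z : B} (hz : z ∈ (extChartAt I p).target)
    (hz' : (extChartAt I p).symm z ∈ (extChartAt I p').source) (v : B) :
    HEq (mfderiv 𝓘(ℝ, B) I (extChartAt I p).symm z v)
      (mfderiv 𝓘(ℝ, B) I (extChartAt I p').symm (chartChange I p p' z)
        (fderiv ℝ (chartChange I p p') z v)) := by
  have h1 : (extChartAt I p).symm =ᶠ[𝓝 z] (extChartAt I p').symm ∘ chartChange I p p' := by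
    filter_upwards [eventually_mem_chart hz hz'] with y hy
    exact ((extChartAt I p').left_inv hy.2).symm
  have h2 : chartChange I p p' z ∈ (extChartAt I p').target := (extChartAt I p').map_source hz'
  have h3 := ((contDiffAt_chartChange hz hz').differentiableAt (by simp)).mdifferentiableAt
  have h4 := mfderiv_comp z ((contMDiffAt_extChartAt_symm' h2).mdifferentiableAt (by simp)) h3
  rw [h1.mfderiv_eq, h4, mfderiv_eq_fderiv]
  rfl

lemma chartForm_eq_pullback (α : DiffForm I S k) {p p' : S} {z : B} (hz : z ∈ (extChartAt I p).target)
    (hz' : (extChartAt I p).symm z ∈ (extChartAt I p').source) :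
    chartForm I α p z = (chartForm I α p' (chartChange I p p' z)).compContinuousLinearMap
      (fderiv ℝ (chartChange I p p') z) := by
  have key : ∀ s s' : S, s = s' → ∀ (v : Fin k → TangentSpace I s) (v' : Fin k → TangentSpace I s'),
      (∀ i, HEq (v i) (v' i)) → α s v = α s' v' := by
    rintro s _ rfl v v' h
    rw [funext fun i ↦ eq_of_heq (h i)]
  ext v
  exact key _ _ ((extChartAt I p').left_inv hz').symm _ _
    fun i ↦ mfderiv_extChartAt_symm_eq hz hz' (v i)

variable (I) in
/-- Smoothness of a differential form near a point. -/
def SmoothFormAt (α : DiffForm I S k) (s : S) : Prop :=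
  ContDiffAt ℝ ∞ (chartForm I α s) (extChartAt I s s)

/-- Smoothness at s is defined in the chart at s; pulling back along the change of charts transfers
it to any chart around s. -/
lemma SmoothFormAt.contDiffAt {α : DiffForm I S k} {p : S} {z : B}
    (hz : z ∈ (extChartAt I p).target) (h : SmoothFormAt I α ((extChartAt I p).symm z)) :
    ContDiffAt ℝ ∞ (chartForm I α p) z := by
  set s := (extChartAt I p).symm z with hs
  have hz' : (extChartAt I p).symm z ∈ (extChartAt I s).source := mem_extChartAt_source s
  have h0 : chartChange I p s z = extChartAt I s s := rfl
  have h1 : chartForm I α p =ᶠ[𝓝 z] fun y ↦ (chartForm I α s (chartChange I p s y)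
      ).compContinuousLinearMap (fderiv ℝ (chartChange I p s) y) := by
    filter_upwards [eventually_mem_chart hz hz'] with y hy using chartForm_eq_pullback α hy.1 hy.2
  refine ContDiffAt.congr_of_eventuallyEq ?_ h1
  have hc := contDiffAt_chartChange hz hz'
  refine contDiffAt_form_iff.2 fun v ↦ ?_
  refine ContDiffAt.form_apply (f := fun y ↦ chartForm I α s (chartChange I p s y))
    (v := fun i y ↦ fderiv ℝ (chartChange I p s) y (v i)) ?_ fun i ↦ ?_
  · exact ContDiffAt.comp (g := chartForm I α s) z (by rw [h0]; exact h) hc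
  · exact (hc.fderiv_right (m := ∞) (by simp)).clm_apply contDiffAt_const

lemma isSmoothForm_iff {α : DiffForm I S k} : IsSmoothForm I α ↔ ∀ s, SmoothFormAt I α s :=
  ⟨fun h s ↦ (h s).contDiffAt (extChartAt_target_mem_nhds s),
    fun h _ _ hz ↦ ((h _).contDiffAt hz).contDiffWithinAt⟩

/-- `extD` uses a different chart at each point. Naturality of d under pull-back shows that in any
single chart it is the ordinary exterior derivative. -/
lemma chartForm_extD {α : DiffForm I S k} {p : S} {z : B} (hz : z ∈ (extChartAt I p).target)
    (h : SmoothFormAt I α ((extChartAt I p).symm z)) :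
    chartForm I (extD I α) p z = extDeriv (chartForm I α p) z := by
  set s := (extChartAt I p).symm z with hs
  have hz' : (extChartAt I p).symm z ∈ (extChartAt I s).source := mem_extChartAt_source s
  have h1 : chartForm I α p =ᶠ[𝓝 z] fun y ↦ (chartForm I α s (chartChange I p s y)
      ).compContinuousLinearMap (fderiv ℝ (chartChange I p s) y) := by
    filter_upwards [eventually_mem_chart hz hz'] with y hy using chartForm_eq_pullback α hy.1 hy.2
  have hc := contDiffAt_chartChange hz hz'
  have hd : DifferentiableAt ℝ (chartForm I α s) (chartChange I p s z) :=
    ContDiffAt.differentiableAt h (by simp)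
  rw [h1.extDeriv_eq, extDeriv_pullback hd hc
    (by rw [minSmoothness_of_isRCLikeNormedField]; exact ENat.LEInfty.out)]
  have h3 := (mfderiv_comp z (mdifferentiableAt_extChartAt (mem_chart_source H s))
    ((contMDiffAt_extChartAt_symm' hz).mdifferentiableAt (by simp)))
  have h4 : fderiv ℝ (chartChange I p s) z = (mfderiv I 𝓘(ℝ, B) (extChartAt I s) s).comp
      (mfderiv 𝓘(ℝ, B) I (extChartAt I p).symm z) := by
    rw [← mfderiv_eq_fderiv]
    exact h3
  rw [h4]
  rfl

lemma eventually_chart {P : S → Prop} {p : S} {z : B} (hz : z ∈ (extChartAt I p).target)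
    (h : ∀ᶠ s in 𝓝 ((extChartAt I p).symm z), P s) :
    ∀ᶠ y in 𝓝 z, y ∈ (extChartAt I p).target ∧ P ((extChartAt I p).symm y) :=
  ((isOpen_extChartAt_target p).eventually_mem hz).and <|
    (contMDiffAt_extChartAt_symm' hz).continuousAt.eventually h

lemma chartForm_congr {α β : DiffForm I S k} {p : S} {z : B}
    (h : α ((extChartAt I p).symm z) = β ((extChartAt I p).symm z)) :
    chartForm I α p z = chartForm I β p z := by
  rw [chartForm, h, chartForm]

lemma SmoothFormAt.congr {α β : DiffForm I S k} {s : S} (h : SmoothFormAt I α s)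
    (hαβ : ∀ᶠ s' in 𝓝 s, β s' = α s') : SmoothFormAt I β s := by
  refine ContDiffAt.congr_of_eventuallyEq h ?_
  rw [← extChartAt_to_inv (I := I) s] at hαβ
  filter_upwards [eventually_chart (mem_extChartAt_target s) hαβ] with y hy
  exact chartForm_congr hy.2

lemma SmoothFormAt.extD {α : DiffForm I S k} {s : S} (h : ∀ᶠ s' in 𝓝 s, SmoothFormAt I α s') :
    SmoothFormAt I (extD I α) s := by
  rw [← extChartAt_to_inv (I := I) s] at h
  have hs := mem_extChartAt_target (I := I) s
  have h1 := ((h.self_of_nhds).contDiffAt hs).fderiv_right (m := ∞) (by simp)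
  refine ((ContinuousAlternatingMap.alternatizeUncurryFinCLM ℝ B ℝ).contDiff.contDiffAt.comp _
    h1).congr_of_eventuallyEq ?_
  filter_upwards [eventually_chart hs h] with y hy
  exact chartForm_extD hy.1 hy.2

lemma SmoothFormAt.add {α β : DiffForm I S k} {s : S} (hα : SmoothFormAt I α s)
    (hβ : SmoothFormAt I β s) : SmoothFormAt I (α + β) s := ContDiffAt.add hα hβ

lemma SmoothFormAt.const_smul {α : DiffForm I S k} {s : S} (hα : SmoothFormAt I α s) (c : ℝ) :
    SmoothFormAt I (c • α) s := ContDiffAt.const_smul c hα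

lemma smoothFormAt_zero (s : S) : SmoothFormAt I (0 : DiffForm I S k) s := by
  exact contDiffAt_const (c := (0 : B [⋀^Fin k]→L[ℝ] ℝ))

lemma SmoothFormAt.sum {κ : Type*} (J : Finset κ) {α : κ → DiffForm I S k} {s : S}
    (h : ∀ i ∈ J, SmoothFormAt I (α i) s) : SmoothFormAt I (∑ i ∈ J, α i) s := by
  classical
  induction J using Finset.induction_on with
  | empty => exact smoothFormAt_zero s
  | insert a J ha ih =>
    rw [Finset.sum_insert ha]
    exact (h a (Finset.mem_insert_self a J)).add (ih fun i hi ↦ h i (Finset.mem_insert_of_mem hi))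

lemma SmoothFormAt.wedge {a b : ℕ} {α : DiffForm I S a} {β : DiffForm I S b} {s : S}
    (hα : SmoothFormAt I α s) (hβ : SmoothFormAt I β s) :
    SmoothFormAt I (k := a + b) (fun s ↦ FinslerGBC.wedge (α s) (β s)) s := by
  refine contDiffAt_form_iff.2 fun v ↦ ?_
  have h : ∀ y, chartForm I (k := a + b) (fun s ↦ FinslerGBC.wedge (α s) (β s)) s y v =
      ((a.factorial * b.factorial : ℕ) : ℝ)⁻¹ * ∑ σ : Equiv.Perm (Fin a ⊕ Fin b),
      ((Equiv.Perm.sign σ : ℤ) : ℝ) * (chartForm I α s y (fun i ↦ v (finSumFinEquiv (σ (Sum.inl i)))) *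
        chartForm I β s y (fun i ↦ v (finSumFinEquiv (σ (Sum.inr i))))) :=
    fun y ↦ wedge_apply_eq _ _ _
  rw [funext h]
  exact contDiffAt_const.mul <| ContDiffAt.sum fun σ _ ↦ contDiffAt_const.mul <|
    (contDiffAt_form_iff.1 hα _).mul (contDiffAt_form_iff.1 hβ _)

lemma SmoothFormAt.wedgeFamily {d l : ℕ} {α : Fin l → DiffForm I S d} {s : S}
    (h : ∀ i, SmoothFormAt I (α i) s) :
    SmoothFormAt I (k := d * l) (fun s ↦ FinslerGBC.wedgeFamily d l fun i ↦ α i s) s := by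
  induction l with
  | zero =>
    refine contDiffAt_form_iff.2 fun v ↦ ?_
    exact contDiffAt_const (c := (1 : ℝ))
  | succ l ih => exact SmoothFormAt.wedge (ih fun i ↦ h i.castSucc) (h (Fin.last l))

lemma SmoothFormAt.domDomCongr {a b : ℕ} (h : a = b) {α : DiffForm I S a} {s : S}
    (hα : SmoothFormAt I α s) :
    SmoothFormAt I (k := b) (fun s ↦ (α s).domDomCongr (finCongr h)) s := by
  subst h
  exact hα

lemma extD_const_smul (c : ℝ) (α : DiffForm I S k) : extD I (c • α) = c • extD I α := by
  ext s : 1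
  have h : extDeriv (chartForm I (c • α) s) (extChartAt I s s) =
      c • extDeriv (chartForm I α s) (extChartAt I s s) := extDeriv_smul c (chartForm I α s)
  rw [extD, h]
  rfl

lemma extD_add {α β : DiffForm I S k} {s : S} (hα : SmoothFormAt I α s) (hβ : SmoothFormAt I β s) :
    extD I (α + β) s = extD I α s + extD I β s := by
  have h : extDeriv (chartForm I (α + β) s) (extChartAt I s s) =
      extDeriv (chartForm I α s) (extChartAt I s s) + extDeriv (chartForm I β s) (extChartAt I s s) :=
    extDeriv_add (ContDiffAt.differentiableAt hα (by simp)) (ContDiffAt.differentiableAt hβ (by simp))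
  rw [extD, h]
  rfl

lemma extD_sum {κ : Type*} (J : Finset κ) (α : κ → DiffForm I S k) (s : S)
    (h : ∀ i ∈ J, SmoothFormAt I (α i) s) :
    extD I (∑ i ∈ J, α i) s = ∑ i ∈ J, extD I (α i) s := by
  classical
  induction J using Finset.induction_on with
  | empty =>
    have h0 := congrFun (extD_const_smul (I := I) (S := S) (k := k) 0 0) s
    rw [zero_smul, zero_smul] at h0
    exact h0
  | insert a J ha ih =>
    have hJ : ∀ i ∈ J, SmoothFormAt I (α i) s := fun i hi ↦ h i (Finset.mem_insert_of_mem hi)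
    rw [Finset.sum_insert ha, Finset.sum_insert ha, ← ih hJ,
      extD_add (h a (Finset.mem_insert_self a J)) (SmoothFormAt.sum J hJ)]

end ManifoldForms

end

section

/-! ### Change of frame for curvature matrices -/

section FrameChange

variable {B : Type*} [NormedAddCommGroup B] [NormedSpace ℝ B] {n : ℕ}

lemma extDeriv_one_apply (α : B → B [⋀^Fin 1]→L[ℝ] ℝ) (z : B) (v : Fin 2 → B) :
    extDeriv α z v = fderiv ℝ α z (v 0) (fun _ ↦ v 1) - fderiv ℝ α z (v 1) (fun _ ↦ v 0) := by
  have h0 : (0 : Fin 2).removeNth v = fun _ ↦ v 1 := funext fun i ↦ by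
    rw [Subsingleton.elim i 0]; rfl
  have h1 : (1 : Fin 2).removeNth v = fun _ ↦ v 0 := funext fun i ↦ by
    rw [Subsingleton.elim i 0]; rfl
  rw [extDeriv, ContinuousAlternatingMap.alternatizeUncurryFin_apply, Fin.sum_univ_two, h0, h1]
  simp [sub_eq_add_neg]

/-- The pure algebra of the gauge transformation W'G = dG + GW on two vectors u, v: `Gu` is the
derivative of G along u, `Auv` that of W(v) along u, and `H` the second derivative of G, whose
symmetry makes it drop out. -/
lemma matrix_frame_change {R : Type*} [Ring R] {G Gu Gv Wu Wv Wu' Wv' Auv Avu Auv' Avu' H : R}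
    (hu : Wu' * G = Gu + G * Wu) (hv : Wv' * G = Gv + G * Wv)
    (huv : Wv' * Gu + Auv' * G = H + (Gu * Wv + G * Auv))
    (hvu : Wu' * Gv + Avu' * G = H + (Gv * Wu + G * Avu)) :
    (Auv' - Avu' - (Wu' * Wv' - Wv' * Wu')) * G = G * (Auv - Avu - (Wu * Wv - Wv * Wu)) := by
  have h1 : Auv' * G = H + (Gu * Wv + G * Auv) - Wv' * Gu := eq_sub_of_add_eq' huv
  have h2 : Avu' * G = H + (Gv * Wu + G * Avu) - Wu' * Gv := eq_sub_of_add_eq' hvu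
  simp only [sub_mul, mul_sub, h1, h2, mul_assoc, hu, hv]
  simp only [mul_add, ← mul_assoc, hu, hv]
  noncomm_ring

/-- The curvature of a matrix of one-forms transforms tensorially under gauge transformations. -/
lemma curvature_frame_change {w w' : Fin n → Fin n → B → B [⋀^Fin 1]→L[ℝ] ℝ}
    {g : Fin n → Fin n → B → ℝ} {z : B} (hw : ∀ i j, DifferentiableAt ℝ (w i j) z)
    (hw' : ∀ i j, DifferentiableAt ℝ (w' i j) z) (hg : ∀ i j, ContDiffAt ℝ ∞ (g i j) z)
    (h : ∀ᶠ y in 𝓝 z, ∀ i j (v : B), ∑ k, w' i k y (fun _ ↦ v) * g k j y =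
      fderiv ℝ (g i j) y v + ∑ k, g i k y * w k j y (fun _ ↦ v)) (i j : Fin n) (v : Fin 2 → B) :
    ∑ k, ((extDeriv (w' i k) z).toAlternatingMap -
      ∑ l, wedge (w' i l z).toAlternatingMap (w' l k z).toAlternatingMap) v * g k j z =
    ∑ k, g i k z * ((extDeriv (w k j) z).toAlternatingMap -
      ∑ l, wedge (w k l z).toAlternatingMap (w l j z).toAlternatingMap) v := by
  let G : Matrix (Fin n) (Fin n) ℝ := .of fun i j ↦ g i j z
  let Gd (u : B) : Matrix (Fin n) (Fin n) ℝ := .of fun i j ↦ fderiv ℝ (g i j) z u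
  let W (u : B) : Matrix (Fin n) (Fin n) ℝ := .of fun i j ↦ w i j z fun _ ↦ u
  let W' (u : B) : Matrix (Fin n) (Fin n) ℝ := .of fun i j ↦ w' i j z fun _ ↦ u
  let A (u v : B) : Matrix (Fin n) (Fin n) ℝ := .of fun i j ↦ fderiv ℝ (w i j) z u fun _ ↦ v
  let A' (u v : B) : Matrix (Fin n) (Fin n) ℝ := .of fun i j ↦ fderiv ℝ (w' i j) z u fun _ ↦ v
  let H (u v : B) : Matrix (Fin n) (Fin n) ℝ := .of fun i j ↦ fderiv ℝ (fderiv ℝ (g i j)) z u v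
  have hH : ∀ u v, H u v = H v u := fun u v ↦ by
    ext i j
    exact ((hg i j).isSymmSndFDerivAt (by simpa using ENat.LEInfty.out)).eq u v
  have h1 : ∀ u, W' u * G = Gd u + G * W u := fun u ↦ by
    ext i j
    exact h.self_of_nhds i j u
  -- The gauge relation on v, differentiated along u. This is why that relation is needed on a
  -- neighbourhood.
  have h2 : ∀ u v, W' v * Gd u + A' u v * G = H u v + (Gd u * W v + G * A u v) := fun u v ↦ by
    ext i j
    have hF : ∀ {a : B → B [⋀^Fin 1]→L[ℝ] ℝ}, DifferentiableAt ℝ a z → HasFDerivAt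
        (fun y ↦ a y fun _ ↦ v) ((ContinuousAlternatingMap.apply ℝ B ℝ fun _ ↦ v).comp
          (fderiv ℝ a z)) z := fun {a} ha ↦
      ((ContinuousAlternatingMap.apply ℝ B ℝ fun _ ↦ v).hasFDerivAt (x := a z)).comp z ha.hasFDerivAt
    have hG : ∀ i j, HasFDerivAt (g i j) (fderiv ℝ (g i j) z) z := fun i j ↦
      ((hg i j).differentiableAt (by simp)).hasFDerivAt
    have hD : HasFDerivAt (fun y ↦ fderiv ℝ (g i j) y v)
        ((ContinuousLinearMap.apply ℝ ℝ v).comp (fderiv ℝ (fderiv ℝ (g i j)) z)) z :=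
      (ContinuousLinearMap.apply ℝ ℝ v).hasFDerivAt.comp z <|
        (((hg i j).fderiv_right (m := 1) (by norm_cast)).differentiableAt one_ne_zero).hasFDerivAt
    have hL := HasFDerivAt.fun_sum (u := Finset.univ) fun k _ ↦ (hF (hw' i k)).mul (hG k j)
    have hR := hD.add (HasFDerivAt.fun_sum (u := Finset.univ) fun k _ ↦ (hG i k).mul (hF (hw k j)))
    have hE := hL.unique (hR.congr_of_eventuallyEq (h.mono fun y hy ↦ hy i j v))
    have hE' := DFunLike.congr_fun hE u
    simp only [sum_apply, add_apply, smul_apply, smul_eq_mul,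
      Finset.sum_add_distrib, ContinuousLinearMap.comp_apply] at hE'
    simp only [Matrix.add_apply, Matrix.mul_apply, W', Gd, A', G, H, W, A, Matrix.of_apply]
    refine Eq.trans ?_ (hE'.trans ?_)
    · congr 1
      exact Finset.sum_congr rfl fun k _ ↦ mul_comm _ _
    · rw [add_comm (∑ k, _) (∑ k, _)]
      exact congrArg₂ (· + ·) rfl
        (congrArg₂ (· + ·) (Finset.sum_congr rfl fun k _ ↦ mul_comm _ _) rfl)
  have h3 := matrix_frame_change (h1 (v 0)) (h1 (v 1)) (h2 (v 0) (v 1)) ((h2 (v 1) (v 0)).trans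
    (by rw [hH (v 1)]))
  have h4 : ∀ {a : Fin n → Fin n → B → B [⋀^Fin 1]→L[ℝ] ℝ} (i k : Fin n),
      ((extDeriv (a i k) z).toAlternatingMap -
        ∑ l, wedge (a i l z).toAlternatingMap (a l k z).toAlternatingMap) v =
      fderiv ℝ (a i k) z (v 0) (fun _ ↦ v 1) - fderiv ℝ (a i k) z (v 1) (fun _ ↦ v 0) -
        (∑ l, a i l z (fun _ ↦ v 0) * a l k z (fun _ ↦ v 1) -
          ∑ l, a i l z (fun _ ↦ v 1) * a l k z (fun _ ↦ v 0)) := fun {a} i k ↦ by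
    rw [AlternatingMap.sub_apply, alternating_sum_apply, ← Finset.sum_sub_distrib]
    congr 1
    · exact extDeriv_one_apply _ _ _
    · exact Finset.sum_congr rfl fun l _ ↦ wedge_one_one_apply _ _ _
  simp only [h4]
  exact congrFun (congrFun h3 i) j

end FrameChange

end

section

/-! ### Curvature forms and transgression on a manifold -/

section ManifoldCurvature

variable {B : Type*} [NormedAddCommGroup B] [NormedSpace ℝ B] [FiniteDimensional ℝ B]
  {H : Type*} [TopologicalSpace H] {I : ModelWithCorners ℝ B H} [I.Boundaryless]
  {S : Type*} [TopologicalSpace S] [ChartedSpace H S] [IsManifold I ∞ S] {k : ℕ}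

lemma mfderiv_extChartAt_self (p : S) :
    mfderiv I 𝓘(ℝ, B) (extChartAt I p) p = ContinuousLinearMap.id ℝ B := by
  refine (mdifferentiableAt_extChartAt (I := I) (mem_chart_source H p)).mfderiv.trans ?_
  rw [I.range_eq_univ, fderivWithin_univ]
  have h : writtenInExtChartAt I 𝓘(ℝ, B) p (extChartAt I p) =ᶠ[𝓝 (extChartAt I p p)] id := by
    filter_upwards [extChartAt_target_mem_nhds (I := I) p] with y hy
    exact (extChartAt I p).right_inv hy
  exact h.fderiv_eq.trans fderiv_id

lemma mfderiv_extChartAt_symm_self (p : S) :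
    (mfderiv 𝓘(ℝ, B) I (extChartAt I p).symm (extChartAt I p p) : B →L[ℝ] B) =
      ContinuousLinearMap.id ℝ B := by
  have hz := mem_extChartAt_target (I := I) p
  refine ((contMDiffAt_extChartAt_symm' hz).mdifferentiableAt (by simp)).mfderiv.trans ?_
  rw [ModelWithCorners.range_eq_univ, fderivWithin_univ]
  have h : writtenInExtChartAt 𝓘(ℝ, B) I (extChartAt I p p) (extChartAt I p).symm
      =ᶠ[𝓝 (extChartAt I p p)] id := by
    filter_upwards [extChartAt_target_mem_nhds (I := I) p] with y hy
    rw [writtenInExtChartAt, extChartAt_to_inv]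
    exact (extChartAt I p).right_inv hy
  exact h.fderiv_eq.trans fderiv_id

lemma chartForm_self (α : DiffForm I S k) (p : S) :
    (chartForm I α p (extChartAt I p p)).toAlternatingMap = α p := by
  -- The base point is made a variable so that its equality with p can be substituted; the inverse
  -- chart at p has derivative the identity there.
  have key : ∀ (s : S) (L : B →L[ℝ] B), s = p → L = ContinuousLinearMap.id ℝ B →
      (α s).compLinearMap (M₂ := B) L.toLinearMap = α p := by
    rintro s _ rfl rfl
    rfl
  exact key _ _ (extChartAt_to_inv p) (mfderiv_extChartAt_symm_self p)

lemma extD_self (α : DiffForm I S k) (p : S) :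
    extD I α p = (extDeriv (chartForm I α p) (extChartAt I p p)).toAlternatingMap := by
  rw [extD, mfderiv_extChartAt_self]
  rfl

variable {n : ℕ}

/-- The curvature forms `dW - W ∧ W` of a matrix of one-forms. -/
def curvOf (W : Fin n → Fin n → DiffForm I S 1) (i j : Fin n) : DiffForm I S 2 := fun s ↦
  extD I (W i j) s - ∑ k, wedge (W i k s) (W k j s)

lemma chartForm_curvOf {W : Fin n → Fin n → DiffForm I S 1} {p : S} {z : B}
    (hz : z ∈ (extChartAt I p).target)
    (h : ∀ i j, SmoothFormAt I (W i j) ((extChartAt I p).symm z)) (i j : Fin n) :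
    (chartForm I (curvOf W i j) p z).toAlternatingMap =
      (extDeriv (chartForm I (W i j) p) z).toAlternatingMap -
        ∑ k, wedge (chartForm I (W i k) p z).toAlternatingMap
          (chartForm I (W k j) p z).toAlternatingMap := by
  rw [← chartForm_extD hz (h i j)]
  ext v
  rw [AlternatingMap.sub_apply, alternating_sum_apply]
  change (_ - ∑ k, wedge (a := 1) (b := 1) (W i k _) (W k j _)) _ = _
  rw [AlternatingMap.sub_apply, alternating_sum_apply]
  refine congrArg₂ (· - ·) rfl (Finset.sum_congr rfl fun l _ ↦ ?_)
  exact DFunLike.congr_fun (wedge_compLinearMap (W i l _) (W l j _)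
    (mfderiv 𝓘(ℝ, B) I (extChartAt I p).symm z : B →L[ℝ] _).toLinearMap) v

lemma SmoothFormAt.curvOf {W : Fin n → Fin n → DiffForm I S 1} {s : S}
    (h : ∀ᶠ s' in 𝓝 s, ∀ i j, SmoothFormAt I (W i j) s') (i j : Fin n) :
    SmoothFormAt I (curvOf W i j) s := by
  have h1 := SmoothFormAt.extD (α := W i j) (h.mono fun s' hs' ↦ hs' i j)
  have h2 := SmoothFormAt.sum Finset.univ fun k _ ↦
    SmoothFormAt.wedge (h.self_of_nhds i k) (h.self_of_nhds k j)
  refine (h1.add (h2.const_smul (-1))).congr (.of_forall fun s' ↦ ?_)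
  rw [FinslerGBC.curvOf, Pi.add_apply, Pi.smul_apply, Finset.sum_apply]
  exact (sub_eq_add_neg _ _).trans (congrArg _ (neg_one_smul ℝ _).symm)

variable {q : ℕ}

lemma isCurvatureAt_chart {W : Fin (q + 1) → Fin (q + 1) → DiffForm I S 1} {p : S}
    (h : ∀ᶠ s in 𝓝 p, ∀ i j, SmoothFormAt I (W i j) s ∧ W j i s = -W i j s) :
    IsCurvatureAt (fun i j ↦ chartForm I (W i j) p) (fun i j ↦ chartForm I (curvOf W i j) p)
      (extChartAt I p p) where
  contDiffAt i j := (h.self_of_nhds i j).1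
  differentiableAt i j := ContDiffAt.differentiableAt
    (SmoothFormAt.curvOf (h.mono fun s hs i j ↦ (hs i j).1) i j) (by simp)
  antisymm := by
    rw [← extChartAt_to_inv (I := I) p] at h
    filter_upwards [eventually_chart (mem_extChartAt_target p) h] with y hy i j
    rw [chartForm, (hy.2 i j).2]
    rfl
  curv := by
    rw [← extChartAt_to_inv (I := I) p] at h
    filter_upwards [eventually_chart (mem_extChartAt_target p) h] with y hy i j
    exact chartForm_curvOf hy.1 (fun i j ↦ (hy.2 i j).1) i j

/-- The transgression formula for the curvature of a skew-symmetric matrix of one-forms. -/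
theorem pfaffian_curvOf_eq {V : Type*} [AddCommGroup V] [Module ℝ V] (b : Basis (Fin (q + 1)) ℝ V)
    {W : Fin (q + 1) → Fin (q + 1) → DiffForm I S 1} {p : S}
    (h : ∀ᶠ s in 𝓝 p, ∀ i j, SmoothFormAt I (W i j) s ∧ W j i s = -W i j s)
    (Φ : Fin (q / 2 + 1) → DiffForm I S q)
    (hΦ : ∀ᶠ s in 𝓝 p, ∀ k, Φ k s = chernSum (fun i j ↦ curvOf W i j s) (fun i j ↦ W i j s) k)
    (hΦs : ∀ k, SmoothFormAt I (Φ k) p) :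
    (berezin b).compAlternatingMap (expNeg ((1 / 2 : ℝ) • ∑ i, ∑ j, (LinearMap.toSpanSingleton ℝ _
      (ExteriorAlgebra.ι ℝ (b i) * ExteriorAlgebra.ι ℝ (b j))).compAlternatingMap
        (curvOf W i j p)) (q + 1)) =
      (-1 : ℝ) ^ q • ∑ k : Fin (q / 2 + 1), chernCoeff q k • extD I (Φ k) p := by
  have h1 := (isCurvatureAt_chart h).pfaffian_eq b (finBasis ℝ B) (fun k ↦ chartForm I (Φ k) p)
    (fun k ↦ ContDiffAt.differentiableAt (hΦs k) (by simp)) fun k ↦ by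
      rw [← extChartAt_to_inv (I := I) p] at hΦ
      filter_upwards [eventually_chart (mem_extChartAt_target p) hΦ] with y hy
      refine Eq.trans ?_ (chernSum_compLinearMap _ _ k (mfderiv 𝓘(ℝ, B) I (extChartAt I p).symm y :
        B →L[ℝ] _).toLinearMap)
      rw [← hy.2 k]
      rfl
  simp only [extD_self]
  refine Eq.trans ?_ h1
  simp only [formsAt, chartForm_self]
  rfl

lemma SmoothFormAt.chernSum {Ω : Fin (q + 1) → Fin (q + 1) → DiffForm I S 2}
    {W : Fin (q + 1) → Fin (q + 1) → DiffForm I S 1} {s : S} (hΩ : ∀ i j, SmoothFormAt I (Ω i j) s)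
    (hW : ∀ i j, SmoothFormAt I (W i j) s) (k : Fin (q / 2 + 1)) :
    SmoothFormAt I (fun s ↦ FinslerGBC.chernSum (fun i j ↦ Ω i j s) (fun i j ↦ W i j s) k) s := by
  have h := SmoothFormAt.sum (Finset.univ : Finset (Equiv.Perm (Fin q))) fun σ _ ↦
    (SmoothFormAt.domDomCongr (show 2 * (k : ℕ) + 1 * (q - 2 * k) = q by omega) <|
      SmoothFormAt.wedge (SmoothFormAt.wedgeFamily (d := 2) (l := k)
        fun i ↦ hΩ (σ ⟨2 * i, by omega⟩).castSucc (σ ⟨2 * i + 1, by omega⟩).castSucc)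
      (SmoothFormAt.wedgeFamily (d := 1) (l := q - 2 * k) fun j ↦
        hW (σ ⟨2 * k + j, by omega⟩).castSucc (Fin.last q))).const_smul ((Equiv.Perm.sign σ : ℤ) : ℝ)
  refine h.congr (.of_forall fun s' ↦ ?_)
  rw [FinslerGBC.chernSum, Finset.sum_apply]
  rfl

lemma curvOf_frame_change {W W' : Fin n → Fin n → DiffForm I S 1} {g : Fin n → Fin n → S → ℝ}
    {p : S} (hW : ∀ᶠ s in 𝓝 p, ∀ i j, SmoothFormAt I (W i j) s ∧ SmoothFormAt I (W' i j) s)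
    (hg : ∀ᶠ s in 𝓝 p, ∀ i j, ContMDiffAt I 𝓘(ℝ) ∞ (g i j) s)
    (h : ∀ᶠ s in 𝓝 p, ∀ i j (ξ : TangentSpace I s), ∑ k, W' i k s (fun _ ↦ ξ) * g k j s =
      mvfderiv I (g i j) s ξ + ∑ k, g i k s * W k j s (fun _ ↦ ξ)) (i j : Fin n) :
    ∑ k, g k j p • curvOf W' i k p = ∑ k, g i k p • curvOf W k j p := by
  rw [← extChartAt_to_inv (I := I) p] at hg hW h
  have hz := mem_extChartAt_target (I := I) p
  have h1 := curvature_frame_change (w := fun i j ↦ chartForm I (W i j) p)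
    (w' := fun i j ↦ chartForm I (W' i j) p) (g := fun i j ↦ g i j ∘ (extChartAt I p).symm)
    (z := extChartAt I p p)
    (fun i j ↦ ((hW.self_of_nhds i j).1.contDiffAt hz).differentiableAt (by simp))
    (fun i j ↦ ((hW.self_of_nhds i j).2.contDiffAt hz).differentiableAt (by simp))
    (fun i j ↦ contMDiffAt_iff_contDiffAt.1 <|
      (hg.self_of_nhds i j).comp _ (contMDiffAt_extChartAt_symm' hz)) (by
      filter_upwards [eventually_chart hz h, eventually_chart hz hg] with y hy hy' i j v
      have h2 := mfderiv_comp y ((hy'.2 i j).mdifferentiableAt (by simp))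
        ((contMDiffAt_extChartAt_symm' hy.1).mdifferentiableAt (by simp))
      rw [← mfderiv_eq_fderiv, h2]
      exact hy.2 i j _)
  ext v
  have h3 := h1 i j v
  have hW0 := hW.self_of_nhds
  have h4 := fun i j ↦ chartForm_curvOf hz (W := W) (fun i j ↦ (hW0 i j).1) i j
  have h5 := fun i j ↦ chartForm_curvOf hz (W := W') (fun i j ↦ (hW0 i j).2) i j
  simp only [← h4, ← h5] at h3
  simp only [chartForm_self, Function.comp_apply, extChartAt_to_inv] at h3
  simp only [alternating_sum_apply, AlternatingMap.smul_apply, smul_eq_mul]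
  refine Eq.trans ?_ h3
  exact Finset.sum_congr rfl fun k _ ↦ mul_comm _ _

end ManifoldCurvature

end

section

/-! ### Invariance under oriented orthonormal changes of basis -/

section BasisChange

variable {T : Type*} [AddCommGroup T] [Module ℝ T] {V : Type*} [AddCommGroup V] [Module ℝ V]
  {n : ℕ} {g : Fin n → Fin n → ℝ}

/-- The contraction of two vectors that transform alike is invariant under an orthogonal matrix. It
serves both for θ and for the curvature. -/
lemma sum_mul_frame_change {A : Type*} [Ring A] [Algebra ℝ A] {x y r r' : Fin n → A}
    (hg : ∀ k l, ∑ i, g i k * g i l = if k = l then 1 else 0) (hy : ∀ i, y i = ∑ j, g i j • x j)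
    (hr : ∀ i, r' i = ∑ k, g i k • r k) : ∑ i, r' i * y i = ∑ k, r k * x k := by
  have h : ∀ i, r' i * y i = ∑ k, ∑ l, (g i k * g i l) • (r k * x l) := fun i ↦ by
    rw [hr, hy, Finset.sum_mul]
    simp only [Finset.mul_sum, smul_mul_smul_comm]
  simp only [h]
  rw [Finset.sum_comm]
  refine Finset.sum_congr rfl fun k _ ↦ ?_
  rw [Finset.sum_comm]
  simp only [← Finset.sum_smul, hg, ite_smul, one_smul, zero_smul, Finset.sum_ite_eq,
    Finset.mem_univ, if_true]

/-- `½ ∑ Ωᵢⱼ ⊗ eᵢ ∧ eⱼ`. -/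
abbrev curvElt (e : Fin n → V) (Ω : Fin n → Fin n → T [⋀^Fin 2]→ₗ[ℝ] ℝ) :
    T [⋀^Fin 2]→ₗ[ℝ] ExteriorAlgebra ℝ V :=
  (1 / 2 : ℝ) • ∑ i, ∑ j, (LinearMap.toSpanSingleton ℝ _
    (ExteriorAlgebra.ι ℝ (e i) * ExteriorAlgebra.ι ℝ (e j))).compAlternatingMap (Ω i j)

lemma curvElt_frame_change {e e' : Fin n → V} {Ω Ω' : Fin n → Fin n → T [⋀^Fin 2]→ₗ[ℝ] ℝ}
    (hg : ∀ k l, ∑ i, g i k * g i l = if k = l then 1 else 0) (he : ∀ i, e' i = ∑ j, g i j • e j)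
    (hΩ : ∀ i j, ∑ k, g k j • Ω' i k = ∑ k, g i k • Ω k j) : curvElt e' Ω' = curvElt e Ω := by
  have hι : ∀ i, ExteriorAlgebra.ι ℝ (e' i) = ∑ j, g i j • ExteriorAlgebra.ι ℝ (e j) := fun i ↦ by
    simp only [he, map_sum, map_smul]
  ext v
  have hv : ∀ i j, ∑ k, g k j * Ω' i k v = ∑ k, g i k * Ω k j v := fun i j ↦ by
    have := DFunLike.congr_fun (hΩ i j) v
    simpa only [alternating_sum_apply, AlternatingMap.smul_apply, smul_eq_mul] using this
  -- The double sum is viewed as a contraction of eᵢ with ∑ⱼ Ωᵢⱼ eⱼ, and the second family again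
  -- transforms by g.
  have key : ∀ (e : Fin n → V) (Ω : Fin n → Fin n → T [⋀^Fin 2]→ₗ[ℝ] ℝ), curvElt e Ω v =
      (1 / 2 : ℝ) • ∑ i, ExteriorAlgebra.ι ℝ (e i) * ∑ j, Ω i j v • ExteriorAlgebra.ι ℝ (e j) := by
    intro e Ω
    rw [curvElt, AlternatingMap.smul_apply, alternating_sum_apply]
    simp only [alternating_sum_apply, LinearMap.compAlternatingMap_apply,
      LinearMap.toSpanSingleton_apply, Finset.mul_sum, mul_smul_comm]
  rw [key, key]
  congr 1
  refine sum_mul_frame_change hg (fun i ↦ ?_) hι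
  simp only [hι, Finset.smul_sum, smul_smul]
  rw [Finset.sum_comm]
  conv_rhs => rw [Finset.sum_comm]
  refine Finset.sum_congr rfl fun l _ ↦ ?_
  rw [← Finset.sum_smul, ← Finset.sum_smul, ← hv]
  exact congrArg (· • _) (Finset.sum_congr rfl fun k _ ↦ mul_comm _ _)

/-- An orthogonal matrix has determinant ±1, and the common orientation selects +1. Hence the
Berezin integral and e₁⋯eₙ are the same for both bases. -/
lemma det_eq_of_orthogonal {b b' : Basis (Fin n) ℝ V}
    (hg : ∀ k l, ∑ i, g i k * g i l = if k = l then 1 else 0) (hb : ∀ i, b' i = ∑ j, g i j • b j)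
    (ho : b.orientation = b'.orientation) : b.det = b'.det := by
  have h1 : b.det b' = (Matrix.of g).det := by
    rw [Basis.det_apply, ← Matrix.det_transpose]
    congr 1
    ext i j
    rw [Matrix.transpose_apply, Basis.toMatrix_apply, hb, map_sum]
    simp [Finsupp.single_apply]
  have h2 : (Matrix.of g).transpose * Matrix.of g = 1 := by
    ext k l
    rw [Matrix.mul_apply, Matrix.one_apply, ← hg]
    rfl
  have h3 : b.det b' * b.det b' = 1 := by
    rw [h1]
    nth_rw 1 [← Matrix.det_transpose]
    rw [← Matrix.det_mul, h2, Matrix.det_one]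
  have h4 : 0 < b.det b' := (Basis.orientation_eq_iff_det_pos b b').1 ho
  have h5 : b.det b' = 1 := by nlinarith
  rw [b.det.eq_smul_basis_det b', h5, one_smul]

lemma berezin_congr {b b' : Basis (Fin n) ℝ V} (h : b.det = b'.det) : berezin b = berezin b' := by
  rw [berezin, h, berezin]

lemma vecProd_congr {b b' : Basis (Fin n) ℝ V} (h : b.det = b'.det) :
    vecProd T b = vecProd T b' := by
  have h1 : ExteriorAlgebra.ιMulti ℝ n b' = b.det b' • ExteriorAlgebra.ιMulti ℝ n b :=
    DFunLike.congr_fun (ιMulti_eq_det_smul b) ⇑b'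
  rw [vecProd_eq_inrSuper, vecProd_eq_inrSuper, h1, h, Basis.det_self, one_smul]

variable {q : ℕ}

/-- After multiplication by the volume element the form is an expression in the curvature element, θ
and eₙ, each of which is the same for both bases. -/
lemma chernSum_frame_change {g : Fin (q + 1) → Fin (q + 1) → ℝ} {κ : Type*} [Fintype κ] (t : Basis κ ℝ T)
    {b b' : Basis (Fin (q + 1)) ℝ V}
    {Ω Ω' : Fin (q + 1) → Fin (q + 1) → T [⋀^Fin 2]→ₗ[ℝ] ℝ}
    {w w' : Fin (q + 1) → Fin (q + 1) → T [⋀^Fin 1]→ₗ[ℝ] ℝ}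
    (hg : ∀ k l, ∑ i, g i k * g i l = if k = l then 1 else 0) (hb : ∀ i, b' i = ∑ j, g i j • b j)
    (ho : b.orientation = b'.orientation) (hlast : b' (Fin.last q) = b (Fin.last q))
    (hΩ : ∀ i j, Ω j i = -Ω i j) (hΩ' : ∀ i j, Ω' j i = -Ω' i j)
    (hw : w (Fin.last q) (Fin.last q) = 0) (hw' : w' (Fin.last q) (Fin.last q) = 0)
    (hΩΩ' : ∀ i j, ∑ k, g k j • Ω' i k = ∑ k, g i k • Ω k j)
    (hww' : ∀ i, w' i (Fin.last q) = ∑ k, g i k • w k (Fin.last q)) (k : Fin (q / 2 + 1)) :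
    chernSum Ω' w' k = chernSum Ω w k := by
  have hdet := det_eq_of_orthogonal hg hb ho
  refine realSuper_injective t b ?_
  have hθ : thetaSuper t b' w' = thetaSuper t b w := by
    rw [thetaSuper_eq_sum t b' hw', thetaSuper_eq_sum t b hw]
    refine sum_mul_frame_change hg (fun i ↦ ?_) fun i ↦ ?_
    · rw [hb, vecSuper_sum]
      simp only [vecSuper_smul]
    · rw [hww', map_sum]
      simp only [map_smul]
  have hO : curvSuper t b' Ω' = curvSuper t b Ω := by
    rw [← extSuper_curv, ← extSuper_curv]
    exact congrArg _ (curvElt_frame_change hg hb hΩΩ')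
  rw [realSuper_chernSum_mul t b Ω w hΩ k, vecProd_congr hdet, realSuper_chernSum_mul t b' Ω' w' hΩ' k,
    hθ, hO, hlast]

end BasisChange

end

section

variable {m q : ℕ} {M : Type*} [TopologicalSpace M]
  [ChartedSpace (EuclideanSpace ℝ (Fin m)) M]
  {E : M → Type*} [∀ x, AddCommGroup (E x)] [∀ x, Module ℝ (E x)]
  [TopologicalSpace (TotalSpace (FibModel q) E)] [∀ x, TopologicalSpace (E x)]
  [FiberBundle (FibModel q) E] [VectorBundle ℝ (FibModel q) E]

/-! ### Smooth trivializations of the sphere bundle and of E -/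

section SphereCharts

variable (q E) in
/-- The preferred trivialization of `E` at `x`. -/
abbrev triv (x : M) : Trivialization (FibModel q) (π (FibModel q) E) :=
  trivializationAt (FibModel q) E x

variable (q E) in
/-- The trivialization of `SE` induced by the preferred trivialization of `E` at `x`. -/
abbrev rayTriv (x : M) : Pretrivialization (UnitSphere q) (π (UnitSphere q) (RayFiber q E)) :=
  rayPretrivialization (triv q E x)

lemma mem_triv (x : M) : x ∈ (triv q E x).baseSet := FiberBundle.mem_baseSet_trivializationAt' x

variable [IsManifold (𝓡 m) ∞ M] [ContMDiffVectorBundle ∞ (FibModel q) E (𝓡 m)]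

/-- The chart of SE at p is this trivialization followed by a chart of M × S^q, which is stripped
off. -/
lemma contMDiffAt_rayTriv (p : SphereBundle q E) :
    ContMDiffAt (sphereModel m q) (sphereModel m q) ∞ (rayTriv q E p.proj) p := by
  have h1 := contMDiffOn_chart (I := sphereModel m q) (n := ∞) (x := p)
  have h2 := contMDiffOn_chart_symm (I := sphereModel m q) (n := ∞)
    (x := (rayTriv q E p.proj p : M × UnitSphere q))
  have hsrc : ∀ w ∈ (chartAt (ModelProd (EuclideanSpace ℝ (Fin m)) (EuclideanSpace ℝ (Fin q)))
      p).source, rayTriv q E p.proj w ∈ (chartAt (ModelProd (EuclideanSpace ℝ (Fin m))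
        (EuclideanSpace ℝ (Fin q))) (rayTriv q E p.proj p)).source := fun w hw ↦ hw.2
  have h4 := h2.comp h1 fun w hw ↦ (chartAt _ _).map_source (hsrc w hw)
  refine (h4.contMDiffAt ((chartAt _ p).open_source.mem_nhds (mem_chart_source _ p))
    ).congr_of_eventuallyEq ?_
  filter_upwards [(chartAt (ModelProd (EuclideanSpace ℝ (Fin m)) (EuclideanSpace ℝ (Fin q)))
    p).open_source.mem_nhds (mem_chart_source _ p)] with w hw
  exact ((chartAt _ _).left_inv (hsrc w hw)).symm

lemma contMDiffAt_rayTriv_symm (p : SphereBundle q E) :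
    ContMDiffAt (sphereModel m q) (sphereModel m q) ∞ (rayTriv q E p.proj).toPartialEquiv.symm
      (rayTriv q E p.proj p) := by
  have h1 := contMDiffOn_chart_symm (I := sphereModel m q) (n := ∞) (x := p)
  have h2 := contMDiffOn_chart (I := sphereModel m q) (n := ∞)
    (x := (rayTriv q E p.proj p : M × UnitSphere q))
  have hR : rayTriv q E p.proj p ∈ (rayTriv q E p.proj).target := ⟨mem_triv _, mem_univ _⟩
  set c := chartAt (ModelProd (EuclideanSpace ℝ (Fin m)) (EuclideanSpace ℝ (Fin q)))
    (rayTriv q E p.proj p : M × UnitSphere q) with hc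
  have h4 := h1.comp (h2.mono inter_subset_left) (s := c.source ∩ (rayTriv q E p.proj).target)
    fun w hw ↦ ⟨c.map_source hw.1, by
      change c.symm (c w) ∈ (rayTriv q E p.proj).target
      rw [c.left_inv hw.1]
      exact hw.2⟩
  have hn : c.source ∩ (rayTriv q E p.proj).target ∈ 𝓝 (rayTriv q E p.proj p) :=
    (c.open_source.inter (rayTriv q E p.proj).open_target).mem_nhds ⟨mem_chart_source _ _, hR⟩
  refine (h4.contMDiffAt hn).congr_of_eventuallyEq ?_
  filter_upwards [hn] with w hw
  change _ = (rayTriv q E p.proj).toPartialEquiv.symm (c.symm (c w))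
  rw [c.left_inv hw.1]

end SphereCharts

section Triv

lemma fiberEquiv_apply {x : M} (e : Trivialization (FibModel q) (π (FibModel q) E))
    [MemTrivializationAtlas e] (hx : x ∈ e.baseSet) (v : E x) : fiberEquiv e x v = (e ⟨x, v⟩).2 := by
  rw [fiberEquiv_of_mem e hx]
  rfl

lemma fiberEquiv_symm_eq {x : M} (e : Trivialization (FibModel q) (π (FibModel q) E))
    [MemTrivializationAtlas e] (hx : x ∈ e.baseSet) (u : FibModel q) :
    TotalSpace.mk' (FibModel q) x ((fiberEquiv e x).symm u) =
      e.toOpenPartialHomeomorph.symm (x, u) := by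
  rw [fiberEquiv_of_mem e hx]
  exact e.mk_symm hx u

variable [IsManifold (𝓡 m) ∞ M] [ContMDiffVectorBundle ∞ (FibModel q) E (𝓡 m)]

lemma contMDiffAt_triv (e : Trivialization (FibModel q) (π (FibModel q) E)) [MemTrivializationAtlas e]
    {y : TotalSpace (FibModel q) E} (hy : y.proj ∈ e.baseSet) :
    ContMDiffAt (totalModel m q) (totalModel m q) ∞ e y :=
  (e.contMDiffOn (IB := 𝓡 m)).contMDiffAt (e.open_source.mem_nhds (e.mem_source.2 hy))

lemma contMDiffAt_triv_symm (e : Trivialization (FibModel q) (π (FibModel q) E))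
    [MemTrivializationAtlas e] {z : M × FibModel q} (hz : z.1 ∈ e.baseSet) :
    ContMDiffAt (totalModel m q) (totalModel m q) ∞ e.toOpenPartialHomeomorph.symm z :=
  (e.contMDiffOn_symm (IB := 𝓡 m)).contMDiffAt (e.open_target.mem_nhds (e.mem_target.2 hz))

end Triv

/-! ### The tautological section and the quotient map E ∖ 0 → SE -/

section Taut

lemma isOpen_ne_zero : IsOpen {y : TotalSpace (FibModel q) E | y.2 ≠ 0} := by
  rw [isOpen_iff_mem_nhds]
  intro y hy
  set e := triv q E y.proj with he
  have hx : y.proj ∈ e.baseSet := mem_triv _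
  have h0 : ∀ y' : TotalSpace (FibModel q) E, y'.proj ∈ e.baseSet → (y'.2 ≠ 0 ↔ (e y').2 ≠ 0) :=
    fun y' h ↦ by
      rw [← fiberEquiv_apply e h]
      exact (LinearEquiv.map_ne_zero_iff _).symm
  have hc : ContinuousAt (fun y' ↦ (e y').2) y :=
    (e.continuousOn.continuousAt (e.open_source.mem_nhds (e.mem_source.2 hx))).snd
  filter_upwards [(FiberBundle.continuous_proj (FibModel q) E).continuousAt.preimage_mem_nhds
    (e.open_baseSet.mem_nhds hx), hc.eventually_ne ((h0 y hx).1 hy)] with y' h1 h2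
  exact (h0 y' h1).2 h2


variable {F : TotalSpace (FibModel q) E → ℝ}

/-- Euler's identity: along the ray of y the function F² is a²F(y)², whose second derivative is
2F(y)². -/
lemma IsFinslerMetric.fundamentalTensor_self (hF : IsFinslerMetric m F) {x : M} {y : E x} (hy : y ≠ 0) :
    fundamentalTensor F y y y = F ⟨x, y⟩ ^ 2 := by
  have h0 : ∀ a : ℝ, 0 < a → F ⟨x, a • y⟩ ^ 2 = a ^ 2 * F ⟨x, y⟩ ^ 2 := fun a ha ↦ by
    rw [hF.homogeneous x y a ha, mul_pow]
  have h1 : ∀ a : ℝ, 0 < a → lineDeriv ℝ (fun w ↦ F ⟨x, w⟩ ^ 2) (a • y) y = 2 * a * F ⟨x, y⟩ ^ 2 := by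
    intro a ha
    have hd : HasDerivAt (fun s : ℝ ↦ (a + s) ^ 2 * F ⟨x, y⟩ ^ 2) (2 * a * F ⟨x, y⟩ ^ 2) 0 := by
      have := (((hasDerivAt_id (0 : ℝ)).const_add a).pow 2).mul_const (F ⟨x, y⟩ ^ 2)
      simpa using this
    refine (Filter.EventuallyEq.deriv_eq ?_).trans hd.deriv
    filter_upwards [lt_mem_nhds (show -a < 0 by linarith)] with s hs
    rw [← add_smul, h0 _ (by linarith)]
  have hd : HasDerivAt (fun t : ℝ ↦ 2 * (1 + t) * F ⟨x, y⟩ ^ 2) (2 * F ⟨x, y⟩ ^ 2) 0 := by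
    have := (((hasDerivAt_id (0 : ℝ)).const_add 1).const_mul 2).mul_const (F ⟨x, y⟩ ^ 2)
    simpa using this
  have h2 : lineDeriv ℝ (fun z ↦ lineDeriv ℝ (fun w ↦ F ⟨x, w⟩ ^ 2) z y) y y = 2 * F ⟨x, y⟩ ^ 2 := by
    refine (Filter.EventuallyEq.deriv_eq ?_).trans hd.deriv
    filter_upwards [lt_mem_nhds (show (-1 : ℝ) < 0 by norm_num)] with t ht
    rw [← h1 (1 + t) (by linarith), add_smul, one_smul]
  rw [fundamentalTensor, h2]
  ring

/-- Only F ≥ 0 is postulated; strict positivity follows from g_y(y, y) = F(y)² and positive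
definiteness. -/
lemma IsFinslerMetric.pos (hF : IsFinslerMetric m F) {x : M} {y : E x} (hy : y ≠ 0) : 0 < F ⟨x, y⟩ := by
  refine (hF.nonneg _).lt_of_ne fun h ↦ ?_
  have := hF.posDef x y hy y hy
  rw [hF.fundamentalTensor_self hy, ← h] at this
  simp at this

lemma IsFinslerMetric.inv_smul_eq (hF : IsFinslerMetric m F) {x : M} {y y' : E x} (hy : y ≠ 0) (hy' : y' ≠ 0)
    (h : SameRay ℝ y y') : (F ⟨x, y⟩)⁻¹ • y = (F ⟨x, y'⟩)⁻¹ • y' := by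
  obtain ⟨c, hc, rfl⟩ := h.exists_pos_left hy hy'
  rw [hF.homogeneous x y c hc, smul_smul, mul_inv, mul_right_comm, inv_mul_cancel₀ hc.ne', one_mul]

lemma IsFinslerMetric.taut_eq (hF : IsFinslerMetric m F) {x : M} {y : E x} (hy : y ≠ 0) :
    taut F (⟨x, (rayOfNeZero ℝ y hy : Module.Ray ℝ (E x))⟩ : SphereBundle q E) = (F ⟨x, y⟩)⁻¹ • y := by
  refine hF.inv_smul_eq (Module.Ray.someVector_ne_zero _) hy ?_
  rw [← ray_eq_iff (R := ℝ) (Module.Ray.someVector_ne_zero _) hy]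
  exact Module.Ray.someVector_ray _

lemma IsFinslerMetric.taut_ne_zero (hF : IsFinslerMetric m F) (p : SphereBundle q E) : taut F p ≠ 0 :=
  smul_ne_zero (inv_ne_zero (hF.pos (Module.Ray.someVector_ne_zero _)).ne')
    (Module.Ray.someVector_ne_zero _)

lemma IsFinslerMetric.apply_taut (hF : IsFinslerMetric m F) (p : SphereBundle q E) : F (tautLift F p) = 1 := by
  have h := hF.pos (Module.Ray.someVector_ne_zero (p.2 : Module.Ray ℝ (E p.proj)))
  rw [tautLift, taut, hF.homogeneous _ _ _ (inv_pos.2 h), inv_mul_cancel₀ h.ne']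

lemma toSphere_of_ne (p₀ : SphereBundle q E) {x : M} {y : E x} (hy : y ≠ 0) :
    toSphere p₀ (⟨x, y⟩ : TotalSpace (FibModel q) E) = ⟨x, (rayOfNeZero ℝ y hy : Module.Ray ℝ (E x))⟩ :=
  dif_pos hy

lemma IsFinslerMetric.toSphere_tautLift (hF : IsFinslerMetric m F) (p₀ p : SphereBundle q E) :
    toSphere p₀ (tautLift F p) = p := by
  rw [tautLift, toSphere_of_ne p₀ (hF.taut_ne_zero p)]
  refine congrArg (TotalSpace.mk p.proj) ?_
  conv_rhs => rw [← Module.Ray.someVector_ray (p.2 : Module.Ray ℝ (E p.proj))]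
  exact (ray_eq_iff (R := ℝ) _ _).2
    (SameRay.sameRay_pos_smul_left _ (inv_pos.2 (hF.pos (Module.Ray.someVector_ne_zero _))))

lemma IsFinslerMetric.tautLift_toSphere (hF : IsFinslerMetric m F) (p₀ : SphereBundle q E) {x : M}
    {y : E x} (hy : y ≠ 0) : tautLift F (toSphere p₀ (⟨x, y⟩ : TotalSpace (FibModel q) E)) =
      ⟨x, (F ⟨x, y⟩)⁻¹ • y⟩ := by
  rw [toSphere_of_ne p₀ hy, tautLift, hF.taut_eq hy]

variable [IsManifold (𝓡 m) ∞ M] [ContMDiffVectorBundle ∞ (FibModel q) E (𝓡 m)]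

lemma IsFinslerMetric.contMDiffAt (hF : IsFinslerMetric m F) {y : TotalSpace (FibModel q) E}
    (hy : y.2 ≠ 0) : ContMDiffAt (totalModel m q) 𝓘(ℝ) ∞ F y :=
  hF.smooth.contMDiffAt (isOpen_ne_zero.mem_nhds hy)

/-- In a trivialization the lift of the ray through a unit vector u is u/F(u), and F is smooth and
nonzero there. -/
lemma IsFinslerMetric.contMDiffAt_tautLift (hF : IsFinslerMetric m F) (p : SphereBundle q E) :
    ContMDiffAt (sphereModel m q) (totalModel m q) ∞ (tautLift F) p := by
  set e := triv q E p.proj with he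
  have hx : p.proj ∈ e.baseSet := mem_triv _
  have hR := contMDiffAt_rayTriv (m := m) p
  have h1 : ContMDiffAt (sphereModel m q) (𝓡 m) ∞ (fun s ↦ (rayTriv q E p.proj s).1) p :=
    contMDiffAt_fst.comp p hR
  have h2 : ContMDiffAt (sphereModel m q) 𝓘(ℝ, FibModel q) ∞
      (fun s ↦ ((rayTriv q E p.proj s).2 : FibModel q)) p :=
    ((contMDiff_coe_sphere (E := FibModel q) (n := q)).contMDiffAt).comp p (contMDiffAt_snd.comp p hR)
  have h3 : ContMDiffAt (sphereModel m q) (totalModel m q) ∞ (fun s ↦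
      e.toOpenPartialHomeomorph.symm ((rayTriv q E p.proj s).1, ((rayTriv q E p.proj s).2 : FibModel q)))
      p := (contMDiffAt_triv_symm e hx).comp p (h1.prodMk h2)
  have hs : ∀ (x : M) (u : UnitSphere q), (fiberEquiv e x).symm (u : FibModel q) ≠ 0 := fun x u ↦
    (LinearEquiv.map_ne_zero_iff _).2 (sphere_ne_zero u)
  have h4 : ContMDiffAt (sphereModel m q) 𝓘(ℝ) ∞ (fun s ↦ F (e.toOpenPartialHomeomorph.symm
      ((rayTriv q E p.proj s).1, ((rayTriv q E p.proj s).2 : FibModel q)))) p := by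
    refine ContMDiffAt.comp (g := F) p (hF.contMDiffAt ?_) h3
    have h := fiberEquiv_symm_eq e hx ((rayTriv q E p.proj p).2 : FibModel q)
    change (e.toOpenPartialHomeomorph.symm (p.proj, _)).2 ≠ 0
    rw [← h]
    exact hs _ _
  have h5 : F (e.toOpenPartialHomeomorph.symm
      ((rayTriv q E p.proj p).1, ((rayTriv q E p.proj p).2 : FibModel q))) ≠ 0 := by
    have h := fiberEquiv_symm_eq e hx ((rayTriv q E p.proj p).2 : FibModel q)
    change F (e.toOpenPartialHomeomorph.symm (p.proj, _)) ≠ 0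
    rw [← h]
    exact (hF.pos (hs _ _)).ne'
  have h6 := (contMDiffAt_triv_symm (m := m) e (z := ((rayTriv q E p.proj p).1,
    (F (e.toOpenPartialHomeomorph.symm ((rayTriv q E p.proj p).1,
      ((rayTriv q E p.proj p).2 : FibModel q))))⁻¹ • ((rayTriv q E p.proj p).2 : FibModel q)))
        hx).comp p (h1.prodMk ((h4.inv₀ h5).smul h2))
  refine h6.congr_of_eventuallyEq ?_
  filter_upwards [(contMDiff_sphereProj m q E).continuous.continuousAt.preimage_mem_nhds
    (e.open_baseSet.mem_nhds hx)] with s hs'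
  have hs1 : s.proj ∈ e.baseSet := hs'
  set u := (rayTriv q E p.proj s).2 with hu
  have h7 : s = ⟨s.proj, (rayOfNeZero ℝ ((fiberEquiv e s.proj).symm (u : FibModel q)) (hs _ _) :
      Module.Ray ℝ (E s.proj))⟩ := ((rayTriv q E p.proj).left_inv hs1).symm
  have h8 : tautLift F s = ⟨s.proj, (F ⟨s.proj, (fiberEquiv e s.proj).symm (u : FibModel q)⟩)⁻¹ •
      (fiberEquiv e s.proj).symm (u : FibModel q)⟩ := by
    conv_lhs => rw [h7]
    rw [tautLift, hF.taut_eq]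
  rw [h8, ← map_smul]
  have h9 := fiberEquiv_symm_eq e hs1 (u : FibModel q)
  have h10 := fiberEquiv_symm_eq e hs1
    ((F ⟨s.proj, (fiberEquiv e s.proj).symm (u : FibModel q)⟩)⁻¹ • (u : FibModel q))
  exact h10.trans (congrArg (fun y ↦ e.toOpenPartialHomeomorph.symm
    (s.proj, (F y)⁻¹ • (u : FibModel q))) h9)

lemma contMDiffAt_toSphere (p₀ : SphereBundle q E) {y : TotalSpace (FibModel q) E} (hy : y.2 ≠ 0) :
    ContMDiffAt (totalModel m q) (sphereModel m q) ∞ (toSphere p₀) y := by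
  set e := triv q E y.proj with he
  have hx : y.proj ∈ e.baseSet := mem_triv _
  set p : SphereBundle q E := ⟨y.proj, (rayOfNeZero ℝ y.2 hy : Module.Ray ℝ (E y.proj))⟩ with hp
  have hne : ∀ y' : TotalSpace (FibModel q) E, y'.proj ∈ e.baseSet → y'.2 ≠ 0 → (e y').2 ≠ 0 :=
    fun y' h h' ↦ by
      rw [← fiberEquiv_apply e h]
      exact (LinearEquiv.map_ne_zero_iff _).2 h'
  have hR : ∀ (y' : TotalSpace (FibModel q) E) (h : y'.proj ∈ e.baseSet) (h' : y'.2 ≠ 0),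
      rayTriv q E y.proj ⟨y'.proj, (rayOfNeZero ℝ y'.2 h' : Module.Ray ℝ (E y'.proj))⟩ =
        (y'.proj, directionOrDefault (e y').2) := by
    intro y' h h'
    refine Prod.ext rfl ?_
    rw [directionOrDefault_of_ne (hne y' h h')]
    refine (rayEquivSphere_rayOfNeZero (fiberEquiv e y'.proj y'.2)
      ((LinearEquiv.map_ne_zero_iff _).2 h')).trans (Subtype.ext ?_)
    change ‖_‖⁻¹ • _ = ‖_‖⁻¹ • _
    rw [fiberEquiv_apply e h]
  have h1 := contMDiffAt_triv (m := m) e hx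
  have h2 : ContMDiffAt (totalModel m q) (sphereModel m q) ∞
      (fun y' : TotalSpace (FibModel q) E ↦ (y'.proj, directionOrDefault (e y').2)) y :=
    (contMDiffAt_proj E).prodMk ((contMDiffAt_direction (hne y hx hy)).comp y (contMDiffAt_snd.comp y h1))
  have h3 := contMDiffAt_rayTriv_symm (m := m) p
  have h4 : rayTriv q E p.proj p = (y.proj, directionOrDefault (e y).2) := hR y hx hy
  rw [h4] at h3
  refine (h3.comp y h2).congr_of_eventuallyEq ?_
  filter_upwards [(FiberBundle.continuous_proj (FibModel q) E).continuousAt.preimage_mem_nhds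
    (e.open_baseSet.mem_nhds hx), isOpen_ne_zero.mem_nhds hy] with y' h5 h6
  rw [Function.comp_apply, ← hR y' h5 h6]
  refine (toSphere_of_ne p₀ h6).trans ?_
  exact ((rayTriv q E y.proj).left_inv (x := (⟨y'.proj, (rayOfNeZero ℝ y'.2 h6 :
    Module.Ray ℝ (E y'.proj))⟩ : SphereBundle q E)) h5).symm

end Taut

end

section

/-! ### Directional derivatives in the fibres -/

section FiberDerivatives

variable {V : Type*} [NormedAddCommGroup V] [NormedSpace ℝ V]

/-- Each derivative lowers the degree of homogeneity by one; with a = c and then a = 1 it shows that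
g_y has degree zero in y. -/
lemma lineDeriv_homogeneous {W : Type*} [AddCommGroup W] [Module ℝ W] {f : W → ℝ} {c : ℝ}
    (hc : c ≠ 0) (a : ℝ) (h : ∀ z, f (c • z) = c * a * f z) (z v : W) :
    lineDeriv ℝ f (c • z) v = a * lineDeriv ℝ f z v := by
  have h1 : ∀ t : ℝ, f (c • z + t • v) = c * a * f (z + (c⁻¹ * t) • v) := fun t ↦ by
    rw [← h, smul_add, smul_smul, mul_inv_cancel_left₀ hc]
  have h2 : deriv (fun t : ℝ ↦ f (z + (c⁻¹ * t) • v)) 0 = c⁻¹ * deriv (fun t : ℝ ↦ f (z + t • v)) 0 := by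
    have := deriv_comp_mul_left c⁻¹ (fun t : ℝ ↦ f (z + t • v)) 0
    simpa using this
  rw [lineDeriv, funext h1, deriv_const_mul_field, h2, lineDeriv]
  field_simp

lemma lineDeriv_comp_linearEquiv {W : Type*} [AddCommGroup W] [Module ℝ W] (L : W ≃ₗ[ℝ] V)
    (f : W → ℝ) (y v : W) : lineDeriv ℝ f y v = lineDeriv ℝ (fun u ↦ f (L.symm u)) (L y) (L v) := by
  simp only [lineDeriv, map_add, map_smul, LinearEquiv.symm_apply_apply]

variable {φ : V → ℝ}

lemma lineDeriv_eq_fderiv_of_contDiffOn (h : ∀ z ≠ 0, ContDiffAt ℝ ∞ φ z) {z : V} (hz : z ≠ 0) (v : V) :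
    lineDeriv ℝ φ z v = fderiv ℝ φ z v :=
  ((h z hz).differentiableAt (by simp)).lineDeriv_eq_fderiv

lemma lineDeriv_lineDeriv_eq (h : ∀ z ≠ 0, ContDiffAt ℝ ∞ φ z) {z : V} (hz : z ≠ 0) (u v : V) :
    lineDeriv ℝ (fun z ↦ lineDeriv ℝ φ z v) z u = fderiv ℝ (fderiv ℝ φ) z u v := by
  have h2 : ContDiffAt ℝ ∞ (fderiv ℝ φ) z := (h z hz).fderiv_right (by simp)
  have h3 : HasFDerivAt (fun z ↦ lineDeriv ℝ φ z v) ((ContinuousLinearMap.apply ℝ ℝ v).comp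
      (fderiv ℝ (fderiv ℝ φ) z)) z := by
    refine (((ContinuousLinearMap.apply ℝ ℝ v).hasFDerivAt).comp z
      (h2.differentiableAt (by simp)).hasFDerivAt).congr_of_eventuallyEq ?_
    filter_upwards [isOpen_ne.mem_nhds hz] with w hw
    exact lineDeriv_eq_fderiv_of_contDiffOn h hw v
  rw [h3.differentiableAt.lineDeriv_eq_fderiv, h3.fderiv]
  rfl

set_option synthInstance.maxHeartbeats 200000 in
lemma lineDeriv_lineDeriv_lineDeriv_eq (h : ∀ z ≠ 0, ContDiffAt ℝ ∞ φ z) {z : V} (hz : z ≠ 0)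
    (u v w : V) :
    lineDeriv ℝ (fun z ↦ lineDeriv ℝ (fun z ↦ lineDeriv ℝ φ z w) z v) z u =
      fderiv ℝ (fderiv ℝ (fderiv ℝ φ)) z u v w := by
  have h2 : ContDiffAt ℝ ∞ (fderiv ℝ (fderiv ℝ φ)) z :=
    ((h z hz).fderiv_right (m := ∞) (by simp)).fderiv_right (by simp)
  have h3 : HasFDerivAt (fun z ↦ lineDeriv ℝ (fun z ↦ lineDeriv ℝ φ z w) z v)
      ((ContinuousLinearMap.apply ℝ ℝ w).comp ((ContinuousLinearMap.apply ℝ (V →L[ℝ] ℝ) v).comp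
      (fderiv ℝ (fderiv ℝ (fderiv ℝ φ)) z))) z := by
    refine (((ContinuousLinearMap.apply ℝ ℝ w).hasFDerivAt).comp z
      (((ContinuousLinearMap.apply ℝ (V →L[ℝ] ℝ) v).hasFDerivAt).comp z
      (h2.differentiableAt (by simp)).hasFDerivAt)).congr_of_eventuallyEq ?_
    filter_upwards [isOpen_ne.mem_nhds hz] with w hw
    exact lineDeriv_lineDeriv_eq h hw v _
  rw [h3.differentiableAt.lineDeriv_eq_fderiv, h3.fderiv]
  rfl

lemma fderiv_fderiv_swap (h : ∀ z ≠ 0, ContDiffAt ℝ ∞ φ z) {z : V} (hz : z ≠ 0) (u v : V) :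
    fderiv ℝ (fderiv ℝ φ) z u v = fderiv ℝ (fderiv ℝ φ) z v u :=
  (h z hz).isSymmSndFDerivAt (by simpa using ENat.LEInfty.out) u v

lemma fderiv_fderiv_fderiv_swap_left (h : ∀ z ≠ 0, ContDiffAt ℝ ∞ φ z) {z : V} (hz : z ≠ 0)
    (u v w : V) : fderiv ℝ (fderiv ℝ (fderiv ℝ φ)) z u v w =
      fderiv ℝ (fderiv ℝ (fderiv ℝ φ)) z v u w := by
  have h2 : ContDiffAt ℝ ∞ (fderiv ℝ φ) z := (h z hz).fderiv_right (by simp)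
  rw [h2.isSymmSndFDerivAt (by simpa using ENat.LEInfty.out) u v]

lemma fderiv_fderiv_fderiv_swap_right (h : ∀ z ≠ 0, ContDiffAt ℝ ∞ φ z) {z : V} (hz : z ≠ 0)
    (u v w : V) : fderiv ℝ (fderiv ℝ (fderiv ℝ φ)) z u v w =
      fderiv ℝ (fderiv ℝ (fderiv ℝ φ)) z u w v := by
  rw [← lineDeriv_lineDeriv_lineDeriv_eq h hz, ← lineDeriv_lineDeriv_lineDeriv_eq h hz]
  refine Filter.EventuallyEq.lineDeriv_eq ?_
  filter_upwards [isOpen_ne.mem_nhds hz] with z' hz'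
  rw [lineDeriv_lineDeriv_eq h hz', lineDeriv_lineDeriv_eq h hz', fderiv_fderiv_swap h hz']

end FiberDerivatives

/-! ### Smoothness of derivatives along a vector space factor -/

section PartialDerivatives

variable {B : Type*} [NormedAddCommGroup B] [NormedSpace ℝ B] {H : Type*} [TopologicalSpace H]
  {I : ModelWithCorners ℝ B H} {S : Type*} [TopologicalSpace S] [ChartedSpace H S]
  {V : Type*} [NormedAddCommGroup V] [NormedSpace ℝ V]
  {W : Type*} [NormedAddCommGroup W] [NormedSpace ℝ W]

/-- The derivative along the vector space factor is smooth. -/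
lemma contMDiffAt_partial_fderiv [IsManifold I ∞ S] {f : S × V → W} {z : S × V}
    (hf : ContMDiffAt (I.prod 𝓘(ℝ, V)) 𝓘(ℝ, W) ∞ f z) :
    ContMDiffAt (I.prod 𝓘(ℝ, V)) 𝓘(ℝ, V →L[ℝ] W) ∞
      (fun z ↦ fderiv ℝ (fun u ↦ f (z.1, u)) z.2) z := by
  have h1 : ContMDiffAt ((I.prod 𝓘(ℝ, V)).prod 𝓘(ℝ, V)) 𝓘(ℝ, W) ∞
      (Function.uncurry fun (z : S × V) (u : V) ↦ f (z.1, u)) (z, z.2) :=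
    ContMDiffAt.comp (g := f) (z, z.2) hf
      ((contMDiffAt_fst.comp _ contMDiffAt_fst).prodMk contMDiffAt_snd)
  have h2 := ContMDiffAt.mfderiv (m := ∞) (fun (z : S × V) (u : V) ↦ f (z.1, u)) Prod.snd h1
    contMDiffAt_snd (by simp)
  refine h2.congr_of_eventuallyEq (Filter.Eventually.of_forall fun z' ↦ ?_)
  refine Eq.trans ?_ (congrFun (inTangentCoordinates_model_space (I := 𝓘(ℝ, V)) (I' := 𝓘(ℝ, W))
    (Prod.snd : S × V → V) (fun x ↦ f (x.1, x.2))
    (fun x ↦ mfderiv 𝓘(ℝ, V) 𝓘(ℝ, W) (fun u ↦ f (x.1, u)) x.2) z) z').symm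
  exact mfderiv_eq_fderiv.symm

/-- A tangent vector of `S × V` in the direction of `V`. -/
lemma mfderiv_apply_zero_prod {f : S × V → W} {x : S} {u : V}
    (hf : MDifferentiableAt (I.prod 𝓘(ℝ, V)) 𝓘(ℝ, W) f (x, u)) (v : V) :
    (mfderiv (I.prod 𝓘(ℝ, V)) 𝓘(ℝ, W) f (x, u) : (B × V) →L[ℝ] W) (0, v) =
      fderiv ℝ (fun w ↦ f (x, w)) u v := by
  have h := mfderiv_comp (I := 𝓘(ℝ, V)) (I' := I.prod 𝓘(ℝ, V)) u (f := fun w : V ↦ (x, w)) (g := f) hf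
    (mdifferentiableAt_const.prodMk mdifferentiableAt_id)
  rw [mfderiv_prod_right] at h
  have h2 : mfderiv 𝓘(ℝ, V) 𝓘(ℝ, W) (f ∘ fun w : V ↦ (x, w)) u = fderiv ℝ (fun w ↦ f (x, w)) u :=
    mfderiv_eq_fderiv
  rw [h2] at h
  exact (congrArg (fun L : V →L[ℝ] W ↦ L v) h).symm

end PartialDerivatives

/-! ### Fundamental and Cartan tensors in a trivialization -/

section FiberTensors

variable {m q : ℕ} {M : Type*} [TopologicalSpace M]
  [ChartedSpace (EuclideanSpace ℝ (Fin m)) M]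
  {E : M → Type*} [∀ x, AddCommGroup (E x)] [∀ x, Module ℝ (E x)]
  [TopologicalSpace (TotalSpace (FibModel q) E)] [∀ x, TopologicalSpace (E x)]
  [FiberBundle (FibModel q) E] [VectorBundle ℝ (FibModel q) E]
  {F : TotalSpace (FibModel q) E → ℝ}

lemma fundamentalTensor_smul (hF : IsFinslerMetric m F) {x : M} (y u v : E x) {c : ℝ} (hc : 0 < c) :
    fundamentalTensor F (c • y) u v = fundamentalTensor F y u v := by
  have h1 : ∀ z, lineDeriv ℝ (fun w ↦ F ⟨x, w⟩ ^ 2) (c • z) v =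
      c * 1 * lineDeriv ℝ (fun w ↦ F ⟨x, w⟩ ^ 2) z v := fun z ↦ by
    rw [mul_one]
    refine lineDeriv_homogeneous hc.ne' c (fun z ↦ ?_) z v
    rw [hF.homogeneous x z c hc]
    ring
  rw [fundamentalTensor, fundamentalTensor, lineDeriv_homogeneous hc.ne' 1 h1, one_mul]

/-- The function `F²` on the fibre at `x`, in the trivialization `e`. -/
def fiberSq (F : TotalSpace (FibModel q) E → ℝ) (e : Trivialization (FibModel q) (π (FibModel q) E))
    [MemTrivializationAtlas e] (x : M) (u : FibModel q) : ℝ :=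
  F (TotalSpace.mk' (FibModel q) x ((fiberEquiv e x).symm u)) ^ 2

variable [IsManifold (𝓡 m) ∞ M] [ContMDiffVectorBundle ∞ (FibModel q) E (𝓡 m)]

variable (e : Trivialization (FibModel q) (π (FibModel q) E)) [MemTrivializationAtlas e]

lemma IsFinslerMetric.contMDiffAt_fiberSq (hF : IsFinslerMetric m F) {x : M} (hx : x ∈ e.baseSet)
    {u : FibModel q} (hu : u ≠ 0) :
    ContMDiffAt (totalModel m q) 𝓘(ℝ) ∞ (fun z : M × FibModel q ↦ fiberSq F e z.1 z.2) (x, u) := by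
  have h : ContMDiffAt (totalModel m q) 𝓘(ℝ) ∞ (fun z ↦ F (e.toOpenPartialHomeomorph.symm z)) (x, u) := by
    refine ContMDiffAt.comp (g := F) _ (hF.contMDiffAt ?_) (contMDiffAt_triv_symm e hx)
    rw [← fiberEquiv_symm_eq e hx]
    exact (LinearEquiv.map_ne_zero_iff _).2 hu
  refine (h.pow 2).congr_of_eventuallyEq ?_
  filter_upwards [continuousAt_fst.preimage_mem_nhds (e.open_baseSet.mem_nhds hx)] with z hz
  rw [fiberSq, fiberEquiv_symm_eq e hz]

lemma IsFinslerMetric.contDiffAt_fiberSq (hF : IsFinslerMetric m F) {x : M} (hx : x ∈ e.baseSet)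
    {u : FibModel q} (hu : u ≠ 0) : ContDiffAt ℝ ∞ (fiberSq F e x) u :=
  (ContMDiffAt.comp u (hF.contMDiffAt_fiberSq e hx hu)
    (contMDiffAt_const.prodMk contMDiffAt_id)).contDiffAt

/-- The fibre E x carries no norm, so its directional derivatives are transported to the model
fibre. There they are Fréchet derivatives, which supplies bilinearity, symmetry and smoothness. -/
lemma fundamentalTensor_eq (hF : IsFinslerMetric m F) {x : M} (hx : x ∈ e.baseSet) {y : E x} (hy : y ≠ 0)
    (u v : E x) : fundamentalTensor F y u v = 1 / 2 * fderiv ℝ (fderiv ℝ (fiberSq F e x))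
      (fiberEquiv e x y) (fiberEquiv e x u) (fiberEquiv e x v) := by
  rw [fundamentalTensor, lineDeriv_comp_linearEquiv (fiberEquiv e x)]
  simp only [lineDeriv_comp_linearEquiv (fiberEquiv e x) (fun w ↦ F ⟨x, w⟩ ^ 2),
    LinearEquiv.apply_symm_apply]
  exact congrArg _ (lineDeriv_lineDeriv_eq (fun z hz ↦ hF.contDiffAt_fiberSq e hx hz)
    ((LinearEquiv.map_ne_zero_iff _).2 hy) _ _)

lemma cartanTensor_eq (hF : IsFinslerMetric m F) {x : M} (hx : x ∈ e.baseSet) {y : E x} (hy : y ≠ 0)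
    (u v w : E x) : cartanTensor F y u v w = F ⟨x, y⟩ / 4 * fderiv ℝ (fderiv ℝ (fderiv ℝ (fiberSq F e x)))
      (fiberEquiv e x y) (fiberEquiv e x u) (fiberEquiv e x v) (fiberEquiv e x w) := by
  have h1 : ∀ z', lineDeriv ℝ (fun y' ↦ F ⟨x, y'⟩ ^ 2) z' w =
      lineDeriv ℝ (fiberSq F e x) (fiberEquiv e x z') (fiberEquiv e x w) :=
    fun z' ↦ lineDeriv_comp_linearEquiv (fiberEquiv e x) _ z' w
  have h2 : ∀ z, lineDeriv ℝ (fun z' ↦ lineDeriv ℝ (fun y' ↦ F ⟨x, y'⟩ ^ 2) z' w) z v =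
      lineDeriv ℝ (fun z' ↦ lineDeriv ℝ (fiberSq F e x) z' (fiberEquiv e x w)) (fiberEquiv e x z)
        (fiberEquiv e x v) := fun z ↦ by
    simp only [h1]
    rw [lineDeriv_comp_linearEquiv (fiberEquiv e x)]
    simp only [LinearEquiv.apply_symm_apply]
  rw [cartanTensor]
  simp only [h2]
  rw [lineDeriv_comp_linearEquiv (fiberEquiv e x)]
  simp only [LinearEquiv.apply_symm_apply]
  exact congrArg _ (lineDeriv_lineDeriv_lineDeriv_eq (fun z hz ↦ hF.contDiffAt_fiberSq e hx hz)
    ((LinearEquiv.map_ne_zero_iff _).2 hy) _ _ _)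

/-- The differential of a function on `E` applied to a vertical vector. -/
lemma mfderiv_apply_vertical {W : Type*} [NormedAddCommGroup W] [NormedSpace ℝ W]
    {y : TotalSpace (FibModel q) E} (hx : y.proj ∈ e.baseSet) {h : TotalSpace (FibModel q) E → W}
    (hh : MDifferentiableAt (totalModel m q) 𝓘(ℝ, W) h y) {ζ : TangentSpace (totalModel m q) y}
    (hζ : mfderiv (totalModel m q) (𝓡 m) (π (FibModel q) E) y ζ = 0) :
    mfderiv (totalModel m q) 𝓘(ℝ, W) h y ζ =
      fderiv ℝ (fun u ↦ h (TotalSpace.mk' (FibModel q) y.proj ((fiberEquiv e y.proj).symm u)))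
        (fiberEquiv e y.proj y.2)
        (mfderiv (totalModel m q) 𝓘(ℝ, FibModel q) (fun z ↦ (e z).2) y ζ) := by
  have hy : fiberEquiv e y.proj y.2 = (e y).2 := fiberEquiv_apply e hx y.2
  have he : e y = (y.proj, fiberEquiv e y.proj y.2) := Prod.ext (e.coe_fst' hx) hy.symm
  have h1 := (contMDiffAt_triv (m := m) e hx).mdifferentiableAt (by simp)
  have hs : e.toOpenPartialHomeomorph.symm (y.proj, fiberEquiv e y.proj y.2) = y := by
    rw [← he]
    exact e.left_inv (e.mem_source.2 hx)
  have h2 : MDifferentiableAt (totalModel m q) 𝓘(ℝ, W) (fun z ↦ h (e.toOpenPartialHomeomorph.symm z))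
      (y.proj, fiberEquiv e y.proj y.2) := by
    refine MDifferentiableAt.comp (I' := totalModel m q) (g := h) _ ?_
      ((contMDiffAt_triv_symm (m := m) e hx).mdifferentiableAt (by simp))
    rw [hs]
    exact hh
  have h3 : mfderiv (totalModel m q) 𝓘(ℝ, W) h y = mfderiv (totalModel m q) 𝓘(ℝ, W)
      (fun z : TotalSpace (FibModel q) E ↦ h (e.toOpenPartialHomeomorph.symm (z.proj, (e z).2))) y := by
    refine Filter.EventuallyEq.mfderiv_eq ?_
    filter_upwards [e.open_source.mem_nhds (e.mem_source.2 hx)] with z hz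
    congr 1
    have := e.left_inv hz
    conv_lhs => rw [← this]
    exact congrArg _ (Prod.ext (e.coe_fst hz) rfl)
  have h4 : MDifferentiableAt (totalModel m q) 𝓘(ℝ, FibModel q) (fun z ↦ (e z).2) y := h1.snd
  have h5 := ((contMDiffAt_proj (n := ∞) (IB := 𝓡 m) (p := y) E).mdifferentiableAt (by simp))
  have h6 : HasMFDerivAt (totalModel m q) (totalModel m q)
      (fun z : TotalSpace (FibModel q) E ↦ (z.proj, (e z).2)) y _ :=
    h5.hasMFDerivAt.prodMk h4.hasMFDerivAt
  rw [hy] at h2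
  have h7 := HasMFDerivAt.comp (I' := totalModel m q) y (f := fun z : TotalSpace (FibModel q) E ↦ (z.proj, (e z).2))
    (g := fun z ↦ h (e.toOpenPartialHomeomorph.symm z)) h2.hasMFDerivAt h6
  have h8 := h7.mfderiv
  rw [h3]
  refine (congrArg (fun L : (EuclideanSpace ℝ (Fin m) × FibModel q) →L[ℝ] W ↦ L ζ) h8).trans ?_
  refine (congrArg (fun v : EuclideanSpace ℝ (Fin m) ↦ (mfderiv (totalModel m q) 𝓘(ℝ, W)
    (fun z ↦ h (e.toOpenPartialHomeomorph.symm z)) (y.proj, (e y).2) :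
      (EuclideanSpace ℝ (Fin m) × FibModel q) →L[ℝ] W) (v, _)) hζ).trans ?_
  refine (mfderiv_apply_zero_prod h2 _).trans ?_
  rw [hy]
  simp only [fiberEquiv_symm_eq e hx]
  rfl

end FiberTensors

end

section

variable {m q : ℕ} {M : Type*} [TopologicalSpace M]
  [ChartedSpace (EuclideanSpace ℝ (Fin m)) M]
  {E : M → Type*} [∀ x, AddCommGroup (E x)] [∀ x, Module ℝ (E x)]
  [TopologicalSpace (TotalSpace (FibModel q) E)] [∀ x, TopologicalSpace (E x)]
  [FiberBundle (FibModel q) E] [VectorBundle ℝ (FibModel q) E]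
  {F : TotalSpace (FibModel q) E → ℝ}

/-! ### Local frames and the metric on the pulled-back bundle -/

section Frames

/-- The coordinates on `E x` in the preferred trivialization at `x₀`. -/
abbrev coordEquiv (x₀ x : M) : E x ≃ₗ[ℝ] FibModel q := fiberEquiv (triv q E x₀) x

lemma stdFrame_apply {x₀ x : M} (hx : x ∈ (triv q E x₀).baseSet) (i : Fin (q + 1)) :
    stdFrame q x₀ i x = (coordEquiv (E := E) x₀ x).symm (EuclideanSpace.single i 1) := by
  rw [stdFrame, Trivialization.localFrame_apply_of_mem_baseSet _ _ hx, Trivialization.basisAt,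
    coordEquiv, fiberEquiv_of_mem _ hx]
  simp

lemma coordEquiv_stdFrame {x₀ x : M} (hx : x ∈ (triv q E x₀).baseSet) (i : Fin (q + 1)) :
    coordEquiv x₀ x (stdFrame (E := E) q x₀ i x) = EuclideanSpace.single i 1 := by
  rw [stdFrame_apply hx, LinearEquiv.apply_symm_apply]

lemma sum_coordEquiv_smul_stdFrame {x₀ x : M} (hx : x ∈ (triv q E x₀).baseSet) (v : E x) :
    ∑ i, (coordEquiv x₀ x v : FibModel q) i • stdFrame q x₀ i x = v := by
  apply (coordEquiv (q := q) x₀ x).injective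
  rw [map_sum]
  have h : ∀ i, coordEquiv x₀ x ((coordEquiv x₀ x v : FibModel q) i • stdFrame (E := E) q x₀ i x) =
      (coordEquiv x₀ x v : FibModel q) i • EuclideanSpace.single i 1 := fun i ↦ by
    rw [map_smul, coordEquiv_stdFrame hx]
  simp only [h]
  ext j
  simp [Pi.single_apply]

lemma stdCoord_eq (x : M) (i : Fin (q + 1)) (v : E x) :
    stdCoord q x i v = (coordEquiv x x v : FibModel q) i := by
  rw [coordEquiv, fiberEquiv_apply _ (mem_triv x), stdCoord]
  simp only [ContinuousLinearMap.comp_apply, Trivialization.continuousLinearMapAt_apply,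
    Trivialization.linearMapAt_apply, mem_triv, if_true]
  rfl

end Frames

section Metric

variable [IsManifold (𝓡 m) ∞ M] [ContMDiffVectorBundle ∞ (FibModel q) E (𝓡 m)]

/-- The fundamental tensor as a function on `SE`, in the trivialization at `x₀`. -/
lemma sphereMetric_eq (hF : IsFinslerMetric m F) {x₀ : M} {p : SphereBundle q E}
    (hp : p.proj ∈ (triv q E x₀).baseSet) (u v : E p.proj) :
    sphereMetric F p u v = 1 / 2 * fderiv ℝ (fderiv ℝ (fiberSq F (triv q E x₀) p.proj))
      (coordEquiv x₀ p.proj (taut F p)) (coordEquiv x₀ p.proj u) (coordEquiv x₀ p.proj v) :=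
  fundamentalTensor_eq _ hF hp (hF.taut_ne_zero p) u v

variable (F) in
/-- `sphereMetric` as a bilinear form. -/
def metricBilin (p : SphereBundle q E) : E p.proj →ₗ[ℝ] E p.proj →ₗ[ℝ] ℝ :=
  (1 / 2 : ℝ) • ((ContinuousLinearMap.coeLM ℝ).comp (fderiv ℝ (fderiv ℝ (fiberSq F (triv q E p.proj) p.proj))
      (coordEquiv p.proj p.proj (taut F p))).toLinearMap).compl₁₂
    (coordEquiv p.proj p.proj).toLinearMap (coordEquiv p.proj p.proj).toLinearMap

lemma metricBilin_apply (hF : IsFinslerMetric m F) (p : SphereBundle q E) (u v : E p.proj) :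
    metricBilin F p u v = sphereMetric F p u v :=
  (sphereMetric_eq hF (mem_triv _) u v).symm

lemma sphereMetric_comm (hF : IsFinslerMetric m F) (p : SphereBundle q E) (u v : E p.proj) :
    sphereMetric F p u v = sphereMetric F p v u := by
  rw [sphereMetric_eq hF (mem_triv _), sphereMetric_eq hF (mem_triv _), fderiv_fderiv_swap
    (fun z hz ↦ hF.contDiffAt_fiberSq _ (mem_triv _) hz)
    ((LinearEquiv.map_ne_zero_iff _).2 (hF.taut_ne_zero p))]

lemma sphereMetric_pos (hF : IsFinslerMetric m F) (p : SphereBundle q E) {u : E p.proj} (hu : u ≠ 0) :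
    0 < sphereMetric F p u u := hF.posDef _ _ (hF.taut_ne_zero p) u hu

lemma sphereMetric_taut (hF : IsFinslerMetric m F) (p : SphereBundle q E) :
    sphereMetric F p (taut F p) (taut F p) = 1 := by
  have h := hF.apply_taut p
  rw [sphereMetric, hF.fundamentalTensor_self (hF.taut_ne_zero p)]
  rw [tautLift] at h
  rw [h, one_pow]

lemma sphereMetric_smul_left (hF : IsFinslerMetric m F) (p : SphereBundle q E) (c : ℝ) (u v : E p.proj) :
    sphereMetric F p (c • u) v = c * sphereMetric F p u v := by
  simp only [← metricBilin_apply hF, map_smul, LinearMap.smul_apply, smul_eq_mul]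

lemma sphereMetric_smul_right (hF : IsFinslerMetric m F) (p : SphereBundle q E) (c : ℝ) (u v : E p.proj) :
    sphereMetric F p u (c • v) = c * sphereMetric F p u v := by
  simp only [← metricBilin_apply hF, map_smul, smul_eq_mul]

lemma sphereMetric_add_left (hF : IsFinslerMetric m F) (p : SphereBundle q E) (u u' v : E p.proj) :
    sphereMetric F p (u + u') v = sphereMetric F p u v + sphereMetric F p u' v := by
  simp only [← metricBilin_apply hF, map_add, LinearMap.add_apply]

lemma sphereMetric_sub_left (hF : IsFinslerMetric m F) (p : SphereBundle q E) (u u' v : E p.proj) :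
    sphereMetric F p (u - u') v = sphereMetric F p u v - sphereMetric F p u' v := by
  simp only [← metricBilin_apply hF, map_sub, LinearMap.sub_apply]

lemma sphereMetric_sum_left {ι : Type*} (s : Finset ι) (hF : IsFinslerMetric m F) (p : SphereBundle q E)
    (u : ι → E p.proj) (v : E p.proj) :
    sphereMetric F p (∑ i ∈ s, u i) v = ∑ i ∈ s, sphereMetric F p (u i) v := by
  simp only [← metricBilin_apply hF]
  rw [map_sum, LinearMap.sum_apply]

lemma sphereMetric_sum_right {ι : Type*} (s : Finset ι) (hF : IsFinslerMetric m F) (p : SphereBundle q E)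
    (u : ι → E p.proj) (v : E p.proj) :
    sphereMetric F p v (∑ i ∈ s, u i) = ∑ i ∈ s, sphereMetric F p v (u i) := by
  simp only [← metricBilin_apply hF]
  rw [map_sum]

lemma cartanTensor_taut_eq (hF : IsFinslerMetric m F) {x₀ : M} {p : SphereBundle q E}
    (hp : p.proj ∈ (triv q E x₀).baseSet) (u v w : E p.proj) :
    cartanTensor F (taut F p) u v w = 1 / 4 *
      fderiv ℝ (fderiv ℝ (fderiv ℝ (fiberSq F (triv q E x₀) p.proj)))
      (coordEquiv x₀ p.proj (taut F p)) (coordEquiv x₀ p.proj u) (coordEquiv x₀ p.proj v)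
        (coordEquiv x₀ p.proj w) := by
  have h := hF.apply_taut p
  rw [tautLift] at h
  rw [cartanTensor_eq _ hF hp (hF.taut_ne_zero p), h]

variable (F) in
/-- The Cartan tensor on `SE` as a trilinear form. -/
def cartanTrilin (p : SphereBundle q E) (w : E p.proj) : E p.proj →ₗ[ℝ] E p.proj →ₗ[ℝ] ℝ :=
  (1 / 4 : ℝ) • ((ContinuousLinearMap.coeLM ℝ).comp
    (fderiv ℝ (fderiv ℝ (fderiv ℝ (fiberSq F (triv q E p.proj) p.proj)))
      (coordEquiv p.proj p.proj (taut F p)) (coordEquiv p.proj p.proj w)).toLinearMap).compl₁₂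
    (coordEquiv p.proj p.proj).toLinearMap (coordEquiv p.proj p.proj).toLinearMap

lemma cartanTrilin_apply (hF : IsFinslerMetric m F) (p : SphereBundle q E) (u v w : E p.proj) :
    cartanTrilin F p u v w = cartanTensor F (taut F p) u v w :=
  (cartanTensor_taut_eq hF (mem_triv _) u v w).symm

lemma cartanTensor_swap_left (hF : IsFinslerMetric m F) (p : SphereBundle q E) (u v w : E p.proj) :
    cartanTensor F (taut F p) u v w = cartanTensor F (taut F p) v u w := by
  rw [cartanTensor_taut_eq hF (mem_triv _), cartanTensor_taut_eq hF (mem_triv _),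
    fderiv_fderiv_fderiv_swap_left (fun z hz ↦ hF.contDiffAt_fiberSq _ (mem_triv _) hz)
    ((LinearEquiv.map_ne_zero_iff _).2 (hF.taut_ne_zero p))]

lemma cartanTensor_swap_right (hF : IsFinslerMetric m F) (p : SphereBundle q E) (u v w : E p.proj) :
    cartanTensor F (taut F p) u v w = cartanTensor F (taut F p) u w v := by
  rw [cartanTensor_taut_eq hF (mem_triv _), cartanTensor_taut_eq hF (mem_triv _),
    fderiv_fderiv_fderiv_swap_right (fun z hz ↦ hF.contDiffAt_fiberSq _ (mem_triv _) hz)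
    ((LinearEquiv.map_ne_zero_iff _).2 (hF.taut_ne_zero p))]

lemma cartanTensor_sum_smul_right {ι : Type*} (s : Finset ι) (hF : IsFinslerMetric m F)
    (p : SphereBundle q E) (c : ι → ℝ) (u v : E p.proj) (w : ι → E p.proj) :
    cartanTensor F (taut F p) u v (∑ i ∈ s, c i • w i) =
      ∑ i ∈ s, c i * cartanTensor F (taut F p) u v (w i) := by
  simp only [← cartanTrilin_apply hF]
  rw [map_sum]
  simp only [map_smul, smul_eq_mul]

lemma cartanTensor_sum_smul_mid {ι : Type*} (s : Finset ι) (hF : IsFinslerMetric m F)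
    (p : SphereBundle q E) (c : ι → ℝ) (u w : E p.proj) (v : ι → E p.proj) :
    cartanTensor F (taut F p) u (∑ i ∈ s, c i • v i) w =
      ∑ i ∈ s, c i * cartanTensor F (taut F p) u (v i) w := by
  simp only [cartanTensor_swap_right hF p u _ w, cartanTensor_sum_smul_right s hF]

lemma cartanTensor_sum_smul_left {ι : Type*} (s : Finset ι) (hF : IsFinslerMetric m F)
    (p : SphereBundle q E) (c : ι → ℝ) (u : ι → E p.proj) (v w : E p.proj) :
    cartanTensor F (taut F p) (∑ i ∈ s, c i • u i) v w =
      ∑ i ∈ s, c i * cartanTensor F (taut F p) (u i) v w := by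
  simp only [cartanTensor_swap_left hF p _ v w, cartanTensor_sum_smul_mid s hF]

/-- The vector `A^j_{ik} u^i w^k 𝔰_j` is characterized by `g(·, v) = A(v, u, w)`. -/
lemma sphereMetric_cartanCoeff (hF : IsFinslerMetric m F) (p : SphereBundle q E) (u w v : E p.proj) :
    sphereMetric F p (∑ i, stdCoord q p.proj i u • ∑ j, ∑ k, cartanCoeff F p j i k •
        stdCoord q p.proj k w • stdFrame q p.proj j p.proj) v = cartanTensor F (taut F p) v u w := by
  have hx : p.proj ∈ (triv q E p.proj).baseSet := mem_triv _
  set f : Fin (q + 1) → E p.proj := fun i ↦ stdFrame q p.proj i p.proj with hf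
  set G : Matrix (Fin (q + 1)) (Fin (q + 1)) ℝ := Matrix.of fun a b ↦ sphereMetric F p (f a) (f b) with hG
  have hexp : ∀ v : E p.proj, v = ∑ i, stdCoord q p.proj i v • f i := fun v ↦ by
    conv_lhs => rw [← sum_coordEquiv_smul_stdFrame hx v]
    simp only [stdCoord_eq, hf]
  -- The Gram matrix is invertible by positive definiteness; otherwise its inverse would be the
  -- default value 0.
  have hunit : IsUnit G.det := by
    rw [← Matrix.isUnit_iff_isUnit_det, ← Matrix.mulVec_injective_iff_isUnit]
    refine (injective_iff_map_eq_zero (Matrix.mulVecLin G)).2 fun c hc ↦ ?_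
    have h1 : ∀ a, sphereMetric F p (f a) (∑ b, c b • f b) = 0 := fun a ↦ by
      have h2 := congrFun hc a
      simp only [Matrix.mulVecLin_apply, Matrix.mulVec, dotProduct, Pi.zero_apply] at h2
      rw [sphereMetric_sum_right _ hF, ← h2]
      exact Finset.sum_congr rfl fun b _ ↦ (sphereMetric_smul_right hF p _ _ _).trans (mul_comm _ _)
    have h3 : sphereMetric F p (∑ b, c b • f b) (∑ b, c b • f b) = 0 := by
      rw [sphereMetric_sum_left _ hF]
      simp only [sphereMetric_smul_left hF, h1, mul_zero, Finset.sum_const_zero]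
    have h4 : ∑ b, c b • f b = 0 := by
      by_contra h
      exact (sphereMetric_pos hF p h).ne' h3
    have h5 := congrArg (coordEquiv (q := q) p.proj p.proj) h4
    rw [map_sum, map_zero] at h5
    simp only [map_smul, hf, coordEquiv_stdFrame hx] at h5
    funext j
    have := congrArg (fun v : FibModel q ↦ v j) h5
    simpa [Pi.single_apply] using this
  -- Lowering the raised index of A on frame vectors. Multilinearity then extends this to arbitrary
  -- w, v and u in turn.
  have hcore : ∀ i k l, ∑ j, cartanCoeff F p j i k * sphereMetric F p (f j) (f l) =
      cartanTensor F (taut F p) (f l) (f i) (f k) := by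
    intro i k l
    have h1 : ∀ a, ∑ j, G⁻¹ j a * G j l = if a = l then 1 else 0 := fun a ↦ by
      have hs : G.transpose = G := by
        ext a b
        exact sphereMetric_comm hF p _ _
      have h2 := congrFun (congrFun (Matrix.mul_nonsing_inv G hunit) l) a
      rw [Matrix.mul_apply, Matrix.one_apply] at h2
      simp only [eq_comm (a := a)]
      rw [← h2]
      refine Finset.sum_congr rfl fun j _ ↦ ?_
      rw [mul_comm, ← congrFun (congrFun hs l) j, Matrix.transpose_apply]
    have h3 : ∀ j, cartanCoeff F p j i k = ∑ a, G⁻¹ j a * cartanTensor F (taut F p) (f a) (f i) (f k) :=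
      fun j ↦ rfl
    have h4 : ∀ j, sphereMetric F p (f j) (f l) = G j l := fun j ↦ rfl
    simp only [h3, h4, Finset.sum_mul]
    rw [Finset.sum_comm]
    have h5 : ∀ a, ∑ j, G⁻¹ j a * cartanTensor F (taut F p) (f a) (f i) (f k) * G j l =
        (∑ j, G⁻¹ j a * G j l) * cartanTensor F (taut F p) (f a) (f i) (f k) := fun a ↦ by
      rw [Finset.sum_mul]
      exact Finset.sum_congr rfl fun j _ ↦ by ring
    simp only [h5, h1, ite_mul, one_mul, zero_mul, Finset.sum_ite_eq', Finset.mem_univ, if_true]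
  have hcore2 : ∀ i k v, sphereMetric F p (∑ j, cartanCoeff F p j i k • f j) v =
      cartanTensor F (taut F p) v (f i) (f k) := fun i k v ↦ by
    rw [hexp v, cartanTensor_sum_smul_left _ hF, sphereMetric_sum_right _ hF]
    refine Finset.sum_congr rfl fun l _ ↦ ?_
    rw [sphereMetric_smul_right hF, sphereMetric_sum_left _ hF, ← hcore]
    simp only [sphereMetric_smul_left hF]
  have hcore3 : ∀ i, sphereMetric F p (∑ j, ∑ k, cartanCoeff F p j i k • stdCoord q p.proj k w • f j) v =
      cartanTensor F (taut F p) v (f i) w := fun i ↦ by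
    conv_rhs => rw [hexp w]
    rw [cartanTensor_sum_smul_right _ hF, Finset.sum_comm, sphereMetric_sum_left _ hF]
    refine Finset.sum_congr rfl fun k _ ↦ ?_
    rw [← hcore2, ← sphereMetric_smul_left hF, Finset.smul_sum]
    simp only [smul_comm (stdCoord q p.proj k w)]
  conv_rhs => rw [hexp u]
  rw [cartanTensor_sum_smul_mid _ hF, sphereMetric_sum_left _ hF]
  refine Finset.sum_congr rfl fun i _ ↦ ?_
  rw [sphereMetric_smul_left hF, ← hcore3]

end Metric

end

section

variable {m q : ℕ} {M : Type*} [TopologicalSpace M]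
  [ChartedSpace (EuclideanSpace ℝ (Fin m)) M]
  {E : M → Type*} [∀ x, AddCommGroup (E x)] [∀ x, Module ℝ (E x)]
  [TopologicalSpace (TotalSpace (FibModel q) E)] [∀ x, TopologicalSpace (E x)]
  [FiberBundle (FibModel q) E] [VectorBundle ℝ (FibModel q) E]
  {F : TotalSpace (FibModel q) E → ℝ}
  [IsManifold (𝓡 m) ∞ M] [ContMDiffVectorBundle ∞ (FibModel q) E (𝓡 m)]

/-! ### Smooth sections of the pulled-back bundle -/

section SmoothSections

lemma eventually_mem_triv {x₀ : M} {p : SphereBundle q E} (hp : p.proj ∈ (triv q E x₀).baseSet) :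
    ∀ᶠ s in 𝓝 p, s.proj ∈ (triv q E x₀).baseSet :=
  (FiberBundle.continuous_proj (UnitSphere q) (RayFiber q E)).continuousAt.preimage_mem_nhds
    ((triv q E x₀).open_baseSet.mem_nhds hp)

/-- Smoothness at `p` of a section of `π^*E`. -/
abbrev SmoothSectionAt (X : (s : SphereBundle q E) → PullbackBundle m q E s) (p : SphereBundle q E) : Prop :=
  ContMDiffAt (sphereModel m q) ((sphereModel m q).prod 𝓘(ℝ, FibModel q)) ∞
    (fun s ↦ TotalSpace.mk' (FibModel q) s (X s)) p

lemma smoothSectionAt_iff {x₀ : M} {p : SphereBundle q E} (hp : p.proj ∈ (triv q E x₀).baseSet)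
    (X : (s : SphereBundle q E) → PullbackBundle m q E s) :
    SmoothSectionAt X p ↔ ContMDiffAt (sphereModel m q) 𝓘(ℝ, FibModel q) ∞
      (fun s : SphereBundle q E ↦ coordEquiv (q := q) (E := E) x₀ s.proj (X s)) p := by
  have : MemTrivializationAtlas ((triv q E x₀).pullback (sphereProj m q E)) :=
    ⟨⟨triv q E x₀, inferInstance, rfl⟩⟩
  refine (((triv q E x₀).pullback (sphereProj m q E)).contMDiffAt_section_iff (x₀ := p) hp).trans ?_
  refine Filter.EventuallyEq.contMDiffAt_iff ?_
  filter_upwards [eventually_mem_triv hp] with s hs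
  exact (fiberEquiv_apply (triv q E x₀) hs (X s)).symm

lemma IsFinslerMetric.smoothSectionAt_taut (hF : IsFinslerMetric m F) (p : SphereBundle q E) :
    SmoothSectionAt (m := m) (fun s ↦ (taut F s : E s.proj)) p := by
  refine (smoothSectionAt_iff (mem_triv p.proj) _).2 ?_
  have h := contMDiffAt_snd.comp p
    ((contMDiffAt_triv (m := m) (triv q E p.proj) (y := tautLift F p) (mem_triv p.proj)).comp p
      (hF.contMDiffAt_tautLift p))
  refine h.congr_of_eventuallyEq ?_
  filter_upwards [eventually_mem_triv (mem_triv p.proj)] with s hs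
  exact fiberEquiv_apply _ hs _

lemma smoothSectionAt_stdFrame {x₀ : M} {p : SphereBundle q E} (hp : p.proj ∈ (triv q E x₀).baseSet)
    (i : Fin (q + 1)) : SmoothSectionAt (m := m) (pullbackSection m q (stdFrame (E := E) q x₀ i)) p := by
  refine (smoothSectionAt_iff hp _).2 ((contMDiffAt_const (c := EuclideanSpace.single i (1 : ℝ))).congr_of_eventuallyEq ?_)
  filter_upwards [eventually_mem_triv hp] with s hs
  exact coordEquiv_stdFrame hs i

/-- The second derivatives of `F²` along the fibres are smooth. -/
lemma IsFinslerMetric.contMDiffAt_fderiv_fiberSq (hF : IsFinslerMetric m F) (x₀ : M) {x : M}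
    (hx : x ∈ (triv q E x₀).baseSet) {u : FibModel q} (hu : u ≠ 0) :
    ContMDiffAt (totalModel m q) 𝓘(ℝ, FibModel q →L[ℝ] FibModel q →L[ℝ] ℝ) ∞
      (fun z : M × FibModel q ↦ fderiv ℝ (fderiv ℝ (fiberSq F (triv q E x₀) z.1)) z.2) (x, u) :=
  contMDiffAt_partial_fderiv (f := fun z ↦ fderiv ℝ (fiberSq F (triv q E x₀) z.1) z.2)
    (contMDiffAt_partial_fderiv (f := fun z ↦ fiberSq F (triv q E x₀) z.1 z.2)
      (hF.contMDiffAt_fiberSq (triv q E x₀) hx hu))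

lemma contMDiffAt_sphereMetric (hF : IsFinslerMetric m F) {p : SphereBundle q E}
    {X Y : (s : SphereBundle q E) → PullbackBundle m q E s} (hX : SmoothSectionAt X p)
    (hY : SmoothSectionAt Y p) :
    ContMDiffAt (sphereModel m q) 𝓘(ℝ) ∞ (fun s ↦ sphereMetric F s (X s) (Y s)) p := by
  have hp : p.proj ∈ (triv q E p.proj).baseSet := mem_triv _
  have h1 := (smoothSectionAt_iff hp _).1 hX
  have h2 := (smoothSectionAt_iff hp _).1 hY
  have h3 := (smoothSectionAt_iff hp _).1 (hF.smoothSectionAt_taut p)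
  have h4 : ContMDiffAt (sphereModel m q) 𝓘(ℝ, FibModel q →L[ℝ] FibModel q →L[ℝ] ℝ) ∞
      (fun s : SphereBundle q E ↦ fderiv ℝ (fderiv ℝ (fiberSq F (triv q E p.proj) s.proj))
        (coordEquiv p.proj s.proj (taut F s))) p :=
    ContMDiffAt.comp (g := fun z : M × FibModel q ↦ fderiv ℝ (fderiv ℝ (fiberSq F (triv q E p.proj) z.1)) z.2)
      p (hF.contMDiffAt_fderiv_fiberSq p.proj hp ((LinearEquiv.map_ne_zero_iff _).2 (hF.taut_ne_zero p)))
      ((contMDiff_sphereProj m q E p).prodMk h3)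
  have h5 := (contMDiffAt_const (c := (1 / 2 : ℝ))).mul ((h4.clm_apply h1).clm_apply h2)
  refine h5.congr_of_eventuallyEq ?_
  filter_upwards [eventually_mem_triv hp] with s hs
  exact sphereMetric_eq hF hs _ _

end SmoothSections

/-! ### Vertical derivatives of the metric -/

section VerticalDerivative

variable (F) in
/-- The function `g(𝔰ₐ, 𝔰_b)` on `E`. -/
def frameTensor (x₀ : M) (a b : Fin (q + 1)) (y : TotalSpace (FibModel q) E) : ℝ :=
  fundamentalTensor F y.2 (stdFrame q x₀ a y.proj) (stdFrame q x₀ b y.proj)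

lemma contMDiffAt_frameTensor (hF : IsFinslerMetric m F) {x₀ : M} (a b : Fin (q + 1))
    {y : TotalSpace (FibModel q) E} (hx : y.proj ∈ (triv q E x₀).baseSet) (hy : y.2 ≠ 0) :
    ContMDiffAt (totalModel m q) 𝓘(ℝ) ∞ (frameTensor F x₀ a b) y := by
  have h1 := contMDiffAt_triv (m := m) (triv q E x₀) hx
  have h2 : ((triv q E x₀) y).2 ≠ 0 := by
    rw [← fiberEquiv_apply (triv q E x₀) hx y.2]
    exact (LinearEquiv.map_ne_zero_iff _).2 hy
  have h4 : ContMDiffAt (totalModel m q) 𝓘(ℝ, FibModel q →L[ℝ] FibModel q →L[ℝ] ℝ) ∞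
      (fun y : TotalSpace (FibModel q) E ↦ fderiv ℝ (fderiv ℝ (fiberSq F (triv q E x₀) y.proj))
        ((triv q E x₀) y).2) y :=
    ContMDiffAt.comp (g := fun z : M × FibModel q ↦ fderiv ℝ (fderiv ℝ (fiberSq F (triv q E x₀) z.1)) z.2)
      y (hF.contMDiffAt_fderiv_fiberSq x₀ hx h2)
      ((contMDiffAt_proj E).prodMk (contMDiffAt_snd.comp y h1))
  have h5 := (contMDiffAt_const (c := (1 / 2 : ℝ))).mul ((h4.clm_apply
    (contMDiffAt_const (c := EuclideanSpace.single a (1 : ℝ)))).clm_apply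
    (contMDiffAt_const (c := EuclideanSpace.single b (1 : ℝ))))
  refine h5.congr_of_eventuallyEq ?_
  filter_upwards [(FiberBundle.continuous_proj (FibModel q) E).continuousAt.preimage_mem_nhds
    ((triv q E x₀).open_baseSet.mem_nhds hx), isOpen_ne_zero.mem_nhds hy] with y' h6 h7
  rw [frameTensor, fundamentalTensor_eq (triv q E x₀) hF h6 h7]
  rw [show fiberEquiv (triv q E x₀) y'.proj (stdFrame q x₀ a y'.proj) = _ from coordEquiv_stdFrame h6 a,
    show fiberEquiv (triv q E x₀) y'.proj (stdFrame q x₀ b y'.proj) = _ from coordEquiv_stdFrame h6 b,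
    fiberEquiv_apply _ h6]
  rfl

/-- By homogeneity of degree zero, a metric coefficient on SE lifts to the fundamental tensor on all
of E ∖ 0, so it can be differentiated there in every vertical direction, radial ones included. -/
lemma frameTensor_tautLift_toSphere (hF : IsFinslerMetric m F) (x₀ : M) (a b : Fin (q + 1))
    (p₀ : SphereBundle q E) {y : TotalSpace (FibModel q) E} (hy : y.2 ≠ 0) :
    frameTensor F x₀ a b (tautLift F (toSphere p₀ y)) = frameTensor F x₀ a b y := by
  rw [show y = ⟨y.proj, y.2⟩ from rfl, hF.tautLift_toSphere p₀ hy]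
  exact fundamentalTensor_smul hF _ _ _ (inv_pos.2 (hF.pos hy))

variable (Θ : EhresmannConnection m q E)

lemma verticalLift_isVertical (hF : IsFinslerMetric m F) (p : SphereBundle q E)
    (ξ : TangentSpace (sphereModel m q) p) :
    mfderiv (totalModel m q) (𝓡 m) (π (FibModel q) E) (tautLift F p) (verticalLift F Θ p ξ) = 0 :=
  Θ.isVertical _ (hF.taut_ne_zero p) _

/-- The derivative along `verticalProj ξ` of a function on `SE` is the derivative of its lift to `E ∖ 0`. -/
lemma mfderiv_verticalProj {B : Type*} [NormedAddCommGroup B] [NormedSpace ℝ B] {H : Type*}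
    [TopologicalSpace H] {J : ModelWithCorners ℝ B H} {S : Type*} [TopologicalSpace S] [ChartedSpace H S]
    (hF : IsFinslerMetric m F) (p : SphereBundle q E)
    {f : SphereBundle q E → S} (hf : MDifferentiableAt (sphereModel m q) J f p)
    (ξ : TangentSpace (sphereModel m q) p) :
    (mfderiv (sphereModel m q) J f p : (EuclideanSpace ℝ (Fin m) × EuclideanSpace ℝ (Fin q)) →L[ℝ] B)
        (verticalProj F Θ p ξ) =
      (mfderiv (totalModel m q) J (fun y ↦ f (toSphere p y)) (tautLift F p) :
        (EuclideanSpace ℝ (Fin m) × FibModel q) →L[ℝ] B) (verticalLift F Θ p ξ) := by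
  have h := hF.toSphere_tautLift p p
  have h1 : HasMFDerivAt (sphereModel m q) J f (toSphere p (tautLift F p))
      (mfderiv (sphereModel m q) J f (toSphere p (tautLift F p))) := by
    rw [h]
    exact hf.hasMFDerivAt
  have h2 := ((contMDiffAt_toSphere (m := m) p (y := tautLift F p) (hF.taut_ne_zero p)).mdifferentiableAt
    (by simp)).hasMFDerivAt
  have h3 := (h1.comp _ h2).mfderiv
  have h4 := congrArg (fun L : (EuclideanSpace ℝ (Fin m) × FibModel q) →L[ℝ] B ↦
    L (verticalLift F Θ p ξ)) h3
  refine Eq.trans ?_ h4.symm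
  have h5 : ∀ p' : SphereBundle q E, p' = p →
      (mfderiv (sphereModel m q) J f p : (EuclideanSpace ℝ (Fin m) × EuclideanSpace ℝ (Fin q)) →L[ℝ] B) =
      (mfderiv (sphereModel m q) J f p' : (EuclideanSpace ℝ (Fin m) × EuclideanSpace ℝ (Fin q)) →L[ℝ] B) := by
    rintro _ rfl
    rfl
  exact congrArg (fun L : (EuclideanSpace ℝ (Fin m) × EuclideanSpace ℝ (Fin q)) →L[ℝ] B ↦
    L (verticalProj F Θ p ξ)) (h5 _ h)

lemma mfderiv_sphereProj_verticalProj (hF : IsFinslerMetric m F) (p : SphereBundle q E)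
    (ξ : TangentSpace (sphereModel m q) p) :
    mfderiv (sphereModel m q) (𝓡 m) (π (UnitSphere q) (RayFiber q E)) p (verticalProj F Θ p ξ) = 0 := by
  refine (mfderiv_verticalProj Θ hF p ((contMDiff_sphereProj m q E).mdifferentiable (by simp) p) ξ).trans ?_
  have h : mfderiv (totalModel m q) (𝓡 m) (fun y ↦ (toSphere p y).proj) (tautLift F p) =
      mfderiv (totalModel m q) (𝓡 m) (π (FibModel q) E) (tautLift F p) := by
    refine Filter.EventuallyEq.mfderiv_eq ?_
    filter_upwards [isOpen_ne_zero.mem_nhds (show (tautLift F p).2 ≠ 0 from hF.taut_ne_zero p)] with y hy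
    rw [show y = ⟨y.proj, y.2⟩ from rfl, toSphere_of_ne p hy]
  refine (congrArg (fun L : (EuclideanSpace ℝ (Fin m) × FibModel q) →L[ℝ] EuclideanSpace ℝ (Fin m) ↦
    L (verticalLift F Θ p ξ)) h).trans ?_
  exact verticalLift_isVertical Θ hF p ξ

/-- `∂g_{ab}/∂yᵏ δyᵏ = 2 A_{abk} δyᵏ`. -/
lemma mfderiv_sphereMetric_verticalProj (hF : IsFinslerMetric m F) {x₀ : M} {p : SphereBundle q E}
    (hp : p.proj ∈ (triv q E x₀).baseSet) (a b : Fin (q + 1)) (ξ : TangentSpace (sphereModel m q) p) :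
    (mfderiv (sphereModel m q) 𝓘(ℝ) (fun s : SphereBundle q E ↦ sphereMetric F s (stdFrame q x₀ a s.proj)
      (stdFrame q x₀ b s.proj)) p : (EuclideanSpace ℝ (Fin m) × EuclideanSpace ℝ (Fin q)) →L[ℝ] ℝ)
      (verticalProj F Θ p ξ) =
    2 * cartanTensor F (taut F p) (deltaY F Θ p ξ) (stdFrame q x₀ a p.proj) (stdFrame q x₀ b p.proj) := by
  have hf := (contMDiffAt_sphereMetric hF (smoothSectionAt_stdFrame (m := m) hp a)
    (smoothSectionAt_stdFrame hp b)).mdifferentiableAt (by simp)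
  refine (mfderiv_verticalProj Θ hF p hf ξ).trans ?_
  have hy : (tautLift F p).2 ≠ 0 := hF.taut_ne_zero p
  have h1 : mfderiv (totalModel m q) 𝓘(ℝ) (fun y : TotalSpace (FibModel q) E ↦ sphereMetric F
      (toSphere p y) (stdFrame q x₀ a (toSphere p y).proj) (stdFrame q x₀ b (toSphere p y).proj))
      (tautLift F p) = mfderiv (totalModel m q) 𝓘(ℝ) (frameTensor F x₀ a b) (tautLift F p) := by
    refine Filter.EventuallyEq.mfderiv_eq ?_
    filter_upwards [isOpen_ne_zero.mem_nhds hy] with y hy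
    exact frameTensor_tautLift_toSphere hF x₀ a b p hy
  refine (congrArg (fun L : (EuclideanSpace ℝ (Fin m) × FibModel q) →L[ℝ] ℝ ↦
    L (verticalLift F Θ p ξ)) h1).trans ?_
  set η : FibModel q := mfderiv (totalModel m q) 𝓘(ℝ, FibModel q) (fun z ↦ (triv q E p.proj z).2)
    (tautLift F p) (verticalLift F Θ p ξ) with hη
  have hpp : p.proj ∈ (triv q E p.proj).baseSet := mem_triv _
  refine (mfderiv_apply_vertical (triv q E p.proj) (mem_triv p.proj)
    ((contMDiffAt_frameTensor hF a b (y := tautLift F p) hp hy).mdifferentiableAt (by simp))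
    (verticalLift_isVertical Θ hF p ξ)).trans ?_
  have hδ : deltaY F Θ p ξ = (coordEquiv p.proj p.proj).symm η := by
    rw [coordEquiv, fiberEquiv_of_mem _ hpp]
    exact (triv q E p.proj).symmL_apply (R := ℝ) hpp η
  set L := coordEquiv (q := q) (E := E) p.proj p.proj with hL
  set A : E p.proj := stdFrame q x₀ a p.proj with hA
  set B : E p.proj := stdFrame q x₀ b p.proj with hB
  change fderiv ℝ (fun u ↦ fundamentalTensor (E := E) F (L.symm u) A B) (L (taut F p)) η = _
  have hd : DifferentiableAt ℝ (fun u ↦ fundamentalTensor (E := E) F (L.symm u) A B) (L (taut F p)) := by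
    have h2 : L (taut F p) ≠ 0 := (LinearEquiv.map_ne_zero_iff _).2 hy
    have h3 : ContDiffAt ℝ ∞ (fderiv ℝ (fderiv ℝ (fiberSq F (triv q E p.proj) p.proj))) (L (taut F p)) :=
      ((hF.contDiffAt_fiberSq _ hpp h2).fderiv_right (m := ∞) (by simp)).fderiv_right (by simp)
    have h4 := (((h3.differentiableAt (by simp)).clm_apply (differentiableAt_const (L A))).clm_apply
      (differentiableAt_const (L B))).const_mul (1 / 2)
    refine h4.congr_of_eventuallyEq ?_
    filter_upwards [isOpen_ne.mem_nhds h2] with u hu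
    refine (fundamentalTensor_eq (triv q E p.proj) hF hpp ((LinearEquiv.map_ne_zero_iff L.symm).2 hu)
      A B).trans ?_
    rw [show fiberEquiv (triv q E p.proj) p.proj (L.symm u) = u from L.apply_symm_apply u]
  rw [← hd.lineDeriv_eq_fderiv, hδ]
  have h5 := lineDeriv_comp_linearEquiv L (fun y ↦ fundamentalTensor F y A B) (taut F p) (L.symm η)
  rw [LinearEquiv.apply_symm_apply] at h5
  rw [← h5, cartanTensor]
  have h6 := hF.apply_taut p
  rw [tautLift] at h6
  rw [h6]
  simp only [fundamentalTensor]
  rw [lineDeriv, lineDeriv, deriv_const_mul_field]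
  -- The derivative of ½(F²)'' is twice the Cartan tensor, whose prefactor F/4 is ¼ at ℓ.
  have h7 : ∀ a b : ℝ, a = b → 1 / 2 * a = 2 * (1 / 4 * b) := fun a b h ↦ by rw [h]; ring
  exact h7 _ _ rfl

end VerticalDerivative

end

section

/-! ### Smooth vector fields under tangent maps -/

section TangentMaps

variable {B : Type*} [NormedAddCommGroup B] [NormedSpace ℝ B] {H : Type*} [TopologicalSpace H]
  {I : ModelWithCorners ℝ B H} {S : Type*} [TopologicalSpace S] [ChartedSpace H S] [IsManifold I ∞ S]
  {B' : Type*} [NormedAddCommGroup B'] [NormedSpace ℝ B'] {H' : Type*} [TopologicalSpace H']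
  {I' : ModelWithCorners ℝ B' H'} {S' : Type*} [TopologicalSpace S'] [ChartedSpace H' S'] [IsManifold I' ∞ S']
  {B₀ : Type*} [NormedAddCommGroup B₀] [NormedSpace ℝ B₀] {H₀ : Type*} [TopologicalSpace H₀]
  {I₀ : ModelWithCorners ℝ B₀ H₀} {S₀ : Type*} [TopologicalSpace S₀] [ChartedSpace H₀ S₀]

/-- The map is smooth only on an open set, as for the quotient map off the zero section or an
inverse chart on its target, so the tangent map within that set is used. -/
lemma contMDiffAt_mfderiv_apply {f : S → S'} {U : Set S} (hU : IsOpen U)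
    (hf : ∀ s ∈ U, ContMDiffAt I I' ∞ f s) {b : S₀ → S} {v : (n : S₀) → TangentSpace I (b n)} {p : S₀}
    (hp : b p ∈ U) (hv : ContMDiffAt I₀ (I.prod 𝓘(ℝ, B)) ∞ (fun n ↦ TotalSpace.mk' B (b n) (v n)) p) :
    ContMDiffAt I₀ (I'.prod 𝓘(ℝ, B')) ∞
      (fun n ↦ TotalSpace.mk' B' (E := (TangentSpace I' : S' → Type _)) (f (b n)) (mfderiv I I' f (b n) (v n))) p := by
  have h1 : ContMDiffOn I I' ∞ f U := fun s hs ↦ (hf s hs).contMDiffWithinAt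
  have h2 := h1.contMDiffOn_tangentMapWithin (m := ∞) (by simp) hU.uniqueMDiffOn
  have hb : ContMDiffAt I₀ I ∞ b p := (contMDiffAt_proj (IB := I) (TangentSpace I : S → Type _)).comp p hv
  have h3 : ContMDiffAt I.tangent I'.tangent ∞ (tangentMapWithin I I' f U) (TotalSpace.mk' B (b p) (v p)) := by
    refine h2.contMDiffAt ((FiberBundle.continuous_proj B (TangentSpace I : S → Type _)).continuousAt.preimage_mem_nhds ?_)
    exact hU.mem_nhds hp
  refine (h3.comp p hv).congr_of_eventuallyEq ?_
  filter_upwards [hb.continuousAt.preimage_mem_nhds (hU.mem_nhds hp)] with n hn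
  exact (tangentMapWithin_eq_tangentMap (p := TotalSpace.mk' B (b n) (v n)) (hU.uniqueMDiffWithinAt hn)
    ((hf _ hn).mdifferentiableAt (by simp))).symm

end TangentMaps

variable {m q : ℕ} {M : Type*} [TopologicalSpace M]
  [ChartedSpace (EuclideanSpace ℝ (Fin m)) M]
  {E : M → Type*} [∀ x, AddCommGroup (E x)] [∀ x, Module ℝ (E x)]
  [TopologicalSpace (TotalSpace (FibModel q) E)] [∀ x, TopologicalSpace (E x)]
  [FiberBundle (FibModel q) E] [VectorBundle ℝ (FibModel q) E]
  {F : TotalSpace (FibModel q) E → ℝ}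
  [IsManifold (𝓡 m) ∞ M] [ContMDiffVectorBundle ∞ (FibModel q) E (𝓡 m)]

/-- Smoothness at `p` of a vector field on `SE`. -/
abbrev SmoothFieldAt (V : (s : SphereBundle q E) → TangentSpace (sphereModel m q) s) (p : SphereBundle q E) :
    Prop :=
  ContMDiffAt (sphereModel m q) ((sphereModel m q).prod 𝓘(ℝ, EuclideanSpace ℝ (Fin m) × EuclideanSpace ℝ (Fin q)))
    ∞ (fun s ↦ TotalSpace.mk' (EuclideanSpace ℝ (Fin m) × EuclideanSpace ℝ (Fin q))
      (E := (TangentSpace (sphereModel m q) : SphereBundle q E → Type _)) s (V s)) p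

/-- The projection is a composition of three smooth bundle maps: the tangent map of the lift, the
connection form, and the tangent map of the quotient. -/
lemma SmoothFieldAt.verticalProj (hF : IsFinslerMetric m F) (Θ : EhresmannConnection m q E)
    {V : (s : SphereBundle q E) → TangentSpace (sphereModel m q) s} {p : SphereBundle q E}
    (hV : SmoothFieldAt V p) : SmoothFieldAt (fun s ↦ verticalProj F Θ s (V s)) p := by
  have h1 := contMDiffAt_mfderiv_apply (I := sphereModel m q) (I' := totalModel m q) (f := tautLift F) isOpen_univ
    (fun s _ ↦ hF.contMDiffAt_tautLift s) (mem_univ p) hV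
  have hn : (tautLift F p).2 ≠ 0 := hF.taut_ne_zero p
  have h2 := ContMDiffAt.clm_bundle_apply (E₁ := (TangentSpace (totalModel m q) : TotalSpace (FibModel q) E → Type _))
    (E₂ := (TangentSpace (totalModel m q) : TotalSpace (FibModel q) E → Type _)) (b := tautLift F)
    (ϕ := fun s ↦ Θ.form (tautLift F s)) (ContMDiffAt.comp p
    (Θ.smooth.contMDiffAt (isOpen_ne_zero.mem_nhds hn)) (hF.contMDiffAt_tautLift p)) h1
  have h3 := contMDiffAt_mfderiv_apply (I := totalModel m q) (I' := sphereModel m q) (f := toSphere p)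
    isOpen_ne_zero (fun y hy ↦ contMDiffAt_toSphere p hy) hn h2
  refine h3.congr_of_eventuallyEq (Filter.Eventually.of_forall fun s ↦ ?_)
  have h4 : ∀ (s' : SphereBundle q E) (w w' : EuclideanSpace ℝ (Fin m) × EuclideanSpace ℝ (Fin q)), s' = s →
      w = w' → TotalSpace.mk' (EuclideanSpace ℝ (Fin m) × EuclideanSpace ℝ (Fin q))
      (E := (TangentSpace (sphereModel m q) : SphereBundle q E → Type _)) s w = TotalSpace.mk' _ s' w' := by
    rintro _ w _ rfl rfl
    rfl
  refine h4 _ _ _ (hF.toSphere_tautLift p s) ?_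
  -- The default value of the quotient map changes with s, but it is taken only on the zero section,
  -- away from ℓ.
  have h5 : (mfderiv (totalModel m q) (sphereModel m q) (toSphere s) (tautLift F s) :
      (EuclideanSpace ℝ (Fin m) × FibModel q) →L[ℝ] (EuclideanSpace ℝ (Fin m) × EuclideanSpace ℝ (Fin q))) =
      mfderiv (totalModel m q) (sphereModel m q) (toSphere p) (tautLift F s) := by
    have h6 : (toSphere s : TotalSpace (FibModel q) E → SphereBundle q E) =ᶠ[𝓝 (tautLift F s)] toSphere p := by
      filter_upwards [isOpen_ne_zero.mem_nhds (show (tautLift F s).2 ≠ 0 from hF.taut_ne_zero s)] with y hy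
      exact (toSphere_of_ne s hy).trans (toSphere_of_ne p hy).symm
    have h7 := h6.mfderiv_eq (I := totalModel m q) (I' := sphereModel m q)
    exact h7
  exact congrArg (fun L : (EuclideanSpace ℝ (Fin m) × FibModel q) →L[ℝ]
    (EuclideanSpace ℝ (Fin m) × EuclideanSpace ℝ (Fin q)) ↦ L (verticalLift F Θ s (V s))) h5

variable [∀ x, IsTopologicalAddGroup (E x)] [∀ x, ContinuousSMul ℝ (E x)]

/-! ### Locality and the Leibniz rule for connections -/

section Leibniz

lemma SmoothSectionAt.mdifferentiableAt {X : (s : SphereBundle q E) → PullbackBundle m q E s}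
    {p : SphereBundle q E} (h : SmoothSectionAt X p) :
    MDifferentiableAt (sphereModel m q) ((sphereModel m q).prod 𝓘(ℝ, FibModel q))
      (fun s ↦ TotalSpace.mk' (FibModel q) s (X s)) p :=
  ContMDiffAt.mdifferentiableAt h (by simp)

lemma connection_congr (N : Connection m q E) {X Y : (s : SphereBundle q E) → PullbackBundle m q E s}
    {p : SphereBundle q E} (hX : SmoothSectionAt X p) (h : ∀ᶠ s in 𝓝 p, X s = Y s) :
    N X p = N Y p := by
  have hY : SmoothSectionAt Y p := ContMDiffAt.congr_of_eventuallyEq hX (h.mono fun s hs ↦ by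
    exact congrArg (TotalSpace.mk' (FibModel q) s) hs.symm)
  exact (N.isCovariantDerivativeOn (s := univ)).congr_of_eventuallyEq hX.mdifferentiableAt
    hY.mdifferentiableAt Filter.univ_mem h

lemma SmoothSectionAt.sum_smul {ι : Type*} (t : Finset ι) {g : ι → SphereBundle q E → ℝ}
    {X : ι → (s : SphereBundle q E) → PullbackBundle m q E s} {p : SphereBundle q E}
    (hg : ∀ i ∈ t, ContMDiffAt (sphereModel m q) 𝓘(ℝ) ∞ (g i) p) (hX : ∀ i ∈ t, SmoothSectionAt (X i) p) :
    SmoothSectionAt (fun s ↦ ∑ i ∈ t, g i s • X i s) p :=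
  ContMDiffAt.sum_section fun i hi ↦ (hg i hi).smul_section (hX i hi)

lemma connection_sum_smul (N : Connection m q E) {ι : Type*} (t : Finset ι) {g : ι → SphereBundle q E → ℝ}
    {X : ι → (s : SphereBundle q E) → PullbackBundle m q E s} {p : SphereBundle q E}
    (hg : ∀ i ∈ t, ContMDiffAt (sphereModel m q) 𝓘(ℝ) ∞ (g i) p) (hX : ∀ i ∈ t, SmoothSectionAt (X i) p)
    (ξ : TangentSpace (sphereModel m q) p) :
    N (fun s ↦ ∑ i ∈ t, g i s • X i s) p ξ =
      ∑ i ∈ t, (g i p • N (X i) p ξ + mvfderiv (sphereModel m q) (g i) p ξ • X i p) := by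
  classical
  induction t using Finset.induction_on with
  | empty =>
    have h : N (fun s ↦ 0) p = 0 := (N.isCovariantDerivativeOn (s := univ)).zero
    simp only [Finset.sum_empty, h]
    rfl
  | insert i t hi ih =>
    have h1 := ih (fun j hj ↦ hg j (Finset.mem_insert_of_mem hj)) (fun j hj ↦ hX j (Finset.mem_insert_of_mem hj))
    have h2 := SmoothSectionAt.sum_smul t (fun j hj ↦ hg j (Finset.mem_insert_of_mem hj))
      (fun j hj ↦ hX j (Finset.mem_insert_of_mem hj))
    have hgi := hg i (Finset.mem_insert_self i t)
    have hXi := hX i (Finset.mem_insert_self i t)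
    have h3 : SmoothSectionAt (g i • X i) p := hgi.smul_section hXi
    have h4 := (N.isCovariantDerivativeOn (s := univ)).add h3.mdifferentiableAt h2.mdifferentiableAt
    have h5 := (N.isCovariantDerivativeOn (s := univ)).leibniz hXi.mdifferentiableAt
      (hgi.mdifferentiableAt (by simp))
    rw [Finset.sum_insert hi, ← h1]
    simp only [Finset.sum_insert hi]
    refine (congrArg (fun L : _ →L[ℝ] PullbackBundle m q E p ↦ L ξ) h4).trans ?_
    rw [h5]
    rfl

end Leibniz

end

section

lemma sum_smulRight_sub_apply {ι κ l T V : Type*} [Fintype ι] [Fintype κ] [Fintype l] [AddCommGroup T]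
    [Module ℝ T] [TopologicalSpace T] [IsTopologicalAddGroup T] [ContinuousSMul ℝ T] [AddCommGroup V]
    [Module ℝ V] [TopologicalSpace V] [IsTopologicalAddGroup V] [ContinuousSMul ℝ V]
    (c : ι → V →L[ℝ] ℝ) (A : ι → κ → l → ℝ) (d : l → T →L[ℝ] ℝ) (f : κ → V) (G : ι → T →L[ℝ] V) (u : V) (ξ : T) :
    (∑ i, ContinuousLinearMap.smulRight (c i) ((∑ j, ∑ k, A i j k • (d k).smulRight (f j)) - G i) :
      V →L[ℝ] T →L[ℝ] V) u ξ = ∑ i, c i u • (∑ j, ∑ k, A i j k • d k ξ • f j) - ∑ i, c i u • G i ξ := by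
  rw [← Finset.sum_sub_distrib, _root_.sum_apply, _root_.sum_apply]
  refine Finset.sum_congr rfl fun i _ ↦ ?_
  rw [ContinuousLinearMap.smulRight_apply, smul_apply, sub_apply, smul_sub, _root_.sum_apply]
  simp only [_root_.sum_apply, smul_apply, ContinuousLinearMap.smulRight_apply]

variable {m q : ℕ} {M : Type*} [TopologicalSpace M]
  [ChartedSpace (EuclideanSpace ℝ (Fin m)) M]
  {E : M → Type*} [∀ x, AddCommGroup (E x)] [∀ x, Module ℝ (E x)]
  [TopologicalSpace (TotalSpace (FibModel q) E)] [∀ x, TopologicalSpace (E x)]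
  [FiberBundle (FibModel q) E] [VectorBundle ℝ (FibModel q) E]
  {F : TotalSpace (FibModel q) E → ℝ}
  [IsManifold (𝓡 m) ∞ M] [ContMDiffVectorBundle ∞ (FibModel q) E (𝓡 m)]
  [∀ x, IsTopologicalAddGroup (E x)] [∀ x, ContinuousSMul ℝ (E x)]
  (Θ : EhresmannConnection m q E) (D : Connection m q E)

/-! ### The modified connection: compatibility and smoothness -/

section ModifiedConnection

variable (m) in
/-- The section `𝔰ₐ` of `π^*E`. -/
abbrev pullbackFrame (x₀ : M) (a : Fin (q + 1)) : (s : SphereBundle q E) → PullbackBundle m q E s :=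
  pullbackSection m q (stdFrame q x₀ a)

/-- The derivative `D_ξ X`, as a vector of `E x`. -/
def Connection.deriv (X : (s : SphereBundle q E) → PullbackBundle m q E s) (p : SphereBundle q E)
    (ξ : TangentSpace (sphereModel m q) p) : E p.proj := D X p ξ

lemma modifiedConnection_deriv (X : (s : SphereBundle q E) → PullbackBundle m q E s) (p : SphereBundle q E)
    (u : E p.proj) (hu : u = X p) (ξ : TangentSpace (sphereModel m q) p) :
    (modifiedConnection F Θ D).deriv X p ξ = D.deriv X p ξ +
      (∑ i, stdCoord q p.proj i u • (∑ j, ∑ k, cartanCoeff F p j i k •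
        stdCoord q p.proj k (deltaY F Θ p ξ) • stdFrame q p.proj j p.proj) -
      ∑ i, stdCoord q p.proj i u • D.deriv (pullbackFrame m p.proj i) p (verticalProj F Θ p ξ)) := by
  subst hu
  exact congrArg (fun v : E p.proj ↦ D.deriv X p ξ + v) (sum_smulRight_sub_apply
    (fun i ↦ stdCoord q p.proj i) (fun i j k ↦ cartanCoeff F p j i k)
    (fun k ↦ (stdCoord q p.proj k).comp (deltaY F Θ p)) (fun j ↦ stdFrame q p.proj j p.proj)
    (fun i ↦ (D (pullbackFrame m p.proj i) p).comp (verticalProj F Θ p)) (X p : E p.proj) ξ)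

/-- The vertical part of the connection form of `D` does not depend on the trivialization. -/
lemma sum_smul_connection_vertical (x₀ : M) {p : SphereBundle q E} (hp : p.proj ∈ (triv q E x₀).baseSet)
    (u : E p.proj) {v : TangentSpace (sphereModel m q) p}
    (hv : mfderiv (sphereModel m q) (𝓡 m) (π (UnitSphere q) (RayFiber q E)) p v = 0) :
    ∑ i, stdCoord q p.proj i u • D.deriv (pullbackFrame m p.proj i) p v =
      ∑ a, (coordEquiv x₀ p.proj u : FibModel q) a • D.deriv (pullbackFrame m x₀ a) p v := by
  have hpp : p.proj ∈ (triv q E p.proj).baseSet := mem_triv _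
  let h : Fin (q + 1) → Fin (q + 1) → M → ℝ := fun a i x ↦
    (coordEquiv p.proj x (stdFrame (E := E) q x₀ a x) : FibModel q) i
  have hsm : ∀ a i, ContMDiffAt (𝓡 m) 𝓘(ℝ) ∞ (h a i) p.proj := fun a i ↦ by
    have h1 := (triv q E p.proj).contMDiffAt_section_iff (IB := 𝓡 m) (n := ∞) hpp |>.1
      (contMDiffAt_localFrame_of_mem (I := 𝓡 m) ∞ (triv q E x₀) (EuclideanSpace.basisFun _ ℝ).toBasis a hp)
    have h2 : ContMDiffAt 𝓘(ℝ, FibModel q) 𝓘(ℝ) ∞ (fun w : FibModel q ↦ w i)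
        ((triv q E p.proj) ⟨p.proj, stdFrame q x₀ a p.proj⟩).2 :=
      (EuclideanSpace.proj (𝕜 := ℝ) i : FibModel q →L[ℝ] ℝ).contDiff.contDiffAt.contMDiffAt
    refine (h2.comp p.proj h1).congr_of_eventuallyEq ?_
    filter_upwards [(triv q E p.proj).open_baseSet.mem_nhds hpp] with x hx
    exact congrArg (fun w : FibModel q ↦ w i) (fiberEquiv_apply _ hx _)
  have hsm' : ∀ a i, ContMDiffAt (sphereModel m q) 𝓘(ℝ) ∞ (fun s : SphereBundle q E ↦ h a i s.proj) p :=
    fun a i ↦ ContMDiffAt.comp p (hsm a i) (contMDiff_sphereProj m q E p)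
  -- The transition functions are pulled back from M, so the inhomogeneous term of the Leibniz rule
  -- vanishes on vertical vectors.
  have hd : ∀ a i, mvfderiv (sphereModel m q) (fun s : SphereBundle q E ↦ h a i s.proj) p v = 0 := fun a i ↦ by
    have h1 := mfderiv_comp p ((hsm a i).mdifferentiableAt (by simp))
      ((contMDiff_sphereProj m q E p).mdifferentiableAt (by simp))
    refine (congrArg (fun L : (EuclideanSpace ℝ (Fin m) × EuclideanSpace ℝ (Fin q)) →L[ℝ] ℝ ↦ L v) h1).trans ?_
    refine (congrArg (fun w : EuclideanSpace ℝ (Fin m) ↦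
      (mfderiv (𝓡 m) 𝓘(ℝ) (h a i) p.proj : EuclideanSpace ℝ (Fin m) →L[ℝ] ℝ) w) hv).trans ?_
    exact map_zero _
  have hD : ∀ a, D.deriv (pullbackFrame m x₀ a) p v =
      ∑ i, h a i p.proj • D.deriv (pullbackFrame m p.proj i) p v := fun a ↦ by
    have h1 := connection_congr D (smoothSectionAt_stdFrame (m := m) hp a)
      (Y := fun s ↦ ∑ i, h a i s.proj • pullbackFrame m p.proj i s) (by
        filter_upwards [eventually_mem_triv hpp] with s hs
        exact (sum_coordEquiv_smul_stdFrame hs _).symm)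
    have h2 := connection_sum_smul D Finset.univ (g := fun i s ↦ h a i s.proj)
      (X := fun i ↦ pullbackFrame m p.proj i) (fun i _ ↦ hsm' a i)
      (fun i _ ↦ smoothSectionAt_stdFrame (m := m) hpp i) v
    simp only [hd, zero_smul, add_zero] at h2
    exact (congrArg (fun L : _ →L[ℝ] PullbackBundle m q E p ↦ L v) h1).trans h2
  simp only [hD, Finset.smul_sum]
  rw [Finset.sum_comm]
  refine Finset.sum_congr rfl fun i _ ↦ ?_
  simp only [smul_smul]
  rw [← Finset.sum_smul, stdCoord_eq]
  congr 1
  have h3 := congrArg (fun w ↦ (coordEquiv (q := q) p.proj p.proj w : FibModel q) i) (sum_coordEquiv_smul_stdFrame hp u)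
  rw [← h3]
  simp only [map_sum, map_smul]
  simp [h]

/-- The difference of `D` and the modified connection, as a skew-symmetric bilinear form. -/
lemma sphereMetric_modifiedConnection (hF : IsFinslerMetric m F) (hDF : IsMetricCompatible F D) (x₀ : M)
    {p : SphereBundle q E} (hp : p.proj ∈ (triv q E x₀).baseSet)
    (X : (s : SphereBundle q E) → PullbackBundle m q E s) (ξ : TangentSpace (sphereModel m q) p) (u w : E p.proj)
    (hu : u = X p) : sphereMetric F p ((modifiedConnection F Θ D).deriv X p ξ) w = sphereMetric F p (D.deriv X p ξ) w +
      1 / 2 * ∑ a, ∑ b, (coordEquiv x₀ p.proj u : FibModel q) a * (coordEquiv x₀ p.proj w : FibModel q) b *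
        (sphereMetric F p (D.deriv (pullbackFrame m x₀ b) p (verticalProj F Θ p ξ)) (stdFrame q x₀ a p.proj) -
          sphereMetric F p (D.deriv (pullbackFrame m x₀ a) p (verticalProj F Θ p ξ)) (stdFrame q x₀ b p.proj)) := by
  set v := verticalProj F Θ p ξ with hv
  set cu : FibModel q := coordEquiv x₀ p.proj u with hcu
  set cw : FibModel q := coordEquiv x₀ p.proj w with hcw
  have h1 : sphereMetric F p ((modifiedConnection F Θ D).deriv X p ξ) w = sphereMetric F p (D.deriv X p ξ) w +
      (cartanTensor F (taut F p) w u (deltaY F Θ p ξ) -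
        ∑ a, cu a * sphereMetric F p (D.deriv (pullbackFrame m x₀ a) p v) w) := by
    rw [modifiedConnection_deriv Θ D X p u hu ξ, sphereMetric_add_left hF, sphereMetric_sub_left hF, sphereMetric_cartanCoeff hF,
      sum_smul_connection_vertical D x₀ hp u (mfderiv_sphereProj_verticalProj Θ hF p ξ),
      sphereMetric_sum_left _ hF]
    simp only [sphereMetric_smul_left hF, ← hcu]
    rfl
  -- Compatibility of D in the vertical direction: A is the symmetric part of the vertical
  -- coefficients ϱ.
  have h2 : ∀ a b, 2 * cartanTensor F (taut F p) (deltaY F Θ p ξ) (stdFrame q x₀ a p.proj) (stdFrame q x₀ b p.proj) =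
      sphereMetric F p (D.deriv (pullbackFrame m x₀ a) p v) (stdFrame q x₀ b p.proj) +
        sphereMetric F p (stdFrame q x₀ a p.proj) (D.deriv (pullbackFrame m x₀ b) p v) := fun a b ↦ by
    refine (mfderiv_sphereMetric_verticalProj Θ hF hp a b ξ).symm.trans ?_
    exact hDF p _ _ (SmoothSectionAt.mdifferentiableAt (smoothSectionAt_stdFrame hp a))
      (SmoothSectionAt.mdifferentiableAt (smoothSectionAt_stdFrame hp b)) v
  have h3 : cartanTensor F (taut F p) w u (deltaY F Θ p ξ) = ∑ a, ∑ b, cu a * cw b *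
      cartanTensor F (taut F p) (deltaY F Θ p ξ) (stdFrame q x₀ a p.proj) (stdFrame q x₀ b p.proj) := by
    rw [cartanTensor_swap_right hF, cartanTensor_swap_left hF, cartanTensor_swap_right hF]
    conv_lhs => rw [← sum_coordEquiv_smul_stdFrame hp u, ← sum_coordEquiv_smul_stdFrame hp w]
    rw [cartanTensor_sum_smul_mid _ hF]
    refine Finset.sum_congr rfl fun a _ ↦ ?_
    rw [cartanTensor_sum_smul_right _ hF, Finset.mul_sum]
    exact Finset.sum_congr rfl fun b _ ↦ (mul_assoc _ _ _).symm
  have h4 : ∀ a, sphereMetric F p (D.deriv (pullbackFrame m x₀ a) p v) w =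
      ∑ b, cw b * sphereMetric F p (D.deriv (pullbackFrame m x₀ a) p v) (stdFrame q x₀ b p.proj) := fun a ↦ by
    conv_lhs => rw [← sum_coordEquiv_smul_stdFrame hp w]
    rw [sphereMetric_sum_right _ hF]
    exact Finset.sum_congr rfl fun b _ ↦ sphereMetric_smul_right hF p _ _ _
  rw [h1, h3]
  simp only [h4, Finset.mul_sum]
  rw [← Finset.sum_sub_distrib]
  congr 1
  refine Finset.sum_congr rfl fun a _ ↦ ?_
  rw [← Finset.sum_sub_distrib]
  refine Finset.sum_congr rfl fun b _ ↦ ?_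
  have h5 := h2 a b
  rw [sphereMetric_comm hF p (stdFrame q x₀ a p.proj)] at h5
  -- A_{ab} - ϱ_{ab} = ½(ϱ_{ba} - ϱ_{ab}), in which the Cartan tensor no longer occurs.
  linear_combination (1 / 2 * cu a * cw b) * h5

/-- The modified connection is compatible with `g`. -/
lemma isMetricCompatible_modifiedConnection (hF : IsFinslerMetric m F) (hDF : IsMetricCompatible F D) :
    IsMetricCompatible F (modifiedConnection F Θ D) := by
  intro p X Y hX hY ξ
  have h1 := sphereMetric_modifiedConnection Θ D hF hDF p.proj (mem_triv _) X ξ (X p) (Y p) rfl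
  have h2 := sphereMetric_modifiedConnection Θ D hF hDF p.proj (mem_triv _) Y ξ (Y p) (X p) rfl
  refine (hDF p X Y hX hY ξ).trans ?_
  set cu : FibModel q := coordEquiv p.proj p.proj (X p)
  set cw : FibModel q := coordEquiv p.proj p.proj (Y p)
  have h3 : sphereMetric F p ((modifiedConnection F Θ D).deriv X p ξ) (Y p) +
      sphereMetric F p ((modifiedConnection F Θ D).deriv Y p ξ) (X p) =
      sphereMetric F p (D.deriv X p ξ) (Y p) + sphereMetric F p (D.deriv Y p ξ) (X p) := by
    rw [h1, h2, add_add_add_comm, add_eq_left, ← mul_add]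
    refine mul_eq_zero_of_right _ ?_
    -- Exchanging the roles of X and Y transposes the double sum, and the skew correction cancels.
    conv_lhs => arg 2; rw [Finset.sum_comm]
    rw [← Finset.sum_add_distrib]
    refine Finset.sum_eq_zero fun a _ ↦ ?_
    rw [← Finset.sum_add_distrib]
    refine Finset.sum_eq_zero fun b _ ↦ ?_
    ring
  have h4 := fun (N : Connection m q E) ↦ sphereMetric_comm hF p (X p) (N.deriv Y p ξ)
  exact (congrArg (_ + ·) (h4 D)).trans (h3.symm.trans (congrArg (_ + ·) (h4 _).symm))

lemma SmoothSectionAt.connection (hD : IsSmoothConnection D) {X : (s : SphereBundle q E) → PullbackBundle m q E s}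
    {p : SphereBundle q E} (hX : ∀ᶠ s in 𝓝 p, SmoothSectionAt X s)
    {V : (s : SphereBundle q E) → TangentSpace (sphereModel m q) s} (hV : SmoothFieldAt V p) :
    SmoothSectionAt (fun s ↦ D X s (V s)) p := by
  obtain ⟨U, hU, hUo, hpU⟩ := eventually_nhds_iff.1 hX
  have h1 := (hD U hUo).contMDiff (σ := X) (fun s hs ↦ ContMDiffAt.contMDiffWithinAt (hU s hs))
  exact ContMDiffAt.clm_bundle_apply
    (E₁ := (TangentSpace (sphereModel m q) : SphereBundle q E → Type _))
    (E₂ := PullbackBundle m q E) (b := fun s ↦ s) (ϕ := fun s ↦ D X s) (v := V)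
    (h1.contMDiffAt (hUo.mem_nhds hpU)) hV

/-- The definition of ∇ uses a trivialization that changes with the point, so smoothness cannot be
read off from it. The skew formula uses one fixed trivialization and only D, g and the vertical
projection, all of them smooth. -/
lemma contMDiffAt_sphereMetric_modifiedConnection (hF : IsFinslerMetric m F) (hD : IsSmoothConnection D)
    (hDF : IsMetricCompatible F D) {p : SphereBundle q E}
    {X Y : (s : SphereBundle q E) → PullbackBundle m q E s} (hX : ∀ᶠ s in 𝓝 p, SmoothSectionAt X s)
    (hY : SmoothSectionAt Y p) {V : (s : SphereBundle q E) → TangentSpace (sphereModel m q) s}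
    (hV : SmoothFieldAt V p) :
    ContMDiffAt (sphereModel m q) 𝓘(ℝ) ∞
      (fun s ↦ sphereMetric F s (modifiedConnection F Θ D X s (V s)) (Y s)) p := by
  have hp : p.proj ∈ (triv q E p.proj).baseSet := mem_triv _
  have hfr : ∀ a, SmoothSectionAt (pullbackFrame (E := E) m p.proj a) p := fun a ↦ smoothSectionAt_stdFrame hp a
  have hfr' : ∀ a, ∀ᶠ s in 𝓝 p, SmoothSectionAt (pullbackFrame (E := E) m p.proj a) s := fun a ↦ by
    filter_upwards [eventually_mem_triv hp] with s hs
    exact smoothSectionAt_stdFrame hs a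
  have hc : ∀ {Z : (s : SphereBundle q E) → PullbackBundle m q E s}, SmoothSectionAt Z p → ∀ a,
      ContMDiffAt (sphereModel m q) 𝓘(ℝ) ∞
        (fun s : SphereBundle q E ↦ (coordEquiv (E := E) p.proj s.proj (Z s) : FibModel q) a) p := by
    intro Z hZ a
    exact ((EuclideanSpace.proj (𝕜 := ℝ) a : FibModel q →L[ℝ] ℝ).contDiff.contDiffAt.contMDiffAt).comp p
      ((smoothSectionAt_iff hp Z).1 hZ)
  have hvp := hV.verticalProj hF Θ
  have hDa := fun a ↦ SmoothSectionAt.connection D hD (hfr' a) hvp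
  have h1 := (contMDiffAt_sphereMetric hF (SmoothSectionAt.connection D hD hX hV) hY).add
    ((contMDiffAt_const (c := (1 / 2 : ℝ))).mul (contMDiffAt_finsetSum (t := Finset.univ) fun a _ ↦
      contMDiffAt_finsetSum (t := Finset.univ) fun b _ ↦ ((hc hX.self_of_nhds a).mul (hc hY b)).mul
        ((contMDiffAt_sphereMetric hF (hDa b) (hfr a)).sub (contMDiffAt_sphereMetric hF (hDa a) (hfr b)))))
  refine h1.congr_of_eventuallyEq ?_
  filter_upwards [eventually_mem_triv hp] with s hs
  exact sphereMetric_modifiedConnection Θ D hF hDF p.proj hs X (V s) (X s) (Y s) rfl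

end ModifiedConnection

end

section

/-! ### Smoothness of one-forms tested on vector fields -/

section OneForms

variable {B : Type*} [NormedAddCommGroup B] [NormedSpace ℝ B] [FiniteDimensional ℝ B]
  {H : Type*} [TopologicalSpace H] {I : ModelWithCorners ℝ B H} [I.Boundaryless]
  {S : Type*} [TopologicalSpace S] [ChartedSpace H S] [IsManifold I ∞ S]

/-- A one-form is smooth if its values on smooth vector fields are. -/
lemma SmoothFormAt.of_apply {α : DiffForm I S 1} {p : S}
    (h : ∀ V : (s : S) → TangentSpace I s, ContMDiffAt I (I.prod 𝓘(ℝ, B)) ∞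
      (fun s ↦ TotalSpace.mk' B (E := (TangentSpace I : S → Type _)) s (V s)) p →
      ContMDiffAt I 𝓘(ℝ) ∞ (fun s ↦ α s (fun _ ↦ V s)) p) : SmoothFormAt I α p := by
  refine contDiffAt_form_iff.2 fun w ↦ ?_
  -- The vector field that is constant in the chart at p.
  let V : (s : S) → TangentSpace I s := fun s ↦
    (mfderiv 𝓘(ℝ, B) I (extChartAt I p).symm (extChartAt I p s) : B →L[ℝ] B) (w 0)
  have hz := mem_extChartAt_target (I := I) p
  have hconst : ContMDiffAt I (𝓘(ℝ, B).prod 𝓘(ℝ, B)) ∞ (fun s ↦ TotalSpace.mk' B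
      (E := (TangentSpace 𝓘(ℝ, B) : B → Type _)) (extChartAt I p s) (w 0)) p := by
    refine Bundle.contMDiffAt_totalSpace.2 ⟨contMDiffAt_extChartAt, ?_⟩
    refine (contMDiffAt_const (c := w 0)).congr_of_eventuallyEq (.of_forall fun s ↦ ?_)
    exact congrArg Prod.snd (trivializationAt_model_space_apply (I := 𝓘(ℝ, B)) _ _)
  have hV := contMDiffAt_mfderiv_apply (I := 𝓘(ℝ, B)) (I' := I) (f := (extChartAt I p).symm)
    (isOpen_extChartAt_target p) (fun z hz ↦ contMDiffAt_extChartAt_symm' hz) hz hconst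
  have hV' : ContMDiffAt I (I.prod 𝓘(ℝ, B)) ∞
      (fun s ↦ TotalSpace.mk' B (E := (TangentSpace I : S → Type _)) s (V s)) p := by
    refine hV.congr_of_eventuallyEq ?_
    filter_upwards [extChartAt_source_mem_nhds (I := I) p] with s hs
    have h4 : ∀ (s' : S) (v : B), s' = s → TotalSpace.mk' B (E := (TangentSpace I : S → Type _)) s v =
        TotalSpace.mk' B s' v := by
      rintro _ v rfl
      rfl
    exact h4 _ _ ((extChartAt I p).left_inv hs)
  have h1 := h V hV'
  rw [← extChartAt_to_inv (I := I) p] at h1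
  have h2 := (h1.comp _ (contMDiffAt_extChartAt_symm' hz)).contDiffAt
  refine h2.congr_of_eventuallyEq ?_
  filter_upwards [extChartAt_target_mem_nhds (I := I) p] with z hz'
  have h5 : ∀ z' : B, z' = z → ∀ s, α s (fun i ↦ (mfderiv 𝓘(ℝ, B) I (extChartAt I p).symm z : B →L[ℝ] B) (w i)) =
      α s (fun _ ↦ (mfderiv 𝓘(ℝ, B) I (extChartAt I p).symm z' : B →L[ℝ] B) (w 0)) := by
    rintro _ rfl s
    refine congrArg _ (funext fun i ↦ ?_)
    rw [Subsingleton.elim i 0]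
  exact h5 _ ((extChartAt I p).right_inv hz') _

end OneForms

variable {m q : ℕ} {M : Type*} [TopologicalSpace M]
  [ChartedSpace (EuclideanSpace ℝ (Fin m)) M]
  {E : M → Type*} [∀ x, AddCommGroup (E x)] [∀ x, Module ℝ (E x)]
  [TopologicalSpace (TotalSpace (FibModel q) E)] [∀ x, TopologicalSpace (E x)]
  [FiberBundle (FibModel q) E] [VectorBundle ℝ (FibModel q) E]
  {F : TotalSpace (FibModel q) E → ℝ}
  [IsManifold (𝓡 m) ∞ M] [ContMDiffVectorBundle ∞ (FibModel q) E (𝓡 m)]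
  [∀ x, IsTopologicalAddGroup (E x)] [∀ x, ContinuousSMul ℝ (E x)]
  {o : ∀ x, Orientation ℝ (E x) (Fin (q + 1))}
  (Θ : EhresmannConnection m q E) (D N : Connection m q E)

/-! ### Connection forms of orthonormal frames -/

section FrameForms

variable (e e' : OrthonormalFrame (m := m) F o)

/-- The value at `p` of a vector of the frame. -/
def OrthonormalFrame.vecAt (i : Fin (q + 1)) (p : SphereBundle q E) : E p.proj := e.vec i p

lemma OrthonormalFrame.sphereMetric_vecAt {p : SphereBundle q E} (hp : p ∈ e.domain) (i j : Fin (q + 1)) :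
    sphereMetric F p (e.vecAt i p) (e.vecAt j p) = if i = j then 1 else 0 := e.orthonormal p hp i j

lemma OrthonormalFrame.smoothSectionAt {p : SphereBundle q E} (hp : p ∈ e.domain) (i : Fin (q + 1)) :
    SmoothSectionAt (e.vec i) p := e.isLocalFrame.contMDiffAt e.isOpen_domain hp i

lemma OrthonormalFrame.sum_coeff {p : SphereBundle q E} (hp : p ∈ e.domain) (v : E p.proj) :
    ∑ i, e.isLocalFrame.coeff i p v • e.vecAt i p = v := by
  have h := (e.isLocalFrame.toBasisAt hp).sum_repr v
  refine Eq.trans (Finset.sum_congr rfl fun i _ ↦ ?_) h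
  rw [IsLocalFrameOn.toBasisAt_coe, IsLocalFrameOn.coeff, dif_pos hp]
  rfl

lemma OrthonormalFrame.coeff_eq (hF : IsFinslerMetric m F) {p : SphereBundle q E} (hp : p ∈ e.domain)
    (v : E p.proj) (j : Fin (q + 1)) : e.isLocalFrame.coeff j p v = sphereMetric F p v (e.vecAt j p) := by
  conv_rhs => rw [← e.sum_coeff hp v]
  rw [sphereMetric_sum_left _ hF]
  simp only [sphereMetric_smul_left hF, e.sphereMetric_vecAt hp, mul_ite, mul_one, mul_zero,
    Finset.sum_ite_eq', Finset.mem_univ, if_true]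

lemma OrthonormalFrame.sum_sphereMetric_smul (hF : IsFinslerMetric m F) {p : SphereBundle q E} (hp : p ∈ e.domain)
    (v : E p.proj) : ∑ j, sphereMetric F p v (e.vecAt j p) • e.vecAt j p = v := by
  simp only [← e.coeff_eq hF hp, e.sum_coeff hp]

lemma connForm_apply (hF : IsFinslerMetric m F) {p : SphereBundle q E} (hp : p ∈ e.domain) (i j : Fin (q + 1))
    (ξ : TangentSpace (sphereModel m q) p) :
    connForm N e i j p (fun _ ↦ ξ) = sphereMetric F p (N.deriv (e.vec i) p ξ) (e.vecAt j p) :=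
  e.coeff_eq hF hp (N.deriv (e.vec i) p ξ) j

lemma one_form_ext {T : Type*} [AddCommGroup T] [Module ℝ T] {α β : T [⋀^Fin 1]→ₗ[ℝ] ℝ}
    (h : ∀ ξ, α (fun _ ↦ ξ) = β (fun _ ↦ ξ)) : α = β := by
  ext v
  rw [show v = fun _ ↦ v 0 from funext fun i ↦ by rw [Subsingleton.elim i 0]]
  exact h _

variable {N}

lemma IsMetricCompatible.mfderiv_eq (hN : IsMetricCompatible F N) {p : SphereBundle q E} (hp : p ∈ e.domain)
    (hp' : p ∈ e'.domain) (i j : Fin (q + 1)) (ξ : TangentSpace (sphereModel m q) p) :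
    mvfderiv (sphereModel m q) (fun s ↦ sphereMetric F s (e'.vecAt i s) (e.vecAt j s)) p ξ =
      sphereMetric F p (N.deriv (e'.vec i) p ξ) (e.vecAt j p) +
        sphereMetric F p (e'.vecAt i p) (N.deriv (e.vec j) p ξ) :=
  hN p _ _ (e'.smoothSectionAt hp' i).mdifferentiableAt (e.smoothSectionAt hp j).mdifferentiableAt ξ

lemma connForm_antisymm (hF : IsFinslerMetric m F) (hN : IsMetricCompatible F N) {p : SphereBundle q E}
    (hp : p ∈ e.domain) (i j : Fin (q + 1)) : connForm N e j i p = -connForm N e i j p := by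
  refine one_form_ext fun ξ ↦ ?_
  have h1 := hN.mfderiv_eq e e hp hp i j ξ
  have h2 : (fun s ↦ sphereMetric F s (e.vecAt i s) (e.vecAt j s)) =ᶠ[𝓝 p] fun _ ↦ if i = j then (1 : ℝ) else 0 := by
    filter_upwards [e.isOpen_domain.mem_nhds hp] with s hs
    exact e.sphereMetric_vecAt hs i j
  have h3 : mvfderiv (sphereModel m q) (fun s ↦ sphereMetric F s (e.vecAt i s) (e.vecAt j s)) p ξ = 0 := by
    have h4 := h2.mfderiv_eq (I := sphereModel m q) (I' := 𝓘(ℝ))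
    rw [mfderiv_const] at h4
    exact congrArg (fun L : (EuclideanSpace ℝ (Fin m) × EuclideanSpace ℝ (Fin q)) →L[ℝ] ℝ ↦ L ξ) h4
  rw [h3, sphereMetric_comm hF p (e.vecAt i p), ← connForm_apply N e hF hp, ← connForm_apply N e hF hp] at h1
  rw [AlternatingMap.neg_apply]
  linarith

/-- With G = (g(e'ᵢ, eⱼ)), compatibility differentiates G, and skew symmetry turns the second term
into -GW. This is the gauge relation W'G = dG + GW. -/
lemma connForm_frame_change (hF : IsFinslerMetric m F) (hN : IsMetricCompatible F N) {p : SphereBundle q E}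
    (hp : p ∈ e.domain) (hp' : p ∈ e'.domain) (i j : Fin (q + 1)) (ξ : TangentSpace (sphereModel m q) p) :
    ∑ k, connForm N e' i k p (fun _ ↦ ξ) * sphereMetric F p (e'.vecAt k p) (e.vecAt j p) =
      mvfderiv (sphereModel m q) (fun s ↦ sphereMetric F s (e'.vecAt i s) (e.vecAt j s)) p ξ +
        ∑ k, sphereMetric F p (e'.vecAt i p) (e.vecAt k p) * connForm N e k j p (fun _ ↦ ξ) := by
  have h1 : sphereMetric F p (N.deriv (e'.vec i) p ξ) (e.vecAt j p) =
      ∑ k, connForm N e' i k p (fun _ ↦ ξ) * sphereMetric F p (e'.vecAt k p) (e.vecAt j p) := by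
    conv_lhs => rw [← e'.sum_sphereMetric_smul hF hp' (N.deriv (e'.vec i) p ξ)]
    rw [sphereMetric_sum_left _ hF]
    refine Finset.sum_congr rfl fun k _ ↦ ?_
    rw [sphereMetric_smul_left hF, connForm_apply N e' hF hp']
  have h2 : sphereMetric F p (e'.vecAt i p) (N.deriv (e.vec j) p ξ) =
      -∑ k, sphereMetric F p (e'.vecAt i p) (e.vecAt k p) * connForm N e k j p (fun _ ↦ ξ) := by
    conv_lhs => rw [← e.sum_sphereMetric_smul hF hp (N.deriv (e.vec j) p ξ)]
    rw [sphereMetric_sum_right _ hF, ← Finset.sum_neg_distrib]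
    refine Finset.sum_congr rfl fun k _ ↦ ?_
    rw [sphereMetric_smul_right hF, connForm_antisymm e hF hN hp j k, AlternatingMap.neg_apply,
      connForm_apply N e hF hp]
    ring
  rw [hN.mfderiv_eq e e' hp hp' i j ξ, h1, h2]
  ring

lemma smoothFormAt_connForm (hF : IsFinslerMetric m F) (hD : IsSmoothConnection D) (hDF : IsMetricCompatible F D)
    {p : SphereBundle q E} (hp : p ∈ e.domain) (i j : Fin (q + 1)) :
    SmoothFormAt (sphereModel m q) (connForm (modifiedConnection F Θ D) e i j) p := by
  refine SmoothFormAt.of_apply fun V hV ↦ ?_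
  have h := contMDiffAt_sphereMetric_modifiedConnection Θ D hF hD hDF (X := e.vec i)
    (by filter_upwards [e.isOpen_domain.mem_nhds hp] with s hs using e.smoothSectionAt hs i)
    (e.smoothSectionAt hp j) hV
  refine h.congr_of_eventuallyEq ?_
  filter_upwards [e.isOpen_domain.mem_nhds hp] with s hs
  exact connForm_apply _ e hF hs i j (V s)

end FrameForms

/-! ### Independence of the Pfaffian from the frame -/

section FrameIndependence

variable (e e' : OrthonormalFrame (m := m) F o) {p : SphereBundle q E}

lemma OrthonormalFrame.transition_orthogonal (hF : IsFinslerMetric m F) (hp : p ∈ e.domain) (hp' : p ∈ e'.domain)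
    (k l : Fin (q + 1)) : ∑ i, sphereMetric F p (e'.vecAt i p) (e.vecAt k p) *
      sphereMetric F p (e'.vecAt i p) (e.vecAt l p) = if k = l then 1 else 0 := by
  rw [← e.sphereMetric_vecAt hp k l]
  conv_rhs => rw [← e'.sum_sphereMetric_smul hF hp' (e.vecAt k p)]
  rw [sphereMetric_sum_left _ hF]
  refine Finset.sum_congr rfl fun i _ ↦ ?_
  rw [sphereMetric_smul_left hF, sphereMetric_comm hF p (e.vecAt k p)]

variable {e e' D}

lemma curvForm_frame_change (hF : IsFinslerMetric m F) (hD : IsSmoothConnection D) (hDF : IsMetricCompatible F D)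
    (hp : p ∈ e.domain) (hp' : p ∈ e'.domain) (i j : Fin (q + 1)) :
    ∑ k, sphereMetric F p (e'.vecAt k p) (e.vecAt j p) • curvForm (modifiedConnection F Θ D) e' i k p =
      ∑ k, sphereMetric F p (e'.vecAt i p) (e.vecAt k p) • curvForm (modifiedConnection F Θ D) e k j p := by
  have hn : ∀ᶠ s in 𝓝 p, s ∈ e.domain ∧ s ∈ e'.domain :=
    (e.isOpen_domain.eventually_mem hp).and (e'.isOpen_domain.eventually_mem hp')
  refine curvOf_frame_change (W := connForm (modifiedConnection F Θ D) e)
    (W' := connForm (modifiedConnection F Θ D) e')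
    (g := fun i j s ↦ sphereMetric F s (e'.vecAt i s) (e.vecAt j s)) ?_ ?_ ?_ i j
  · filter_upwards [hn] with s hs i j
    exact ⟨smoothFormAt_connForm Θ D e hF hD hDF hs.1 i j, smoothFormAt_connForm Θ D e' hF hD hDF hs.2 i j⟩
  · filter_upwards [hn] with s hs i j
    exact contMDiffAt_sphereMetric hF (e'.smoothSectionAt hs.2 i) (e.smoothSectionAt hs.1 j)
  · filter_upwards [hn] with s hs i j ξ
    exact connForm_frame_change e e' hF (isMetricCompatible_modifiedConnection Θ D hF hDF) hs.1 hs.2 i j ξ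

lemma pfaffian_frame_change (hF : IsFinslerMetric m F) (hD : IsSmoothConnection D) (hDF : IsMetricCompatible F D)
    (hp : p ∈ e.domain) (hp' : p ∈ e'.domain) :
    pfaffian (modifiedConnection F Θ D) e' p hp' = pfaffian (modifiedConnection F Θ D) e p hp := by
  have hb : ∀ i, e'.isLocalFrame.toBasisAt hp' i = ∑ j, sphereMetric F p (e'.vecAt i p) (e.vecAt j p) •
      e.isLocalFrame.toBasisAt hp j := fun i ↦ by
    simp only [IsLocalFrameOn.toBasisAt_coe]
    exact (e.sum_sphereMetric_smul hF hp (e'.vecAt i p)).symm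
  have h1 := berezin_congr (det_eq_of_orthogonal (e.transition_orthogonal e' hF hp hp') hb
    ((e.oriented p hp).trans (e'.oriented p hp').symm))
  have h2 : curvElement (modifiedConnection F Θ D) e' p = curvElement (modifiedConnection F Θ D) e p :=
    curvElt_frame_change (e := fun i ↦ e.vec i p) (e' := fun i ↦ e'.vec i p)
      (e.transition_orthogonal e' hF hp hp') (fun i ↦ (e.sum_sphereMetric_smul hF hp (e'.vecAt i p)).symm)
      (curvForm_frame_change Θ hF hD hDF hp hp')
  rw [pfaffian, pfaffian, h1, h2]

end FrameIndependence

end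

section

/-! ### Skew symmetry of the curvature forms -/

section CurvatureSymmetry

variable {B : Type*} [NormedAddCommGroup B] [NormedSpace ℝ B] [FiniteDimensional ℝ B]
  {H : Type*} [TopologicalSpace H] {I : ModelWithCorners ℝ B H} [I.Boundaryless]
  {S : Type*} [TopologicalSpace S] [ChartedSpace H S] [IsManifold I ∞ S] {q : ℕ}

lemma curvOf_antisymm {W : Fin (q + 1) → Fin (q + 1) → DiffForm I S 1} {p : S}
    (h : ∀ᶠ s in 𝓝 p, ∀ i j, SmoothFormAt I (W i j) s ∧ W j i s = -W i j s) (i j : Fin (q + 1)) :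
    curvOf W j i p = -curvOf W i j p := by
  have h1 := ((isCurvatureAt_chart h).curv_antisymm (finBasis ℝ B)
    (EuclideanSpace.basisFun (Fin (q + 1)) ℝ).toBasis).self_of_nhds i j
  rw [chartForm_self, chartForm_self] at h1
  exact h1

end CurvatureSymmetry

variable {m q : ℕ} {M : Type*} [TopologicalSpace M]
  [ChartedSpace (EuclideanSpace ℝ (Fin m)) M]
  {E : M → Type*} [∀ x, AddCommGroup (E x)] [∀ x, Module ℝ (E x)]
  [TopologicalSpace (TotalSpace (FibModel q) E)] [∀ x, TopologicalSpace (E x)]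
  [FiberBundle (FibModel q) E] [VectorBundle ℝ (FibModel q) E]
  {F : TotalSpace (FibModel q) E → ℝ}
  [IsManifold (𝓡 m) ∞ M] [ContMDiffVectorBundle ∞ (FibModel q) E (𝓡 m)]
  [∀ x, IsTopologicalAddGroup (E x)] [∀ x, ContinuousSMul ℝ (E x)]
  {o : ∀ x, Orientation ℝ (E x) (Fin (q + 1))}
  (Θ : EhresmannConnection m q E) {D : Connection m q E}

/-! ### Chern's forms of adapted frames -/

section AdaptedFrames

variable {e e' : OrthonormalFrame (m := m) F o} {p : SphereBundle q E}

lemma eventually_connForm (hF : IsFinslerMetric m F) (hD : IsSmoothConnection D)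
    (hDF : IsMetricCompatible F D) (hp : p ∈ e.domain) : ∀ᶠ s in 𝓝 p, ∀ i j,
      SmoothFormAt (sphereModel m q) (connForm (modifiedConnection F Θ D) e i j) s ∧
        connForm (modifiedConnection F Θ D) e j i s = -connForm (modifiedConnection F Θ D) e i j s := by
  filter_upwards [e.isOpen_domain.eventually_mem hp] with s hs i j
  exact ⟨smoothFormAt_connForm Θ D e hF hD hDF hs i j,
    connForm_antisymm e hF (isMetricCompatible_modifiedConnection Θ D hF hDF) hs i j⟩

lemma curvForm_antisymm (hF : IsFinslerMetric m F) (hD : IsSmoothConnection D)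
    (hDF : IsMetricCompatible F D) (hp : p ∈ e.domain) (i j : Fin (q + 1)) :
    curvForm (modifiedConnection F Θ D) e j i p = -curvForm (modifiedConnection F Θ D) e i j p :=
  curvOf_antisymm (W := connForm (modifiedConnection F Θ D) e) (eventually_connForm Θ hF hD hDF hp) i j

/-- Both frames end in ℓ, so the last column of the transition matrix is constant. The term dG drops
out there, and the forms ϖᵢⁿ transform like a vector. -/
lemma connForm_last_frame_change {N : Connection m q E} (hF : IsFinslerMetric m F)
    (hN : IsMetricCompatible F N) (he : e.IsAdapted) (he' : e'.IsAdapted) (hp : p ∈ e.domain)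
    (hp' : p ∈ e'.domain) (i : Fin (q + 1)) : connForm N e' i (Fin.last q) p =
      ∑ k, sphereMetric F p (e'.vecAt i p) (e.vecAt k p) • connForm N e k (Fin.last q) p := by
  have hlast : ∀ s ∈ e.domain, s ∈ e'.domain → ∀ k, sphereMetric F s (e'.vecAt k s) (e.vecAt (Fin.last q) s) =
      if k = Fin.last q then 1 else 0 := fun s hs hs' k ↦ by
    have : e.vecAt (Fin.last q) s = e'.vecAt (Fin.last q) s := (he s hs).trans (he' s hs').symm
    rw [this, e'.sphereMetric_vecAt hs']
  refine one_form_ext fun ξ ↦ ?_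
  have h1 := connForm_frame_change e e' hF hN hp hp' i (Fin.last q) ξ
  have h2 : (fun s ↦ sphereMetric F s (e'.vecAt i s) (e.vecAt (Fin.last q) s)) =ᶠ[𝓝 p]
      fun _ ↦ if i = Fin.last q then (1 : ℝ) else 0 := by
    filter_upwards [e.isOpen_domain.mem_nhds hp, e'.isOpen_domain.mem_nhds hp'] with s hs hs'
    exact hlast s hs hs' i
  have h3 : mvfderiv (sphereModel m q) (fun s ↦ sphereMetric F s (e'.vecAt i s) (e.vecAt (Fin.last q) s)) p ξ
      = 0 := by
    have h4 := h2.mfderiv_eq (I := sphereModel m q) (I' := 𝓘(ℝ))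
    rw [mfderiv_const] at h4
    exact congrArg (fun L : (EuclideanSpace ℝ (Fin m) × EuclideanSpace ℝ (Fin q)) →L[ℝ] ℝ ↦ L ξ) h4
  rw [h3, zero_add] at h1
  simp only [hlast p hp hp', mul_ite, mul_one, mul_zero, Finset.sum_ite_eq', Finset.mem_univ, if_true] at h1
  rw [h1, alternating_sum_apply]
  rfl

lemma chernForm_frame_change (hF : IsFinslerMetric m F) (hD : IsSmoothConnection D)
    (hDF : IsMetricCompatible F D) (he : e.IsAdapted) (he' : e'.IsAdapted) (hp : p ∈ e.domain)
    (hp' : p ∈ e'.domain) (k : Fin (q / 2 + 1)) :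
    chernForm (modifiedConnection F Θ D) e' k p = chernForm (modifiedConnection F Θ D) e k p := by
  have hb : ∀ i, e'.isLocalFrame.toBasisAt hp' i = ∑ j, sphereMetric F p (e'.vecAt i p) (e.vecAt j p) •
      e.isLocalFrame.toBasisAt hp j := fun i ↦ by
    simp only [IsLocalFrameOn.toBasisAt_coe]
    exact (e.sum_sphereMetric_smul hF hp (e'.vecAt i p)).symm
  have hN := isMetricCompatible_modifiedConnection Θ D hF hDF
  exact chernSum_frame_change (T := EuclideanSpace ℝ (Fin m) × EuclideanSpace ℝ (Fin q))
    (finBasis ℝ _) (b := e.isLocalFrame.toBasisAt hp) (b' := e'.isLocalFrame.toBasisAt hp')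
    (Ω := fun i j ↦ curvForm (modifiedConnection F Θ D) e i j p)
    (Ω' := fun i j ↦ curvForm (modifiedConnection F Θ D) e' i j p)
    (w := fun i j ↦ connForm (modifiedConnection F Θ D) e i j p)
    (w' := fun i j ↦ connForm (modifiedConnection F Θ D) e' i j p)
    (e.transition_orthogonal e' hF hp hp') hb ((e.oriented p hp).trans (e'.oriented p hp').symm)
    (by
      rw [IsLocalFrameOn.toBasisAt_coe, IsLocalFrameOn.toBasisAt_coe]
      exact (he' p hp').trans (he p hp).symm)
    (curvForm_antisymm Θ hF hD hDF hp) (curvForm_antisymm Θ hF hD hDF hp')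
    (eq_zero_of_eq_neg (connForm_antisymm e hF hN hp _ _))
    (eq_zero_of_eq_neg (connForm_antisymm e' hF hN hp' _ _))
    (curvForm_frame_change Θ hF hD hDF hp hp')
    (connForm_last_frame_change hF hN he he' hp hp') k

lemma smoothFormAt_chernForm (hF : IsFinslerMetric m F) (hD : IsSmoothConnection D)
    (hDF : IsMetricCompatible F D) (hp : p ∈ e.domain) (k : Fin (q / 2 + 1)) :
    SmoothFormAt (sphereModel m q) (chernForm (modifiedConnection F Θ D) e k) p := by
  have h := (eventually_connForm (e := e) Θ hF hD hDF hp).mono fun s hs i j ↦ (hs i j).1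
  exact SmoothFormAt.chernSum (fun i j ↦ SmoothFormAt.curvOf h i j) h.self_of_nhds k

/-- The transgression formula, in terms of forms which agree with the forms of Chern of a frame. -/
lemma pfaffian_eq_extD (hF : IsFinslerMetric m F) (hD : IsSmoothConnection D)
    (hDF : IsMetricCompatible F D) (hp : p ∈ e.domain)
    {Φ : Fin (q / 2 + 1) → DiffForm (sphereModel m q) (SphereBundle q E) q}
    (hΦ : ∀ᶠ s in 𝓝 p, ∀ k, Φ k s = chernForm (modifiedConnection F Θ D) e k s) :
    pfaffian (modifiedConnection F Θ D) e p hp =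
      (-1 : ℝ) ^ q • ∑ k : Fin (q / 2 + 1), chernCoeff q k • extD (sphereModel m q) (Φ k) p := by
  have h := pfaffian_curvOf_eq (e.isLocalFrame.toBasisAt hp) (eventually_connForm (e := e) Θ hF hD hDF hp) Φ hΦ
    fun k ↦ (smoothFormAt_chernForm Θ hF hD hDF hp k).congr (hΦ.mono fun s hs ↦ hs k)
  simp only [IsLocalFrameOn.toBasisAt_coe] at h
  exact h

end AdaptedFrames

end

section

variable {m q : ℕ} {M : Type*} [TopologicalSpace M]
  [ChartedSpace (EuclideanSpace ℝ (Fin m)) M]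
  {E : M → Type*} [∀ x, AddCommGroup (E x)] [∀ x, Module ℝ (E x)]
  [TopologicalSpace (TotalSpace (FibModel q) E)] [∀ x, TopologicalSpace (E x)]
  [FiberBundle (FibModel q) E] [VectorBundle ℝ (FibModel q) E]
  {F : TotalSpace (FibModel q) E → ℝ}
  [IsManifold (𝓡 m) ∞ M] [ContMDiffVectorBundle ∞ (FibModel q) E (𝓡 m)]

/-! ### Existence of orthonormal and adapted frames -/

section Fibre

variable {n : ℕ} {p : SphereBundle q E} {v : Fin n → E p.proj}

lemma linearIndependent_of_orthonormal (hF : IsFinslerMetric m F)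
    (hv : ∀ i j, sphereMetric F p (v i) (v j) = if i = j then 1 else 0) : LinearIndependent ℝ v := by
  refine Fintype.linearIndependent_iff.2 fun g hg i ↦ ?_
  have h1 : sphereMetric F p (∑ j, g j • v j) (v i) = g i := by
    rw [sphereMetric_sum_left _ hF]
    simp only [sphereMetric_smul_left hF, hv, mul_ite, mul_one, mul_zero, Finset.sum_ite_eq',
      Finset.mem_univ, if_true]
  rw [← h1, hg, ← metricBilin_apply hF, map_zero, LinearMap.zero_apply]

lemma finrank_fiber (x : M) : finrank ℝ (E x) = q + 1 := by
  rw [(coordEquiv (q := q) (E := E) x x).finrank_eq]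
  simp

lemma exists_notMem_span (hn : n ≤ q) : ∃ u, u ∉ Submodule.span ℝ (range v) := by
  by_contra! h
  have h1 : Submodule.span ℝ (range v) = ⊤ := eq_top_iff.2 fun u _ ↦ h u
  have h2 := finrank_range_le_card (R := ℝ) v
  rw [Set.finrank, h1, finrank_top, finrank_fiber (q := q), Fintype.card_fin] at h2
  omega

end Fibre

variable [∀ x, IsTopologicalAddGroup (E x)] [∀ x, ContinuousSMul ℝ (E x)]

/-- A vector of the fibre at `p` extends to a smooth section. -/
lemma exists_smoothSection (p : SphereBundle q E) (u : E p.proj) :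
    ∃ Y : (s : SphereBundle q E) → E s.proj, Y p = u ∧ ∀ᶠ s in 𝓝 p, SmoothSectionAt (m := m) Y s := by
  refine ⟨fun s ↦ (coordEquiv p.proj s.proj).symm (coordEquiv (q := q) p.proj p.proj u),
    LinearEquiv.symm_apply_apply _ _, ?_⟩
  filter_upwards [eventually_mem_triv (mem_triv p.proj)] with s hs
  refine (smoothSectionAt_iff hs _).2 ((contMDiffAt_const
    (c := coordEquiv (q := q) p.proj p.proj u)).congr_of_eventuallyEq (.of_forall fun s' ↦ ?_))
  exact LinearEquiv.apply_symm_apply _ _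

/-- One step of the Gram–Schmidt process. -/
lemma exists_next_orthonormal (hF : IsFinslerMetric m F) {n : ℕ} (hn : n ≤ q) {p : SphereBundle q E}
    {X : Fin n → (s : SphereBundle q E) → E s.proj}
    (hX : ∀ᶠ s in 𝓝 p, (∀ i, SmoothSectionAt (m := m) (X i) s) ∧
      ∀ i j, sphereMetric F s (X i s) (X j s) = if i = j then 1 else 0) :
    ∃ Y : (s : SphereBundle q E) → E s.proj, ∀ᶠ s in 𝓝 p, SmoothSectionAt (m := m) Y s ∧
      sphereMetric F s (Y s) (Y s) = 1 ∧ ∀ i, sphereMetric F s (Y s) (X i s) = 0 := by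
  obtain ⟨u, hu⟩ := exists_notMem_span (q := q) (v := fun i ↦ X i p) hn
  obtain ⟨b, hb, hbs⟩ := exists_smoothSection (m := m) p u
  -- Since the value of b at p lies outside the span of the given sections, w is nonzero at p, and
  -- so has positive norm nearby.
  let w : (s : SphereBundle q E) → E s.proj := fun s ↦ b s - ∑ i, sphereMetric F s (b s) (X i s) • X i s
  have hw : ∀ᶠ s in 𝓝 p, SmoothSectionAt (m := m) w s := by
    filter_upwards [hX, hbs] with s hs hbs
    exact ContMDiffAt.sub_section hbs (SmoothSectionAt.sum_smul Finset.univ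
      (fun i _ ↦ contMDiffAt_sphereMetric hF hbs (hs.1 i)) fun i _ ↦ hs.1 i)
  have hwX : ∀ᶠ s in 𝓝 p, ∀ i, sphereMetric F s (w s) (X i s) = 0 := by
    filter_upwards [hX] with s hs i
    rw [sphereMetric_sub_left hF, sphereMetric_sum_left _ hF]
    simp only [sphereMetric_smul_left hF, hs.2, mul_ite, mul_one, mul_zero, Finset.sum_ite_eq',
      Finset.mem_univ, if_true, sub_self]
  have hwp : w p ≠ 0 := by
    intro h
    refine hu ?_
    rw [← hb, sub_eq_zero.1 h]
    exact Submodule.sum_mem _ fun i _ ↦ Submodule.smul_mem _ _ (Submodule.subset_span ⟨i, rfl⟩)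
  have hpos : ∀ᶠ s in 𝓝 p, 0 < sphereMetric F s (w s) (w s) :=
    (contMDiffAt_sphereMetric hF hw.self_of_nhds hw.self_of_nhds).continuousAt.eventually
      (lt_mem_nhds (sphereMetric_pos hF p hwp))
  refine ⟨fun s ↦ (√(sphereMetric F s (w s) (w s)))⁻¹ • w s, ?_⟩
  filter_upwards [hw, hwX, hpos] with s h1 h2 h3
  refine ⟨?_, ?_, fun i ↦ ?_⟩
  · have h4 := (contMDiffAt_sphereMetric hF h1 h1)
    have h5 : ContMDiffAt (sphereModel m q) 𝓘(ℝ) ∞ (fun s ↦ (√(sphereMetric F s (w s) (w s)))⁻¹) s :=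
      ContMDiffAt.comp (g := fun t : ℝ ↦ (√t)⁻¹) s (((Real.contDiffAt_sqrt h3.ne').inv
        (Real.sqrt_ne_zero'.2 h3)).contMDiffAt) h4
    exact ContMDiffAt.smul_section h5 h1
  · rw [sphereMetric_smul_left hF, sphereMetric_smul_right hF, ← mul_assoc, ← mul_inv,
      Real.mul_self_sqrt h3.le, inv_mul_cancel₀ h3.ne']
  · rw [sphereMetric_smul_left hF, h2, mul_zero]

/-- Gram–Schmidt starts with ℓ, which already has length one, so ℓ is kept unchanged in position 0.
-/
lemma exists_orthonormal_sections (hF : IsFinslerMetric m F) (p : SphereBundle q E) (n : ℕ) (hn : n ≤ q) :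
    ∃ X : Fin (n + 1) → (s : SphereBundle q E) → E s.proj, (∀ s, X 0 s = taut F s) ∧
      ∀ᶠ s in 𝓝 p, (∀ i, SmoothSectionAt (m := m) (X i) s) ∧
        ∀ i j, sphereMetric F s (X i s) (X j s) = if i = j then 1 else 0 := by
  induction n with
  | zero =>
    refine ⟨fun _ ↦ taut F, fun _ ↦ rfl, .of_forall fun s ↦ ⟨fun _ ↦ hF.smoothSectionAt_taut s, fun i j ↦ ?_⟩⟩
    rw [sphereMetric_taut hF, if_pos (Subsingleton.elim (α := Fin 1) i j)]
  | succ n ih =>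
    obtain ⟨X, hX0, hX⟩ := ih (by omega)
    obtain ⟨Y, hY⟩ := exists_next_orthonormal hF hn hX
    refine ⟨Fin.snoc (α := fun _ ↦ (s : SphereBundle q E) → E s.proj) X Y, fun s ↦ ?_, ?_⟩
    · rw [← hX0 s, ← Fin.castSucc_zero, Fin.snoc_castSucc]
    · filter_upwards [hX, hY] with s hs hs'
      refine ⟨fun i ↦ ?_, fun i j ↦ ?_⟩
      · induction i using Fin.lastCases with
        | last => rw [Fin.snoc_last]; exact hs'.1
        | cast i => rw [Fin.snoc_castSucc]; exact hs.1 i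
      · induction i using Fin.lastCases with
        | last =>
          induction j using Fin.lastCases with
          | last => simpa only [Fin.snoc_last, if_true] using hs'.2.1
          | cast j =>
            rw [Fin.snoc_last, Fin.snoc_castSucc, hs'.2.2, if_neg (Fin.castSucc_lt_last j).ne']
        | cast i =>
          induction j using Fin.lastCases with
          | last =>
            rw [Fin.snoc_last, Fin.snoc_castSucc, sphereMetric_comm hF, hs'.2.2,
              if_neg (Fin.castSucc_lt_last i).ne]
          | cast j =>
            rw [Fin.snoc_castSucc, Fin.snoc_castSucc, hs.2]
            simp only [Fin.castSucc_inj]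

variable {o : ∀ x, Orientation ℝ (E x) (Fin (q + 1))}

/-- A positively oriented basis of the model fibre. -/
def modelBasis (o : ∀ x, Orientation ℝ (E x) (Fin (q + 1))) (x : M) : Basis (Fin (q + 1)) ℝ (FibModel q) :=
  (Orientation.map (Fin (q + 1)) (coordEquiv x x) (o x)).someBasis (by simp)

/-- Orthonormal sections near `p` which form a positively oriented basis at `p` are an oriented
orthonormal frame near `p`. -/
lemma exists_orthonormalFrame (hF : IsFinslerMetric m F) (ho : IsBundleOrientation o) {p : SphereBundle q E}
    {X : Fin (q + 1) → (s : SphereBundle q E) → E s.proj}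
    (hX : ∀ᶠ s in 𝓝 p, (∀ i, SmoothSectionAt (m := m) (X i) s) ∧
      ∀ i j, sphereMetric F s (X i s) (X j s) = if i = j then 1 else 0)
    (hpos : 0 < (modelBasis o p.proj).det fun i ↦ coordEquiv p.proj p.proj (X i p)) :
    ∃ e : OrthonormalFrame (m := m) F o, p ∈ e.domain ∧ ∀ i s, e.vec i s = X i s := by
  -- Positivity at p persists by continuity of the determinant; the orientation of E is locally
  -- constant in the trivialization.
  have h1 : ∀ᶠ s : SphereBundle q E in 𝓝 p, 0 < (modelBasis o p.proj).det fun i ↦ coordEquiv p.proj s.proj (X i s) := by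
    have hc : ContinuousAt (fun s : SphereBundle q E ↦ (modelBasis o p.proj).det
        fun i ↦ coordEquiv p.proj s.proj (X i s)) p :=
      (continuous_alternating _).continuousAt.comp (continuousAt_pi.2 fun i ↦
        ((smoothSectionAt_iff (mem_triv p.proj) _).1 (hX.self_of_nhds.1 i)).continuousAt)
    exact hc.eventually (lt_mem_nhds hpos)
  have h2 : ∀ᶠ s : SphereBundle q E in 𝓝 p,
      Orientation.map (Fin (q + 1)) (coordEquiv p.proj s.proj) (o s.proj) = (modelBasis o p.proj).orientation := by
    have h := (contMDiff_sphereProj m q E p).continuousAt.eventually (ho p.proj)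
    filter_upwards [h] with s hs
    rw [modelBasis, Orientation.someBasis_orientation]
    exact hs
  obtain ⟨U, hU, hUo, hpU⟩ := eventually_nhds_iff.1 (hX.and (h1.and h2))
  have hli : ∀ s ∈ U, LinearIndependent ℝ fun i ↦ X i s := fun s hs ↦
    linearIndependent_of_orthonormal hF (hU s hs).1.2
  have hframe : IsLocalFrameOn (V := PullbackBundle m q E) (sphereModel m q) (FibModel q) ∞ X U :=
    { linearIndependent := fun {s} hs ↦ hli s hs
      generating := fun {s} hs ↦ by
        have h := (hli s hs).span_eq_top_of_card_eq_finrank (by rw [finrank_fiber (q := q), Fintype.card_fin])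
        exact h.ge
      contMDiffOn := fun i s hs ↦ ((hU s hs).1.1 i).contMDiffWithinAt }
  refine ⟨⟨U, hUo, X, hframe, fun s hs ↦ (hU s hs).1.2, fun s hs ↦ ?_⟩, hpU, fun _ _ ↦ rfl⟩
  have h3 : (Basis.map (M' := FibModel q) (hframe.toBasisAt hs) (coordEquiv (E := E) p.proj s.proj)).orientation =
      (modelBasis o p.proj).orientation := by
    refine ((Basis.orientation_eq_iff_det_pos _ _).2 ?_).symm
    refine (hU s hs).2.1.trans_eq (congrArg _ (funext fun i ↦ ?_))
    exact congrArg (coordEquiv (q := q) (E := E) p.proj s.proj) (hframe.toBasisAt_coe hs i).symm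
  refine (Orientation.map (Fin (q + 1)) (coordEquiv (q := q) p.proj s.proj)).injective ?_
  refine Eq.trans ?_ (h3.trans (hU s hs).2.2.symm)
  exact (Basis.orientation_map (hframe.toBasisAt hs) (coordEquiv (q := q) (E := E) p.proj s.proj)).symm

/-- Around every point there is an oriented orthonormal frame, which is adapted if the rank of the
bundle is at least two. -/
lemma exists_frame (hF : IsFinslerMetric m F) (ho : IsBundleOrientation o) (p : SphereBundle q E) :
    ∃ e : OrthonormalFrame (m := m) F o, p ∈ e.domain ∧ (0 < q → e.IsAdapted) := by
  obtain ⟨X, hX0, hX⟩ := exists_orthonormal_sections (m := m) hF p q le_rfl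
  -- The order is reversed so that ℓ comes last, as required for adapted frames.
  have hdet : (modelBasis o p.proj).det (fun i ↦ coordEquiv p.proj p.proj (X i.rev p)) ≠ 0 := by
    have hli := ((linearIndependent_of_orthonormal hF hX.self_of_nhds.2).comp _
      Fin.rev_injective).map' (coordEquiv (q := q) (E := E) p.proj p.proj).toLinearMap (LinearEquiv.ker _)
    exact ((Basis.is_basis_iff_det (modelBasis o p.proj)).1
      ⟨hli, hli.span_eq_top_of_card_eq_finrank (by simp)⟩).ne_zero
  obtain ⟨c, hc, hcd⟩ : ∃ c : ℝ, c * c = 1 ∧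
      0 < c * (modelBasis o p.proj).det (fun i ↦ coordEquiv p.proj p.proj (X i.rev p)) := by
    rcases hdet.lt_or_gt with h | h
    · exact ⟨-1, by norm_num, by linarith⟩
    · exact ⟨1, by norm_num, by linarith⟩
  -- The orientation is corrected by the sign of the vector with index 0. For q > 0 this is not ℓ;
  -- for q = 0 it is, and the frame may fail to be adapted.
  let d : Fin (q + 1) → ℝ := fun i ↦ if i = 0 then c else 1
  have hd : ∀ i, d i * d i = 1 := fun i ↦ by
    simp only [d]
    split_ifs
    exacts [hc, one_mul 1]
  obtain ⟨e, hp, he⟩ := exists_orthonormalFrame (m := m) (X := fun i s ↦ d i • X i.rev s) hF ho (p := p) (by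
    filter_upwards [hX] with s hs
    refine ⟨fun i ↦ ContMDiffAt.smul_section contMDiffAt_const (hs.1 i.rev), fun i j ↦ ?_⟩
    rw [sphereMetric_smul_left hF, sphereMetric_smul_right hF, hs.2]
    simp only [Fin.rev_inj]
    split_ifs with h
    · rw [h, mul_one, hd]
    · rw [mul_zero, mul_zero]) (by
    simp only [map_smul]
    have h := (modelBasis o p.proj).det.toMultilinearMap.map_smul_univ d
      fun i ↦ coordEquiv p.proj p.proj (X i.rev p)
    refine hcd.trans_eq (Eq.trans ?_ h.symm)
    simp only [d, Finset.prod_ite_eq', Finset.mem_univ, if_true]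
    rfl)
  refine ⟨e, hp, fun hq s _ ↦ (he _ s).trans ?_⟩
  have h : Fin.last q ≠ 0 := fun h ↦ hq.ne' (congrArg Fin.val h)
  simp only [d, if_neg h, one_smul, Fin.rev_last]
  exact hX0 s

variable (Θ : EhresmannConnection m q E) {D : Connection m q E}

/-- The forms of Chern are independent of the frame; for line bundles they do not involve it at all. -/
lemma chernForm_eq_of_isAdapted (hF : IsFinslerMetric m F) (hD : IsSmoothConnection D)
    (hDF : IsMetricCompatible F D) {e e' : OrthonormalFrame (m := m) F o} (he : 0 < q → e.IsAdapted)
    (he' : 0 < q → e'.IsAdapted) {p : SphereBundle q E} (hp : p ∈ e.domain) (hp' : p ∈ e'.domain)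
    (k : Fin (q / 2 + 1)) :
    chernForm (modifiedConnection F Θ D) e' k p = chernForm (modifiedConnection F Θ D) e k p := by
  rcases q.eq_zero_or_pos with hq | hq
  -- For a line bundle both wedge products are empty, so the form is a constant for every frame.
  · have hk : (k : ℕ) = 0 := by omega
    rw [chernForm, chernForm]
    refine Finset.sum_congr rfl fun σ _ ↦ ?_
    congr 4
    · exact funext fun i ↦ absurd i.2 (by omega)
    · exact funext fun i ↦ absurd i.2 (by omega)
  · exact chernForm_frame_change Θ hF hD hDF (he hq) (he' hq) hp hp' k

end

/-! ### Global forms and the transgression formula -/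

section

variable {m q : ℕ} {M : Type*} [TopologicalSpace M]
  [ChartedSpace (EuclideanSpace ℝ (Fin m)) M]
  {E : M → Type*} [∀ x, AddCommGroup (E x)] [∀ x, Module ℝ (E x)]
  [TopologicalSpace (TotalSpace (FibModel q) E)] [∀ x, TopologicalSpace (E x)]
  [FiberBundle (FibModel q) E] [VectorBundle ℝ (FibModel q) E]
  {F : TotalSpace (FibModel q) E → ℝ}
  [IsManifold (𝓡 m) ∞ M] [ContMDiffVectorBundle ∞ (FibModel q) E (𝓡 m)]
  [∀ x, IsTopologicalAddGroup (E x)] [∀ x, ContinuousSMul ℝ (E x)]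
  {o : ∀ x, Orientation ℝ (E x) (Fin (q + 1))}
  (Θ : EhresmannConnection m q E) {D : Connection m q E}

/-- The Pfaffian of the curvature of the modified connection and its transgression by the forms of Chern. -/
theorem exists_transgression (hF : IsFinslerMetric m F) (ho : IsBundleOrientation o)
    (hD : IsSmoothConnection D) (hDF : IsMetricCompatible F D) :
    ∃ (Pf : DiffForm (sphereModel m q) (SphereBundle q E) (q + 1))
      (Φ : Fin (q / 2 + 1) → DiffForm (sphereModel m q) (SphereBundle q E) q),
      IsSmoothForm (sphereModel m q) Pf ∧ (∀ k, IsSmoothForm (sphereModel m q) (Φ k)) ∧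
      (∀ (e : OrthonormalFrame (m := m) F o) (p : SphereBundle q E) (hp : p ∈ e.domain),
        Pf p = pfaffian (modifiedConnection F Θ D) e p hp) ∧
      (∀ e : OrthonormalFrame (m := m) F o, e.IsAdapted → ∀ p ∈ e.domain, ∀ k,
        Φ k p = chernForm (modifiedConnection F Θ D) e k p) ∧
      Pf = (-1 : ℝ) ^ q • extD (sphereModel m q) (∑ k : Fin (q / 2 + 1), chernCoeff q k • Φ k) := by
  choose e hp he using exists_frame (m := m) hF ho
  -- The value at each p uses the frame chosen for p. By independence of the frame, Φₖ agrees near p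
  -- with the form of that single frame, which gives smoothness and allows differentiation.
  let Φ : Fin (q / 2 + 1) → DiffForm (sphereModel m q) (SphereBundle q E) q := fun k p ↦
    chernForm (modifiedConnection F Θ D) (e p) k p
  have hΦ : ∀ e' : OrthonormalFrame (m := m) F o, (0 < q → e'.IsAdapted) → ∀ p ∈ e'.domain, ∀ k,
      Φ k p = chernForm (modifiedConnection F Θ D) e' k p := fun e' he' p hp' k ↦
    chernForm_eq_of_isAdapted Θ hF hD hDF he' (he p) hp' (hp p) k
  have hΦs : ∀ k p, SmoothFormAt (sphereModel m q) (Φ k) p := fun k p ↦ by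
    refine (smoothFormAt_chernForm (e := e p) Θ hF hD hDF (hp p) k).congr ?_
    filter_upwards [(e p).isOpen_domain.mem_nhds (hp p)] with s hs
    exact hΦ (e p) (he p) s hs k
  have hsum : ∀ p, SmoothFormAt (sphereModel m q) (∑ k : Fin (q / 2 + 1), chernCoeff q k • Φ k) p :=
    fun p ↦ SmoothFormAt.sum _ fun k _ ↦ (hΦs k p).const_smul _
  have hPf : (fun p ↦ pfaffian (modifiedConnection F Θ D) (e p) p (hp p)) =
      (-1 : ℝ) ^ q • extD (sphereModel m q) (∑ k : Fin (q / 2 + 1), chernCoeff q k • Φ k) := by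
    funext p
    rw [pfaffian_eq_extD Θ hF hD hDF (hp p) (Φ := Φ) (by
      filter_upwards [(e p).isOpen_domain.mem_nhds (hp p)] with s hs k
      exact hΦ (e p) (he p) s hs k), Pi.smul_apply,
      extD_sum Finset.univ _ p fun k _ ↦ (hΦs k p).const_smul _]
    simp only [extD_const_smul, Pi.smul_apply]
  refine ⟨fun p ↦ pfaffian (modifiedConnection F Θ D) (e p) p (hp p), Φ, ?_,
    fun k ↦ isSmoothForm_iff.2 (hΦs k), fun e' p hp' ↦ pfaffian_frame_change Θ hF hD hDF hp' (hp p),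
    fun e' he' ↦ hΦ e' fun _ ↦ he', hPf⟩
  rw [hPf]
  exact isSmoothForm_iff.2 fun p ↦ (SmoothFormAt.extD (.of_forall hsum)).const_smul _

lemma chernCoeff_div_two_pi_rpow (q k : ℕ) :
    1 / (2 * Real.pi) ^ (((q : ℝ) + 1) / 2) * chernCoeff q k = 1 / Real.pi ^ (((q : ℝ) + 1) / 2) *
      ((-1 : ℝ) ^ k / (k.factorial * (q - 2 * k).factorial * 2 ^ (2 * k + 1)) *
        Real.Gamma (((q : ℝ) + 1 - 2 * k) / 2)) := by
  have h2 : (2 : ℝ) ^ (((q : ℝ) + 1) / 2) ≠ 0 := (Real.rpow_pos_of_pos two_pos _).ne'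
  rw [chernCoeff, Real.mul_rpow two_pos.le Real.pi_pos.le]
  field_simp

/-- The normalized Pfaffian is exact. -/
lemma normalized_pfaffian_eq_extD {B : Type*} [NormedAddCommGroup B] [NormedSpace ℝ B] [FiniteDimensional ℝ B]
    {H : Type*} [TopologicalSpace H] {I : ModelWithCorners ℝ B H} [I.Boundaryless]
    {S : Type*} [TopologicalSpace S] [ChartedSpace H S] [IsManifold I ∞ S] {Pf : DiffForm I S (q + 1)}
    {Φ : Fin (q / 2 + 1) → DiffForm I S q}
    (h : Pf = (-1 : ℝ) ^ q • extD I (∑ k : Fin (q / 2 + 1), chernCoeff q k • Φ k)) :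
    ((1 : ℝ) / (2 * Real.pi) ^ (((q : ℝ) + 1) / 2)) • Pf =
      extD I (((-1 : ℝ) ^ q / Real.pi ^ (((q : ℝ) + 1) / 2)) • ∑ k : Fin (q / 2 + 1),
        ((-1 : ℝ) ^ (k : ℕ) / ((k : ℕ).factorial * (q - 2 * k).factorial * 2 ^ (2 * (k : ℕ) + 1)) *
          Real.Gamma (((q : ℝ) + 1 - 2 * (k : ℕ)) / 2)) • Φ k) := by
  rw [h, ← extD_const_smul, ← extD_const_smul]
  congr 1
  simp only [Finset.smul_sum, smul_smul]
  refine Finset.sum_congr rfl fun k _ ↦ ?_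
  congr 1
  rw [mul_left_comm, ← mul_assoc, mul_assoc, chernCoeff_div_two_pi_rpow]
  ring

end

end FinslerGBC

end

theorem mainTheorem3 {m q : ℕ}
    -- a smooth manifold `M` of dimension `m`
    {M : Type*} [TopologicalSpace M] [ChartedSpace (EuclideanSpace ℝ (Fin m)) M]
    [IsManifold (𝓡 m) ∞ M]
    -- a smooth real vector bundle `E` of rank `n = q + 1` over `M`
    {E : M → Type*} [∀ x, AddCommGroup (E x)] [∀ x, Module ℝ (E x)]
    [∀ x, TopologicalSpace (E x)] [∀ x, IsTopologicalAddGroup (E x)]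
    [∀ x, ContinuousSMul ℝ (E x)] [TopologicalSpace (TotalSpace (FibModel q) E)]
    [FiberBundle (FibModel q) E] [VectorBundle ℝ (FibModel q) E]
    [ContMDiffVectorBundle ∞ (FibModel q) E (𝓡 m)]
    -- a Finsler metric, an orientation and an Ehresmann connection
    (F : TotalSpace (FibModel q) E → ℝ) (hF : IsFinslerMetric m F)
    (o : ∀ x, Orientation ℝ (E x) (Fin (q + 1))) (ho : IsBundleOrientation o)
    (Θ : EhresmannConnection m q E)
    -- a metric-compatible connection `D` on `π^*E`
    (D : Connection m q E) (hD : IsSmoothConnection D) (hDF : IsMetricCompatible F D) :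
    -- there are enough oriented orthonormal frames, adapted ones if `n ≥ 2`
    (∀ p, ∃ e : OrthonormalFrame (m := m) F o, p ∈ e.domain) ∧
    (0 < q → ∀ p, ∃ e : OrthonormalFrame (m := m) F o, e.IsAdapted ∧ p ∈ e.domain) ∧
    ∃ (Pf : DiffForm (sphereModel m q) (SphereBundle q E) (q + 1))
      (Φ : Fin (q / 2 + 1) → DiffForm (sphereModel m q) (SphereBundle q E) q),
      IsSmoothForm (sphereModel m q) Pf ∧ (∀ k, IsSmoothForm (sphereModel m q) (Φ k)) ∧
      -- `Pf` is the Pfaffian `Pf(-Ω)` of the curvature of the modified connection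
      (∀ (e : OrthonormalFrame (m := m) F o) (p : SphereBundle q E) (hp : p ∈ e.domain),
        Pf p = pfaffian (modifiedConnection F Θ D) e p hp) ∧
      -- `Φ k` are the forms of Chern
      (∀ e : OrthonormalFrame (m := m) F o, e.IsAdapted → ∀ p ∈ e.domain, ∀ k,
        Φ k p = chernForm (modifiedConnection F Θ D) e k p) ∧
      -- the transgression formula for `Pf(-Ω)`
      Pf = (-1 : ℝ) ^ q • extD (sphereModel m q) (∑ k : Fin (q / 2 + 1),
        ((-1 : ℝ) ^ (k : ℕ) * (2 : ℝ) ^ (((q : ℝ) + 1) / 2) /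
            ((k : ℕ).factorial * (q - 2 * k).factorial * 2 ^ (2 * (k : ℕ) + 1)) *
          Real.Gamma (((q : ℝ) + 1 - 2 * (k : ℕ)) / 2)) • Φ k) ∧
      -- `Ω^∇ = dΠ`
      ((1 : ℝ) / (2 * Real.pi) ^ (((q : ℝ) + 1) / 2)) • Pf =
        extD (sphereModel m q) (((-1 : ℝ) ^ q / Real.pi ^ (((q : ℝ) + 1) / 2)) •
          ∑ k : Fin (q / 2 + 1),
            ((-1 : ℝ) ^ (k : ℕ) /
                ((k : ℕ).factorial * (q - 2 * k).factorial * 2 ^ (2 * (k : ℕ) + 1)) *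
              Real.Gamma (((q : ℝ) + 1 - 2 * (k : ℕ)) / 2)) • Φ k) := by
  refine ⟨fun p ↦ (exists_frame hF ho p).imp fun _ he ↦ he.1,
    fun hq p ↦ (exists_frame hF ho p).imp fun _ he ↦ ⟨he.2 hq, he.1⟩, ?_⟩
  obtain ⟨Pf, Φ, h1, h2, h3, h4, h5⟩ := exists_transgression Θ hF ho hD hDF
  exact ⟨Pf, Φ, h1, h2, h3, h4, h5, normalized_pfaffian_eq_extD h5⟩
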